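/- **Setting.** Let $k$ be a finite field with $q$ elements, $v=\sqrt q\in\mathbb C$, and let $Q=(I,H,s,t)$ be a finite quiver without loops. Let $\mathcal P$ be the set of isomorphism classes of finite-dimensional representations of $Q$ over $k$; for $\alpha\in\mathcal P$ let $V_\alpha$ be a representative, $a_\alpha=|\mathrm{Aut}(V_\alpha)|$, and write $\alpha$ also for its dimension vector. The classes of the zero representation and of the simple representation at $i$ with zero maps are denoted $0$ and $i$. Let $g^\alpha_{\alpha_1\alpha_2}$ be the number of subrepresentations $W\subseteq V_\alpha$ with $W\simeq V_{\alpha_2}$, $V_\alpha/W\simeq V_{\alpha_1}$. For any finite quiver put $\langle\nu,\nu'\rangle=\sum_i\nu_i\nu'_i-\sum_h\nu_{s(h)}\nu'_{t(h)}$ and $(\nu,\nu')=\langle\nu,\nu'\rangle+\langle\nu',\nu\rangle$. **The algebra.** Let $\tilde H^{\pm}$ be the $\mathbb Q(v)$-algebras with bases $\{K_\mu u^{\pm}_\alpha\mid\mu\in\mathbb ZI,\alpha\in\mathcal P\}$, unit $K_0=u_0^\pm=1$, and $K_\mu K_\nu=K_{\mu+\nu}$, $K_\mu u^\pm_\alpha=v^{\pm(\mu,\alpha)}u^\pm_\alpha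 K_\mu$, $u^\pm_\alpha u^\pm_\beta=v^{\langle\alpha,\beta\rangle}\sum_\lambda g^\lambda_{\alpha\beta}u^\pm_\lambda$, with coproducts $\Delta K_\mu=K_\mu\otimes K_\mu$ and $$\Delta u^+_\lambda=\sum_{\alpha,\beta} v^{\langle\alpha,\beta\rangle}\tfrac{a_\alpha a_\beta}{a_\lambda}g^\lambda_{\alpha\beta}\,u^+_\alpha K_\beta\otimes u^+_\beta,\qquad \Delta u^-_\lambda=\sum_{\alpha,\beta} v^{\langle\alpha,\beta\rangle}\tfrac{a_\alpha a_\beta}{a_\lambda}g^\lambda_{\alpha\beta}\,u^-_\beta\otimes u^-_\alpha K_{-\beta},$$ and the pairing $\varphi(K_\mu u^+_\alpha,K_\nu u^-_\beta)=v^{-(\mu,\nu)-(\alpha,\nu)+(\mu,\beta)}\frac{|V_\alpha|}{a_\alpha}\delta_{\alpha\beta}$. The double Ringel–Hall algebra $D_q(Q)$ is the quotient of the Drinfeld double of $(\tilde H^+,\tilde H^-,\varphi)$, i.e. of the algebra generated by $\tilde H^+$ and $\tilde H^-$ with the relations $\sum\varphi(a_1,b_1)\,b_2a_2=\sum a_1b_1\,\varphi(a_2,b_2)$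 $(a\in\tilde H^+,b\in\tilde H^-)$, by the identification of the two copies of each $K_\mu$. Let $\hat D_q(Q)\subseteq D_q(Q)$ be the subalgebra generated by all $u^+_i$ $(i\in I)$, $u^-_\alpha$ $(\alpha\in\mathcal P)$ and $K_\mu$ $(\mu\in\mathbb ZI)$. **The function space.** Let $\hat Q$ be an enlarged quiver of $Q$: add a vertex $\hat i$ and an arrow $h_i$ joining $i$ and $\hat i$ (in either direction) for every $i\in I$. For $\nu\in\mathbb N\hat I$ fix graded spaces with components $V_j=k^{\nu_j}$, let $E_{\nu,\hat Q}=\bigoplus_{h\in\hat H}\mathrm{Hom}_k(V_{s(h)},V_{t(h)})$, let $G_\nu=\prod_{i\in I}GL(V_i)$ act by conjugation (trivially on the $V_{\hat i}$), and let $\mathcal F_G(E_{\nu,\hat Q})$ be the space of $G_\nu$-invariant functions $E_{\nu,\hat Q}\to\mathbb C$. Fix a nontrivial additive character $\psi$ of $k$. For two orientations $\hat Q,\hat Q'$ of the same graph let $\Phi_{\hat Q,\hat Q'}:\mathcal F_G(E_{\nu,\hat Q})\to\mathcal F_G(E_{\nu,\hat Q'})$ be the Fourier transform along the reversed arrows,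 with kernel $v^{-\nu_{s(h)}\nu_{t(h)}}\psi(\pm\mathrm{tr}(x_hx'_h))$ for each reversed arrow $h$, the sign being $+$ for passing away from and $-$ for passing back to a fixed reference orientation, so that $\Phi_{\hat Q',\hat Q''}\Phi_{\hat Q,\hat Q'}=\Phi_{\hat Q,\hat Q''}$. If $i\in I$ is a source of $\hat Q$, let ${}^iE_{\nu,\hat Q}$ be the set of $x$ for which $\bigoplus_{s(h)=i}x_h$ is injective on $V_i$. For general $\hat Q$, let ${}^i\hat Q$ denote an orientation of the same graph with $i$ a source, and let $\mathcal N_{\nu,\hat Q,i}$ be the space of $f$ such that $\Phi_{\hat Q,{}^i\hat Q}(f)$ vanishes on ${}^iE_{\nu,{}^i\hat Q}$. Put $\mathcal F_{\hat Q}=\bigoplus_{\nu}\mathcal F_G(E_{\nu,\hat Q})/\sum_{i\in I}\mathcal N_{\nu,\hat Q,i}$. **The operators.** For $\nu,\nu'\in\mathbb N\hat I$ with $\nu'-\nu\in\mathbb NI$ let $Z$ be the set of $(x,x',y)$ with $x\in E_{\nu,\hat Q}$, $x'\in E_{\nu',\hat Q}$ and $y=(y_j)$ an injective morphism $x\to x'$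 with $y_{\hat j}=\mathrm{Id}$ for $j\in I$. * $\mathcal K_{\hat Q,i}f=v^{\bar\nu_i-\nu_i}f$ for $f\in\mathcal F_G(E_{\nu,\hat Q})$, where $\bar\nu_i=\sum_{s(h)=i}\nu_{t(h)}+\sum_{t(h)=i}\nu_{s(h)}-\nu_i$ (sums over $h\in\hat H$). * If $i$ is a source and $\nu'=\nu+i$: for $f\in\mathcal F_G(E_{\nu',\hat Q})$, $(\mathcal E^+_{\hat Q,i}f)(x)=v^{-\nu_i}|G_{\nu'}|^{-1}\sum f(x')$, the sum over all $(x',y)$ with $(x,x',y)\in Z$ and $x'\in{}^iE_{\nu',\hat Q}$. For general $\hat Q$, $\mathcal E^+_{\hat Q,i}=\Phi_{{}^i\hat Q,\hat Q}\,\mathcal E^+_{{}^i\hat Q,i}\,\Phi_{\hat Q,{}^i\hat Q}$. On degrees with $\nu_i=0$, $\mathcal E^+_{\hat Q,i}$ is zero. * If $\alpha\in\mathcal P$ and $\nu'=\nu+\alpha$: for $f\in\mathcal F_G(E_{\nu,\hat Q})$, $(\mathcal E^-_{\hat Q,\alpha}f)(x')=(-v)^{\dim V_\alpha}v^{\langle\alpha,\nu\rangle+\dim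 V_\alpha}|G_\nu|^{-1}\sum f(x)$, with $\langle\cdot,\cdot\rangle$ the Euler form of $\hat Q$ and the sum over all $(x,y)$ with $(x,x',y)\in Z$ and $x'/\mathrm{Im}\,y\simeq V_\alpha$. **Theorem 3.2.** The operators above induce well-defined operators on $\mathcal F_{\hat Q}$ (with $\mathcal E^+_{\hat Q,i}$ there independent of the choice of ${}^i\hat Q$), and by defining $$K_{\pm i}.f=\mathcal K^{\pm1}_{\hat Q,i}(f),\qquad u^+_i.f=\mathcal E^+_{\hat Q,i}(f),\qquad u^-_\alpha.f=\mathcal E^-_{\hat Q,\alpha}(f)\qquad(i\in I,\ \alpha\in\mathcal P)$$ the space $\mathcal F_{\hat Q}$ becomes a left $\hat D_q(Q)$-module, $\mathbb Q(v)$ acting by scalars and $\hat D_q(Q)$ acting by $\mathbb C$-linear maps. -/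

import Mathlib

noncomputable section

namespace RingelHall

/-! ## Quivers and their representations over a finite field -/

/-- A quiver with vertex set `J` and arrow set `A`; `s h` and `t h` are the start and the
terminal vertex of the arrow `h`. -/
structure Quiv (J A : Type*) where
  /-- the start of an arrow -/
  s : A → J
  /-- the terminal of an arrow -/
  t : A → J

/-- The Euler form `⟨a, b⟩ = ∑_j a_j b_j - ∑_h a_{s(h)} b_{t(h)}`. -/
def Quiv.euler {J A : Type*} [Fintype J] [Fintype A] (Γ : Quiv J A) (a b : J → ℤ) : ℤ :=
  ∑ j, a j * b j - ∑ h, a (Γ.s h) * b (Γ.t h)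

/-- The symmetric Euler form `(a, b) = ⟨a, b⟩ + ⟨b, a⟩`. -/
def Quiv.symEuler {J A : Type*} [Fintype J] [Fintype A] (Γ : Quiv J A) (a b : J → ℤ) : ℤ :=
  Γ.euler a b + Γ.euler b a

/-- The same underlying graph with another orientation: the arrow `h` is reversed exactly when
`Ω h = true`. -/
def Quiv.reorient {J A : Type*} (Γ : Quiv J A) (Ω : A → Bool) : Quiv J A where
  s h := bif Ω h then Γ.t h else Γ.s h
  t h := bif Ω h then Γ.s h else Γ.t h

/-- The vertex `j` is a source: no arrow ends at `j`. -/
def Quiv.IsSource {J A : Type*} (Γ : Quiv J A) (j : J) : Prop := ∀ h, Γ.t h ≠ j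

/-- The variety `E_d = ⊕_h Hom_k (V_{s(h)}, V_{t(h)})` of representations of dimension vector `d`
on the graded space with components `V_j = k ^ (d j)`. -/
abbrev Rep {J A : Type*} (Γ : Quiv J A) (k : Type*) (d : J → ℕ) : Type _ :=
  ∀ h : A, Matrix (Fin (d (Γ.t h))) (Fin (d (Γ.s h))) k

/-- Graded linear maps `⊕ k ^ (d j) → ⊕ k ^ (d' j)`. -/
abbrev GrMap {J : Type*} (k : Type*) (d d' : J → ℕ) : Type _ :=
  ∀ j : J, Matrix (Fin (d' j)) (Fin (d j)) k

/-- The graded linear map `y` is a morphism of representations `x → x'`. -/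
def IsHom {J A k : Type*} [Field k] {Γ : Quiv J A} {d d' : J → ℕ}
    (x : Rep Γ k d) (x' : Rep Γ k d') (y : GrMap k d d') : Prop :=
  ∀ h, x' h * y (Γ.s h) = y (Γ.t h) * x h

/-- The group `∏_j GL (V_j)`. -/
abbrev GrGL {J : Type*} (k : Type*) [Field k] (d : J → ℕ) : Type _ := ∀ j : J, GL (Fin (d j)) k

/-- The action `g.x = g x g⁻¹`. -/
def act {J A k : Type*} [Field k] {Γ : Quiv J A} {d : J → ℕ} (g : GrGL k d) (x : Rep Γ k d) :
    Rep Γ k d :=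
  fun h => (g (Γ.t h)).val * x h * ((g (Γ.s h))⁻¹).val

theorem act_one {J A k : Type*} [Field k] {Γ : Quiv J A} {d : J → ℕ} (x : Rep Γ k d) :
    act 1 x = x := by
  funext h; simp [act]

theorem act_mul {J A k : Type*} [Field k] {Γ : Quiv J A} {d : J → ℕ} (g g' : GrGL k d)
    (x : Rep Γ k d) : act (g * g') x = act g (act g' x) := by
  funext h; simp only [act, Pi.mul_apply, mul_inv_rev, Units.val_mul, Matrix.mul_assoc]

/-- Isomorphism of representations with the same dimension vector. -/
def isoSetoid {J A : Type*} (Γ : Quiv J A) (k : Type*) [Field k] (d : J → ℕ) :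
    Setoid (Rep Γ k d) where
  r x x' := ∃ g : GrGL k d, act g x = x'
  iseqv :=
    { refl := fun x => ⟨1, act_one x⟩
      symm := by
        rintro x _ ⟨g, rfl⟩
        exact ⟨g⁻¹, by rw [← act_mul, inv_mul_cancel, act_one]⟩
      trans := by
        rintro x _ _ ⟨g, rfl⟩ ⟨g', rfl⟩
        exact ⟨g' * g, act_mul g' g x⟩ }

/-- The set `𝒫` of isomorphism classes of finite-dimensional representations: a dimension vector
together with an isomorphism class of representations of that dimension vector. -/
def IsoCls {J A : Type*} (Γ : Quiv J A) (k : Type*) [Field k] : Type _ :=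
  Σ d : J → ℕ, Quotient (isoSetoid Γ k d)

namespace IsoCls

variable {J A : Type*} {Γ : Quiv J A} {k : Type*} [Field k]

/-- The dimension vector of an isomorphism class. -/
def dim (α : IsoCls Γ k) : J → ℕ := α.1

/-- The dimension vector, as an element of `ℤ J`. -/
def dimZ (α : IsoCls Γ k) : J → ℤ := fun j => (α.dim j : ℤ)

/-- The chosen representation `V_α` in the class `α`. -/
def rep (α : IsoCls Γ k) : Rep Γ k α.dim := Quotient.out (s := isoSetoid Γ k α.1) α.2

/-- The isomorphism class of a representation. -/
def mk {d : J → ℕ} (x : Rep Γ k d) : IsoCls Γ k := ⟨d, Quotient.mk (isoSetoid Γ k d) x⟩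

/-- The class of the zero representation. -/
def zero (Γ : Quiv J A) (k : Type*) [Field k] : IsoCls Γ k := mk (d := 0) 0

/-- The class of the representation of dimension vector `j` in which all arrows act by zero
(for a quiver without loops this is the only class of dimension vector `j`). -/
def simple (Γ : Quiv J A) (k : Type*) [Field k] [DecidableEq J] (j : J) : IsoCls Γ k :=
  mk (d := Pi.single j 1) 0

/-- The order `a_α` of the automorphism group of `V_α`. -/
def aut (α : IsoCls Γ k) : ℕ := Nat.card {g : GrGL k α.dim // act g α.rep = α.rep}

/-- The total dimension of `V_α`. -/
def totalDim [Fintype J] (α : IsoCls Γ k) : ℕ := ∑ j, α.dim j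

/-- The Hall number `g^α_{α₁ α₂}`: the number of subrepresentations `W` of `V_α` such that
`W ≃ V_{α₂}` (there is an injective morphism from `V_{α₂}` with image `W`) and
`V_α / W ≃ V_{α₁}` (there is a surjective morphism to `V_{α₁}` with kernel `W`). -/
def hall (α₁ α₂ α : IsoCls Γ k) : ℕ :=
  Nat.card {W : ∀ j, Submodule k (Fin (α.dim j) → k) //
    (∃ y : GrMap k α₂.dim α.dim, IsHom α₂.rep α.rep y ∧
      ∀ j, Function.Injective (y j).mulVec ∧ LinearMap.range (y j).mulVecLin = W j) ∧
    (∃ z : GrMap k α.dim α₁.dim, IsHom α.rep α₁.rep z ∧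
      ∀ j, Function.Surjective (z j).mulVec ∧ LinearMap.ker (z j).mulVecLin = W j)}

end IsoCls

/-! ## The double Ringel-Hall algebra -/

/-- `v = √q` in `ℂ`, where `q = |k|`. -/
def vC (k : Type*) [Fintype k] : ℂ := ((Real.sqrt (Fintype.card k) : ℝ) : ℂ)

/-- The field `ℚ(v) ⊆ ℂ`. -/
abbrev Qv (k : Type*) [Fintype k] : IntermediateField ℚ ℂ := IntermediateField.adjoin ℚ {vC k}

/-- `v` as an element of `ℚ(v)`. -/
def vv (k : Type*) [Fintype k] : Qv k := ⟨vC k, IntermediateField.mem_adjoin_simple_self ℚ _⟩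

section Double

variable {I H : Type*} [Fintype I] [Fintype H] (Q : Quiv I H) (k : Type*) [Field k] [Fintype k]

/-- The coefficient `v^{⟨α,β⟩} (a_α a_β / a_γ) g^γ_{α β}` of the comultiplications
`Δ(u⁺_γ) = ∑_{α,β} v^{⟨α,β⟩} (a_α a_β / a_γ) g^γ_{α β} u⁺_α K_β ⊗ u⁺_β` and
`Δ(u⁻_γ) = ∑_{α,β} v^{⟨α,β⟩} (a_α a_β / a_γ) g^γ_{α β} u⁻_β ⊗ u⁻_α K_{-β}`. -/
def comulCoeff (γ α β : IsoCls Q k) : Qv k :=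
  vv k ^ Q.euler α.dimZ β.dimZ * ((α.aut : Qv k) * (β.aut : Qv k) / (γ.aut : Qv k)) *
    (IsoCls.hall α β γ : Qv k)

open Classical in
/-- The pairing of basis elements,
`φ(K_μ u⁺_α, K_ν u⁻_β) = v^{-(μ,ν)-(α,ν)+(μ,β)} (|V_α| / a_α) δ_{α β}`. -/
def pairing (μ : I → ℤ) (α : IsoCls Q k) (ν : I → ℤ) (β : IsoCls Q k) : Qv k :=
  vv k ^ (-(Q.symEuler μ ν) - Q.symEuler α.dimZ ν + Q.symEuler μ β.dimZ) *
    ((Fintype.card k : Qv k) ^ α.totalDim / (α.aut : Qv k)) * (if α = β then 1 else 0)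

/-- The value `φ(u⁺_α K_μ, u⁻_β K_ν)`, where
`u⁺_α K_μ = v^{-(μ,α)} K_μ u⁺_α` and `u⁻_β K_ν = v^{(ν,β)} K_ν u⁻_β`. -/
def pairingR (α : IsoCls Q k) (μ : I → ℤ) (β : IsoCls Q k) (ν : I → ℤ) : Qv k :=
  vv k ^ (-(Q.symEuler μ α.dimZ)) * vv k ^ (Q.symEuler ν β.dimZ) * pairing Q k μ α ν β

/-- Generators of the double Ringel-Hall algebra. The copies of `K_μ` in the two extended twisted
Ringel-Hall algebras are identified in the reduced Drinfeld double, so there is only one. -/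
inductive DGen : Type _
  | K (μ : I → ℤ)
  | uP (α : IsoCls Q k)
  | uM (α : IsoCls Q k)

/-- Generators as elements of the free `ℚ(v)`-algebra. -/
abbrev gen (x : DGen Q k) : FreeAlgebra (Qv k) (DGen Q k) := FreeAlgebra.ι (Qv k) x

open DGen in
/-- The relations of the reduced Drinfeld double: the relations of the extended twisted
Ringel-Hall algebras `H̃⁺` and `H̃⁻`, and the relations
`∑ φ(a₁, b₁) b₂ a₂ = ∑ a₁ b₁ φ(a₂, b₂)` (with `Δ a = ∑ a₁ ⊗ a₂`, `Δ b = ∑ b₁ ⊗ b₂`)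
between `a = u⁺_γ` and `b = u⁻_δ`. All sums have only finitely many nonzero terms. -/
inductive DRel : FreeAlgebra (Qv k) (DGen Q k) → FreeAlgebra (Qv k) (DGen Q k) → Prop
  | K_zero : DRel (gen Q k (K 0)) 1
  | uP_zero : DRel (gen Q k (uP (IsoCls.zero Q k))) 1
  | uM_zero : DRel (gen Q k (uM (IsoCls.zero Q k))) 1
  | K_mul (μ ν : I → ℤ) : DRel (gen Q k (K μ) * gen Q k (K ν)) (gen Q k (K (μ + ν)))
  | K_uP (μ : I → ℤ) (α : IsoCls Q k) :
      DRel (gen Q k (K μ) * gen Q k (uP α))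
        (vv k ^ Q.symEuler μ α.dimZ • (gen Q k (uP α) * gen Q k (K μ)))
  | K_uM (μ : I → ℤ) (α : IsoCls Q k) :
      DRel (gen Q k (K μ) * gen Q k (uM α))
        (vv k ^ (-(Q.symEuler μ α.dimZ)) • (gen Q k (uM α) * gen Q k (K μ)))
  | uP_mul (α β : IsoCls Q k) :
      DRel (gen Q k (uP α) * gen Q k (uP β))
        (vv k ^ Q.euler α.dimZ β.dimZ •
          ∑ᶠ γ : IsoCls Q k, (IsoCls.hall α β γ : Qv k) • gen Q k (uP γ))
  | uM_mul (α β : IsoCls Q k) :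
      DRel (gen Q k (uM α) * gen Q k (uM β))
        (vv k ^ Q.euler α.dimZ β.dimZ •
          ∑ᶠ γ : IsoCls Q k, (IsoCls.hall α β γ : Qv k) • gen Q k (uM γ))
  | cross (γ δ : IsoCls Q k) :
      DRel
        (∑ᶠ p : (IsoCls Q k × IsoCls Q k) × (IsoCls Q k × IsoCls Q k),
          (comulCoeff Q k γ p.1.1 p.1.2 * comulCoeff Q k δ p.2.1 p.2.2 *
            pairingR Q k p.1.1 p.1.2.dimZ p.2.2 0) •
              ((gen Q k (uM p.2.1) * gen Q k (K (-p.2.2.dimZ))) * gen Q k (uP p.1.2)))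
        (∑ᶠ p : (IsoCls Q k × IsoCls Q k) × (IsoCls Q k × IsoCls Q k),
          (comulCoeff Q k γ p.1.1 p.1.2 * comulCoeff Q k δ p.2.1 p.2.2 *
            pairingR Q k p.1.2 0 p.2.1 (-p.2.2.dimZ)) •
              ((gen Q k (uP p.1.1) * gen Q k (K p.1.2.dimZ)) * gen Q k (uM p.2.2)))

/-- The double Ringel-Hall algebra `D_q(Q)`: the quotient of the Drinfeld double of
`(H̃⁺, H̃⁻, φ)` in which the two copies of every `K_μ` are identified. -/
def DoubleHall : Type _ := RingQuot (DRel Q k)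

instance : Ring (DoubleHall Q k) := inferInstanceAs (Ring (RingQuot (DRel Q k)))

instance : Algebra (Qv k) (DoubleHall Q k) :=
  inferInstanceAs (Algebra (Qv k) (RingQuot (DRel Q k)))

/-- The quotient map from the free algebra to `D_q(Q)`. -/
def DoubleHall.proj : FreeAlgebra (Qv k) (DGen Q k) →ₐ[Qv k] DoubleHall Q k :=
  RingQuot.mkAlgHom (Qv k) (DRel Q k)

/-- The image of a generator in `D_q(Q)`. -/
def DoubleHall.of (x : DGen Q k) : DoubleHall Q k :=
  DoubleHall.proj Q k (gen Q k x)

variable [DecidableEq I]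

/-- The subalgebra `D̂_q(Q)` of `D_q(Q)` generated by the `u⁺_i`, the `u⁻_α` and the `K_μ`. -/
def DHat : Subalgebra (Qv k) (DoubleHall Q k) :=
  Algebra.adjoin (Qv k)
    (Set.range (fun i : I => DoubleHall.of Q k (.uP (IsoCls.simple Q k i))) ∪
      Set.range (fun α : IsoCls Q k => DoubleHall.of Q k (.uM α)) ∪
      Set.range (fun μ : I → ℤ => DoubleHall.of Q k (.K μ)))

/-- `u⁺_i` as an element of `D̂_q(Q)`. -/
def DHat.uP (i : I) : DHat Q k :=
  ⟨DoubleHall.of Q k (.uP (IsoCls.simple Q k i)),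
    Algebra.subset_adjoin (Or.inl (Or.inl ⟨i, rfl⟩))⟩

/-- `u⁻_α` as an element of `D̂_q(Q)`. -/
def DHat.uM (α : IsoCls Q k) : DHat Q k :=
  ⟨DoubleHall.of Q k (.uM α), Algebra.subset_adjoin (Or.inl (Or.inr ⟨α, rfl⟩))⟩

/-- `K_μ` as an element of `D̂_q(Q)`. -/
def DHat.K (μ : I → ℤ) : DHat Q k :=
  ⟨DoubleHall.of Q k (.K μ), Algebra.subset_adjoin (Or.inr ⟨μ, rfl⟩)⟩

end Double

/-! ## Enlarged quivers and invariant functions -/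

/-- The enlarged quiver of `Q` in which every new arrow `h_i` goes from `i` to `î`. The vertex `i`
is `Sum.inl i`, the vertex `î` is `Sum.inr i`, and the arrow `h_i` is `Sum.inr i`. -/
def Quiv.enlarge {I H : Type*} (Q : Quiv I H) : Quiv (I ⊕ I) (H ⊕ I) where
  s := Sum.elim (fun h => Sum.inl (Q.s h)) Sum.inl
  t := Sum.elim (fun h => Sum.inl (Q.t h)) Sum.inr

/-- The quivers with the same underlying graph as the enlarged quivers of `Q`: an arrow is reversed
exactly when `Ω` is `true` there. -/
abbrev Quiv.hat {I H : Type*} (Q : Quiv I H) (Ω : H ⊕ I → Bool) : Quiv (I ⊕ I) (H ⊕ I) :=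
  Q.enlarge.reorient Ω

/-- The enlarged quivers of `Q` itself: the arrows of `Q` keep their orientation, and the arrow
`h_i` goes from `i` to `î` if `o i = false` and from `î` to `i` if `o i = true`. -/
abbrev framing {H I : Type*} (o : I → Bool) : H ⊕ I → Bool := Sum.elim (fun _ => false) o

section Functions

variable {I H : Type*} [Fintype I] [DecidableEq I] [Fintype H] [DecidableEq H] (Q : Quiv I H)
  {k : Type*} [Field k] [Fintype k] [DecidableEq k]

/-- The representation variety of the enlarged quiver; the dimension vector has the components
`ν i` at `i` and `w i` at `î`. -/
abbrev HRep (k : Type*) (Ω : H ⊕ I → Bool) (ν w : I → ℕ) : Type _ :=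
  Rep (Q.hat Ω) k (Sum.elim ν w)

/-- An element of `G_{ν,I} = ∏_{i ∈ I} GL (V_i)`, extended by the identity at the vertices `î`. -/
def hatGL {ν : I → ℕ} (w : I → ℕ) (g : GrGL k ν) : GrGL k (Sum.elim ν w) :=
  fun j => match j with
  | .inl i => g i
  | .inr _ => (1 : GL _ k)

/-- Graded maps, extended by the identity at the vertices `î`. -/
def hatMap {ν ν' : I → ℕ} (w : I → ℕ) (y : GrMap k ν ν') :
    GrMap k (Sum.elim ν w) (Sum.elim ν' w) :=
  fun j => match j with
  | .inl i => y i
  | .inr i => (1 : Matrix (Fin (w i)) (Fin (w i)) k)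

/-- The order of `G_{ν,I}`. -/
def cardG (k : Type*) [Field k] (ν : I → ℕ) : ℕ := Nat.card (GrGL k ν)

/-- The space of `G_{ν,I}`-invariant functions on `E_{ν,Q̂}`. (Over a finite field every function
is constructible.) -/
def InvFun (k : Type*) [Field k] (Ω : H ⊕ I → Bool) (ν w : I → ℕ) :
    Submodule ℂ (HRep Q k Ω ν w → ℂ) where
  carrier := {f | ∀ (g : GrGL k ν) (x : HRep Q k Ω ν w), f (act (hatGL w g) x) = f x}
  add_mem' := by
    intro f f' hf hf' g x
    simp only [Pi.add_apply, hf g x, hf' g x]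
  zero_mem' := fun _ _ => rfl
  smul_mem' := by
    intro c f hf g x
    simp only [Pi.smul_apply, hf g x]

/-! ### The Fourier transforms -/

/-- The pairing `tr (x y)` between `Hom (V, W)` and `Hom (W, V)`. -/
def trPair {m n : ℕ} (x : Matrix (Fin m) (Fin n) k) (y : Matrix (Fin n) (Fin m) k) : k :=
  Matrix.trace (x * y)

/-- The kernel of the Fourier transform at one edge with end points `p` (start) and `r` (terminal)
in the reference orientation; `a` and `b` say whether the edge is reversed in the first and in the
second quiver. If the orientations agree, nothing happens; otherwise the kernel is
`v^{-d_p d_r} ψ(± tr (x y))`, where the sign depends on the direction of the change, so that the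
two directions are inverse to each other. -/
def edgeKernel {J : Type*} (ψ : AddChar k ℂ) (d : J → ℕ) (p r : J) : (a b : Bool) →
    Matrix (Fin (d (bif a then p else r))) (Fin (d (bif a then r else p))) k →
    Matrix (Fin (d (bif b then p else r))) (Fin (d (bif b then r else p))) k → ℂ
  | false, false, x, y => if x = y then 1 else 0
  | true, true, x, y => if x = y then 1 else 0
  | false, true, x, y => (vC k ^ (d p * d r))⁻¹ *
      ψ (trPair (m := d r) (n := d p) x y)
  | true, false, x, y => (vC k ^ (d p * d r))⁻¹ *
      ψ (-trPair (m := d p) (n := d r) x y)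

theorem edgeKernel_conj {J : Type*} (ψ : AddChar k ℂ) (d : J → ℕ) (p r : J) (G : GrGL k d)
    (a b : Bool)
    (x : Matrix (Fin (d (bif a then p else r))) (Fin (d (bif a then r else p))) k)
    (y : Matrix (Fin (d (bif b then p else r))) (Fin (d (bif b then r else p))) k) :
    edgeKernel ψ d p r a b
      ((G (bif a then p else r)).val * x * ((G (bif a then r else p))⁻¹).val)
      ((G (bif b then p else r)).val * y * ((G (bif b then r else p))⁻¹).val) =
    edgeKernel ψ d p r a b x y := by
  have key : ∀ (m n : ℕ) (A : GL (Fin m) k) (B : GL (Fin n) k) (x y : Matrix (Fin m) (Fin n) k),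
      A.val * x * (B⁻¹).val = A.val * y * (B⁻¹).val ↔ x = y := by
    intro m n A B x y
    constructor
    · intro h
      have h2 := congrArg (fun M => (A⁻¹).val * M * B.val) h
      simpa [Matrix.mul_assoc, ← Matrix.mul_assoc (A⁻¹).val A.val] using h2
    · rintro rfl; rfl
  have tr : ∀ (m n : ℕ) (A : GL (Fin m) k) (B : GL (Fin n) k) (x : Matrix (Fin m) (Fin n) k)
      (y : Matrix (Fin n) (Fin m) k),
      trPair (A.val * x * (B⁻¹).val) (B.val * y * (A⁻¹).val) = trPair x y := by
    intro m n A B x y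
    unfold trPair
    have h1 : (A.val * x * (B⁻¹).val) * (B.val * y * (A⁻¹).val) =
        A.val * (x * y) * (A⁻¹).val := by
      simp [Matrix.mul_assoc]
    rw [h1, Matrix.trace_mul_comm, ← Matrix.mul_assoc]
    simp
  cases a <;> cases b <;> simp only [edgeKernel, cond_true, cond_false]
  · simp only [key]
  · rw [tr]
  · rw [tr]
  · simp only [key]

/-- The kernel of the Fourier transform: the product of the kernels over all edges. -/
def kernel (ψ : AddChar k ℂ) (Ω Ω' : H ⊕ I → Bool) {ν w : I → ℕ}
    (x : HRep Q k Ω ν w) (x' : HRep Q k Ω' ν w) : ℂ :=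
  ∏ h, edgeKernel ψ (Sum.elim ν w) (Q.enlarge.s h) (Q.enlarge.t h) (Ω h) (Ω' h) (x h) (x' h)

theorem kernel_act (ψ : AddChar k ℂ) (Ω Ω' : H ⊕ I → Bool) {ν w : I → ℕ}
    (G : GrGL k (Sum.elim ν w)) (x : HRep Q k Ω ν w) (x' : HRep Q k Ω' ν w) :
    kernel Q ψ Ω Ω' (act G x) (act G x') = kernel Q ψ Ω Ω' x x' := by
  unfold kernel
  refine Finset.prod_congr rfl fun h _ => ?_
  exact edgeKernel_conj ψ (Sum.elim ν w) (Q.enlarge.s h) (Q.enlarge.t h) G (Ω h) (Ω' h) (x h) (x' h)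

/-- The bijection of `E` given by a group element. -/
def actEquiv {J A : Type*} {Γ : Quiv J A} {d : J → ℕ} (g : GrGL k d) : Rep Γ k d ≃ Rep Γ k d where
  toFun := act g
  invFun := act g⁻¹
  left_inv x := by rw [← act_mul, inv_mul_cancel, act_one]
  right_inv x := by rw [← act_mul, mul_inv_cancel, act_one]

/-- The Fourier transform `Φ_{Q̂,Q̂'}` between two orientations of the same graph. -/
def fourier (ψ : AddChar k ℂ) (Ω Ω' : H ⊕ I → Bool) (ν w : I → ℕ) :
    InvFun Q k Ω ν w →ₗ[ℂ] InvFun Q k Ω' ν w where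
  toFun f := ⟨fun x' => ∑ x, kernel Q ψ Ω Ω' x x' * f.1 x, by
    intro g x'
    show ∑ x, kernel Q ψ Ω Ω' x (act (hatGL w g) x') * f.1 x = _
    rw [← Equiv.sum_comp (actEquiv (hatGL w g))]
    refine Finset.sum_congr rfl fun x _ => ?_
    show kernel Q ψ Ω Ω' (act (hatGL w g) x) (act (hatGL w g) x') * f.1 (act (hatGL w g) x) = _
    rw [kernel_act, f.2 g x]⟩
  map_add' f f' := by
    ext x'
    simp [mul_add, Finset.sum_add_distrib]
  map_smul' c f := by
    ext x'
    simp [Finset.mul_sum, mul_left_comm]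

/-! ### The subspaces `𝒩` and the space `ℱ_{Q̂}` -/

/-- The subset `ⁱE` of all `x` such that
`⊕_{s(h) = i} x_h : V_i → ⊕_{s(h) = i} V_{t(h)}` is injective. -/
def injLocus (Ω : H ⊕ I → Bool) (i : I) (ν w : I → ℕ) : Set (HRep Q k Ω ν w) :=
  {x | ∀ u : ∀ j : I ⊕ I, Fin (Sum.elim ν w j) → k,
    (∀ h, (Q.hat Ω).s h = Sum.inl i → (x h).mulVec (u ((Q.hat Ω).s h)) = 0) → u (Sum.inl i) = 0}

/-- The orientation obtained by reversing all arrows that end at `i`, so that `i` becomes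
a source (if the graph has no loops). -/
def toSource (Ω : H ⊕ I → Bool) (i : I) : H ⊕ I → Bool :=
  fun h => if (Q.hat Ω).t h = Sum.inl i then !(Ω h) else Ω h

/-- `𝒩_{ν,Q̂,i}`: the functions whose Fourier transform to an orientation with source `i` vanishes
on `ⁱE`. -/
def nullAt (ψ : AddChar k ℂ) (Ω : H ⊕ I → Bool) (i : I) (ν w : I → ℕ) :
    Submodule ℂ (InvFun Q k Ω ν w) where
  carrier := {f | ∀ x ∈ injLocus Q (toSource Q Ω i) i ν w,
    (fourier Q ψ Ω (toSource Q Ω i) ν w f).1 x = 0}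
  add_mem' := by
    intro f f' hf hf' x hx
    simp [map_add, hf x hx, hf' x hx]
  zero_mem' := by
    intro x _
    simp
  smul_mem' := by
    intro c f hf x hx
    simp [map_smul, hf x hx]

/-- `𝒩_{ν,Q̂}`, the sum of the subspaces `𝒩_{ν,Q̂,i}`. -/
def null (ψ : AddChar k ℂ) (Ω : H ⊕ I → Bool) (ν w : I → ℕ) :
    Submodule ℂ (InvFun Q k Ω ν w) := ⨆ i, nullAt Q ψ Ω i ν w

/-- `ℱ_{ν,Q̂}`, the quotient of the invariant functions by `𝒩_{ν,Q̂}`. -/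
def FGr (ψ : AddChar k ℂ) (Ω : H ⊕ I → Bool) (d : (I → ℕ) × (I → ℕ)) : Type _ :=
  InvFun Q k Ω d.1 d.2 ⧸ null Q ψ Ω d.1 d.2

instance (ψ : AddChar k ℂ) (Ω : H ⊕ I → Bool) (d : (I → ℕ) × (I → ℕ)) :
    AddCommGroup (FGr Q ψ Ω d) :=
  inferInstanceAs (AddCommGroup (InvFun Q k Ω d.1 d.2 ⧸ null Q ψ Ω d.1 d.2))

instance (ψ : AddChar k ℂ) (Ω : H ⊕ I → Bool) (d : (I → ℕ) × (I → ℕ)) :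
    Module ℂ (FGr Q ψ Ω d) :=
  inferInstanceAs (Module ℂ (InvFun Q k Ω d.1 d.2 ⧸ null Q ψ Ω d.1 d.2))

/-- `ℱ_{Q̂}`, the direct sum of the `ℱ_{ν,Q̂}` over all dimension vectors of the enlarged quiver. -/
def FSpace (ψ : AddChar k ℂ) (Ω : H ⊕ I → Bool) : Type _ :=
  DirectSum ((I → ℕ) × (I → ℕ)) (FGr Q ψ Ω)

instance (ψ : AddChar k ℂ) (Ω : H ⊕ I → Bool) : AddCommGroup (FSpace Q ψ Ω) :=
  inferInstanceAs (AddCommGroup (DirectSum ((I → ℕ) × (I → ℕ)) (FGr Q ψ Ω)))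

instance (ψ : AddChar k ℂ) (Ω : H ⊕ I → Bool) : Module ℂ (FSpace Q ψ Ω) :=
  inferInstanceAs (Module ℂ (DirectSum ((I → ℕ) × (I → ℕ)) (FGr Q ψ Ω)))

/-- The class `[f]` in `ℱ_{Q̂}` of an invariant function `f`. -/
def cls (ψ : AddChar k ℂ) (Ω : H ⊕ I → Bool) {ν w : I → ℕ} (f : InvFun Q k Ω ν w) :
    FSpace Q ψ Ω :=
  DirectSum.lof ℂ ((I → ℕ) × (I → ℕ)) (FGr Q ψ Ω) (ν, w)
    (Submodule.Quotient.mk (p := null Q ψ Ω ν w) f)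

/-! ### The operators -/

/-- The exponent `ν̄_i - ν_i`, where
`ν̄_i = ∑_{s(h) = i} ν_{t(h)} + ∑_{t(h) = i} ν_{s(h)} - ν_i`. -/
def kExp (Ω : H ⊕ I → Bool) (i : I) (ν w : I → ℕ) : ℤ :=
  ((∑ h, if (Q.hat Ω).s h = Sum.inl i then ((Sum.elim ν w ((Q.hat Ω).t h) : ℕ) : ℤ) else 0) +
    (∑ h, if (Q.hat Ω).t h = Sum.inl i then ((Sum.elim ν w ((Q.hat Ω).s h) : ℕ) : ℤ) else 0) -
    (ν i : ℤ)) - (ν i : ℤ)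

/-- The map `𝒦_{Q̂,i} = v^{ν̄_i - ν_i} Id`. -/
def opK (Ω : H ⊕ I → Bool) (i : I) (ν w : I → ℕ) :
    InvFun Q k Ω ν w →ₗ[ℂ] InvFun Q k Ω ν w :=
  (vC k ^ kExp Q Ω i ν w) • LinearMap.id

/-- The inverse map `𝒦_{Q̂,i}⁻¹`. -/
def opKinv (Ω : H ⊕ I → Bool) (i : I) (ν w : I → ℕ) :
    InvFun Q k Ω ν w →ₗ[ℂ] InvFun Q k Ω ν w :=
  (vC k ^ (-(kExp Q Ω i ν w))) • LinearMap.id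

/-- Membership of `(x, x', y)` in `Z_{Q̂}`: every `y_j` is injective, `y_ĵ` is the identity, and
`y` is a morphism from `x` to `x'`. -/
def InZ {Ω : H ⊕ I → Bool} {ν ν' w : I → ℕ} (x : HRep Q k Ω ν w) (x' : HRep Q k Ω ν' w)
    (y : GrMap k ν ν') : Prop :=
  (∀ j, Function.Injective (y j).mulVec) ∧ IsHom x x' (hatMap w y)

/-- Translation of graded maps by a group element on the source side. -/
def precomp {ν ν' : I → ℕ} (g : GrGL k ν) : GrMap k ν ν' ≃ GrMap k ν ν' where
  toFun y := fun j => y j * ((g j)⁻¹).val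
  invFun y := fun j => y j * (g j).val
  left_inv y := by funext j; simp [Matrix.mul_assoc]
  right_inv y := by funext j; simp [Matrix.mul_assoc]

/-- Translation of graded maps by a group element on the target side. -/
def postcomp {ν ν' : I → ℕ} (g : GrGL k ν') : GrMap k ν ν' ≃ GrMap k ν ν' where
  toFun y := fun j => (g j).val * y j
  invFun y := fun j => ((g j)⁻¹).val * y j
  left_inv y := by funext j; simp [← Matrix.mul_assoc]
  right_inv y := by funext j; simp [← Matrix.mul_assoc]

theorem inZ_precomp {Ω : H ⊕ I → Bool} {ν ν' w : I → ℕ} (g : GrGL k ν) (x : HRep Q k Ω ν w)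
    (x' : HRep Q k Ω ν' w) (y : GrMap k ν ν') :
    InZ Q (act (hatGL w g) x) x' (precomp g y) ↔ InZ Q x x' y := by
  have hm : hatMap w (precomp g y) = fun j => hatMap w y j * ((hatGL w g j)⁻¹).val := by
    funext j
    cases j with
    | inl i => rfl
    | inr i =>
      have e : (1 : Matrix (Fin (w i)) (Fin (w i)) k) = 1 * ((1 : GL (Fin (w i)) k)⁻¹).val := by simp
      exact e
  have hinj : ∀ (m n : ℕ) (A : GL (Fin n) k) (M : Matrix (Fin m) (Fin n) k),
      Function.Injective (M * (A⁻¹).val).mulVec ↔ Function.Injective M.mulVec := by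
    intro m n A M
    have hb : Function.Bijective ((A⁻¹).val).mulVec := by
      refine Function.bijective_iff_has_inverse.2 ⟨A.val.mulVec, fun v => ?_, fun v => ?_⟩ <;> simp
    have : (M * (A⁻¹).val).mulVec = M.mulVec ∘ ((A⁻¹).val).mulVec := by
      funext v; simp [Matrix.mulVec_mulVec]
    rw [this]
    exact Function.Injective.of_comp_iff' _ hb
  unfold InZ
  refine and_congr (forall_congr' fun j => hinj _ _ _ _) ?_
  rw [hm]
  refine forall_congr' fun h => ?_
  set s := (Q.hat Ω).s h
  set t := (Q.hat Ω).t h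
  show x' h * (hatMap w y s * ((hatGL w g s)⁻¹).val) =
    hatMap w y t * ((hatGL w g t)⁻¹).val * ((hatGL w g t).val * x h * ((hatGL w g s)⁻¹).val) ↔ _
  have e : hatMap w y t * ((hatGL w g t)⁻¹).val *
      ((hatGL w g t).val * x h * ((hatGL w g s)⁻¹).val) =
      hatMap w y t * x h * ((hatGL w g s)⁻¹).val := by
    simp [Matrix.mul_assoc]
  rw [e, ← Matrix.mul_assoc]
  constructor
  · intro hh
    have h2 := congrArg (fun M => M * (hatGL w g s).val) hh
    simpa [Matrix.mul_assoc] using h2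
  · intro hh
    rw [hh]

theorem inZ_postcomp {Ω : H ⊕ I → Bool} {ν ν' w : I → ℕ} (g : GrGL k ν') (x : HRep Q k Ω ν w)
    (x' : HRep Q k Ω ν' w) (y : GrMap k ν ν') :
    InZ Q x (act (hatGL w g) x') (postcomp g y) ↔ InZ Q x x' y := by
  have hm : hatMap w (postcomp g y) = fun j => (hatGL w g j).val * hatMap w y j := by
    funext j
    cases j with
    | inl i => rfl
    | inr i =>
      have e : (1 : Matrix (Fin (w i)) (Fin (w i)) k) = (1 : GL (Fin (w i)) k).val * 1 := by simp
      exact e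
  have hinj : ∀ (m n : ℕ) (A : GL (Fin m) k) (M : Matrix (Fin m) (Fin n) k),
      Function.Injective (A.val * M).mulVec ↔ Function.Injective M.mulVec := by
    intro m n A M
    have hb : Function.Injective A.val.mulVec := by
      refine Function.LeftInverse.injective (g := ((A⁻¹).val).mulVec) fun v => ?_
      simp
    have : (A.val * M).mulVec = A.val.mulVec ∘ M.mulVec := by
      funext v; simp [Matrix.mulVec_mulVec]
    rw [this]
    exact hb.of_comp_iff _
  unfold InZ
  refine and_congr (forall_congr' fun j => hinj _ _ _ _) ?_
  rw [hm]
  refine forall_congr' fun h => ?_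
  set s := (Q.hat Ω).s h
  set t := (Q.hat Ω).t h
  show (hatGL w g t).val * x' h * ((hatGL w g s)⁻¹).val * ((hatGL w g s).val * hatMap w y s) =
    (hatGL w g t).val * hatMap w y t * x h ↔ _
  have e : (hatGL w g t).val * x' h * ((hatGL w g s)⁻¹).val *
      ((hatGL w g s).val * hatMap w y s) = (hatGL w g t).val * (x' h * hatMap w y s) := by
    simp [Matrix.mul_assoc]
  rw [e, Matrix.mul_assoc]
  constructor
  · intro hh
    have h2 := congrArg (fun M => ((hatGL w g t)⁻¹).val * M) hh
    simpa [← Matrix.mul_assoc] using h2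
  · intro hh
    rw [hh]

open Classical in
/-- The map `ℰ⁺_{Q̂,i} = v^{-ν_i} |G_{ν'}|⁻¹ (ⁱp)_! (ⁱp')^*` from the functions on `E_{ν',Q̂}` to
the functions on `E_{ν,Q̂}`, where `ν' = ν + i` (to be used when `i` is a source). -/
def opEplus (Ω : H ⊕ I → Bool) (i : I) (ν w : I → ℕ) :
    InvFun Q k Ω (ν + Pi.single i 1) w →ₗ[ℂ] InvFun Q k Ω ν w where
  toFun f := ⟨fun x =>
      (vC k ^ (-(ν i : ℤ)) * (cardG k (ν + Pi.single i 1) : ℂ)⁻¹) *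
        ∑ x', ∑ y, if InZ Q x x' y ∧ x' ∈ injLocus Q Ω i (ν + Pi.single i 1) w then f.1 x' else 0,
    by
      intro g x
      refine congrArg _ (Finset.sum_congr rfl fun x' _ => ?_)
      rw [← Equiv.sum_comp (precomp g)]
      simp only [inZ_precomp]⟩
  map_add' f f' := by
    ext x
    simp only [Submodule.coe_add, Pi.add_apply, ← mul_add, ← Finset.sum_add_distrib]
    refine congrArg _ (Finset.sum_congr rfl fun x' _ => Finset.sum_congr rfl fun y _ => ?_)
    split_ifs <;> simp
  map_smul' c f := by
    ext x
    simp only [Submodule.coe_smul, Pi.smul_apply, RingHom.id_apply, smul_eq_mul]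
    rw [mul_left_comm]
    simp only [Finset.mul_sum, mul_ite, mul_zero]

/-- A representation of `Q`, seen as a representation of the enlarged quiver that vanishes at the
vertices `î`. -/
def extendZero (o : I → Bool) {d : I → ℕ} (x : Rep Q k d) : HRep Q k (framing o) d 0 :=
  fun h => match h with
  | .inl h => x h
  | .inr _ => 0

/-- `[V_{x'} / Im y] = α`: there is a surjective morphism from `x'` to `V_α` whose kernel is the
image of `y`. -/
def CokerIs (o : I → Bool) {ν ν' w : I → ℕ} (x' : HRep Q k (framing o) ν' w)
    (y : GrMap k ν ν') (α : IsoCls Q k) : Prop :=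
  ∃ z : GrMap k (Sum.elim ν' w) (Sum.elim α.dim 0), IsHom x' (extendZero Q o α.rep) z ∧
    ∀ j, Function.Surjective (z j).mulVec ∧
      LinearMap.ker (z j).mulVecLin = LinearMap.range (hatMap w y j).mulVecLin

theorem cokerIs_postcomp (o : I → Bool) {ν ν' w : I → ℕ} (g : GrGL k ν')
    (x' : HRep Q k (framing o) ν' w) (y : GrMap k ν ν') (α : IsoCls Q k) :
    CokerIs Q o (act (hatGL w g) x') (postcomp g y) α ↔ CokerIs Q o x' y α := by
  have one : ∀ (g : GrGL k ν') (x' : HRep Q k (framing o) ν' w) (y : GrMap k ν ν'),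
      CokerIs Q o x' y α → CokerIs Q o (act (hatGL w g) x') (postcomp g y) α := by
    intro g x' y
    rintro ⟨z, hz, hzj⟩
    have hm : hatMap w (postcomp g y) = fun j => (hatGL w g j).val * hatMap w y j := by
      funext j
      cases j with
      | inl i => rfl
      | inr i =>
        have e : (1 : Matrix (Fin (w i)) (Fin (w i)) k) = (1 : GL (Fin (w i)) k).val * 1 := by simp
        exact e
    refine ⟨fun j => z j * ((hatGL w g j)⁻¹).val, fun h => ?_, fun j => ⟨?_, ?_⟩⟩
    · have hh := hz h
      set s := (Q.hat (framing o)).s h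
      set t := (Q.hat (framing o)).t h
      show _ * (z s * ((hatGL w g s)⁻¹).val) = z t * ((hatGL w g t)⁻¹).val *
        ((hatGL w g t).val * x' h * ((hatGL w g s)⁻¹).val)
      rw [← Matrix.mul_assoc, hh]
      simp [Matrix.mul_assoc]
      rfl
    · intro v
      obtain ⟨u, hu⟩ := (hzj j).1 v
      exact ⟨(hatGL w g j).val.mulVec u, by simp [Matrix.mulVec_mulVec, Matrix.mul_assoc, hu]⟩
    · rw [hm]
      have hk := (hzj j).2
      ext u
      have hk' := SetLike.ext_iff.1 hk (((hatGL w g j)⁻¹).val.mulVec u)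
      simp only [LinearMap.mem_ker, LinearMap.mem_range, Matrix.mulVecLin_apply,
        Matrix.mulVec_mulVec] at hk' ⊢
      rw [hk']
      refine exists_congr fun u' => ?_
      constructor
      · intro h1
        rw [← Matrix.mulVec_mulVec, h1, Matrix.mulVec_mulVec]
        simp
      · rintro rfl
        rw [Matrix.mulVec_mulVec, ← Matrix.mul_assoc]
        simp
  refine ⟨fun h => ?_, one g x' y⟩
  have h1 := one g⁻¹ _ _ h
  have e1 : act (hatGL w g⁻¹) (act (hatGL w g) x') = x' := by
    rw [← act_mul]
    have : hatGL w g⁻¹ * hatGL w g = 1 := by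
      funext j
      cases j with
      | inl i => exact inv_mul_cancel (g i)
      | inr i => exact mul_one (1 : GL (Fin (w i)) k)
    rw [this, act_one]
  have e2 : postcomp g⁻¹ (postcomp g y) = y := by
    funext j
    simp [postcomp, ← Matrix.mul_assoc]
  rwa [e1, e2] at h1

/-- The element `ν` of `ℤ Î` given by its components `ν i` at `i` and `w i` at `î`. -/
def hatZ (ν w : I → ℕ) : I ⊕ I → ℤ := fun j => ((Sum.elim ν w j : ℕ) : ℤ)

open Classical in
/-- The map `ℰ⁻_{Q̂,α} = (-v)^{dim V_α} v^{⟨α,ν⟩ + dim V_α} |G_ν|⁻¹ p'_! p^*` from the functions on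
`E_{ν,Q̂}` to the functions on `E_{ν',Q̂}`, where `ν' = ν + α`. -/
def opEminus (o : I → Bool) (α : IsoCls Q k) (ν w : I → ℕ) :
    InvFun Q k (framing o) ν w →ₗ[ℂ] InvFun Q k (framing o) (ν + α.dim) w where
  toFun f := ⟨fun x' =>
      ((-vC k) ^ α.totalDim *
          vC k ^ ((Q.hat (framing o)).euler (hatZ α.dim 0) (hatZ ν w) + (α.totalDim : ℤ)) *
          (cardG k ν : ℂ)⁻¹) *
        ∑ x, ∑ y, if InZ Q x x' y ∧ CokerIs Q o x' y α then f.1 x else 0,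
    by
      intro g x'
      refine congrArg _ (Finset.sum_congr rfl fun x _ => ?_)
      rw [← Equiv.sum_comp (postcomp g)]
      simp only [inZ_postcomp, cokerIs_postcomp]⟩
  map_add' f f' := by
    ext x
    simp only [Submodule.coe_add, Pi.add_apply, ← mul_add, ← Finset.sum_add_distrib]
    refine congrArg _ (Finset.sum_congr rfl fun x' _ => Finset.sum_congr rfl fun y _ => ?_)
    split_ifs <;> simp
  map_smul' c f := by
    ext x
    simp only [Submodule.coe_smul, Pi.smul_apply, RingHom.id_apply, smul_eq_mul]
    rw [mul_left_comm]
    simp only [Finset.mul_sum, mul_ite, mul_zero]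

end Functions

end RingelHall

end

open RingelHall

noncomputable section
namespace RingelHall

/-! ## Representations on arbitrary finite index types -/

section Classes

variable {J A k : Type*} [Field k] {Γ : Quiv J A}

/-- Representations of `Γ` on the graded space with components `k ^ (n j)`. -/
abbrev MRep (Γ : Quiv J A) (k : Type*) (n : J → Type) : Type _ :=
  ∀ h : A, Matrix (n (Γ.t h)) (n (Γ.s h)) k

/-- Graded linear maps. -/
abbrev MMap (k : Type*) (n n' : J → Type) : Type _ := ∀ j : J, Matrix (n' j) (n j) k

/-- The index types `Fin (d j)`. -/
abbrev FinD (d : J → ℕ) : J → Type := fun j => Fin (d j)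

variable {n n' n'' m m' : J → Type}
  [∀ j, Fintype (n j)] [∀ j, DecidableEq (n j)]
  [∀ j, Fintype (n' j)] [∀ j, DecidableEq (n' j)]
  [∀ j, Fintype (n'' j)] [∀ j, DecidableEq (n'' j)]
  [∀ j, Fintype (m j)] [∀ j, DecidableEq (m j)]
  [∀ j, Fintype (m' j)] [∀ j, DecidableEq (m' j)]

/-- Morphisms of representations. -/
def IsMHom (x : MRep Γ k n) (x' : MRep Γ k n') (y : MMap k n n') : Prop :=
  ∀ h, x' h * y (Γ.s h) = y (Γ.t h) * x h

/-- Graded linear isomorphisms. -/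
structure MIso (k : Type*) [Field k] (n n' : J → Type)
    [∀ j, Fintype (n j)] [∀ j, DecidableEq (n j)]
    [∀ j, Fintype (n' j)] [∀ j, DecidableEq (n' j)] where
  /-- the map -/
  fwd : MMap k n n'
  /-- the inverse map -/
  bwd : MMap k n' n
  bwd_fwd : ∀ j, bwd j * fwd j = 1
  fwd_bwd : ∀ j, fwd j * bwd j = 1

attribute [simp] MIso.bwd_fwd MIso.fwd_bwd

namespace MIso

theorem ext_fwd {p q : MIso k n n'} (h : p.fwd = q.fwd) : p = q := by
  obtain ⟨a, b, hab, hba⟩ := p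
  obtain ⟨c, d, hcd, hdc⟩ := q
  obtain rfl : a = c := h
  have : b = d := by
    funext j
    calc b j = b j * (a j * d j) := by rw [hdc, Matrix.mul_one]
      _ = d j := by rw [← Matrix.mul_assoc, hab, Matrix.one_mul]
  subst this
  rfl

/-- The identity. -/
def refl (k : Type*) [Field k] (n : J → Type) [∀ j, Fintype (n j)] [∀ j, DecidableEq (n j)] :
    MIso k n n := ⟨fun _ => 1, fun _ => 1, by simp, by simp⟩

/-- The inverse. -/
def symm (p : MIso k n n') : MIso k n' n := ⟨p.bwd, p.fwd, p.fwd_bwd, p.bwd_fwd⟩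

/-- The composition. -/
def trans (p : MIso k n n') (q : MIso k n' n'') : MIso k n n'' where
  fwd j := q.fwd j * p.fwd j
  bwd j := p.bwd j * q.bwd j
  bwd_fwd j := by
    rw [Matrix.mul_assoc, ← Matrix.mul_assoc (q.bwd j), q.bwd_fwd, Matrix.one_mul, p.bwd_fwd]
  fwd_bwd j := by
    rw [Matrix.mul_assoc, ← Matrix.mul_assoc (p.fwd j), p.fwd_bwd, Matrix.one_mul, q.fwd_bwd]

@[simp] theorem bwd_fwd_mul {l : Type} (p : MIso k n n') (j : J) (M : Matrix (n j) l k) :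
    p.bwd j * (p.fwd j * M) = M := by rw [← Matrix.mul_assoc, p.bwd_fwd, Matrix.one_mul]

@[simp] theorem fwd_bwd_mul {l : Type} (p : MIso k n n') (j : J) (M : Matrix (n' j) l k) :
    p.fwd j * (p.bwd j * M) = M := by rw [← Matrix.mul_assoc, p.fwd_bwd, Matrix.one_mul]

/-- Transport of representations. -/
def conj (p : MIso k n n') (x : MRep Γ k n) : MRep Γ k n' :=
  fun h => p.fwd (Γ.t h) * x h * p.bwd (Γ.s h)

theorem refl_conj (x : MRep Γ k n) : (refl k n).conj x = x := by
  funext h; simp [conj, refl]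

theorem trans_conj (p : MIso k n n') (q : MIso k n' n'') (x : MRep Γ k n) :
    (p.trans q).conj x = q.conj (p.conj x) := by
  funext h; simp [conj, trans, Matrix.mul_assoc]

@[simp] theorem symm_conj_conj (p : MIso k n n') (x : MRep Γ k n) : p.symm.conj (p.conj x) = x := by
  funext h; simp [conj, symm, Matrix.mul_assoc]

@[simp] theorem conj_symm_conj (p : MIso k n n') (x : MRep Γ k n') :
    p.conj (p.symm.conj x) = x := p.symm.symm_conj_conj x

theorem isMHom (p : MIso k n n') (x : MRep Γ k n) : IsMHom x (p.conj x) p.fwd := by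
  intro h; simp [conj, Matrix.mul_assoc]

theorem conj_eq_iff (p : MIso k n n') (x : MRep Γ k n) (x' : MRep Γ k n') :
    p.conj x = x' ↔ IsMHom x x' p.fwd := by
  constructor
  · rintro rfl; exact p.isMHom x
  · intro h
    funext a
    simp only [conj]
    rw [← h a, Matrix.mul_assoc, p.fwd_bwd, Matrix.mul_one]

/-- Transport as a bijection. -/
def conjEquiv (p : MIso k n n') : MRep Γ k n ≃ MRep Γ k n' where
  toFun := p.conj
  invFun := p.symm.conj
  left_inv x := by simp
  right_inv x := by simp

/-- The linear equivalences of the components. -/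
def le (p : MIso k n n') (j : J) : (n j → k) ≃ₗ[k] (n' j → k) :=
  LinearEquiv.ofLinearMap (p.fwd j).mulVecLin (p.bwd j).mulVecLin
    (by rw [← Matrix.mulVecLin_mul, p.fwd_bwd, Matrix.mulVecLin_one])
    (by rw [← Matrix.mulVecLin_mul, p.bwd_fwd, Matrix.mulVecLin_one])

theorem le_apply (p : MIso k n n') (j : J) (v : n j → k) : p.le j v = (p.fwd j).mulVec v := rfl

theorem card_eq (p : MIso k n n') (j : J) : Fintype.card (n j) = Fintype.card (n' j) := by
  have := LinearEquiv.finrank_eq (p.le j)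
  simpa using this

/-- The permutation isomorphism given by bijections of the index sets. -/
def ofEquiv (k : Type*) [Field k] (e : ∀ j, n j ≃ n' j) : MIso k n n' where
  fwd j := (1 : Matrix (n' j) (n' j) k).submatrix id (e j)
  bwd j := (1 : Matrix (n' j) (n' j) k).submatrix (e j) id
  bwd_fwd j := by
    ext a b
    simp [Matrix.mul_apply, Matrix.one_apply]
  fwd_bwd j := by
    rw [Matrix.submatrix_mul_equiv, Matrix.one_mul, Matrix.submatrix_id_id]

theorem ofEquiv_conj (e : ∀ j, n j ≃ n' j) (x : MRep Γ k n) :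
    (ofEquiv k e).conj x = fun h => (x h).submatrix (e (Γ.t h)).symm (e (Γ.s h)).symm := by
  funext h
  ext a b
  simp only [conj, ofEquiv, Matrix.mul_apply, Matrix.submatrix_apply, id, Matrix.one_apply,
    ite_mul, one_mul, zero_mul, mul_ite, mul_one, mul_zero]
  rw [Finset.sum_eq_single ((e (Γ.s h)).symm b)]
  · simp only [Equiv.apply_symm_apply, if_true]
    rw [Finset.sum_eq_single ((e (Γ.t h)).symm a)]
    · simp
    · intro c _ hc
      rw [if_neg]
      rintro rfl
      simp at hc
    · simp
  · intro c _ hc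
    rw [if_neg]
    rintro rfl
    simp at hc
  · simp

/-- Linear equivalences as graded isomorphisms. -/
def ofLE (e : ∀ j, (n j → k) ≃ₗ[k] (n' j → k)) : MIso k n n' where
  fwd j := LinearMap.toMatrix' (e j : (n j → k) →ₗ[k] (n' j → k))
  bwd j := LinearMap.toMatrix' ((e j).symm : (n' j → k) →ₗ[k] (n j → k))
  bwd_fwd j := by rw [← LinearMap.toMatrix'_comp]; simp
  fwd_bwd j := by rw [← LinearMap.toMatrix'_comp]; simp

theorem ofLE_le (e : ∀ j, (n j → k) ≃ₗ[k] (n' j → k)) (j : J) : (ofLE e).le j = e j := by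
  ext1 v
  rw [le_apply]
  simp [ofLE, LinearMap.toMatrix'_mulVec]

/-- An element of `∏ GL` as an isomorphism. -/
def ofGL {d : J → ℕ} (g : GrGL k d) : MIso k (FinD d) (FinD d) :=
  ⟨fun j => (g j).val, fun j => ((g j)⁻¹).val, fun j => by simp, fun j => by simp⟩

/-- An automorphism as an element of `∏ GL`. -/
def toGL {d : J → ℕ} (p : MIso k (FinD d) (FinD d)) : GrGL k d :=
  fun j => ⟨p.fwd j, p.bwd j, p.fwd_bwd j, p.bwd_fwd j⟩

/-- `∏ GL` and graded automorphisms. -/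
def glEquiv (k : Type*) [Field k] (d : J → ℕ) : GrGL k d ≃ MIso k (FinD d) (FinD d) where
  toFun := ofGL
  invFun := toGL
  left_inv g := by funext j; exact Units.ext rfl
  right_inv p := ext_fwd rfl

theorem ofGL_conj {d : J → ℕ} (g : GrGL k d) (x : Rep Γ k d) : (ofGL g).conj x = act g x := rfl

/-- Every family of isomorphisms is obtained from a fixed one by automorphisms of the source. -/
def equivOfLeft (p : MIso k n n') : MIso k n'' n ≃ MIso k n'' n' where
  toFun q := q.trans p
  invFun q := q.trans p.symm
  left_inv q := ext_fwd (by funext j; simp [trans, symm])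
  right_inv q := ext_fwd (by funext j; simp [trans, symm])

/-- Every family of isomorphisms is obtained from a fixed one by automorphisms of the target. -/
def equivOfRight (p : MIso k n n') : MIso k n' n'' ≃ MIso k n n'' where
  toFun q := p.trans q
  invFun q := p.symm.trans q
  left_inv q := ext_fwd (by funext j; simp [trans, symm, Matrix.mul_assoc])
  right_inv q := ext_fwd (by funext j; simp [trans, symm, Matrix.mul_assoc])

instance [Finite J] [Finite k] : Finite (MIso k n n') :=
  Finite.of_injective (fun p => p.fwd) fun _ _ h => ext_fwd h

end MIso

theorem mk_eq_mk_iff {d d' : J → ℕ} (x : Rep Γ k d) (x' : Rep Γ k d') :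
    IsoCls.mk x = IsoCls.mk x' ↔ ∃ p : MIso k (FinD d) (FinD d'), p.conj x = x' := by
  constructor
  · intro h
    obtain rfl : d = d' := congrArg Sigma.fst h
    have h2 : Quotient.mk (isoSetoid Γ k d) x = Quotient.mk (isoSetoid Γ k d) x' := by
      exact eq_of_heq (Sigma.mk.inj h).2
    obtain ⟨g, hg⟩ := Quotient.exact h2
    exact ⟨MIso.ofGL g, hg⟩
  · rintro ⟨p, rfl⟩
    obtain rfl : d = d' := by
      funext j
      simpa using p.card_eq j
    unfold IsoCls.mk
    congr 1
    exact Quotient.sound ⟨p.toGL, rfl⟩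

/-- The standard numbering of the index sets. -/
def stdIso (k : Type*) [Field k] (n : J → Type) [∀ j, Fintype (n j)] [∀ j, DecidableEq (n j)] :
    MIso k n (FinD fun j => Fintype.card (n j)) := MIso.ofEquiv k fun j => Fintype.equivFin (n j)

/-- The isomorphism class of a representation. -/
def cl (x : MRep Γ k n) : IsoCls Γ k :=
  IsoCls.mk (d := fun j => Fintype.card (n j)) ((stdIso k n).conj x)

theorem cl_eq_iff (x : MRep Γ k n) (x' : MRep Γ k n') :
    cl x = cl x' ↔ ∃ p : MIso k n n', p.conj x = x' := by
  unfold cl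
  rw [mk_eq_mk_iff]
  constructor
  · rintro ⟨p, hp⟩
    refine ⟨((stdIso k n).trans p).trans (stdIso k n').symm, ?_⟩
    rw [MIso.trans_conj, MIso.trans_conj, hp, MIso.symm_conj_conj]
  · rintro ⟨p, rfl⟩
    refine ⟨((stdIso k n).symm.trans p).trans (stdIso k n'), ?_⟩
    rw [MIso.trans_conj, MIso.trans_conj, MIso.symm_conj_conj]

theorem cl_conj (p : MIso k n n') (x : MRep Γ k n) : cl (p.conj x) = cl x :=
  ((cl_eq_iff _ _).2 ⟨p, rfl⟩).symm

theorem cl_eq_mk {d : J → ℕ} (x : Rep Γ k d) : cl (n := FinD d) x = IsoCls.mk x :=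
  (mk_eq_mk_iff _ _).2 ⟨(stdIso k (FinD d)).symm, by simp⟩

theorem mk_rep (α : IsoCls Γ k) : IsoCls.mk α.rep = α := by
  obtain ⟨d, q⟩ := α
  unfold IsoCls.mk IsoCls.rep
  congr 1
  exact Quotient.out_eq (s := isoSetoid Γ k d) q

@[simp] theorem cl_rep (α : IsoCls Γ k) : cl (n := FinD α.dim) α.rep = α := by
  rw [cl_eq_mk, mk_rep]

theorem dim_cl (x : MRep Γ k n) (j : J) : (cl x).dim j = Fintype.card (n j) := rfl

theorem exists_rep_iso (x : MRep Γ k n) :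
    ∃ p : MIso k (FinD (cl x).dim) n, p.conj (cl x).rep = x :=
  (cl_eq_iff _ _).1 (cl_rep _)

theorem exists_iso_rep {x : MRep Γ k n} {α : IsoCls Γ k} (h : cl x = α) :
    ∃ p : MIso k (FinD α.dim) n, p.conj α.rep = x := by
  subst h; exact exists_rep_iso x

/-! ### Subrepresentations and quotients of a given class -/

/-- The family `W` is a subrepresentation of `x` of class `β`. -/
def SubC (x : MRep Γ k n) (W : ∀ j, Submodule k (n j → k)) (β : IsoCls Γ k) : Prop :=
  ∃ y : MMap k (FinD β.dim) n, IsMHom (n := FinD β.dim) β.rep x y ∧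
    ∀ j, Function.Injective (y j).mulVec ∧ LinearMap.range (y j).mulVecLin = W j

/-- The family `W` is a subrepresentation of `x` with quotient of class `α`. -/
def QuoC (x : MRep Γ k n) (W : ∀ j, Submodule k (n j → k)) (α : IsoCls Γ k) : Prop :=
  ∃ z : MMap k n (FinD α.dim), IsMHom (n' := FinD α.dim) x α.rep z ∧
    ∀ j, Function.Surjective (z j).mulVec ∧ LinearMap.ker (z j).mulVecLin = W j

theorem IsMHom.comp {x : MRep Γ k n} {x' : MRep Γ k n'} {x'' : MRep Γ k n''} {y : MMap k n n'}
    {y' : MMap k n' n''} (h' : IsMHom x' x'' y') (h : IsMHom x x' y) :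
    IsMHom x x'' (fun j => y' j * y j) := by
  intro a
  rw [← Matrix.mul_assoc, h' a, Matrix.mul_assoc, h a, Matrix.mul_assoc]

theorem MIso.bijective_fwd (p : MIso k n n') (j : J) : Function.Bijective (p.fwd j).mulVec :=
  (p.le j).bijective

theorem mulVec_mul_eq {a b c : Type*} [Fintype b] [Fintype c] (M : Matrix a b k) (N : Matrix b c k) :
    (M * N).mulVec = M.mulVec ∘ N.mulVec := by
  funext v; simp [Matrix.mulVec_mulVec]

theorem SubC.of_hom {x : MRep Γ k n} {t : MRep Γ k m} {y : MMap k m n} (hy : IsMHom t x y)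
    (hi : ∀ j, Function.Injective (y j).mulVec) :
    SubC x (fun j => LinearMap.range (y j).mulVecLin) (cl t) := by
  obtain ⟨p, hp⟩ := exists_rep_iso t
  refine ⟨fun j => y j * p.fwd j, hy.comp ((p.conj_eq_iff _ _).1 hp), fun j => ⟨?_, ?_⟩⟩
  · rw [mulVec_mul_eq]; exact (hi j).comp (p.bijective_fwd j).1
  · rw [Matrix.mulVecLin_mul, LinearMap.range_comp_of_range_eq_top]
    exact LinearMap.range_eq_top.2 (p.bijective_fwd j).2

theorem QuoC.of_hom {x : MRep Γ k n} {t : MRep Γ k m} {z : MMap k n m} (hz : IsMHom x t z)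
    (hs : ∀ j, Function.Surjective (z j).mulVec) :
    QuoC x (fun j => LinearMap.ker (z j).mulVecLin) (cl t) := by
  obtain ⟨p, hp⟩ := exists_rep_iso t
  have hq : p.symm.conj t = (cl t).rep := by
    have := p.symm_conj_conj (Γ := Γ) (cl t).rep
    rwa [hp] at this
  refine ⟨fun j => p.bwd j * z j, ((p.symm.conj_eq_iff _ _).1 hq).comp hz, fun j => ⟨?_, ?_⟩⟩
  · rw [mulVec_mul_eq]; exact (p.symm.bijective_fwd j).2.comp (hs j)
  · rw [Matrix.mulVecLin_mul, LinearMap.ker_comp_of_ker_eq_bot]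
    exact LinearMap.ker_eq_bot.2 (p.symm.bijective_fwd j).1

/-- The image of a family of subspaces. -/
def MIso.mapW (p : MIso k n n') (W : ∀ j, Submodule k (n j → k)) : ∀ j, Submodule k (n' j → k) :=
  fun j => (W j).map (p.fwd j).mulVecLin

theorem MIso.mapW_symm (p : MIso k n n') (W : ∀ j, Submodule k (n j → k)) :
    p.symm.mapW (p.mapW W) = W := by
  funext j
  simp only [mapW, ← Submodule.map_comp, ← Matrix.mulVecLin_mul, symm, p.bwd_fwd,
    Matrix.mulVecLin_one, Submodule.map_id]

/-- The bijection between families of subspaces. -/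
def MIso.mapWEquiv (p : MIso k n n') :
    (∀ j, Submodule k (n j → k)) ≃ (∀ j, Submodule k (n' j → k)) where
  toFun := p.mapW
  invFun := p.symm.mapW
  left_inv := p.mapW_symm
  right_inv := p.symm.mapW_symm

theorem SubC.map {x : MRep Γ k n} {W : ∀ j, Submodule k (n j → k)} {β : IsoCls Γ k}
    (h : SubC x W β) (p : MIso k n n') : SubC (p.conj x) (p.mapW W) β := by
  obtain ⟨y, hy, hj⟩ := h
  refine ⟨fun j => p.fwd j * y j, (p.isMHom x).comp hy, fun j => ⟨?_, ?_⟩⟩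
  · rw [mulVec_mul_eq]; exact (p.bijective_fwd j).1.comp (hj j).1
  · rw [Matrix.mulVecLin_mul, LinearMap.range_comp, (hj j).2]; rfl

theorem QuoC.map {x : MRep Γ k n} {W : ∀ j, Submodule k (n j → k)} {β : IsoCls Γ k}
    (h : QuoC x W β) (p : MIso k n n') : QuoC (p.conj x) (p.mapW W) β := by
  obtain ⟨z, hz, hj⟩ := h
  refine ⟨fun j => z j * p.bwd j, hz.comp ?_, fun j => ⟨?_, ?_⟩⟩
  · exact (p.symm.conj_eq_iff _ _).1 (by simp)
  · rw [mulVec_mul_eq]; exact (hj j).1.comp (p.symm.bijective_fwd j).2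
  · rw [Matrix.mulVecLin_mul, LinearMap.ker_comp, (hj j).2]
    ext v
    simp only [Submodule.mem_comap, MIso.mapW, Submodule.mem_map, Matrix.mulVecLin_apply]
    constructor
    · intro h; exact ⟨_, h, by simp⟩
    · rintro ⟨u, hu, rfl⟩; simpa using hu

theorem subC_map_iff {x : MRep Γ k n} {W : ∀ j, Submodule k (n j → k)} {β : IsoCls Γ k}
    (p : MIso k n n') : SubC (p.conj x) (p.mapW W) β ↔ SubC x W β := by
  refine ⟨fun h => ?_, fun h => h.map p⟩
  have := h.map p.symm
  rwa [MIso.symm_conj_conj, MIso.mapW_symm] at this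

theorem quoC_map_iff {x : MRep Γ k n} {W : ∀ j, Submodule k (n j → k)} {β : IsoCls Γ k}
    (p : MIso k n n') : QuoC (p.conj x) (p.mapW W) β ↔ QuoC x W β := by
  refine ⟨fun h => ?_, fun h => h.map p⟩
  have := h.map p.symm
  rwa [MIso.symm_conj_conj, MIso.mapW_symm] at this

theorem hall_eq_card {x : MRep Γ k n} {α β γ : IsoCls Γ k} (hx : cl x = γ) :
    IsoCls.hall α β γ =
      Nat.card {W : ∀ j, Submodule k (n j → k) // SubC x W β ∧ QuoC x W α} := by
  obtain ⟨p, hp⟩ := exists_iso_rep hx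
  refine Nat.card_congr (Equiv.subtypeEquiv p.mapWEquiv fun W => ?_)
  show SubC (n := FinD γ.dim) γ.rep W β ∧ QuoC (n := FinD γ.dim) γ.rep W α ↔ SubC x (p.mapW W) β ∧ QuoC x (p.mapW W) α
  rw [← hp, subC_map_iff, quoC_map_iff]

theorem aut_eq_card {x : MRep Γ k n} {γ : IsoCls Γ k} (hx : cl x = γ) :
    γ.aut = Nat.card {p : MIso k n n // p.conj x = x} := by
  obtain ⟨p, hp⟩ := exists_iso_rep hx
  refine Nat.card_congr (Equiv.subtypeEquiv
    ((MIso.glEquiv k γ.dim).trans ((MIso.equivOfLeft p).trans (MIso.equivOfRight p.symm))) fun g => ?_)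
  show act g γ.rep = γ.rep ↔ (p.symm.trans ((MIso.ofGL g).trans p)).conj x = x
  rw [MIso.trans_conj, MIso.trans_conj, MIso.ofGL_conj, ← hp]
  simp only [MIso.symm_conj_conj]
  exact ⟨fun h => by rw [h], fun h => p.conjEquiv.injective h⟩

theorem aut_pos [Finite J] [Finite k] (γ : IsoCls Γ k) : 0 < γ.aut := by
  rw [aut_eq_card (cl_rep γ)]
  have : Nonempty {p : MIso k (FinD γ.dim) (FinD γ.dim) // p.conj γ.rep = γ.rep} :=
    ⟨⟨MIso.refl k _, MIso.refl_conj _⟩⟩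
  exact Nat.card_pos

theorem exists_mrep {α : IsoCls Γ k} (h : ∀ j, Fintype.card (n j) = α.dim j) :
    ∃ x : MRep Γ k n, cl x = α := by
  let p : MIso k (FinD α.dim) n := MIso.ofEquiv k fun j => Fintype.equivOfCardEq (by simp [h j])
  exact ⟨p.conj α.rep, by rw [cl_conj, cl_rep]⟩

/-- Orbit counting. -/
theorem card_orbit [Finite J] [Finite A] [Finite k] {α : IsoCls Γ k}
    (h : ∀ j, Fintype.card (n j) = α.dim j) :
    Nat.card {x : MRep Γ k n // cl x = α} * α.aut = Nat.card (MIso k n n) := by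
  obtain ⟨x, hx⟩ := exists_mrep h
  rw [aut_eq_card hx, ← Nat.card_prod]
  have key : ∀ x' : {x : MRep Γ k n // cl x = α}, ∃ p : MIso k n n, p.conj x = x'.1 := fun x' =>
    (cl_eq_iff _ _).1 (hx.trans x'.2.symm)
  choose P hP using key
  refine Nat.card_congr (Equiv.ofBijective
    (fun q => q.2.1.trans (P q.1)) ⟨?_, ?_⟩)
  · rintro ⟨x1, q1, h1⟩ ⟨x2, q2, h2⟩ h
    have e := congrArg (fun p : MIso k n n => p.conj x) h
    simp only [MIso.trans_conj, h1, h2, hP] at e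
    obtain rfl := Subtype.ext e
    obtain rfl := (MIso.equivOfLeft (P x1)).injective h
    rfl
  · intro p
    refine ⟨⟨⟨p.conj x, by rw [cl_conj, hx]⟩, p.trans (P ⟨p.conj x, by rw [cl_conj, hx]⟩).symm, ?_⟩, ?_⟩
    · rw [MIso.trans_conj]
      have e := hP ⟨p.conj x, by rw [cl_conj, hx]⟩
      exact (congrArg _ e.symm).trans (MIso.symm_conj_conj _ _)
    · exact (MIso.equivOfLeft _).right_inv p

end Classes

end RingelHall
end

noncomputable section
namespace RingelHall

/-! ## Block representations and extension counts -/

section Blocks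

variable {J A k : Type*} [Field k] {Γ : Quiv J A}

/-- Index types of direct sums. -/
abbrev SumD (m n : J → Type) : J → Type := fun j => m j ⊕ n j

variable {n n' m m' : J → Type}
  [∀ j, Fintype (n j)] [∀ j, DecidableEq (n j)]
  [∀ j, Fintype (n' j)] [∀ j, DecidableEq (n' j)]
  [∀ j, Fintype (m j)] [∀ j, DecidableEq (m j)]
  [∀ j, Fintype (m' j)] [∀ j, DecidableEq (m' j)]

/-- Block upper triangular representations: `t` is a subrepresentation, `s` the quotient. -/
def blk (t : MRep Γ k m) (z : ∀ h, Matrix (m (Γ.t h)) (n (Γ.s h)) k) (s : MRep Γ k n) :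
    MRep Γ k (SumD m n) := fun h => Matrix.fromBlocks (t h) (z h) 0 (s h)

/-- Graded isomorphisms from bijective graded maps. -/
def MIso.ofBij (y : MMap k n n') (hy : ∀ j, Function.Bijective (y j).mulVec) : MIso k n n' :=
  MIso.ofLE fun j => LinearEquiv.ofBijective (y j).mulVecLin (hy j)

@[simp] theorem MIso.ofBij_fwd (y : MMap k n n') (hy : ∀ j, Function.Bijective (y j).mulVec) :
    (MIso.ofBij y hy).fwd = y := by
  funext j
  show LinearMap.toMatrix' (y j).mulVecLin = y j
  rw [← Matrix.toLin'_apply', LinearMap.toMatrix'_toLin']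

/-- The standard coordinate subspaces. -/
def stdW (k : Type*) [Field k] (m n : J → Type) : ∀ j, Submodule k (SumD m n j → k) := fun j =>
  { carrier := {v | ∀ b, v (Sum.inr b) = 0}
    add_mem' := by intro u v hu hv b; simp [hu b, hv b]
    zero_mem' := by intro b; rfl
    smul_mem' := by intro c v hv b; simp [hv b] }

theorem mem_stdW {j : J} {v : m j ⊕ n j → k} : v ∈ stdW k m n j ↔ ∀ b, v (Sum.inr b) = 0 := Iff.rfl

theorem range_fromRows_one {j : J} :
    LinearMap.range (Matrix.fromRows (1 : Matrix (m j) (m j) k) (0 : Matrix (n j) (m j) k)).mulVecLin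
      = stdW k m n j := by
  ext v
  simp only [LinearMap.mem_range, Matrix.mulVecLin_apply, Matrix.fromRows_mulVec, mem_stdW]
  constructor
  · rintro ⟨u, rfl⟩ b; simp
  · intro h
    refine ⟨fun a => v (Sum.inl a), ?_⟩
    funext c
    cases c with
    | inl a => simp
    | inr b => simp [h b]

theorem ker_fromCols_one {j : J} :
    LinearMap.ker (Matrix.fromCols (0 : Matrix (n j) (m j) k) (1 : Matrix (n j) (n j) k)).mulVecLin
      = stdW k m n j := by
  ext v
  simp only [LinearMap.mem_ker, Matrix.mulVecLin_apply, Matrix.fromCols_mulVec, mem_stdW,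
    Matrix.zero_mulVec, Matrix.one_mulVec, zero_add]
  exact funext_iff

theorem fromRows_eq {a b c : Type*} (M : Matrix (a ⊕ b) c k) :
    M = Matrix.fromRows M.toRows₁ M.toRows₂ := (Matrix.fromRows_toRows M).symm

theorem subC_std_iff {x : MRep Γ k (SumD m n)} {β : IsoCls Γ k} :
    SubC x (stdW k m n) β ↔
      (∀ h, (x h).toBlocks₂₁ = 0) ∧ cl (fun h => (x h).toBlocks₁₁ : MRep Γ k m) = β := by
  constructor
  · rintro ⟨y, hy, hj⟩
    have h0 : ∀ j, (y j).toRows₂ = 0 := by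
      intro j
      ext b a
      have : (y j).mulVec (Pi.single a 1) ∈ stdW k m n j := by
        rw [← (hj j).2]; exact ⟨_, rfl⟩
      have := this b
      simpa using this
    have hb : ∀ j, Function.Bijective ((y j).toRows₁).mulVec := by
      intro j
      constructor
      · intro u v huv
        apply (hj j).1
        rw [fromRows_eq (y j), Matrix.fromRows_mulVec, Matrix.fromRows_mulVec, h0 j, huv]
        simp
      · intro v
        have hv : Sum.elim v (0 : n j → k) ∈ stdW k m n j := fun b => rfl
        rw [← (hj j).2] at hv
        obtain ⟨u, hu⟩ := hv
        refine ⟨u, ?_⟩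
        rw [Matrix.mulVecLin_apply, fromRows_eq (y j), Matrix.fromRows_mulVec] at hu
        funext a
        have := congrFun hu (Sum.inl a)
        simpa using this
    let p : MIso k (FinD β.dim) m := MIso.ofBij _ hb
    have hp : p.fwd = fun j => (y j).toRows₁ := MIso.ofBij_fwd _ hb
    have key : ∀ h, (x h).toBlocks₁₁ * p.fwd (Γ.s h) = p.fwd (Γ.t h) * β.rep h ∧
        (x h).toBlocks₂₁ * p.fwd (Γ.s h) = 0 := by
      intro h
      have e := hy h
      rw [← Matrix.fromBlocks_toBlocks (x h), fromRows_eq (y (Γ.s h)), fromRows_eq (y (Γ.t h)),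
        Matrix.fromBlocks_mul_fromRows, Matrix.fromRows_mul, h0, h0] at e
      obtain ⟨e1, e2⟩ := Matrix.fromRows_inj e
      rw [hp]
      simp only [Matrix.mul_zero, Matrix.zero_mul, add_zero] at e1 e2
      exact ⟨e1, e2⟩
    refine ⟨fun h => ?_, ?_⟩
    · have := congrArg (fun M => M * p.bwd (Γ.s h)) (key h).2
      simpa [Matrix.mul_assoc] using this
    · rw [← cl_rep β, eq_comm, cl_eq_iff]
      exact ⟨p, (p.conj_eq_iff _ _).2 fun h => (key h).1⟩
  · rintro ⟨h0, rfl⟩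
    have : IsMHom (fun h => (x h).toBlocks₁₁ : MRep Γ k m) x
        (fun j => Matrix.fromRows (1 : Matrix (m j) (m j) k) (0 : Matrix (n j) (m j) k)) := by
      intro h
      conv_lhs => rw [← Matrix.fromBlocks_toBlocks (x h)]
      rw [Matrix.fromBlocks_mul_fromRows, Matrix.fromRows_mul, h0]
      simp
    have h2 := SubC.of_hom this fun j => by
      intro u v huv
      simp only [Matrix.fromRows_mulVec, Matrix.one_mulVec, Matrix.zero_mulVec] at huv
      funext a
      simpa using congrFun huv (Sum.inl a)
    simpa only [range_fromRows_one] using h2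

theorem quoC_std_iff {x : MRep Γ k (SumD m n)} {α : IsoCls Γ k} :
    QuoC x (stdW k m n) α ↔
      (∀ h, (x h).toBlocks₂₁ = 0) ∧ cl (fun h => (x h).toBlocks₂₂ : MRep Γ k n) = α := by
  constructor
  · rintro ⟨z, hz, hj⟩
    have h0 : ∀ j, (z j).toCols₁ = 0 := by
      intro j
      ext b a
      have : (Pi.single (Sum.inl a) 1 : m j ⊕ n j → k) ∈ LinearMap.ker (z j).mulVecLin := by
        rw [(hj j).2]; intro b; simp
      have := congrFun this b
      simpa using this
    have ez : ∀ j, z j = Matrix.fromCols 0 (z j).toCols₂ := by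
      intro j
      rw [← h0 j, Matrix.fromCols_toCols]
    have hb : ∀ j, Function.Bijective ((z j).toCols₂).mulVec := by
      intro j
      constructor
      · refine (injective_iff_map_eq_zero ((z j).toCols₂).mulVecLin).2 fun v hv => ?_
        have : Sum.elim (0 : m j → k) v ∈ LinearMap.ker (z j).mulVecLin := by
          rw [LinearMap.mem_ker, Matrix.mulVecLin_apply, ez j, Matrix.fromCols_mulVec]
          simpa using hv
        rw [(hj j).2] at this
        funext b
        exact this b
      · intro v
        obtain ⟨u, hu⟩ := (hj j).1 v
        refine ⟨fun b => u (Sum.inr b), ?_⟩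
        rw [ez j, Matrix.fromCols_mulVec] at hu
        simpa [Function.comp_def] using hu
    let p : MIso k n (FinD α.dim) := MIso.ofBij _ hb
    have hp : p.fwd = fun j => (z j).toCols₂ := MIso.ofBij_fwd _ hb
    have key : ∀ h, α.rep h * p.fwd (Γ.s h) = p.fwd (Γ.t h) * (x h).toBlocks₂₂ ∧
        p.fwd (Γ.t h) * (x h).toBlocks₂₁ = 0 := by
      intro h
      have e := hz h
      rw [← Matrix.fromBlocks_toBlocks (x h), ez (Γ.s h), ez (Γ.t h),
        Matrix.fromCols_mul_fromBlocks, Matrix.mul_fromCols] at e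
      obtain ⟨e1, e2⟩ := Matrix.fromCols_inj e
      rw [hp]
      simp only [Matrix.mul_zero, Matrix.zero_mul, zero_add] at e1 e2
      exact ⟨e2, e1.symm⟩
    refine ⟨fun h => ?_, ?_⟩
    · have := congrArg (fun M => p.bwd (Γ.t h) * M) (key h).2
      simpa using this
    · rw [← cl_rep α, cl_eq_iff]
      exact ⟨p, (p.conj_eq_iff _ _).2 fun h => (key h).1⟩
  · rintro ⟨h0, rfl⟩
    have : IsMHom x (fun h => (x h).toBlocks₂₂ : MRep Γ k n)
        (fun j => Matrix.fromCols (0 : Matrix (n j) (m j) k) (1 : Matrix (n j) (n j) k)) := by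
      intro h
      conv_rhs => rw [← Matrix.fromBlocks_toBlocks (x h)]
      rw [Matrix.fromCols_mul_fromBlocks, Matrix.mul_fromCols, h0]
      simp
    have h2 := QuoC.of_hom this fun j => by
      intro v
      exact ⟨Sum.elim 0 v, by simp [Matrix.fromCols_mulVec]⟩
    simpa only [ker_fromCols_one] using h2

/-- A short exact sequence of graded spaces splits. -/
theorem exists_frame {y : MMap k m n'} {z : MMap k n' n}
    (hy : ∀ j, Function.Injective (y j).mulVec) (hz : ∀ j, Function.Surjective (z j).mulVec)
    (h : ∀ j, LinearMap.range (y j).mulVecLin = LinearMap.ker (z j).mulVecLin) :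
    ∃ p : MIso k (SumD m n) n', p.mapW (stdW k m n) = fun j => LinearMap.range (y j).mulVecLin := by
  have hr : ∀ j, ∃ r : Matrix (n' j) (n j) k, ∀ v, (z j).mulVec (r.mulVec v) = v := by
    intro j
    obtain ⟨g, hg⟩ := LinearMap.exists_rightInverse_of_surjective (z j).mulVecLin
      (LinearMap.range_eq_top.2 (hz j))
    refine ⟨LinearMap.toMatrix' g, fun v => ?_⟩
    rw [LinearMap.toMatrix'_mulVec]
    exact LinearMap.congr_fun hg v
  choose r hr using hr
  have hzy : ∀ j u, (z j).mulVec ((y j).mulVec u) = 0 := by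
    intro j u
    have : (y j).mulVec u ∈ LinearMap.ker (z j).mulVecLin := by rw [← h j]; exact ⟨u, rfl⟩
    exact this
  have hb : ∀ j, Function.Bijective (Matrix.fromCols (y j) (r j)).mulVec := by
    intro j
    constructor
    · refine (injective_iff_map_eq_zero (Matrix.fromCols (y j) (r j)).mulVecLin).2 fun v hv => ?_
      rw [Matrix.mulVecLin_apply, Matrix.fromCols_mulVec] at hv
      have h1 := congrArg (z j).mulVec hv
      rw [Matrix.mulVec_add, hzy, hr, zero_add, Matrix.mulVec_zero] at h1
      rw [h1, Matrix.mulVec_zero, add_zero] at hv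
      have h2 : v ∘ Sum.inl = 0 := hy j (by rw [hv, Matrix.mulVec_zero])
      funext c
      cases c with
      | inl a => exact congrFun h2 a
      | inr b => exact congrFun h1 b
    · intro v
      have : v - (r j).mulVec ((z j).mulVec v) ∈ LinearMap.range (y j).mulVecLin := by
        rw [h j, LinearMap.mem_ker, Matrix.mulVecLin_apply, Matrix.mulVec_sub, hr, sub_self]
      obtain ⟨u, hu⟩ := this
      refine ⟨Sum.elim u ((z j).mulVec v), ?_⟩
      rw [Matrix.fromCols_mulVec]
      simp only [Matrix.mulVecLin_apply] at hu
      simp [Function.comp_def, hu]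
  refine ⟨MIso.ofBij _ hb, ?_⟩
  funext j
  rw [MIso.mapW, MIso.ofBij_fwd, ← range_fromRows_one, ← LinearMap.range_comp,
    ← Matrix.mulVecLin_mul, Matrix.fromCols_mul_fromRows]
  simp

theorem exists_frame_of_subC_quoC {x : MRep Γ k n'} {W : ∀ j, Submodule k (n' j → k)}
    {α β : IsoCls Γ k} (h1 : SubC x W β) (h2 : QuoC x W α)
    (hm : ∀ j, Fintype.card (m j) = β.dim j) (hn : ∀ j, Fintype.card (n j) = α.dim j) :
    ∃ p : MIso k (SumD m n) n', p.mapW (stdW k m n) = W := by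
  obtain ⟨y, -, hy⟩ := h1
  obtain ⟨z, -, hz⟩ := h2
  let e : MIso k m (FinD β.dim) := MIso.ofEquiv k fun j => Fintype.equivOfCardEq (by simp [hm j])
  let f : MIso k (FinD α.dim) n := MIso.ofEquiv k fun j => Fintype.equivOfCardEq (by simp [hn j])
  have er : ∀ j, LinearMap.range (y j * e.fwd j).mulVecLin = W j := by
    intro j
    rw [Matrix.mulVecLin_mul, LinearMap.range_comp_of_range_eq_top, (hy j).2]
    exact LinearMap.range_eq_top.2 (e.bijective_fwd j).2
  obtain ⟨p, hp⟩ := exists_frame (y := fun j => y j * e.fwd j) (z := fun j => f.fwd j * z j)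
    (fun j => by rw [mulVec_mul_eq]; exact (hy j).1.comp (e.bijective_fwd j).1)
    (fun j => by rw [mulVec_mul_eq]; exact (f.bijective_fwd j).2.comp (hz j).1)
    (fun j => by
      rw [er, Matrix.mulVecLin_mul, LinearMap.ker_comp_of_ker_eq_bot, (hz j).2]
      exact LinearMap.ker_eq_bot.2 (f.bijective_fwd j).1)
  exact ⟨p, hp.trans (funext er)⟩

/-- Automorphisms that preserve the standard subspaces. -/
abbrev Par (k : Type*) [Field k] (m n : J → Type)
    [∀ j, Fintype (n j)] [∀ j, DecidableEq (n j)] [∀ j, Fintype (m j)] [∀ j, DecidableEq (m j)] :=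
  {p : MIso k (SumD m n) (SumD m n) // p.mapW (stdW k m n) = stdW k m n}

theorem toBlocks₂₁_of_mapW_le {m n m' n' : J → Type}
    [∀ j, Fintype (n j)] [∀ j, DecidableEq (n j)] [∀ j, Fintype (m j)] [∀ j, DecidableEq (m j)]
    [∀ j, Fintype (n' j)] [∀ j, DecidableEq (n' j)] [∀ j, Fintype (m' j)] [∀ j, DecidableEq (m' j)]
    {p : MIso k (SumD m n) (SumD m' n')}
    {j : J} (h : p.mapW (stdW k m n) j ≤ stdW k m' n' j) : (p.fwd j).toBlocks₂₁ = 0 := by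
  ext b a
  have h1 : (Pi.single (Sum.inl a) 1 : m j ⊕ n j → k) ∈ stdW k m n j := fun b => by simp
  have := h ⟨_, h1, rfl⟩ b
  rw [Matrix.mulVecLin_apply, Matrix.mulVec_single_one] at this
  exact this

theorem mapW_le_of_toBlocks₂₁ {m n m' n' : J → Type}
    [∀ j, Fintype (n j)] [∀ j, DecidableEq (n j)] [∀ j, Fintype (m j)] [∀ j, DecidableEq (m j)]
    [∀ j, Fintype (n' j)] [∀ j, DecidableEq (n' j)] [∀ j, Fintype (m' j)] [∀ j, DecidableEq (m' j)]
    {p : MIso k (SumD m n) (SumD m' n')} {j : J}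
    (h : (p.fwd j).toBlocks₂₁ = 0) : p.mapW (stdW k m n) j ≤ stdW k m' n' j := by
  rintro _ ⟨v, hv, rfl⟩ b
  rw [Matrix.mulVecLin_apply, ← Matrix.fromBlocks_toBlocks (p.fwd j), h, Matrix.fromBlocks_mulVec]
  have : v ∘ Sum.inr = 0 := funext hv
  simp [this]

theorem mapW_eq_iff {m n m' n' : J → Type}
    [∀ j, Fintype (n j)] [∀ j, DecidableEq (n j)] [∀ j, Fintype (m j)] [∀ j, DecidableEq (m j)]
    [∀ j, Fintype (n' j)] [∀ j, DecidableEq (n' j)] [∀ j, Fintype (m' j)] [∀ j, DecidableEq (m' j)]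
    {p : MIso k (SumD m n) (SumD m' n')} :
    p.mapW (stdW k m n) = stdW k m' n' ↔
      (∀ j, (p.fwd j).toBlocks₂₁ = 0) ∧ (∀ j, (p.bwd j).toBlocks₂₁ = 0) := by
  constructor
  · intro h
    refine ⟨fun j => toBlocks₂₁_of_mapW_le (congrFun h j).le, fun j => ?_⟩
    refine toBlocks₂₁_of_mapW_le (p := p.symm) (congrFun (?_ : _ = stdW k m n) j).le
    rw [← h, MIso.mapW_symm]
  · rintro ⟨h1, h2⟩
    funext j
    refine le_antisymm (mapW_le_of_toBlocks₂₁ (h1 j)) ?_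
    have := mapW_le_of_toBlocks₂₁ (p := p.symm) (h2 j)
    have h3 := Submodule.map_mono (f := (p.fwd j).mulVecLin) this
    have h4 := congrFun (p.symm.mapW_symm (stdW k m' n')) j
    rw [← h4]
    exact h3

/-- Block upper triangular automorphisms. -/
def parEquiv (k : Type*) [Field k] (m n : J → Type)
    [∀ j, Fintype (n j)] [∀ j, DecidableEq (n j)] [∀ j, Fintype (m j)] [∀ j, DecidableEq (m j)] :
    Par k m n ≃ MIso k m m × MIso k n n × MMap k n m where
  toFun p :=
    have key := mapW_eq_iff.1 p.2
    have hl : ∀ j, Matrix.fromBlocks (p.1.bwd j).toBlocks₁₁ (p.1.bwd j).toBlocks₁₂ 0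
        (p.1.bwd j).toBlocks₂₂ * Matrix.fromBlocks (p.1.fwd j).toBlocks₁₁ (p.1.fwd j).toBlocks₁₂ 0
        (p.1.fwd j).toBlocks₂₂ = Matrix.fromBlocks 1 0 0 1 := fun j => by
      have e := p.1.bwd_fwd j
      rw [← Matrix.fromBlocks_toBlocks (p.1.fwd j), ← Matrix.fromBlocks_toBlocks (p.1.bwd j),
        key.1 j, key.2 j, ← Matrix.fromBlocks_one] at e
      exact e
    have hr : ∀ j, Matrix.fromBlocks (p.1.fwd j).toBlocks₁₁ (p.1.fwd j).toBlocks₁₂ 0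
        (p.1.fwd j).toBlocks₂₂ * Matrix.fromBlocks (p.1.bwd j).toBlocks₁₁ (p.1.bwd j).toBlocks₁₂ 0
        (p.1.bwd j).toBlocks₂₂ = Matrix.fromBlocks 1 0 0 1 := fun j => by
      have e := p.1.fwd_bwd j
      rw [← Matrix.fromBlocks_toBlocks (p.1.fwd j), ← Matrix.fromBlocks_toBlocks (p.1.bwd j),
        key.1 j, key.2 j, ← Matrix.fromBlocks_one] at e
      exact e
    (⟨fun j => (p.1.fwd j).toBlocks₁₁, fun j => (p.1.bwd j).toBlocks₁₁,
      fun j => by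
        have e := hl j
        rw [Matrix.fromBlocks_multiply, Matrix.fromBlocks_inj] at e
        simpa using e.1,
      fun j => by
        have e := hr j
        rw [Matrix.fromBlocks_multiply, Matrix.fromBlocks_inj] at e
        simpa using e.1⟩,
    ⟨fun j => (p.1.fwd j).toBlocks₂₂, fun j => (p.1.bwd j).toBlocks₂₂,
      fun j => by
        have e := hl j
        rw [Matrix.fromBlocks_multiply, Matrix.fromBlocks_inj] at e
        simpa using e.2.2.2,
      fun j => by
        have e := hr j
        rw [Matrix.fromBlocks_multiply, Matrix.fromBlocks_inj] at e
        simpa using e.2.2.2⟩,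
    fun j => (p.1.fwd j).toBlocks₁₂)
  invFun q := ⟨⟨fun j => Matrix.fromBlocks (q.1.fwd j) (q.2.2 j) 0 (q.2.1.fwd j),
      fun j => Matrix.fromBlocks (q.1.bwd j) (-(q.1.bwd j * q.2.2 j * q.2.1.bwd j)) 0 (q.2.1.bwd j),
      fun j => by simp [Matrix.fromBlocks_multiply, Matrix.mul_assoc],
      fun j => by simp [Matrix.fromBlocks_multiply, Matrix.mul_assoc]⟩,
    mapW_eq_iff.2 ⟨fun j => by simp, fun j => by simp⟩⟩
  left_inv p := by
    apply Subtype.ext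
    apply MIso.ext_fwd
    funext j
    have key := (mapW_eq_iff.1 p.2).1 j
    conv_rhs => rw [← Matrix.fromBlocks_toBlocks (p.1.fwd j), key]
  right_inv q := by
    refine Prod.ext (MIso.ext_fwd ?_) (Prod.ext (MIso.ext_fwd ?_) ?_) <;> funext j <;> simp

variable (m n) in
theorem card_mmap [Fintype J] [Fintype k] :
    Nat.card (MMap k n m) =
      Fintype.card k ^ ∑ j, Fintype.card (m j) * Fintype.card (n j) := by
  rw [Nat.card_pi, ← Finset.prod_pow_eq_pow_sum]
  refine Finset.prod_congr rfl fun j _ => ?_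
  simp [Matrix, Nat.card_eq_fintype_card, pow_mul, mul_comm (Fintype.card (m j))]

variable (m n) in
theorem card_par [Fintype J] [Fintype k] :
    Nat.card (Par k m n) = Nat.card (MIso k m m) * Nat.card (MIso k n n) *
      Fintype.card k ^ ∑ j, Fintype.card (m j) * Fintype.card (n j) := by
  rw [Nat.card_congr (parEquiv k m n), Nat.card_prod, Nat.card_prod, card_mmap, mul_assoc]

/-- The number of block upper triangular representations of class `γ` with given diagonal. -/
def extn (t : MRep Γ k m) (s : MRep Γ k n) (γ : IsoCls Γ k) : ℕ :=
  Nat.card {z : ∀ h, Matrix (m (Γ.t h)) (n (Γ.s h)) k // cl (blk t z s) = γ}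

/-- Block diagonal isomorphisms. -/
def MIso.diag (p : MIso k m m') (q : MIso k n n') : MIso k (SumD m n) (SumD m' n') :=
  ⟨fun j => Matrix.fromBlocks (p.fwd j) 0 0 (q.fwd j),
    fun j => Matrix.fromBlocks (p.bwd j) 0 0 (q.bwd j),
    fun j => by simp [Matrix.fromBlocks_multiply],
    fun j => by simp [Matrix.fromBlocks_multiply]⟩

theorem MIso.diag_conj_blk (p : MIso k m m') (q : MIso k n n') (t : MRep Γ k m)
    (z : ∀ h, Matrix (m (Γ.t h)) (n (Γ.s h)) k) (s : MRep Γ k n) :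
    (p.diag q).conj (blk t z s) =
      blk (p.conj t) (fun h => p.fwd (Γ.t h) * z h * q.bwd (Γ.s h)) (q.conj s) := by
  funext h
  simp [MIso.conj, MIso.diag, blk, Matrix.fromBlocks_multiply]

theorem extn_congr {t : MRep Γ k m} {t' : MRep Γ k m'} {s : MRep Γ k n} {s' : MRep Γ k n'}
    (ht : cl t = cl t') (hs : cl s = cl s') (γ : IsoCls Γ k) : extn t s γ = extn t' s' γ := by
  obtain ⟨p, rfl⟩ := (cl_eq_iff _ _).1 ht
  obtain ⟨q, rfl⟩ := (cl_eq_iff _ _).1 hs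
  refine Nat.card_congr (Equiv.subtypeEquiv
    { toFun := fun z h => p.fwd (Γ.t h) * z h * q.bwd (Γ.s h)
      invFun := fun z h => p.bwd (Γ.t h) * z h * q.fwd (Γ.s h)
      left_inv := fun z => by funext h; simp [Matrix.mul_assoc]
      right_inv := fun z => by funext h; simp [Matrix.mul_assoc] } fun z => ?_)
  show _ ↔ cl (blk _ _ _) = γ
  rw [Equiv.coe_fn_mk, ← MIso.diag_conj_blk, cl_conj]

end Blocks

end RingelHall
end

noncomputable section
namespace RingelHall

/-! ## Hall numbers and extension counts -/

theorem card_sigma_const {X : Type*} [Finite X] {F : X → Type*} [∀ x, Finite (F x)] {c : ℕ}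
    (h : ∀ x, Nat.card (F x) = c) : Nat.card (Σ x, F x) = Nat.card X * c := by
  have := Fintype.ofFinite X
  rw [Nat.card_sigma, Finset.sum_congr rfl fun x _ => h x, Finset.sum_const, smul_eq_mul,
    Finset.card_univ, Nat.card_eq_fintype_card]

section Riedtmann

variable {J A k : Type*} [Fintype J] [Fintype A] [Field k] [Fintype k] {Γ : Quiv J A}

variable {n n' m m' : J → Type}
  [∀ j, Fintype (n j)] [∀ j, DecidableEq (n j)]
  [∀ j, Fintype (n' j)] [∀ j, DecidableEq (n' j)]
  [∀ j, Fintype (m j)] [∀ j, DecidableEq (m j)]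
  [∀ j, Fintype (m' j)] [∀ j, DecidableEq (m' j)]

instance finite_families : Finite (∀ j, Submodule k (n j → k)) := by
  have : ∀ j, Finite (Submodule k (n j → k)) := fun j =>
    Finite.of_injective (fun W => (W : Set (n j → k))) SetLike.coe_injective
  infer_instance

theorem hall_dim {α β γ : IsoCls Γ k} (h : IsoCls.hall α β γ ≠ 0) (j : J) :
    γ.dim j = α.dim j + β.dim j := by
  rw [hall_eq_card (cl_rep γ)] at h
  obtain ⟨⟨W, h1, h2⟩⟩ := (Nat.card_ne_zero.1 h).1
  obtain ⟨p, -⟩ := exists_frame_of_subC_quoC (m := FinD β.dim) (n := FinD α.dim) h1 h2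
    (by simp) (by simp)
  have := p.card_eq j
  simp only [Fintype.card_sum, Fintype.card_fin] at this
  omega

theorem card_frames {x : MRep Γ k n'} {α β γ : IsoCls Γ k} (hx : cl x = γ)
    (hm : ∀ j, Fintype.card (m j) = β.dim j) (hn : ∀ j, Fintype.card (n j) = α.dim j) :
    Nat.card {p : MIso k (SumD m n) n' //
        SubC x (p.mapW (stdW k m n)) β ∧ QuoC x (p.mapW (stdW k m n)) α} =
      IsoCls.hall α β γ * Nat.card (Par k m n) := by
  rw [hall_eq_card hx, ← Nat.card_prod]
  have key : ∀ W : {W : ∀ j, Submodule k (n' j → k) // SubC x W β ∧ QuoC x W α},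
      ∃ p : MIso k (SumD m n) n', p.mapW (stdW k m n) = W.1 := fun W =>
    exists_frame_of_subC_quoC W.2.1 W.2.2 hm hn
  choose P hP using key
  have tr : ∀ (q : MIso k (SumD m n) (SumD m n)) (p : MIso k (SumD m n) n') W,
      (q.trans p).mapW W = p.mapW (q.mapW W) := by
    intro q p W
    funext j
    simp only [MIso.mapW, MIso.trans, Matrix.mulVecLin_mul, Submodule.map_comp]
  symm
  refine Nat.card_congr (Equiv.ofBijective
    (fun Wq => ⟨Wq.2.1.trans (P Wq.1), by rw [tr, Wq.2.2, hP]; exact Wq.1.2⟩) ⟨?_, ?_⟩)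
  · rintro ⟨W, q, hq⟩ ⟨W', q', hq'⟩ h
    have h1 := congrArg Subtype.val h
    simp only at h1
    have h2 := congrArg (fun p : MIso k (SumD m n) n' => p.mapW (stdW k m n)) h1
    simp only [tr, hq, hq', hP] at h2
    obtain rfl := Subtype.ext h2
    obtain rfl := (MIso.equivOfLeft (P W)).injective h1
    rfl
  · rintro ⟨p, hp⟩
    refine ⟨⟨⟨p.mapW (stdW k m n), hp⟩, p.trans (P ⟨p.mapW (stdW k m n), hp⟩).symm, ?_⟩, ?_⟩
    · have e := hP ⟨p.mapW (stdW k m n), hp⟩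
      have : ∀ W, (p.trans (P ⟨p.mapW (stdW k m n), hp⟩).symm).mapW W =
          (P ⟨p.mapW (stdW k m n), hp⟩).symm.mapW (p.mapW W) := by
        intro W
        funext j
        simp only [MIso.mapW, MIso.trans, Matrix.mulVecLin_mul, Submodule.map_comp]
      rw [this]
      exact (congrArg _ e.symm).trans (MIso.mapW_symm _ _)
    · exact Subtype.ext ((MIso.equivOfLeft _).right_inv p)

theorem card_blk (t : MRep Γ k m) (s : MRep Γ k n) (γ : IsoCls Γ k) :
    Nat.card {y : MRep Γ k (SumD m n) // cl y = γ ∧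
        SubC y (stdW k m n) (cl t) ∧ QuoC y (stdW k m n) (cl s)} =
      Nat.card {t' : MRep Γ k m // cl t' = cl t} * Nat.card {s' : MRep Γ k n // cl s' = cl s} *
        extn t s γ := by
  rw [← Nat.card_prod]
  have : ∀ x : {t' : MRep Γ k m // cl t' = cl t} × {s' : MRep Γ k n // cl s' = cl s},
      Nat.card {z : ∀ h, Matrix (m (Γ.t h)) (n (Γ.s h)) k // cl (blk x.1.1 z x.2.1) = γ} =
        extn t s γ := fun x => extn_congr x.1.2 x.2.2 γ
  rw [← card_sigma_const this]
  refine Nat.card_congr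
    { toFun := fun y => ⟨(⟨_, (subC_std_iff.1 y.2.2.1).2⟩, ⟨_, (quoC_std_iff.1 y.2.2.2).2⟩),
        ⟨fun h => (y.1 h).toBlocks₁₂, ?_⟩⟩
      invFun := fun q => ⟨blk q.1.1.1 q.2.1 q.1.2.1, q.2.2, subC_std_iff.2 ⟨?_, ?_⟩,
        quoC_std_iff.2 ⟨?_, ?_⟩⟩
      left_inv := ?_
      right_inv := ?_ }
  · have e : blk (fun h => (y.1 h).toBlocks₁₁ : MRep Γ k m) (fun h => (y.1 h).toBlocks₁₂)
        (fun h => (y.1 h).toBlocks₂₂ : MRep Γ k n) = y.1 := by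
      funext h
      have := (subC_std_iff.1 y.2.2.1).1 h
      rw [blk, ← this, Matrix.fromBlocks_toBlocks]
    show cl (blk _ _ _) = γ
    rw [e]
    exact y.2.1
  · intro h; simp [blk]
  · simpa [blk] using q.1.1.2
  · intro h; simp [blk]
  · simpa [blk] using q.1.2.2
  · intro y
    apply Subtype.ext
    funext h
    have := (subC_std_iff.1 y.2.2.1).1 h
    show Matrix.fromBlocks _ _ 0 _ = _
    rw [← this, Matrix.fromBlocks_toBlocks]
  · rintro ⟨⟨⟨t', ht⟩, ⟨s', hs⟩⟩, ⟨z, hz⟩⟩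
    rfl

theorem card_orbit_pos {α : IsoCls Γ k} (h : ∀ j, Fintype.card (n j) = α.dim j) :
    0 < Nat.card {x : MRep Γ k n // cl x = α} := by
  obtain ⟨x, hx⟩ := exists_mrep h
  have : Nonempty {x : MRep Γ k n // cl x = α} := ⟨⟨x, hx⟩⟩
  exact Nat.card_pos

/-- Riedtmann's formula. -/
theorem hall_mul_aut (t : MRep Γ k m) (s : MRep Γ k n) (γ : IsoCls Γ k) :
    IsoCls.hall (cl s) (cl t) γ * (cl s).aut * (cl t).aut *
      Fintype.card k ^ (∑ j, Fintype.card (m j) * Fintype.card (n j)) =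
      γ.aut * extn t s γ := by
  by_cases hd : ∀ j, Fintype.card (SumD m n j) = γ.dim j
  · have e1 : Nat.card {xp : MRep Γ k (SumD m n) × MIso k (SumD m n) (SumD m n) //
        cl xp.1 = γ ∧ SubC xp.1 (xp.2.mapW (stdW k m n)) (cl t) ∧
          QuoC xp.1 (xp.2.mapW (stdW k m n)) (cl s)} =
        Nat.card {x : MRep Γ k (SumD m n) // cl x = γ} *
          (IsoCls.hall (cl s) (cl t) γ * Nat.card (Par k m n)) := by
      rw [← card_sigma_const (X := {x : MRep Γ k (SumD m n) // cl x = γ})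
        (F := fun x => {p : MIso k (SumD m n) (SumD m n) //
          SubC x.1 (p.mapW (stdW k m n)) (cl t) ∧ QuoC x.1 (p.mapW (stdW k m n)) (cl s)})
        fun x => card_frames x.2 (fun j => rfl) (fun j => rfl)]
      exact Nat.card_congr
        { toFun := fun y => ⟨⟨y.1.1, y.2.1⟩, ⟨y.1.2, y.2.2⟩⟩
          invFun := fun y => ⟨(y.1.1, y.2.1), y.1.2, y.2.2⟩
          left_inv := fun _ => rfl
          right_inv := fun _ => rfl }
    have e2 : Nat.card {xp : MRep Γ k (SumD m n) × MIso k (SumD m n) (SumD m n) //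
        cl xp.1 = γ ∧ SubC xp.1 (xp.2.mapW (stdW k m n)) (cl t) ∧
          QuoC xp.1 (xp.2.mapW (stdW k m n)) (cl s)} =
        Nat.card {y : MRep Γ k (SumD m n) // cl y = γ ∧
          SubC y (stdW k m n) (cl t) ∧ QuoC y (stdW k m n) (cl s)} *
        Nat.card (MIso k (SumD m n) (SumD m n)) := by
      rw [← Nat.card_prod]
      refine Nat.card_congr
        { toFun := fun y => (⟨y.1.2.symm.conj y.1.1, ?_⟩, y.1.2)
          invFun := fun y => ⟨(y.2.conj y.1.1, y.2), ?_⟩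
          left_inv := ?_
          right_inv := ?_ }
      · refine ⟨by rw [cl_conj, y.2.1], ?_⟩
        have := y.2.2
        rwa [← subC_map_iff y.1.2.symm, ← quoC_map_iff y.1.2.symm, MIso.mapW_symm] at this
      · refine ⟨by rw [cl_conj, y.1.2.1], ?_⟩
        rw [subC_map_iff, quoC_map_iff]
        exact y.1.2.2
      · intro y; simp
      · intro y; simp
    rw [e1, card_blk, card_par] at e2
    have o1 := card_orbit (Γ := Γ) (k := k) (n := SumD m n) hd
    have o2 := card_orbit (n := m) (α := cl t) fun j => rfl
    have o3 := card_orbit (n := n) (α := cl s) fun j => rfl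
    have p1 := card_orbit_pos (Γ := Γ) (k := k) (n := SumD m n) hd
    have p2 := card_orbit_pos (n := m) (α := cl t) fun j => rfl
    have p3 := card_orbit_pos (n := n) (α := cl s) fun j => rfl
    rw [← o1, ← o2, ← o3] at e2
    refine Nat.eq_of_mul_eq_mul_left (mul_pos (mul_pos p1 p2) p3) ?_
    linarith
  · have h1 : extn t s γ = 0 := by
      rw [extn, Nat.card_eq_zero]
      refine Or.inl ⟨fun z => hd fun j => ?_⟩
      rw [← z.2]; rfl
    have h2 : IsoCls.hall (cl s) (cl t) γ = 0 := by
      by_contra h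
      refine hd fun j => ?_
      rw [hall_dim h j, dim_cl, dim_cl, Fintype.card_sum, add_comm]
    rw [h1, h2]; simp

/-- Counting subrepresentations by injective morphisms. -/
theorem card_sub_hom (x₀ : MRep Γ k n) (x' : MRep Γ k n') (α : IsoCls Γ k) :
    Nat.card {xy : MRep Γ k n × MMap k n n' // cl xy.1 = cl x₀ ∧ IsMHom xy.1 x' xy.2 ∧
        (∀ j, Function.Injective (xy.2 j).mulVec) ∧
        QuoC x' (fun j => LinearMap.range (xy.2 j).mulVecLin) α} =
      IsoCls.hall α (cl x₀) (cl x') * Nat.card (MIso k n n) := by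
  rw [hall_eq_card (x := x') rfl, ← Nat.card_prod]
  have key : ∀ W : {W : ∀ j, Submodule k (n' j → k) // SubC x' W (cl x₀) ∧ QuoC x' W α},
      ∃ y : MMap k n n', IsMHom x₀ x' y ∧ ∀ j, Function.Injective (y j).mulVec ∧
        LinearMap.range (y j).mulVecLin = W.1 j := by
    rintro ⟨W, ⟨y, hy, hj⟩, -⟩
    obtain ⟨p, hp⟩ := exists_rep_iso x₀
    have hq : p.symm.conj x₀ = (cl x₀).rep := by
      have := p.symm_conj_conj (Γ := Γ) (cl x₀).rep
      rwa [hp] at this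
    refine ⟨fun j => y j * p.bwd j, hy.comp ((p.symm.conj_eq_iff _ _).1 hq), fun j => ⟨?_, ?_⟩⟩
    · rw [mulVec_mul_eq]; exact (hj j).1.comp (p.symm.bijective_fwd j).1
    · rw [Matrix.mulVecLin_mul, LinearMap.range_comp_of_range_eq_top, (hj j).2]
      exact LinearMap.range_eq_top.2 (p.symm.bijective_fwd j).2
  choose Y hY hYj using key
  have rg : ∀ W (g : MIso k n n) j,
      LinearMap.range (Y W j * g.fwd j).mulVecLin = W.1 j := by
    intro W g j
    rw [Matrix.mulVecLin_mul, LinearMap.range_comp_of_range_eq_top, (hYj W j).2]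
    exact LinearMap.range_eq_top.2 (g.bijective_fwd j).2
  have cancel : ∀ {j : J} {l : Type} [Fintype l] {M : Matrix (n' j) (n j) k}
      {B C : Matrix (n j) l k}, Function.Injective M.mulVec → M * B = M * C → B = C := by
    intro j l _ M B C hM h
    classical
    ext a b
    have h2 := congrArg (fun N => N.mulVec (Pi.single b 1)) h
    simp only [← Matrix.mulVec_mulVec] at h2
    have := congrFun (hM h2) a
    simpa using this
  symm
  refine Nat.card_congr (Equiv.ofBijective
    (fun Wg => ⟨(Wg.2.symm.conj x₀, fun j => Y Wg.1 j * Wg.2.fwd j), ?_⟩) ⟨?_, ?_⟩)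
  · refine ⟨cl_conj _ _, (hY _).comp ?_, fun j => ?_, ?_⟩
    · exact (Wg.2.conj_eq_iff _ _).1 (by simp)
    · rw [mulVec_mul_eq]; exact (hYj Wg.1 j).1.comp (Wg.2.bijective_fwd j).1
    · simpa only [rg] using Wg.1.2.2
  · rintro ⟨W, g⟩ ⟨W', g'⟩ h
    have h1 : (fun j => Y W j * g.fwd j) = fun j => Y W' j * g'.fwd j :=
      congrArg (fun z => z.1.2) h
    obtain rfl : W = W' := Subtype.ext (funext fun j => by
      rw [← rg W g j, ← rg W' g' j, congrFun h1 j])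
    have : g = g' := MIso.ext_fwd (funext fun j => cancel (hYj W j).1 (congrFun h1 j))
    rw [this]
  · rintro ⟨⟨x, y⟩, hx, hy, hi, hq⟩
    have hW : SubC x' (fun j => LinearMap.range (y j).mulVecLin) (cl x₀) := by
      rw [← hx]; exact SubC.of_hom hy hi
    let W : {W : ∀ j, Submodule k (n' j → k) // SubC x' W (cl x₀) ∧ QuoC x' W α} := ⟨_, hW, hq⟩
    have hg : ∀ j, ∃ g : (n j → k) ≃ₗ[k] (n j → k), ∀ v, (Y W j).mulVec (g v) = (y j).mulVec v := by
      intro j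
      let e1 := LinearEquiv.ofInjective (Y W j).mulVecLin (hYj W j).1
      let e2 := LinearEquiv.ofInjective (y j).mulVecLin (hi j)
      let e3 := LinearEquiv.ofEq (LinearMap.range (y j).mulVecLin)
        (LinearMap.range (Y W j).mulVecLin) (hYj W j).2.symm
      refine ⟨(e2.trans e3).trans e1.symm, fun v => ?_⟩
      have : (e1 (((e2.trans e3).trans e1.symm) v)).1 = (e2 v).1 := by simp [e3]
      exact this
    choose g hg using hg
    have hyg : ∀ j, Y W j * (MIso.ofLE g).fwd j = y j := by
      intro j
      ext a b
      have := congrFun (hg j (Pi.single b 1)) a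
      rw [← MIso.ofLE_le g, MIso.le_apply, Matrix.mulVec_mulVec] at this
      simpa using this
    refine ⟨(W, MIso.ofLE g), Subtype.ext (Prod.ext ?_ (funext hyg))⟩
    show (MIso.ofLE g).symm.conj x₀ = x
    have : (MIso.ofLE g).conj x = x₀ := by
      rw [MIso.conj_eq_iff]
      intro h
      apply cancel (hYj W _).1
      rw [← Matrix.mul_assoc, ← hY W h, Matrix.mul_assoc, hyg, ← Matrix.mul_assoc, hyg, hy h]
    rw [← this, MIso.symm_conj_conj]

end Riedtmann

end RingelHall
end

noncomputable section
namespace RingelHall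

section Assoc

variable {J A k : Type*} [Fintype J] [Fintype A] [Field k] [Fintype k] {Γ : Quiv J A}

variable {n n' m m' l : J → Type}
  [∀ j, Fintype (n j)] [∀ j, DecidableEq (n j)]
  [∀ j, Fintype (n' j)] [∀ j, DecidableEq (n' j)]
  [∀ j, Fintype (m j)] [∀ j, DecidableEq (m j)]
  [∀ j, Fintype (m' j)] [∀ j, DecidableEq (m' j)]
  [∀ j, Fintype (l j)] [∀ j, DecidableEq (l j)]

theorem matrix_mul_right_cancel {a b c : Type*} [Fintype a] [Fintype b] [DecidableEq a] [DecidableEq b]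
    {M : Matrix a b k} (hM : Function.Surjective M.mulVec) {B C : Matrix c a k}
    (h : B * M = C * M) : B = C := by
  obtain ⟨g, hg⟩ := LinearMap.exists_rightInverse_of_surjective M.mulVecLin
      (LinearMap.range_eq_top.2 hM)
  have : M * LinearMap.toMatrix' g = 1 := by
    have e := congrArg LinearMap.toMatrix' hg
    rw [LinearMap.toMatrix'_comp, LinearMap.toMatrix'_id] at e
    rw [← e, ← Matrix.toLin'_apply', LinearMap.toMatrix'_toLin']
  calc B = B * M * LinearMap.toMatrix' g := by rw [Matrix.mul_assoc, this, Matrix.mul_one]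
    _ = C := by rw [h, Matrix.mul_assoc, this, Matrix.mul_one]

/-- Counting subrepresentations by surjective morphisms. -/
theorem card_quo_hom (x₀ : MRep Γ k n) (x' : MRep Γ k n') (β : IsoCls Γ k) :
    Nat.card {xz : MRep Γ k n × MMap k n' n // cl xz.1 = cl x₀ ∧ IsMHom x' xz.1 xz.2 ∧
        (∀ j, Function.Surjective (xz.2 j).mulVec) ∧
        SubC x' (fun j => LinearMap.ker (xz.2 j).mulVecLin) β} =
      IsoCls.hall (cl x₀) β (cl x') * Nat.card (MIso k n n) := by
  rw [hall_eq_card (x := x') rfl, ← Nat.card_prod]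
  have key : ∀ W : {W : ∀ j, Submodule k (n' j → k) // SubC x' W β ∧ QuoC x' W (cl x₀)},
      ∃ z : MMap k n' n, IsMHom x' x₀ z ∧ ∀ j, Function.Surjective (z j).mulVec ∧
        LinearMap.ker (z j).mulVecLin = W.1 j := by
    rintro ⟨W, -, ⟨z, hz, hj⟩⟩
    obtain ⟨p, hp⟩ := exists_rep_iso x₀
    refine ⟨fun j => p.fwd j * z j, ((p.conj_eq_iff _ _).1 hp).comp hz, fun j => ⟨?_, ?_⟩⟩
    · rw [mulVec_mul_eq]; exact (p.bijective_fwd j).2.comp (hj j).1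
    · rw [Matrix.mulVecLin_mul, LinearMap.ker_comp_of_ker_eq_bot, (hj j).2]
      exact LinearMap.ker_eq_bot.2 (p.bijective_fwd j).1
  choose Z hZ hZj using key
  have rg : ∀ W (g : MIso k n n) j,
      LinearMap.ker (g.fwd j * Z W j).mulVecLin = W.1 j := by
    intro W g j
    rw [Matrix.mulVecLin_mul, LinearMap.ker_comp_of_ker_eq_bot, (hZj W j).2]
    exact LinearMap.ker_eq_bot.2 (g.bijective_fwd j).1
  symm
  refine Nat.card_congr (Equiv.ofBijective
    (fun Wg => ⟨(Wg.2.conj x₀, fun j => Wg.2.fwd j * Z Wg.1 j), ?_⟩) ⟨?_, ?_⟩)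
  · refine ⟨cl_conj _ _, (Wg.2.isMHom x₀).comp (hZ _), fun j => ?_, ?_⟩
    · rw [mulVec_mul_eq]; exact (Wg.2.bijective_fwd j).2.comp (hZj Wg.1 j).1
    · simpa only [rg] using Wg.1.2.1
  · rintro ⟨W, g⟩ ⟨W', g'⟩ h
    have h1 : (fun j => g.fwd j * Z W j) = fun j => g'.fwd j * Z W' j :=
      congrArg (fun z => z.1.2) h
    obtain rfl : W = W' := Subtype.ext (funext fun j => by
      rw [← rg W g j, ← rg W' g' j, congrFun h1 j])
    have : g = g' := MIso.ext_fwd (funext fun j =>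
      matrix_mul_right_cancel (hZj W j).1 (congrFun h1 j))
    rw [this]
  · rintro ⟨⟨x, z⟩, hx, hz, hs, hq⟩
    have hW : QuoC x' (fun j => LinearMap.ker (z j).mulVecLin) (cl x₀) := by
      rw [← hx]; exact QuoC.of_hom hz hs
    let W : {W : ∀ j, Submodule k (n' j → k) // SubC x' W β ∧ QuoC x' W (cl x₀)} := ⟨_, hq, hW⟩
    have hg : ∀ j, ∃ g : (n j → k) ≃ₗ[k] (n j → k), ∀ v, g ((Z W j).mulVec v) = (z j).mulVec v := by
      intro j
      let e1 := (Z W j).mulVecLin.quotKerEquivOfSurjective (hZj W j).1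
      let e2 := (z j).mulVecLin.quotKerEquivOfSurjective (hs j)
      let e3 := Submodule.quotEquivOfEq (LinearMap.ker (Z W j).mulVecLin)
        (LinearMap.ker (z j).mulVecLin) (hZj W j).2
      refine ⟨(e1.symm.trans e3).trans e2, fun v => ?_⟩
      have h1 : e1.symm ((Z W j).mulVec v) = Submodule.Quotient.mk v := by
        rw [LinearEquiv.symm_apply_eq]; rfl
      simp only [LinearEquiv.trans_apply, h1]
      rfl
    choose g hg using hg
    have hyg : ∀ j, (MIso.ofLE g).fwd j * Z W j = z j := by
      intro j
      ext a b
      have := congrFun (hg j (Pi.single b 1)) a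
      rw [← MIso.ofLE_le g, MIso.le_apply, Matrix.mulVec_mulVec] at this
      simpa using this
    refine ⟨(W, MIso.ofLE g), Subtype.ext (Prod.ext ?_ (funext hyg))⟩
    show (MIso.ofLE g).conj x₀ = x
    rw [MIso.conj_eq_iff]
    intro h
    apply matrix_mul_right_cancel (hZj W _).1
    rw [Matrix.mul_assoc, hyg, hz h, Matrix.mul_assoc, hZ W h, ← Matrix.mul_assoc, hyg]

theorem finite_totalDim_le (Γ : Quiv J A) (k : Type*) [Field k] [Fintype k] (N : ℕ) :
    {α : IsoCls Γ k | α.totalDim ≤ N}.Finite := by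
  have : ∀ d : J → ℕ, Finite (Quotient (isoSetoid Γ k d)) := fun d => Quotient.finite _
  let f : (Σ d : J → Fin (N + 1), Quotient (isoSetoid Γ k fun j => (d j : ℕ))) → IsoCls Γ k :=
    fun x => ⟨fun j => x.1 j, x.2⟩
  refine (Set.finite_range f).subset ?_
  rintro ⟨d, q⟩ hd
  have hj : ∀ j, d j < N + 1 := fun j => Nat.lt_succ_of_le
    ((Finset.single_le_sum (f := d) (fun _ _ => Nat.zero_le _) (Finset.mem_univ j)).trans hd)
  exact ⟨⟨fun j => ⟨d j, hj j⟩, q⟩, rfl⟩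

/-- The finite set of isomorphism classes of total dimension at most `N`. -/
def box (Γ : Quiv J A) (k : Type*) [Field k] [Fintype k] (N : ℕ) : Finset (IsoCls Γ k) :=
  (finite_totalDim_le Γ k N).toFinset

@[simp] theorem mem_box {N : ℕ} {α : IsoCls Γ k} : α ∈ box Γ k N ↔ α.totalDim ≤ N := by
  simp [box]

theorem totalDim_of_hall {α β γ : IsoCls Γ k} (h : IsoCls.hall α β γ ≠ 0) :
    γ.totalDim = α.totalDim + β.totalDim := by
  simp only [IsoCls.totalDim, hall_dim h, Finset.sum_add_distrib]

theorem sum_comp_eq_sum_card {X P M : Type*} [Fintype X] [CommSemiring M] (f : X → P) (S : Finset P)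
    (hf : ∀ x, f x ∈ S) (G : P → M) :
    ∑ x, G (f x) = ∑ μ ∈ S, (Nat.card {x // f x = μ} : M) * G μ := by
  classical
  rw [← Finset.sum_fiberwise_of_maps_to (s := Finset.univ) (t := S) (g := f) fun x _ => hf x]
  refine Finset.sum_congr rfl fun μ _ => ?_
  rw [Finset.sum_congr rfl (g := fun _ => G μ) fun x hx => by rw [(Finset.mem_filter.1 hx).2],
    Finset.sum_const, nsmul_eq_mul, Nat.card_eq_fintype_card, Fintype.card_subtype]

/-- The bijection `(V₁ ⊕ V₂) ⊕ V₃ ≃ V₁ ⊕ (V₂ ⊕ V₃)`. -/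
abbrev assocIso (k : Type*) [Field k] (m n l : J → Type)
    [∀ j, Fintype (n j)] [∀ j, DecidableEq (n j)] [∀ j, Fintype (m j)] [∀ j, DecidableEq (m j)]
    [∀ j, Fintype (l j)] [∀ j, DecidableEq (l j)] :
    MIso k (SumD (SumD m n) l) (SumD m (SumD n l)) :=
  MIso.ofEquiv k fun j => Equiv.sumAssoc (m j) (n j) (l j)

theorem assoc_conj_blk (t₁ : MRep Γ k m) (t₂ : MRep Γ k n) (t₃ : MRep Γ k l)
    (z₁₂ : ∀ h, Matrix (m (Γ.t h)) (n (Γ.s h)) k) (z₁₃ : ∀ h, Matrix (m (Γ.t h)) (l (Γ.s h)) k)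
    (z₂₃ : ∀ h, Matrix (n (Γ.t h)) (l (Γ.s h)) k) :
    (assocIso k m n l).conj (blk (m := SumD m n) (blk t₁ z₁₂ t₂)
      (fun h => Matrix.fromRows (z₁₃ h) (z₂₃ h)) t₃) =
    blk (n := SumD n l) t₁ (fun h => Matrix.fromCols (z₁₂ h) (z₁₃ h)) (blk t₂ z₂₃ t₃) := by
  rw [MIso.ofEquiv_conj]
  funext h
  ext a b
  rcases a with a | a | a <;> rcases b with b | b | b <;>
    simp [blk, Matrix.fromBlocks]

theorem sum_extn_left (t₁ : MRep Γ k m) (t₂ : MRep Γ k n) (t₃ : MRep Γ k l) (γ : IsoCls Γ k)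
    {S : Finset (IsoCls Γ k)} (hS : ∀ z, cl (blk t₁ z t₂) ∈ S) :
    Nat.card {z : (∀ h, Matrix (m (Γ.t h)) (n (Γ.s h)) k) ×
      (∀ h, Matrix (m (Γ.t h) ⊕ n (Γ.t h)) (l (Γ.s h)) k) //
        cl (blk (m := SumD m n) (blk t₁ z.1 t₂) z.2 t₃) = γ} =
      ∑ μ ∈ S, extn t₁ t₂ μ * extn (m := FinD μ.dim) μ.rep t₃ γ := by
  classical
  have e : ∀ z, Nat.card {z' : ∀ h, Matrix (m (Γ.t h) ⊕ n (Γ.t h)) (l (Γ.s h)) k //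
      cl (blk (m := SumD m n) (blk t₁ z t₂) z' t₃) = γ} =
      extn (m := FinD (cl (blk t₁ z t₂)).dim) (cl (blk t₁ z t₂)).rep t₃ γ := fun z =>
    extn_congr (m := SumD m n) (m' := FinD (cl (blk t₁ z t₂)).dim) (t := blk t₁ z t₂)
      (cl_rep _).symm rfl γ
  rw [Nat.card_congr (Equiv.subtypeProdEquivSigmaSubtype fun z z' =>
    cl (blk (m := SumD m n) (blk t₁ z t₂) z' t₃) = γ), Nat.card_sigma,
    Finset.sum_congr rfl fun z _ => e z]
  have := sum_comp_eq_sum_card (fun z => cl (blk t₁ z t₂)) S hS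
    fun μ => extn (m := FinD μ.dim) μ.rep t₃ γ
  simp only [Nat.cast_id] at this
  convert this using 2
  rfl

theorem sum_extn_right (t₁ : MRep Γ k m) (t₂ : MRep Γ k n) (t₃ : MRep Γ k l) (γ : IsoCls Γ k)
    {S : Finset (IsoCls Γ k)} (hS : ∀ z, cl (blk t₂ z t₃) ∈ S) :
    Nat.card {z : (∀ h, Matrix (n (Γ.t h)) (l (Γ.s h)) k) ×
      (∀ h, Matrix (m (Γ.t h)) (n (Γ.s h) ⊕ l (Γ.s h)) k) //
        cl (blk (n := SumD n l) t₁ z.2 (blk t₂ z.1 t₃)) = γ} =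
      ∑ μ ∈ S, extn t₂ t₃ μ * extn (n := FinD μ.dim) t₁ μ.rep γ := by
  classical
  have e : ∀ z, Nat.card {z' : ∀ h, Matrix (m (Γ.t h)) (n (Γ.s h) ⊕ l (Γ.s h)) k //
      cl (blk (n := SumD n l) t₁ z' (blk t₂ z t₃)) = γ} =
      extn (n := FinD (cl (blk t₂ z t₃)).dim) t₁ (cl (blk t₂ z t₃)).rep γ := fun z =>
    extn_congr (n := SumD n l) (n' := FinD (cl (blk t₂ z t₃)).dim) (s := blk t₂ z t₃) rfl
      (cl_rep _).symm γ
  rw [Nat.card_congr (Equiv.subtypeProdEquivSigmaSubtype fun z z' =>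
    cl (blk (n := SumD n l) t₁ z' (blk t₂ z t₃)) = γ), Nat.card_sigma,
    Finset.sum_congr rfl fun z _ => e z]
  have := sum_comp_eq_sum_card (fun z => cl (blk t₂ z t₃)) S hS
    fun μ => extn (n := FinD μ.dim) t₁ μ.rep γ
  simp only [Nat.cast_id] at this
  convert this using 2
  rfl

theorem extn_assoc (t₁ : MRep Γ k m) (t₂ : MRep Γ k n) (t₃ : MRep Γ k l) (γ : IsoCls Γ k)
    {S S' : Finset (IsoCls Γ k)} (hS : ∀ z, cl (blk t₁ z t₂) ∈ S)
    (hS' : ∀ z, cl (blk t₂ z t₃) ∈ S') :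
    ∑ μ ∈ S, extn t₁ t₂ μ * extn (m := FinD μ.dim) μ.rep t₃ γ =
      ∑ μ ∈ S', extn t₂ t₃ μ * extn (n := FinD μ.dim) t₁ μ.rep γ := by
  rw [← sum_extn_left t₁ t₂ t₃ γ hS, ← sum_extn_right t₁ t₂ t₃ γ hS']
  refine Nat.card_congr (Equiv.subtypeEquiv
    { toFun := fun z => (fun h => (z.2 h).toRows₂, fun h => Matrix.fromCols (z.1 h) (z.2 h).toRows₁)
      invFun := fun z => (fun h => (z.2 h).toCols₁, fun h => Matrix.fromRows (z.2 h).toCols₂ (z.1 h))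
      left_inv := fun z => by simp
      right_inv := fun z => by simp } fun z => ?_)
  have := assoc_conj_blk t₁ t₂ t₃ z.1 (fun h => (z.2 h).toRows₁) (fun h => (z.2 h).toRows₂)
  simp only [Matrix.fromRows_toRows] at this
  simp only [Equiv.coe_fn_mk, ← this, cl_conj]

theorem riedtmann (t : MRep Γ k m) (s : MRep Γ k n) {α β : IsoCls Γ k} (ht : cl t = β)
    (hs : cl s = α) (γ : IsoCls Γ k) :
    IsoCls.hall α β γ * α.aut * β.aut * Fintype.card k ^ (∑ j, β.dim j * α.dim j) =
      γ.aut * extn t s γ := by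
  rw [← hall_mul_aut, ht, hs]
  subst ht hs
  rfl

/-- Associativity of Hall numbers. -/
theorem hall_assoc (α β γ κ : IsoCls Γ k) {S S' : Finset (IsoCls Γ k)}
    (hS : ∀ μ : IsoCls Γ k, (∀ j, μ.dim j = β.dim j + γ.dim j) → μ ∈ S)
    (hS' : ∀ μ : IsoCls Γ k, (∀ j, μ.dim j = α.dim j + β.dim j) → μ ∈ S') :
    ∑ μ ∈ S, IsoCls.hall β γ μ * IsoCls.hall α μ κ =
      ∑ μ ∈ S', IsoCls.hall α β μ * IsoCls.hall μ γ κ := by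
  have h := extn_assoc (m := FinD γ.dim) (n := FinD β.dim) (l := FinD α.dim) γ.rep β.rep α.rep κ
    (S := S) (S' := S') (fun z => hS _ fun j => by simp [dim_cl, add_comm])
    (fun z => hS' _ fun j => by simp [dim_cl, add_comm])
  have q0 : 0 < Fintype.card k := Fintype.card_pos
  set q := Fintype.card k
  have a0 := fun μ : IsoCls Γ k => aut_pos μ
  set E := q ^ (∑ j, γ.dim j * β.dim j) * q ^ (∑ j, γ.dim j * α.dim j) *
    q ^ (∑ j, β.dim j * α.dim j)
  have h1 : ∀ μ, κ.aut * (extn (m := FinD γ.dim) (n := FinD β.dim) γ.rep β.rep μ *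
      extn (m := FinD μ.dim) (n := FinD α.dim) μ.rep α.rep κ) =
      (α.aut * β.aut * γ.aut * E) * (IsoCls.hall β γ μ * IsoCls.hall α μ κ) := by
    intro μ
    refine Nat.eq_of_mul_eq_mul_left (a0 μ) ?_
    have r1 := riedtmann (m := FinD γ.dim) (n := FinD β.dim) γ.rep β.rep (cl_rep _) (cl_rep _) μ
    have r2 := riedtmann (m := FinD μ.dim) (n := FinD α.dim) μ.rep α.rep (cl_rep _) (cl_rep _) κ
    by_cases h0 : IsoCls.hall β γ μ = 0
    · rw [h0] at r1
      have : extn (m := FinD γ.dim) (n := FinD β.dim) γ.rep β.rep μ = 0 := by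
        have := a0 μ
        simp only [zero_mul] at r1
        exact (Nat.mul_eq_zero.1 r1.symm).resolve_left this.ne'
      rw [h0, this]; simp
    have hd : q ^ (∑ j, μ.dim j * α.dim j) =
        q ^ (∑ j, γ.dim j * α.dim j) * q ^ (∑ j, β.dim j * α.dim j) := by
      rw [← pow_add, ← Finset.sum_add_distrib]
      congr 1
      refine Finset.sum_congr rfl fun j _ => ?_
      rw [hall_dim h0 j]; ring
    calc _ = (μ.aut * extn (m := FinD γ.dim) (n := FinD β.dim) γ.rep β.rep μ) *
          (κ.aut * extn (m := FinD μ.dim) (n := FinD α.dim) μ.rep α.rep κ) := by ring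
      _ = _ := by rw [← r1, ← r2, hd]; ring
  have h2 : ∀ μ, κ.aut * (extn (m := FinD β.dim) (n := FinD α.dim) β.rep α.rep μ *
      extn (m := FinD γ.dim) (n := FinD μ.dim) γ.rep μ.rep κ) =
      (α.aut * β.aut * γ.aut * E) * (IsoCls.hall α β μ * IsoCls.hall μ γ κ) := by
    intro μ
    refine Nat.eq_of_mul_eq_mul_left (a0 μ) ?_
    have r1 := riedtmann (m := FinD β.dim) (n := FinD α.dim) β.rep α.rep (cl_rep _) (cl_rep _) μ
    have r2 := riedtmann (m := FinD γ.dim) (n := FinD μ.dim) γ.rep μ.rep (cl_rep _) (cl_rep _) κ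
    by_cases h0 : IsoCls.hall α β μ = 0
    · rw [h0] at r1
      have : extn (m := FinD β.dim) (n := FinD α.dim) β.rep α.rep μ = 0 := by
        have := a0 μ
        simp only [zero_mul] at r1
        exact (Nat.mul_eq_zero.1 r1.symm).resolve_left this.ne'
      rw [h0, this]; simp
    have hd : q ^ (∑ j, γ.dim j * μ.dim j) =
        q ^ (∑ j, γ.dim j * β.dim j) * q ^ (∑ j, γ.dim j * α.dim j) := by
      rw [← pow_add, ← Finset.sum_add_distrib]
      congr 1
      refine Finset.sum_congr rfl fun j _ => ?_
      rw [hall_dim h0 j]; ring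
    calc _ = (μ.aut * extn (m := FinD β.dim) (n := FinD α.dim) β.rep α.rep μ) *
          (κ.aut * extn (m := FinD γ.dim) (n := FinD μ.dim) γ.rep μ.rep κ) := by ring
      _ = _ := by rw [← r1, ← r2, hd]; ring
  have hE : 0 < α.aut * β.aut * γ.aut * E := by
    have := a0 α; have := a0 β; have := a0 γ
    positivity
  refine Nat.eq_of_mul_eq_mul_left hE ?_
  rw [Finset.mul_sum, Finset.mul_sum, ← Finset.sum_congr rfl fun μ _ => h1 μ,
    ← Finset.sum_congr rfl fun μ _ => h2 μ, ← Finset.mul_sum, ← Finset.mul_sum, h]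

end Assoc

end RingelHall
end

noncomputable section
namespace RingelHall

/-! ## Pairs of subspaces and Green's formula -/

section Pairs

variable {k : Type*} [Field k]

/-- Adapted decompositions for a pair of subspaces. -/
theorem exists_adapted {V : Type*} [AddCommGroup V] [Module k V] [FiniteDimensional k V]
    (W W' : Submodule k V) {a b c d : Type} [Fintype a] [Fintype b] [Fintype c] [Fintype d]
    (ha : Module.finrank k ↥(W ⊓ W') = Fintype.card a)
    (hb : Module.finrank k W = Fintype.card a + Fintype.card b)
    (hc : Module.finrank k W' = Fintype.card a + Fintype.card c)
    (hd : Module.finrank k V = Fintype.card a + Fintype.card b + Fintype.card c + Fintype.card d) :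
    ∃ (f : ((a ⊕ b) ⊕ (c ⊕ d) → k) ≃ₗ[k] V),
      (∀ v, f v ∈ W ↔ ∀ i, v (Sum.inr i) = 0) ∧
      (∀ v, f v ∈ W' ↔ (∀ i, v (Sum.inl (Sum.inr i)) = 0) ∧ ∀ i, v (Sum.inr (Sum.inr i)) = 0) := by
  classical
  have par : ∀ (U : Submodule k V) (n : Type) [Fintype n], Module.finrank k U = Fintype.card n →
      ∃ g : (n → k) →ₗ[k] V, LinearMap.range g = U := by
    intro U n _ h
    have e : (n → k) ≃ₗ[k] U := LinearEquiv.ofFinrankEq _ _ (by simp [h])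
    refine ⟨U.subtype ∘ₗ e.toLinearMap, ?_⟩
    rw [LinearMap.range_comp_of_range_eq_top _ e.range, Submodule.range_subtype]
  obtain ⟨C, hC⟩ := Submodule.exists_isCompl (W ⊓ W')
  have comp : ∀ U : Submodule k V, W ⊓ W' ≤ U →
      (W ⊓ W') ⊔ (C ⊓ U) = U ∧
        Module.finrank k ↥(C ⊓ U) + Module.finrank k ↥(W ⊓ W') = Module.finrank k U := by
    intro U hU
    have e : (W ⊓ W') ⊔ (C ⊓ U) = U := by
      rw [← sup_inf_assoc_of_le _ hU, hC.sup_eq_top, top_inf_eq]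
    refine ⟨e, ?_⟩
    have h := Submodule.finrank_sup_add_finrank_inf_eq (W ⊓ W') (C ⊓ U)
    have h0 : (W ⊓ W') ⊓ (C ⊓ U) = ⊥ := by
      rw [← inf_assoc, hC.inf_eq_bot, bot_inf_eq]
    rw [e, h0, finrank_bot] at h
    omega
  obtain ⟨hW, hW2⟩ := comp W inf_le_left
  obtain ⟨hW', hW2'⟩ := comp W' inf_le_right
  obtain ⟨E, hE⟩ := Submodule.exists_isCompl (W ⊔ W')
  have hE2 : Module.finrank k E = Fintype.card d := by
    have h1 := Submodule.finrank_add_eq_of_isCompl hE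
    have h2 := Submodule.finrank_sup_add_finrank_inf_eq W W'
    omega
  obtain ⟨ga, hga⟩ := par (W ⊓ W') a ha
  obtain ⟨gb, hgb⟩ := par (C ⊓ W) b (by omega)
  obtain ⟨gc, hgc⟩ := par (C ⊓ W') c (by omega)
  obtain ⟨gd, hgd⟩ := par E d hE2
  let f : ((a ⊕ b) ⊕ (c ⊕ d) → k) →ₗ[k] V :=
    ga ∘ₗ LinearMap.funLeft k k (fun i => Sum.inl (Sum.inl i)) +
    gb ∘ₗ LinearMap.funLeft k k (fun i => Sum.inl (Sum.inr i)) +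
    gc ∘ₗ LinearMap.funLeft k k (fun i => Sum.inr (Sum.inl i)) +
    gd ∘ₗ LinearMap.funLeft k k (fun i => Sum.inr (Sum.inr i))
  have f_apply : ∀ v, f v = ga (fun i => v (Sum.inl (Sum.inl i))) +
      gb (fun i => v (Sum.inl (Sum.inr i))) + gc (fun i => v (Sum.inr (Sum.inl i))) +
      gd (fun i => v (Sum.inr (Sum.inr i))) := fun v => rfl
  have ga_mem : ∀ u, ga u ∈ W ⊓ W' := fun u => hga ▸ ⟨u, rfl⟩
  have gb_mem : ∀ u, gb u ∈ C ⊓ W := fun u => hgb ▸ ⟨u, rfl⟩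
  have gc_mem : ∀ u, gc u ∈ C ⊓ W' := fun u => hgc ▸ ⟨u, rfl⟩
  have inW : ∀ w ∈ W, ∃ v, f v = w ∧ ∀ i, v (Sum.inr i) = 0 := by
    intro w hw
    rw [← hW, Submodule.mem_sup] at hw
    obtain ⟨y, hy, z, hz, rfl⟩ := hw
    rw [← hga] at hy
    rw [← hgb] at hz
    obtain ⟨y, rfl⟩ := hy
    obtain ⟨z, rfl⟩ := hz
    refine ⟨Sum.elim (Sum.elim y z) 0, ?_, fun i => rfl⟩
    rw [f_apply]
    have e1 : gc (fun i => (Sum.elim (Sum.elim y z) 0 : (a ⊕ b) ⊕ (c ⊕ d) → k) (Sum.inr (Sum.inl i)))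
      = 0 := map_zero gc
    have e2 : gd (fun i => (Sum.elim (Sum.elim y z) 0 : (a ⊕ b) ⊕ (c ⊕ d) → k) (Sum.inr (Sum.inr i)))
      = 0 := map_zero gd
    rw [e1, e2, add_zero, add_zero]
    rfl
  have inW' : ∀ w ∈ W', ∃ v, f v = w ∧
      (∀ i, v (Sum.inl (Sum.inr i)) = 0) ∧ ∀ i, v (Sum.inr (Sum.inr i)) = 0 := by
    intro w hw
    rw [← hW', Submodule.mem_sup] at hw
    obtain ⟨y, hy, z, hz, rfl⟩ := hw
    rw [← hga] at hy
    rw [← hgc] at hz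
    obtain ⟨y, rfl⟩ := hy
    obtain ⟨z, rfl⟩ := hz
    refine ⟨Sum.elim (Sum.elim y 0) (Sum.elim z 0), ?_, fun i => rfl, fun i => rfl⟩
    rw [f_apply]
    have e1 : gb (fun i => (Sum.elim (Sum.elim y 0) (Sum.elim z 0) : (a ⊕ b) ⊕ (c ⊕ d) → k)
      (Sum.inl (Sum.inr i))) = 0 := map_zero gb
    have e2 : gd (fun i => (Sum.elim (Sum.elim y 0) (Sum.elim z 0) : (a ⊕ b) ⊕ (c ⊕ d) → k)
      (Sum.inr (Sum.inr i))) = 0 := map_zero gd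
    rw [e1, e2, add_zero, add_zero]
    rfl
  have surj : Function.Surjective f := by
    rw [← LinearMap.range_eq_top, eq_top_iff, ← hE.sup_eq_top]
    refine sup_le (sup_le ?_ ?_) ?_
    · intro w hw
      obtain ⟨v, hv, -⟩ := inW w hw
      exact ⟨v, hv⟩
    · intro w hw
      obtain ⟨v, hv, -⟩ := inW' w hw
      exact ⟨v, hv⟩
    · intro w hw
      rw [← hgd] at hw
      obtain ⟨u, rfl⟩ := hw
      refine ⟨Sum.elim 0 (Sum.elim 0 u), ?_⟩
      rw [f_apply]
      have e1 : ga (fun i => (Sum.elim 0 (Sum.elim 0 u) : (a ⊕ b) ⊕ (c ⊕ d) → k)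
        (Sum.inl (Sum.inl i))) = 0 := map_zero ga
      have e2 : gb (fun i => (Sum.elim 0 (Sum.elim 0 u) : (a ⊕ b) ⊕ (c ⊕ d) → k)
        (Sum.inl (Sum.inr i))) = 0 := map_zero gb
      have e3 : gc (fun i => (Sum.elim 0 (Sum.elim 0 u) : (a ⊕ b) ⊕ (c ⊕ d) → k)
        (Sum.inr (Sum.inl i))) = 0 := map_zero gc
      rw [e1, e2, e3, add_zero, add_zero, zero_add]
      rfl
  have inj : Function.Injective f :=
    (LinearMap.injective_iff_surjective_of_finrank_eq_finrank
      (by simp [hd]; ring)).2 surj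
  refine ⟨LinearEquiv.ofBijective f ⟨inj, surj⟩, fun v => ⟨fun hv => ?_, fun hv => ?_⟩,
    fun v => ⟨fun hv => ?_, fun hv => ?_⟩⟩
  · obtain ⟨u, hu, h0⟩ := inW _ hv
    obtain rfl : u = v := inj hu
    exact h0
  · show f v ∈ W
    rw [f_apply]
    have e1 : gc (fun i => v (Sum.inr (Sum.inl i))) = 0 := by
      rw [show (fun i => v (Sum.inr (Sum.inl i))) = 0 from funext fun i => hv _, map_zero]
    have e2 : gd (fun i => v (Sum.inr (Sum.inr i))) = 0 := by
      rw [show (fun i => v (Sum.inr (Sum.inr i))) = 0 from funext fun i => hv _, map_zero]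
    rw [e1, e2, add_zero, add_zero]
    exact add_mem (ga_mem _).1 (gb_mem _).2
  · obtain ⟨u, hu, h0⟩ := inW' _ hv
    obtain rfl : u = v := inj hu
    exact h0
  · show f v ∈ W'
    rw [f_apply]
    have e1 : gb (fun i => v (Sum.inl (Sum.inr i))) = 0 := by
      rw [show (fun i => v (Sum.inl (Sum.inr i))) = 0 from funext fun i => hv.1 _, map_zero]
    have e2 : gd (fun i => v (Sum.inr (Sum.inr i))) = 0 := by
      rw [show (fun i => v (Sum.inr (Sum.inr i))) = 0 from funext fun i => hv.2 _, map_zero]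
    rw [e1, e2, add_zero, add_zero]
    exact add_mem (ga_mem _).2 (gc_mem _).2

end Pairs

section Frames

variable {J A k : Type*} [Field k] {Γ : Quiv J A}

variable {n' a b c d : J → Type}
  [∀ j, Fintype (n' j)] [∀ j, DecidableEq (n' j)]
  [∀ j, Fintype (a j)] [∀ j, DecidableEq (a j)]
  [∀ j, Fintype (b j)] [∀ j, DecidableEq (b j)]
  [∀ j, Fintype (c j)] [∀ j, DecidableEq (c j)]
  [∀ j, Fintype (d j)] [∀ j, DecidableEq (d j)]

/-- Index types with four blocks. -/
abbrev N4 (a b c d : J → Type) : J → Type := SumD (SumD a b) (SumD c d)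

/-- Exchange of the two middle blocks. -/
abbrev swapIso (k : Type*) [Field k] (a b c d : J → Type)
    [∀ j, Fintype (a j)] [∀ j, DecidableEq (a j)] [∀ j, Fintype (b j)] [∀ j, DecidableEq (b j)]
    [∀ j, Fintype (c j)] [∀ j, DecidableEq (c j)] [∀ j, Fintype (d j)] [∀ j, DecidableEq (d j)] :
    MIso k (N4 a b c d) (N4 a c b d) :=
  MIso.ofEquiv k fun j => Equiv.sumSumSumComm (a j) (b j) (c j) (d j)

/-- The first standard family of subspaces, spanned by the first two blocks. -/
abbrev std1 (k : Type*) [Field k] (a b c d : J → Type) : ∀ j, Submodule k (N4 a b c d j → k) :=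
  stdW k (SumD a b) (SumD c d)

/-- The second standard family of subspaces, spanned by the first and the third block. -/
def std2 (k : Type*) [Field k] (a b c d : J → Type)
    [∀ j, Fintype (a j)] [∀ j, DecidableEq (a j)] [∀ j, Fintype (b j)] [∀ j, DecidableEq (b j)]
    [∀ j, Fintype (c j)] [∀ j, DecidableEq (c j)] [∀ j, Fintype (d j)] [∀ j, DecidableEq (d j)] :
    ∀ j, Submodule k (N4 a b c d j → k) :=
  (swapIso k a b c d).symm.mapW (std1 k a c b d)

theorem ofEquiv_fwd_mulVec {n n' : J → Type}
    [∀ j, Fintype (n j)] [∀ j, DecidableEq (n j)] [∀ j, Fintype (n' j)] [∀ j, DecidableEq (n' j)]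
    (e : ∀ j, n j ≃ n' j) (j : J) (v : n j → k) :
    ((MIso.ofEquiv k e).fwd j).mulVec v = v ∘ (e j).symm := by
  funext x
  simp only [MIso.ofEquiv, Matrix.mulVec, dotProduct, Matrix.submatrix_apply, Matrix.one_apply, id,
    ite_mul, one_mul, zero_mul, Function.comp]
  rw [Finset.sum_eq_single ((e j).symm x)]
  · simp
  · intro y _ hy
    rw [if_neg]
    rintro rfl
    simp at hy
  · simp

theorem mem_std2 {j : J} {v : N4 a b c d j → k} : v ∈ std2 k a b c d j ↔
    (∀ i, v (Sum.inl (Sum.inr i)) = 0) ∧ ∀ i, v (Sum.inr (Sum.inr i)) = 0 := by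
  have h : v ∈ std2 k a b c d j ↔
      ((swapIso k a b c d).fwd j).mulVec v ∈ std1 k a c b d j := by
    constructor
    · rintro ⟨u, hu, rfl⟩
      have : (swapIso k a b c d).fwd j * (swapIso k a b c d).symm.fwd j = 1 :=
        (swapIso k a b c d).fwd_bwd j
      rw [Matrix.mulVecLin_apply, Matrix.mulVec_mulVec, this, Matrix.one_mulVec]
      exact hu
    · intro hu
      refine ⟨_, hu, ?_⟩
      have : (swapIso k a b c d).symm.fwd j * (swapIso k a b c d).fwd j = 1 :=
        (swapIso k a b c d).bwd_fwd j
      rw [Matrix.mulVecLin_apply, Matrix.mulVec_mulVec, this, Matrix.one_mulVec]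
  rw [h, mem_stdW, ofEquiv_fwd_mulVec, Sum.forall]
  rfl

theorem trans_mapW {n n' n'' : J → Type}
    [∀ j, Fintype (n j)] [∀ j, DecidableEq (n j)] [∀ j, Fintype (n' j)] [∀ j, DecidableEq (n' j)]
    [∀ j, Fintype (n'' j)] [∀ j, DecidableEq (n'' j)]
    (p : MIso k n n') (q : MIso k n' n'') (W : ∀ j, Submodule k (n j → k)) :
    (p.trans q).mapW W = q.mapW (p.mapW W) := by
  funext j
  simp only [MIso.mapW, MIso.trans, Matrix.mulVecLin_mul, Submodule.map_comp]

theorem mapW_eq_of_mem {n n' : J → Type}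
    [∀ j, Fintype (n j)] [∀ j, DecidableEq (n j)] [∀ j, Fintype (n' j)] [∀ j, DecidableEq (n' j)]
    (p : MIso k n n') {W : ∀ j, Submodule k (n j → k)} {W' : ∀ j, Submodule k (n' j → k)}
    (h : ∀ j v, p.le j v ∈ W' j ↔ v ∈ W j) : p.mapW W = W' := by
  funext j
  ext u
  constructor
  · rintro ⟨v, hv, rfl⟩
    exact (h j v).2 hv
  · intro hu
    obtain ⟨v, rfl⟩ := (p.le j).surjective u
    exact ⟨v, (h j v).1 hu, rfl⟩

theorem mem_of_mapW_eq {n n' : J → Type}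
    [∀ j, Fintype (n j)] [∀ j, DecidableEq (n j)] [∀ j, Fintype (n' j)] [∀ j, DecidableEq (n' j)]
    (p : MIso k n n') {W : ∀ j, Submodule k (n j → k)} {W' : ∀ j, Submodule k (n' j → k)}
    (h : p.mapW W = W') {j : J} {v : n j → k} : p.le j v ∈ W' j ↔ v ∈ W j := by
  subst h
  constructor
  · rintro ⟨u, hu, he⟩
    obtain rfl : u = v := (p.le j).injective he
    exact hu
  · intro hv; exact ⟨v, hv, rfl⟩

/-- Frames adapted to a pair of families of subspaces. -/
abbrev Fr4 (a b c d : J → Type)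
    [∀ j, Fintype (a j)] [∀ j, DecidableEq (a j)] [∀ j, Fintype (b j)] [∀ j, DecidableEq (b j)]
    [∀ j, Fintype (c j)] [∀ j, DecidableEq (c j)] [∀ j, Fintype (d j)] [∀ j, DecidableEq (d j)]
    (W W' : ∀ j, Submodule k (n' j → k)) : Type _ :=
  {p : MIso k (N4 a b c d) n' // p.mapW (std1 k a b c d) = W ∧ p.mapW (std2 k a b c d) = W'}

theorem exists_fr4 (W W' : ∀ j, Submodule k (n' j → k)) :
    ∃ T S S' R : J → ℕ, Nonempty (Fr4 (FinD T) (FinD S) (FinD S') (FinD R) W W') := by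
  let T : J → ℕ := fun j => Module.finrank k ↥(W j ⊓ W' j)
  let S : J → ℕ := fun j => Module.finrank k ↥(W j) - T j
  let S' : J → ℕ := fun j => Module.finrank k ↥(W' j) - T j
  let R : J → ℕ := fun j => Module.finrank k (n' j → k) - Module.finrank k ↥(W j ⊔ W' j)
  have h : ∀ j, ∃ (f : (N4 (FinD T) (FinD S) (FinD S') (FinD R) j → k) ≃ₗ[k] (n' j → k)),
      (∀ v, f v ∈ W j ↔ ∀ i, v (Sum.inr i) = 0) ∧
      (∀ v, f v ∈ W' j ↔ (∀ i, v (Sum.inl (Sum.inr i)) = 0) ∧ ∀ i, v (Sum.inr (Sum.inr i)) = 0) := by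
    intro j
    have h1 : T j ≤ Module.finrank k ↥(W j) := Submodule.finrank_mono inf_le_left
    have h2 : T j ≤ Module.finrank k ↥(W' j) := Submodule.finrank_mono inf_le_right
    have h3 := Submodule.finrank_sup_add_finrank_inf_eq (W j) (W' j)
    have h4 : Module.finrank k ↥(W j ⊔ W' j) ≤ _ := Submodule.finrank_le _
    refine exists_adapted (W j) (W' j) ?_ ?_ ?_ ?_ <;>
      simp only [Fintype.card_fin, S, S', R] <;> simp only [T] at * <;> omega
  choose f hf hf' using h
  refine ⟨T, S, S', R, ⟨MIso.ofLE f, mapW_eq_of_mem _ fun j v => ?_, mapW_eq_of_mem _ fun j v => ?_⟩⟩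
  · rw [MIso.ofLE_le, hf]; rfl
  · rw [MIso.ofLE_le, hf', mem_std2]

theorem fr4_card {W W' : ∀ j, Submodule k (n' j → k)} (p : Fr4 a b c d W W') (j : J) :
    Fintype.card (a j) = Module.finrank k ↥(W j ⊓ W' j) ∧
    Fintype.card (a j) + Fintype.card (b j) = Module.finrank k ↥(W j) ∧
    Fintype.card (a j) + Fintype.card (c j) = Module.finrank k ↥(W' j) ∧
    Fintype.card (a j) + Fintype.card (b j) + Fintype.card (c j) + Fintype.card (d j) =
      Fintype.card (n' j) := by
  obtain ⟨p, h1, h2⟩ := p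
  have key : ∀ {m : Type} [Fintype m] (U : Submodule k (n' j → k))
      (g : (m → k) →ₗ[k] (N4 a b c d j → k)) (_ : Function.Injective g)
      (_ : ∀ v, p.le j v ∈ U ↔ v ∈ LinearMap.range g), Fintype.card m = Module.finrank k ↥U := by
    intro m _ U g hg hU
    have e : U = LinearMap.range ((p.le j).toLinearMap ∘ₗ g) := by
      ext u
      obtain ⟨v, rfl⟩ := (p.le j).surjective u
      rw [hU, LinearMap.range_comp]
      simp
    rw [e, LinearMap.finrank_range_of_inj]
    · simp
    · exact (p.le j).injective.comp hg
  have r1 : ∀ v, p.le j v ∈ W j ↔ ∀ i, v (Sum.inr i) = 0 := fun v => mem_of_mapW_eq p h1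
  have r2 : ∀ v, p.le j v ∈ W' j ↔
      (∀ i, v (Sum.inl (Sum.inr i)) = 0) ∧ ∀ i, v (Sum.inr (Sum.inr i)) = 0 := fun v => by
    rw [mem_of_mapW_eq p h2, mem_std2]
  let toL : ∀ {m : Type} (g : (m → k) → (N4 a b c d j → k)) (_ : ∀ u v, g (u + v) = g u + g v)
    (_ : ∀ (r : k) u, g (r • u) = r • g u), (m → k) →ₗ[k] (N4 a b c d j → k) := fun g h1 h2 =>
      ⟨⟨g, h1⟩, h2⟩
  refine ⟨?_, ?_, ?_, ?_⟩
  · refine key _ (toL (fun u => Sum.elim (Sum.elim u 0) 0) ?_ ?_) ?_ ?_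
    · intro u v; funext i; rcases i with (i | i) | i <;> simp
    · intro u v; funext i; rcases i with (i | i) | i <;> simp
    · intro u v huv; funext i; exact congrFun huv (Sum.inl (Sum.inl i))
    · intro v
      rw [Submodule.mem_inf, r1, r2]
      constructor
      · rintro ⟨e1, e2, e3⟩
        refine ⟨fun i => v (Sum.inl (Sum.inl i)), ?_⟩
        funext i
        rcases i with (i | i) | i
        · rfl
        · exact (e2 i).symm
        · exact (e1 i).symm
      · rintro ⟨u, rfl⟩
        exact ⟨fun i => rfl, fun i => rfl, fun i => rfl⟩
  · rw [← Fintype.card_sum]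
    refine key _ (toL (fun u => Sum.elim u 0) ?_ ?_) ?_ ?_
    · intro u v; funext i; rcases i with i | i <;> simp
    · intro u v; funext i; rcases i with i | i <;> simp
    · intro u v huv; funext i; exact congrFun huv (Sum.inl i)
    · intro v
      rw [r1]
      constructor
      · intro e1
        refine ⟨fun i => v (Sum.inl i), ?_⟩
        funext i
        rcases i with i | i
        · rfl
        · exact (e1 i).symm
      · rintro ⟨u, rfl⟩
        exact fun i => rfl
  · rw [← Fintype.card_sum]
    refine key _ (toL (fun u => Sum.elim (Sum.elim (u ∘ Sum.inl) 0) (Sum.elim (u ∘ Sum.inr) 0)) ?_ ?_)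
      ?_ ?_
    · intro u v; funext i; rcases i with (i | i) | (i | i) <;> simp
    · intro u v; funext i; rcases i with (i | i) | (i | i) <;> simp
    · intro u v huv
      funext i
      rcases i with i | i
      · exact congrFun huv (Sum.inl (Sum.inl i))
      · exact congrFun huv (Sum.inr (Sum.inl i))
    · intro v
      rw [r2]
      constructor
      · rintro ⟨e1, e2⟩
        refine ⟨Sum.elim (fun i => v (Sum.inl (Sum.inl i))) (fun i => v (Sum.inr (Sum.inl i))), ?_⟩
        funext i
        rcases i with (i | i) | (i | i)
        · rfl
        · exact (e1 i).symm
        · rfl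
        · exact (e2 i).symm
      · rintro ⟨u, rfl⟩
        exact ⟨fun i => rfl, fun i => rfl⟩
  · rw [← p.card_eq j]
    simp only [Fintype.card_sum]
    ring

/-- Automorphisms that preserve both standard families. -/
abbrev Stab4 (k : Type*) [Field k] (a b c d : J → Type)
    [∀ j, Fintype (a j)] [∀ j, DecidableEq (a j)] [∀ j, Fintype (b j)] [∀ j, DecidableEq (b j)]
    [∀ j, Fintype (c j)] [∀ j, DecidableEq (c j)] [∀ j, Fintype (d j)] [∀ j, DecidableEq (d j)] :
    Type _ := Fr4 a b c d (std1 k a b c d) (std2 k a b c d)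

theorem card_fr4 {W W' : ∀ j, Submodule k (n' j → k)} (p : Fr4 a b c d W W') :
    Nat.card (Fr4 a b c d W W') = Nat.card (Stab4 k a b c d) := by
  refine Nat.card_congr (Equiv.subtypeEquiv (MIso.equivOfLeft p.1.symm) fun q => ?_)
  show _ ↔ (q.trans p.1.symm).mapW _ = _ ∧ (q.trans p.1.symm).mapW _ = _
  have e1 := p.2.1
  have e2 := p.2.2
  rw [trans_mapW, trans_mapW]
  constructor
  · rintro ⟨h1, h2⟩
    rw [h1, h2]
    exact ⟨(congrArg p.1.symm.mapW e1.symm).trans (MIso.mapW_symm _ _),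
      (congrArg p.1.symm.mapW e2.symm).trans (MIso.mapW_symm _ _)⟩
  · rintro ⟨h1, h2⟩
    have f1 := congrArg p.1.mapW h1
    have f2 := congrArg p.1.mapW h2
    rw [e1] at f1
    rw [e2] at f2
    exact ⟨(p.1.symm.mapW_symm _).symm.trans f1, (p.1.symm.mapW_symm _).symm.trans f2⟩

end Frames

end RingelHall
end

noncomputable section
namespace RingelHall

section StabCount

variable {J A k : Type*} [Field k] {Γ : Quiv J A}

variable {n n' a b c d : J → Type}
  [∀ j, Fintype (n j)] [∀ j, DecidableEq (n j)]
  [∀ j, Fintype (n' j)] [∀ j, DecidableEq (n' j)]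
  [∀ j, Fintype (a j)] [∀ j, DecidableEq (a j)]
  [∀ j, Fintype (b j)] [∀ j, DecidableEq (b j)]
  [∀ j, Fintype (c j)] [∀ j, DecidableEq (c j)]
  [∀ j, Fintype (d j)] [∀ j, DecidableEq (d j)]

theorem mapW_self_iff (p : MIso k n n) (W : ∀ j, Submodule k (n j → k)) :
    p.mapW W = W ↔ ∀ j, ∀ v ∈ W j, (p.fwd j).mulVec v ∈ W j := by
  constructor
  · intro h j v hv
    have : (p.fwd j).mulVec v ∈ p.mapW W j := ⟨v, hv, rfl⟩
    rwa [h] at this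
  · intro h
    funext j
    refine Submodule.eq_of_le_of_finrank_eq ?_ ?_
    · rintro _ ⟨v, hv, rfl⟩
      exact h j v hv
    · exact LinearEquiv.finrank_map_eq (p.le j) (W j)

theorem mulVec_mem_iff {x y : Type} [Fintype x] [DecidableEq x] (M : Matrix y x k) (P : x → Prop)
    (P' : y → Prop) :
    (∀ v : x → k, (∀ i, P i → v i = 0) → ∀ i, P' i → M.mulVec v i = 0) ↔
      ∀ i i', P' i → ¬ P i' → M i i' = 0 := by
  constructor
  · intro h i i' hi hi'
    have := h (Pi.single i' 1) (fun l hl => by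
      rw [Pi.single_apply, if_neg]
      rintro rfl
      exact hi' hl) i hi
    simpa using this
  · intro h v hv i hi
    refine Finset.sum_eq_zero fun i' _ => ?_
    show M i i' * v i' = 0
    by_cases hP : P i'
    · rw [hv i' hP, mul_zero]
    · rw [h i i' hi hP, zero_mul]

theorem mapW_stdW_iff (p : MIso k (SumD a b) (SumD a b)) :
    p.mapW (stdW k a b) = stdW k a b ↔ ∀ j i i', p.fwd j (Sum.inr i) (Sum.inl i') = 0 := by
  rw [mapW_self_iff]
  refine forall_congr' fun j => ?_
  have := mulVec_mem_iff (p.fwd j) (fun x => ∃ i, x = Sum.inr i) (fun x => ∃ i, x = Sum.inr i)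
  simp only [Sum.forall, reduceCtorEq, exists_false, not_false_eq_true, false_imp_iff, forall_true_left,
    Sum.inr.injEq, exists_eq', implies_true, true_and, not_true_eq_false, and_true] at this
  exact this

theorem mapW_std2_iff (p : MIso k (N4 a b c d) (N4 a b c d)) :
    p.mapW (std2 k a b c d) = std2 k a b c d ↔ ∀ j,
      ((∀ i i', p.fwd j (Sum.inl (Sum.inr i)) (Sum.inl (Sum.inl i')) = 0) ∧
        ∀ i i', p.fwd j (Sum.inl (Sum.inr i)) (Sum.inr (Sum.inl i')) = 0) ∧
      (∀ i i', p.fwd j (Sum.inr (Sum.inr i)) (Sum.inl (Sum.inl i')) = 0) ∧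
        ∀ i i', p.fwd j (Sum.inr (Sum.inr i)) (Sum.inr (Sum.inl i')) = 0 := by
  rw [mapW_self_iff]
  refine forall_congr' fun j => ?_
  have := mulVec_mem_iff (p.fwd j)
    (fun x => (∃ i, x = Sum.inl (Sum.inr i)) ∨ ∃ i, x = Sum.inr (Sum.inr i))
    (fun x => (∃ i, x = Sum.inl (Sum.inr i)) ∨ ∃ i, x = Sum.inr (Sum.inr i))
  simp only [Sum.forall, reduceCtorEq, exists_false, not_false_eq_true, false_imp_iff,
    forall_true_left, Sum.inl.injEq, or_false, false_or, forall_and,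
    Sum.inr.injEq, exists_eq', implies_true, true_and, not_true_eq_false, and_true] at this
  simp only [mem_std2, forall_and]
  exact this.trans (by tauto)

/-- Block decomposition of the automorphisms that preserve both standard families. -/
def stab4Equiv (k : Type*) [Field k] (a b c d : J → Type)
    [∀ j, Fintype (a j)] [∀ j, DecidableEq (a j)] [∀ j, Fintype (b j)] [∀ j, DecidableEq (b j)]
    [∀ j, Fintype (c j)] [∀ j, DecidableEq (c j)] [∀ j, Fintype (d j)] [∀ j, DecidableEq (d j)] :
    Stab4 k a b c d ≃ Par k a b × Par k c d × (MMap k c a × MMap k d a × MMap k d b) where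
  toFun p :=
    (⟨(parEquiv k (SumD a b) (SumD c d) ⟨p.1, p.2.1⟩).1,
        (mapW_stdW_iff _).2 fun j => (((mapW_std2_iff p.1).1 p.2.2) j).1.1⟩,
      ⟨(parEquiv k (SumD a b) (SumD c d) ⟨p.1, p.2.1⟩).2.1,
        (mapW_stdW_iff _).2 fun j => (((mapW_std2_iff p.1).1 p.2.2) j).2.2⟩,
      fun j => (p.1.fwd j).toBlocks₁₂.toBlocks₁₁, fun j => (p.1.fwd j).toBlocks₁₂.toBlocks₁₂,
      fun j => (p.1.fwd j).toBlocks₁₂.toBlocks₂₂)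
  invFun q :=
    ⟨((parEquiv k (SumD a b) (SumD c d)).symm
      (q.1.1, q.2.1.1, fun j => Matrix.fromBlocks (q.2.2.1 j) (q.2.2.2.1 j) 0 (q.2.2.2.2 j))).1,
      ((parEquiv k (SumD a b) (SumD c d)).symm
      (q.1.1, q.2.1.1, fun j => Matrix.fromBlocks (q.2.2.1 j) (q.2.2.2.1 j) 0 (q.2.2.2.2 j))).2,
      (mapW_std2_iff _).2 fun j => ⟨⟨(mapW_stdW_iff _).1 q.1.2 j, fun i i' => rfl⟩,
        ⟨fun i i' => rfl, (mapW_stdW_iff _).1 q.2.1.2 j⟩⟩⟩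
  left_inv p := by
    apply Subtype.ext
    have := (parEquiv k (SumD a b) (SumD c d)).symm_apply_apply ⟨p.1, p.2.1⟩
    have h2 := congrArg Subtype.val this
    refine Eq.trans ?_ h2
    refine congrArg (fun q => ((parEquiv k (SumD a b) (SumD c d)).symm q).1) ?_
    refine Prod.ext rfl (Prod.ext rfl ?_)
    funext j
    have h := (((mapW_std2_iff p.1).1 p.2.2) j).1.2
    have h0 : (p.1.fwd j).toBlocks₁₂.toBlocks₂₁ = 0 := by ext i i'; exact h i i'
    simp only
    rw [← h0, Matrix.fromBlocks_toBlocks]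
    rfl
  right_inv q := by
    have := (parEquiv k (SumD a b) (SumD c d)).apply_symm_apply
      (q.1.1, q.2.1.1, fun j => Matrix.fromBlocks (q.2.2.1 j) (q.2.2.2.1 j) 0 (q.2.2.2.2 j))
    refine Prod.ext (Subtype.ext (congrArg Prod.fst this))
      (Prod.ext (Subtype.ext (congrArg (fun x => x.2.1) this)) rfl)

variable (a b c d) in
theorem card_stab4 [Fintype J] [Fintype k] : Nat.card (Stab4 k a b c d) =
    Nat.card (MIso k a a) * Nat.card (MIso k b b) * Nat.card (MIso k c c) * Nat.card (MIso k d d) *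
      (Fintype.card k ^ (∑ j, Fintype.card (a j) * Fintype.card (b j)) *
       Fintype.card k ^ (∑ j, Fintype.card (c j) * Fintype.card (d j)) *
       Fintype.card k ^ (∑ j, Fintype.card (a j) * Fintype.card (c j)) *
       Fintype.card k ^ (∑ j, Fintype.card (a j) * Fintype.card (d j)) *
       Fintype.card k ^ (∑ j, Fintype.card (b j) * Fintype.card (d j))) := by
  rw [Nat.card_congr (stab4Equiv k a b c d), Nat.card_prod, Nat.card_prod, Nat.card_prod,
    Nat.card_prod, card_par, card_par, card_mmap, card_mmap, card_mmap]
  ring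

end StabCount

section Blk4

variable {J A k : Type*} [Fintype J] [Fintype A] [Field k] [Fintype k] {Γ : Quiv J A}

variable {n' a b c d : J → Type}
  [∀ j, Fintype (n' j)] [∀ j, DecidableEq (n' j)]
  [∀ j, Fintype (a j)] [∀ j, DecidableEq (a j)]
  [∀ j, Fintype (b j)] [∀ j, DecidableEq (b j)]
  [∀ j, Fintype (c j)] [∀ j, DecidableEq (c j)]
  [∀ j, Fintype (d j)] [∀ j, DecidableEq (d j)]

/-- `x` has the subrepresentations `W`, `W'` of classes `β`, `δ` with quotients of classes
`α`, `γ`. -/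
def Cross (α β γ δ : IsoCls Γ k) (x : MRep Γ k n') (W W' : ∀ j, Submodule k (n' j → k)) : Prop :=
  (SubC x W β ∧ QuoC x W α) ∧ (SubC x W' δ ∧ QuoC x W' γ)

theorem cross_map_iff {n : J → Type} [∀ j, Fintype (n j)] [∀ j, DecidableEq (n j)]
    {α β γ δ : IsoCls Γ k} {x : MRep Γ k n'} {W W' : ∀ j, Submodule k (n' j → k)}
    (p : MIso k n' n) : Cross α β γ δ (p.conj x) (p.mapW W) (p.mapW W') ↔ Cross α β γ δ x W W' := by
  simp only [Cross, subC_map_iff, quoC_map_iff]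

/-- The classes of the four diagonal blocks. -/
def diag4 (y : MRep Γ k (N4 a b c d)) : IsoCls Γ k × IsoCls Γ k × IsoCls Γ k × IsoCls Γ k :=
  (cl (fun h => (y h).toBlocks₁₁.toBlocks₁₁ : MRep Γ k a),
    cl (fun h => (y h).toBlocks₁₁.toBlocks₂₂ : MRep Γ k b),
    cl (fun h => (y h).toBlocks₂₂.toBlocks₁₁ : MRep Γ k c),
    cl (fun h => (y h).toBlocks₂₂.toBlocks₂₂ : MRep Γ k d))

/-- A representation that preserves both standard families. -/
def blk4 (t : MRep Γ k a) (s : MRep Γ k b) (s' : MRep Γ k c) (r : MRep Γ k d)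
    (z₁ : ∀ h, Matrix (a (Γ.t h)) (b (Γ.s h)) k) (z₂ : ∀ h, Matrix (c (Γ.t h)) (d (Γ.s h)) k)
    (z₃ : ∀ h, Matrix (a (Γ.t h)) (c (Γ.s h)) k) (z₄ : ∀ h, Matrix (b (Γ.t h)) (d (Γ.s h)) k)
    (f : ∀ h, Matrix (a (Γ.t h)) (d (Γ.s h)) k) : MRep Γ k (N4 a b c d) := fun h =>
  Matrix.fromBlocks (Matrix.fromBlocks (t h) (z₁ h) 0 (s h)) (Matrix.fromBlocks (z₃ h) (f h) 0 (z₄ h))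
    0 (Matrix.fromBlocks (s' h) (z₂ h) 0 (r h))

theorem cross_std_iff {α β γ δ : IsoCls Γ k} {y : MRep Γ k (N4 a b c d)} :
    Cross α β γ δ y (std1 k a b c d) (std2 k a b c d) ↔
      ((∀ h, (y h).toBlocks₂₁ = 0) ∧ cl (fun h => (y h).toBlocks₁₁ : MRep Γ k (SumD a b)) = β ∧
        cl (fun h => (y h).toBlocks₂₂ : MRep Γ k (SumD c d)) = α) ∧
      (∀ h, ((swapIso k a b c d).conj y h).toBlocks₂₁ = 0) ∧
        cl (fun h => ((swapIso k a b c d).conj y h).toBlocks₁₁ : MRep Γ k (SumD a c)) = δ ∧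
        cl (fun h => ((swapIso k a b c d).conj y h).toBlocks₂₂ : MRep Γ k (SumD b d)) = γ := by
  have e : (swapIso k a b c d).mapW (std2 k a b c d) = std1 k a c b d :=
    (swapIso k a b c d).symm.mapW_symm _
  have h1 : SubC y (std2 k a b c d) δ ↔
      SubC ((swapIso k a b c d).conj y) (std1 k a c b d) δ := by
    rw [← e, subC_map_iff]
  have h2 : QuoC y (std2 k a b c d) γ ↔
      QuoC ((swapIso k a b c d).conj y) (std1 k a c b d) γ := by
    rw [← e, quoC_map_iff]
  rw [Cross, h1, h2, subC_std_iff, quoC_std_iff, subC_std_iff, quoC_std_iff]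
  tauto

theorem swap_conj_blk4 (t : MRep Γ k a) (s : MRep Γ k b) (s' : MRep Γ k c) (r : MRep Γ k d)
    (z₁ : ∀ h, Matrix (a (Γ.t h)) (b (Γ.s h)) k) (z₂ : ∀ h, Matrix (c (Γ.t h)) (d (Γ.s h)) k)
    (z₃ : ∀ h, Matrix (a (Γ.t h)) (c (Γ.s h)) k) (z₄ : ∀ h, Matrix (b (Γ.t h)) (d (Γ.s h)) k)
    (f : ∀ h, Matrix (a (Γ.t h)) (d (Γ.s h)) k) :
    (swapIso k a b c d).conj (blk4 t s s' r z₁ z₂ z₃ z₄ f) = blk4 t s' s r z₃ z₄ z₁ z₂ f := by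
  rw [MIso.ofEquiv_conj]
  funext h
  ext i i'
  rcases i with (i | i) | (i | i) <;> rcases i' with (i' | i') | (i' | i') <;> rfl

theorem cross_blk4_iff {α β γ δ : IsoCls Γ k} (t : MRep Γ k a) (s : MRep Γ k b) (s' : MRep Γ k c)
    (r : MRep Γ k d)
    (z₁ : ∀ h, Matrix (a (Γ.t h)) (b (Γ.s h)) k) (z₂ : ∀ h, Matrix (c (Γ.t h)) (d (Γ.s h)) k)
    (z₃ : ∀ h, Matrix (a (Γ.t h)) (c (Γ.s h)) k) (z₄ : ∀ h, Matrix (b (Γ.t h)) (d (Γ.s h)) k)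
    (f : ∀ h, Matrix (a (Γ.t h)) (d (Γ.s h)) k) :
    Cross α β γ δ (blk4 t s s' r z₁ z₂ z₃ z₄ f) (std1 k a b c d) (std2 k a b c d) ↔
      (cl (blk t z₁ s) = β ∧ cl (blk s' z₂ r) = α) ∧ cl (blk t z₃ s') = δ ∧ cl (blk s z₄ r) = γ := by
  rw [cross_std_iff, swap_conj_blk4]
  constructor
  · rintro ⟨⟨-, h1, h2⟩, -, h3, h4⟩
    exact ⟨⟨h1, h2⟩, h3, h4⟩
  · rintro ⟨⟨h1, h2⟩, h3, h4⟩
    exact ⟨⟨fun h => rfl, h1, h2⟩, fun h => rfl, h3, h4⟩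

theorem eq_blk4 {α β γ δ : IsoCls Γ k} {y : MRep Γ k (N4 a b c d)}
    (hy : Cross α β γ δ y (std1 k a b c d) (std2 k a b c d)) :
    y = blk4 (fun h => (y h).toBlocks₁₁.toBlocks₁₁) (fun h => (y h).toBlocks₁₁.toBlocks₂₂)
      (fun h => (y h).toBlocks₂₂.toBlocks₁₁) (fun h => (y h).toBlocks₂₂.toBlocks₂₂)
      (fun h => (y h).toBlocks₁₁.toBlocks₁₂) (fun h => (y h).toBlocks₂₂.toBlocks₁₂)
      (fun h => (y h).toBlocks₁₂.toBlocks₁₁) (fun h => (y h).toBlocks₁₂.toBlocks₂₂)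
      (fun h => (y h).toBlocks₁₂.toBlocks₁₂) := by
  obtain ⟨⟨h1, -, -⟩, h2, -, -⟩ := cross_std_iff.1 hy
  rw [MIso.ofEquiv_conj] at h2
  funext h
  ext i i'
  have e1 := fun i i' => congrFun (congrFun (h1 h) i) i'
  have e2 := fun i i' => congrFun (congrFun (h2 h) i) i'
  rcases i with (i | i) | (i | i) <;> rcases i' with (i' | i') | (i' | i') <;>
    first
    | rfl
    | exact e1 (Sum.inl i) (Sum.inl i')
    | exact e1 (Sum.inl i) (Sum.inr i')
    | exact e1 (Sum.inr i) (Sum.inl i')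
    | exact e1 (Sum.inr i) (Sum.inr i')
    | exact e2 (Sum.inl i) (Sum.inl i')
    | exact e2 (Sum.inl i) (Sum.inr i')
    | exact e2 (Sum.inr i) (Sum.inl i')
    | exact e2 (Sum.inr i) (Sum.inr i')

theorem card_cross_std (α β γ δ τ σ σ' ρ : IsoCls Γ k)
    (ha : ∀ j, Fintype.card (a j) = τ.dim j) (hb : ∀ j, Fintype.card (b j) = σ.dim j)
    (hc : ∀ j, Fintype.card (c j) = σ'.dim j) (hd : ∀ j, Fintype.card (d j) = ρ.dim j) :
    Nat.card {y : MRep Γ k (N4 a b c d) //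
        Cross α β γ δ y (std1 k a b c d) (std2 k a b c d) ∧ diag4 y = (τ, σ, σ', ρ)} =
      (Nat.card {t : MRep Γ k a // cl t = τ} * Nat.card {s : MRep Γ k b // cl s = σ} *
        Nat.card {s' : MRep Γ k c // cl s' = σ'} * Nat.card {r : MRep Γ k d // cl r = ρ}) *
      (extn (m := FinD τ.dim) (n := FinD σ.dim) τ.rep σ.rep β *
        extn (m := FinD σ'.dim) (n := FinD ρ.dim) σ'.rep ρ.rep α *
        extn (m := FinD τ.dim) (n := FinD σ'.dim) τ.rep σ'.rep δ *
        extn (m := FinD σ.dim) (n := FinD ρ.dim) σ.rep ρ.rep γ *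
        Fintype.card k ^ ∑ h, ρ.dim (Γ.s h) * τ.dim (Γ.t h)) := by
  have hf : Nat.card (∀ h, Matrix (a (Γ.t h)) (d (Γ.s h)) k) =
      Fintype.card k ^ ∑ h, ρ.dim (Γ.s h) * τ.dim (Γ.t h) := by
    rw [Nat.card_pi, ← Finset.prod_pow_eq_pow_sum]
    refine Finset.prod_congr rfl fun h _ => ?_
    rw [← ha, ← hd]
    simp [Matrix, Nat.card_eq_fintype_card, pow_mul]
  have key : ∀ x : ({t : MRep Γ k a // cl t = τ} × {s : MRep Γ k b // cl s = σ}) ×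
      ({s' : MRep Γ k c // cl s' = σ'} × {r : MRep Γ k d // cl r = ρ}),
      Nat.card (({z : ∀ h, Matrix (a (Γ.t h)) (b (Γ.s h)) k // cl (blk x.1.1.1 z x.1.2.1) = β} ×
        {z : ∀ h, Matrix (c (Γ.t h)) (d (Γ.s h)) k // cl (blk x.2.1.1 z x.2.2.1) = α}) ×
        ({z : ∀ h, Matrix (a (Γ.t h)) (c (Γ.s h)) k // cl (blk x.1.1.1 z x.2.1.1) = δ} ×
        {z : ∀ h, Matrix (b (Γ.t h)) (d (Γ.s h)) k // cl (blk x.1.2.1 z x.2.2.1) = γ}) ×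
        (∀ h, Matrix (a (Γ.t h)) (d (Γ.s h)) k)) = 
      (extn (m := FinD τ.dim) (n := FinD σ.dim) τ.rep σ.rep β *
        extn (m := FinD σ'.dim) (n := FinD ρ.dim) σ'.rep ρ.rep α *
        extn (m := FinD τ.dim) (n := FinD σ'.dim) τ.rep σ'.rep δ *
        extn (m := FinD σ.dim) (n := FinD ρ.dim) σ.rep ρ.rep γ *
        Fintype.card k ^ ∑ h, ρ.dim (Γ.s h) * τ.dim (Γ.t h)) := by
    rintro ⟨⟨⟨t, ht⟩, ⟨s, hs⟩⟩, ⟨⟨s', hs'⟩, ⟨r, hr⟩⟩⟩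
    rw [Nat.card_prod, Nat.card_prod, Nat.card_prod, Nat.card_prod, hf]
    have e1 := extn_congr (m' := FinD τ.dim) (n' := FinD σ.dim) (ht.trans (cl_rep τ).symm)
      (hs.trans (cl_rep σ).symm) β
    have e2 := extn_congr (m' := FinD σ'.dim) (n' := FinD ρ.dim) (hs'.trans (cl_rep σ').symm)
      (hr.trans (cl_rep ρ).symm) α
    have e3 := extn_congr (m' := FinD τ.dim) (n' := FinD σ'.dim) (ht.trans (cl_rep τ).symm)
      (hs'.trans (cl_rep σ').symm) δ
    have e4 := extn_congr (m' := FinD σ.dim) (n' := FinD ρ.dim) (hs.trans (cl_rep σ).symm)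
      (hr.trans (cl_rep ρ).symm) γ
    rw [← e1, ← e2, ← e3, ← e4]
    simp only [extn, mul_assoc]
  have hE : ∀ E : ℕ, (Nat.card {t : MRep Γ k a // cl t = τ} * Nat.card {s : MRep Γ k b // cl s = σ} *
        Nat.card {s' : MRep Γ k c // cl s' = σ'} * Nat.card {r : MRep Γ k d // cl r = ρ}) * E =
      Nat.card (({t : MRep Γ k a // cl t = τ} × {s : MRep Γ k b // cl s = σ}) ×
        ({s' : MRep Γ k c // cl s' = σ'} × {r : MRep Γ k d // cl r = ρ})) * E := fun E => by
    rw [Nat.card_prod, Nat.card_prod, Nat.card_prod]; ring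
  rw [hE, ← card_sigma_const key]
  refine Nat.card_congr
    { toFun := fun y => ⟨((⟨_, congrArg (fun D => D.1) y.2.2⟩, ⟨_, congrArg (fun D => D.2.1) y.2.2⟩),
          (⟨_, congrArg (fun D => D.2.2.1) y.2.2⟩, ⟨_, congrArg (fun D => D.2.2.2) y.2.2⟩)),
        ((⟨fun h => (y.1 h).toBlocks₁₁.toBlocks₁₂, ?_⟩, ⟨fun h => (y.1 h).toBlocks₂₂.toBlocks₁₂, ?_⟩),
        (⟨fun h => (y.1 h).toBlocks₁₂.toBlocks₁₁, ?_⟩, ⟨fun h => (y.1 h).toBlocks₁₂.toBlocks₂₂, ?_⟩),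
        fun h => (y.1 h).toBlocks₁₂.toBlocks₁₂)⟩
      invFun := fun q => ⟨blk4 q.1.1.1.1 q.1.1.2.1 q.1.2.1.1 q.1.2.2.1 q.2.1.1.1 q.2.1.2.1
        q.2.2.1.1.1 q.2.2.1.2.1 q.2.2.2, (cross_blk4_iff _ _ _ _ _ _ _ _ _).2
          ⟨⟨q.2.1.1.2, q.2.1.2.2⟩, q.2.2.1.1.2, q.2.2.1.2.2⟩, ?_⟩
      left_inv := fun y => Subtype.ext (eq_blk4 y.2.1).symm
      right_inv := fun q => rfl }
  · have h := y.2.1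
    rw [eq_blk4 h, cross_blk4_iff] at h
    exact h.1.1
  · have h := y.2.1
    rw [eq_blk4 h, cross_blk4_iff] at h
    exact h.1.2
  · have h := y.2.1
    rw [eq_blk4 h, cross_blk4_iff] at h
    exact h.2.1
  · have h := y.2.1
    rw [eq_blk4 h, cross_blk4_iff] at h
    exact h.2.2
  · exact Prod.ext q.1.1.1.2 (Prod.ext q.1.1.2.2 (Prod.ext q.1.2.1.2 q.1.2.2.2))

end Blk4

end RingelHall
end

noncomputable section
namespace RingelHall

section Green

variable {J A k : Type*} [Fintype J] [Fintype A] [Field k] [Fintype k] {Γ : Quiv J A}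

variable {n' : J → Type} [∀ j, Fintype (n' j)] [∀ j, DecidableEq (n' j)]

/-- The proportion of the frames with dimension vectors `d` adapted to `W`, `W'` for which the
diagonal blocks of `x` have the classes `D`. -/
def frameRatio (x : MRep Γ k n') (W W' : ∀ j, Submodule k (n' j → k))
    (d : (J → ℕ) × (J → ℕ) × (J → ℕ) × (J → ℕ))
    (D : IsoCls Γ k × IsoCls Γ k × IsoCls Γ k × IsoCls Γ k) : ℚ :=
  (Nat.card {p : Fr4 (FinD d.1) (FinD d.2.1) (FinD d.2.2.1) (FinD d.2.2.2) W W' //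
    diag4 (p.1.symm.conj x) = D} : ℚ) /
    (Nat.card (Stab4 k (FinD d.1) (FinD d.2.1) (FinD d.2.2.1) (FinD d.2.2.2)) : ℚ)

/-- The dimension vectors of a quadruple of classes. -/
def dims4 (D : IsoCls Γ k × IsoCls Γ k × IsoCls Γ k × IsoCls Γ k) :
    (J → ℕ) × (J → ℕ) × (J → ℕ) × (J → ℕ) := (D.1.dim, D.2.1.dim, D.2.2.1.dim, D.2.2.2.dim)

theorem frameRatio_dims (x : MRep Γ k n') (W W' : ∀ j, Submodule k (n' j → k))
    {d : (J → ℕ) × (J → ℕ) × (J → ℕ) × (J → ℕ)}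
    (p : Fr4 (FinD d.1) (FinD d.2.1) (FinD d.2.2.1) (FinD d.2.2.2) W W')
    (D : IsoCls Γ k × IsoCls Γ k × IsoCls Γ k × IsoCls Γ k) :
    frameRatio x W W' (dims4 D) D = frameRatio x W W' d D := by
  by_cases h : dims4 D = d
  · rw [h]
  · have h1 : IsEmpty {p : Fr4 (FinD (dims4 D).1) (FinD (dims4 D).2.1) (FinD (dims4 D).2.2.1)
        (FinD (dims4 D).2.2.2) W W' // diag4 (p.1.symm.conj x) = D} := by
      refine ⟨fun p' => h ?_⟩
      have e := fun j => fr4_card p j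
      have e' := fun j => fr4_card p'.1 j
      simp only [Fintype.card_fin] at e e'
      refine Prod.ext ?_ (Prod.ext ?_ (Prod.ext ?_ ?_)) <;> funext j <;>
        have e1 := e j <;> have e2 := e' j <;> omega
    have h2 : IsEmpty {p : Fr4 (FinD d.1) (FinD d.2.1) (FinD d.2.2.1)
        (FinD d.2.2.2) W W' // diag4 (p.1.symm.conj x) = D} := by
      refine ⟨fun p' => h ?_⟩
      rw [← p'.2]
      refine Prod.ext ?_ (Prod.ext ?_ (Prod.ext ?_ ?_)) <;> funext j <;>
        exact Fintype.card_fin _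
    simp only [frameRatio]
    rw [Nat.card_eq_zero.2 (Or.inl h1), Nat.card_eq_zero.2 (Or.inl h2), Nat.cast_zero, zero_div,
      zero_div]

theorem totalDim_cl (x : MRep Γ k n') : (cl x).totalDim = ∑ j, Fintype.card (n' j) := rfl

theorem sum_frameRatio (x : MRep Γ k n') (W W' : ∀ j, Submodule k (n' j → k))
    (S : Finset (IsoCls Γ k))
    (hS : ∀ κ : IsoCls Γ k, κ.totalDim ≤ ∑ j, Fintype.card (n' j) → κ ∈ S) :
    ∑ D ∈ S ×ˢ S ×ˢ S ×ˢ S, frameRatio x W W' (dims4 D) D = 1 := by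
  obtain ⟨T, U, U', R, ⟨p⟩⟩ := exists_fr4 W W'
  rw [Finset.sum_congr rfl fun D _ => frameRatio_dims x W W' (d := (T, U, U', R)) p D]
  have := Fintype.ofFinite (Fr4 (FinD T) (FinD U) (FinD U') (FinD R) W W')
  have hc := card_fr4 p
  have h := sum_comp_eq_sum_card (X := Fr4 (FinD T) (FinD U) (FinD U') (FinD R) W W')
    (fun p => diag4 (p.1.symm.conj x)) (S ×ˢ S ×ˢ S ×ˢ S) (fun p => by
      have e : ∀ j, _ := fun j => (p.1.card_eq j)
      simp only [Fintype.card_sum, Fintype.card_fin] at e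
      simp only [Finset.mem_product]
      simp only [← e, Finset.sum_add_distrib] at hS
      refine ⟨hS _ ?_, hS _ ?_, hS _ ?_, hS _ ?_⟩ <;> rw [diag4, totalDim_cl] <;>
        simp only [Fintype.card_fin] <;> omega) fun _ => (1 : ℚ)
  have hpos : (Nat.card (Stab4 k (FinD T) (FinD U) (FinD U') (FinD R)) : ℚ) ≠ 0 := by
    rw [← hc]
    have : Nonempty (Fr4 (FinD T) (FinD U) (FinD U') (FinD R) W W') := ⟨p⟩
    exact_mod_cast Nat.card_pos.ne'
  unfold frameRatio
  rw [← Finset.sum_div, div_eq_one_iff_eq hpos, ← hc]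
  simp only [mul_one, Finset.sum_const, Finset.card_univ, nsmul_eq_mul] at h
  rw [← h, Nat.card_eq_fintype_card]

/-- Representations with crossing subrepresentations. -/
abbrev CrossT (n' : J → Type) [∀ j, Fintype (n' j)] [∀ j, DecidableEq (n' j)]
    (α β γ δ : IsoCls Γ k) : Type _ :=
  {xW : MRep Γ k n' × (∀ j, Submodule k (n' j → k)) × (∀ j, Submodule k (n' j → k)) //
    Cross α β γ δ xW.1 xW.2.1 xW.2.2}

theorem card_crossT (α β γ δ : IsoCls Γ k) :
    Nat.card (CrossT n' α β γ δ) =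
      ∑ᶠ x : MRep Γ k n', IsoCls.hall α β (cl x) * IsoCls.hall γ δ (cl x) := by
  have := Fintype.ofFinite (MRep Γ k n')
  rw [finsum_eq_sum_of_fintype]
  have e : CrossT n' α β γ δ ≃ Σ x : MRep Γ k n',
      {W : ∀ j, Submodule k (n' j → k) // SubC x W β ∧ QuoC x W α} ×
      {W : ∀ j, Submodule k (n' j → k) // SubC x W δ ∧ QuoC x W γ} :=
    { toFun := fun y => ⟨y.1.1, ⟨_, y.2.1⟩, ⟨_, y.2.2⟩⟩
      invFun := fun y => ⟨(y.1, y.2.1.1, y.2.2.1), y.2.1.2, y.2.2.2⟩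
      left_inv := fun y => rfl
      right_inv := fun y => rfl }
  rw [Nat.card_congr e, Nat.card_sigma]
  refine Finset.sum_congr rfl fun x _ => ?_
  rw [Nat.card_prod, ← hall_eq_card rfl, ← hall_eq_card rfl]

theorem card_cross_frames (α β γ δ : IsoCls Γ k)
    (D : IsoCls Γ k × IsoCls Γ k × IsoCls Γ k × IsoCls Γ k) :
    Nat.card (Σ y : CrossT n' α β γ δ,
      {p : Fr4 (FinD D.1.dim) (FinD D.2.1.dim) (FinD D.2.2.1.dim) (FinD D.2.2.2.dim)
        y.1.2.1 y.1.2.2 // diag4 (p.1.symm.conj y.1.1) = D}) =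
    Nat.card (MIso k (N4 (FinD D.1.dim) (FinD D.2.1.dim) (FinD D.2.2.1.dim) (FinD D.2.2.2.dim)) n') *
    Nat.card {y : MRep Γ k (N4 (FinD D.1.dim) (FinD D.2.1.dim) (FinD D.2.2.1.dim)
        (FinD D.2.2.2.dim)) //
        Cross α β γ δ y (std1 k _ _ _ _) (std2 k _ _ _ _) ∧ diag4 y = D} := by
  rw [← Nat.card_prod]
  have cr : ∀ (p : MIso k (N4 (FinD D.1.dim) (FinD D.2.1.dim) (FinD D.2.2.1.dim)
      (FinD D.2.2.2.dim)) n') (y : MRep Γ k (N4 (FinD D.1.dim) (FinD D.2.1.dim) (FinD D.2.2.1.dim)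
        (FinD D.2.2.2.dim))), Cross α β γ δ (p.conj y) (p.mapW (std1 k _ _ _ _))
          (p.mapW (std2 k _ _ _ _)) ↔ Cross α β γ δ y (std1 k _ _ _ _) (std2 k _ _ _ _) :=
    fun p y => cross_map_iff p
  symm
  refine Nat.card_congr (Equiv.ofBijective (fun w => ⟨⟨(w.1.conj w.2.1, w.1.mapW (std1 k _ _ _ _),
    w.1.mapW (std2 k _ _ _ _)), (cr _ _).2 w.2.2.1⟩, ⟨w.1, rfl, rfl⟩, ?_⟩) ⟨?_, ?_⟩)
  · simpa using w.2.2.2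
  · rintro ⟨p, y, hy⟩ ⟨p', y', hy'⟩ h
    have h0 : p = p' := congrArg (fun z => z.2.1.1) h
    subst h0
    have h4 : p.conj y = p.conj y' := congrArg (fun z => z.1.1.1) h
    obtain rfl := p.conjEquiv.injective h4
    rfl
  · rintro ⟨⟨⟨x, W, W'⟩, h⟩, ⟨p, h1, h2⟩, hD⟩
    change p.mapW _ = W at h1
    change p.mapW _ = W' at h2
    subst h1 h2
    obtain ⟨y, rfl⟩ := p.conjEquiv.surjective x
    exact ⟨(p, ⟨y, (cr _ _).1 h, by simpa [MIso.conjEquiv] using hD⟩), rfl⟩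

theorem card_crossT_eq (α β γ δ : IsoCls Γ k) (S : Finset (IsoCls Γ k))
    (hS : ∀ κ : IsoCls Γ k, κ.totalDim ≤ ∑ j, Fintype.card (n' j) → κ ∈ S) :
    (Nat.card (CrossT n' α β γ δ) : ℚ) = ∑ D ∈ S ×ˢ S ×ˢ S ×ˢ S,
      (Nat.card (MIso k (N4 (FinD D.1.dim) (FinD D.2.1.dim) (FinD D.2.2.1.dim)
        (FinD D.2.2.2.dim)) n') : ℚ) *
      (Nat.card {y : MRep Γ k (N4 (FinD D.1.dim) (FinD D.2.1.dim) (FinD D.2.2.1.dim)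
        (FinD D.2.2.2.dim)) //
        Cross α β γ δ y (std1 k _ _ _ _) (std2 k _ _ _ _) ∧ diag4 y = D} : ℚ) /
      (Nat.card (Stab4 k (FinD D.1.dim) (FinD D.2.1.dim) (FinD D.2.2.1.dim)
        (FinD D.2.2.2.dim)) : ℚ) := by
  have := Fintype.ofFinite (CrossT n' α β γ δ)
  calc (Nat.card (CrossT n' α β γ δ) : ℚ) = ∑ y : CrossT n' α β γ δ,
        ∑ D ∈ S ×ˢ S ×ˢ S ×ˢ S, frameRatio y.1.1 y.1.2.1 y.1.2.2 (dims4 D) D := by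
        rw [Finset.sum_congr rfl fun y _ => sum_frameRatio y.1.1 y.1.2.1 y.1.2.2 S hS]
        simp [Nat.card_eq_fintype_card]
    _ = _ := by
        rw [Finset.sum_comm]
        refine Finset.sum_congr rfl fun D _ => ?_
        simp only [frameRatio, dims4]
        rw [← Finset.sum_div, ← Nat.cast_mul, ← card_cross_frames, Nat.card_sigma, Nat.cast_sum]
        rfl

theorem sum_hall_mul_hall (α β γ δ : IsoCls Γ k) (S : Finset (IsoCls Γ k))
    (hn : ∀ j, Fintype.card (n' j) = α.dim j + β.dim j)
    (hS : ∀ κ : IsoCls Γ k, κ.totalDim ≤ α.totalDim + β.totalDim → κ ∈ S) :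
    (Nat.card (CrossT n' α β γ δ) : ℚ) = Nat.card (MIso k n' n') *
      ∑ κ ∈ S, (IsoCls.hall α β κ : ℚ) * IsoCls.hall γ δ κ / κ.aut := by
  have := Fintype.ofFinite (MRep Γ k n')
  rw [card_crossT, finsum_eq_sum_of_fintype, Nat.cast_sum, Finset.mul_sum]
  have h := sum_comp_eq_sum_card (fun x : MRep Γ k n' => cl x) S (fun x => hS _ (by
    rw [totalDim_cl]
    simp only [hn, Finset.sum_add_distrib]
    exact le_rfl)) (fun κ => (IsoCls.hall α β κ : ℚ) * IsoCls.hall γ δ κ)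
  push_cast
  rw [h]
  refine Finset.sum_congr rfl fun κ _ => ?_
  by_cases h0 : IsoCls.hall α β κ = 0
  · simp [h0]
  · have h1 := card_orbit (n := n') (α := κ) fun j => by rw [hn, hall_dim h0]
    have h2 : (κ.aut : ℚ) ≠ 0 := by exact_mod_cast (aut_pos κ).ne'
    rw [← h1]
    push_cast
    field_simp

/-- **Green's formula.** -/
theorem green_rat (α β γ δ : IsoCls Γ k) (S : Finset (IsoCls Γ k))
    (hS : ∀ κ : IsoCls Γ k, κ.totalDim ≤ α.totalDim + β.totalDim → κ ∈ S) :
    ∑ κ ∈ S, (IsoCls.hall α β κ : ℚ) * IsoCls.hall γ δ κ / κ.aut =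
      ∑ D ∈ S ×ˢ S ×ˢ S ×ˢ S, (Fintype.card k : ℚ) ^ (-Γ.euler D.2.2.2.dimZ D.1.dimZ) *
        (IsoCls.hall D.2.2.2 D.2.1 γ * IsoCls.hall D.2.2.1 D.1 δ * IsoCls.hall D.2.2.2 D.2.2.1 α *
          IsoCls.hall D.2.1 D.1 β) * (D.1.aut * D.2.1.aut * D.2.2.1.aut * D.2.2.2.aut) /
          (α.aut * β.aut * γ.aut * δ.aut) := by
  have hq : (Fintype.card k : ℚ) ≠ 0 := by exact_mod_cast Fintype.card_ne_zero
  have ha : ∀ κ : IsoCls Γ k, (κ.aut : ℚ) ≠ 0 := fun κ => by exact_mod_cast (aut_pos κ).ne'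
  have h1 := sum_hall_mul_hall (n' := FinD fun j => α.dim j + β.dim j) α β γ δ S
    (fun j => by simp) hS
  have h2 := card_crossT_eq (n' := FinD fun j => α.dim j + β.dim j) α β γ δ S (by
    intro κ hκ
    refine hS κ (hκ.trans (le_of_eq ?_))
    simp [Finset.sum_add_distrib, IsoCls.totalDim])
  have hG : (Nat.card (MIso k (FinD fun j => α.dim j + β.dim j)
      (FinD fun j => α.dim j + β.dim j)) : ℚ) ≠ 0 := by
    have : Nonempty (MIso k (FinD fun j => α.dim j + β.dim j)
      (FinD fun j => α.dim j + β.dim j)) := ⟨MIso.refl k _⟩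
    exact_mod_cast Nat.card_pos.ne'
  rw [h1] at h2
  refine mul_left_cancel₀ hG (h2.trans ?_)
  rw [Finset.mul_sum]
  refine Finset.sum_congr rfl ?_
  rintro ⟨τ, σ, σ', ρ⟩ -
  simp only
  by_cases hD : ∀ j, τ.dim j + σ.dim j + (σ'.dim j + ρ.dim j) = α.dim j + β.dim j
  · have hM : Nat.card (MIso k (N4 (FinD τ.dim) (FinD σ.dim) (FinD σ'.dim) (FinD ρ.dim))
        (FinD fun j => α.dim j + β.dim j)) = Nat.card (MIso k (FinD fun j => α.dim j + β.dim j)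
        (FinD fun j => α.dim j + β.dim j)) := by
      have e : MIso k (N4 (FinD τ.dim) (FinD σ.dim) (FinD σ'.dim) (FinD ρ.dim))
        (FinD fun j => α.dim j + β.dim j) := MIso.ofEquiv k fun j => Fintype.equivOfCardEq (by
          simp only [Fintype.card_sum, Fintype.card_fin, hD])
      exact Nat.card_congr (MIso.equivOfRight e).symm
    rw [hM, mul_div_assoc]
    congr 1
    have c := card_cross_std (a := FinD τ.dim) (b := FinD σ.dim) (c := FinD σ'.dim)
      (d := FinD ρ.dim) α β γ δ τ σ σ' ρ (fun j => Fintype.card_fin _) (fun j => Fintype.card_fin _)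
      (fun j => Fintype.card_fin _) (fun j => Fintype.card_fin _)
    have o1 := card_orbit (Γ := Γ) (k := k) (n := FinD τ.dim) (α := τ) fun j => Fintype.card_fin _
    have o2 := card_orbit (Γ := Γ) (k := k) (n := FinD σ.dim) (α := σ) fun j => Fintype.card_fin _
    have o3 := card_orbit (Γ := Γ) (k := k) (n := FinD σ'.dim) (α := σ') fun j => Fintype.card_fin _
    have o4 := card_orbit (Γ := Γ) (k := k) (n := FinD ρ.dim) (α := ρ) fun j => Fintype.card_fin _
    have r1 := riedtmann (m := FinD τ.dim) (n := FinD σ.dim) τ.rep σ.rep (cl_rep τ) (cl_rep σ) β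
    have r2 := riedtmann (m := FinD σ'.dim) (n := FinD ρ.dim) σ'.rep ρ.rep (cl_rep σ') (cl_rep ρ) α
    have r3 := riedtmann (m := FinD τ.dim) (n := FinD σ'.dim) τ.rep σ'.rep (cl_rep τ) (cl_rep σ') δ
    have r4 := riedtmann (m := FinD σ.dim) (n := FinD ρ.dim) σ.rep ρ.rep (cl_rep σ) (cl_rep ρ) γ
    rw [c, card_stab4, ← o1, ← o2, ← o3, ← o4]
    have p1 := card_orbit_pos (Γ := Γ) (k := k) (n := FinD τ.dim) (α := τ) fun j => Fintype.card_fin _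
    have p2 := card_orbit_pos (Γ := Γ) (k := k) (n := FinD σ.dim) (α := σ) fun j => Fintype.card_fin _
    have p3 := card_orbit_pos (Γ := Γ) (k := k) (n := FinD σ'.dim) (α := σ') fun j => Fintype.card_fin _
    have p4 := card_orbit_pos (Γ := Γ) (k := k) (n := FinD ρ.dim) (α := ρ) fun j => Fintype.card_fin _
    have hE : (Fintype.card k : ℚ) ^ (-Γ.euler ρ.dimZ τ.dimZ) =
        (Fintype.card k : ℚ) ^ (∑ h, ρ.dim (Γ.s h) * τ.dim (Γ.t h)) /
          (Fintype.card k : ℚ) ^ (∑ j, τ.dim j * ρ.dim j) := by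
      rw [← zpow_natCast, ← zpow_natCast, ← zpow_sub₀ hq]
      congr 1
      simp only [Quiv.euler, IsoCls.dimZ, neg_sub]
      push_cast
      congr 1
      exact Finset.sum_congr rfl fun j _ => mul_comm _ _
    rw [hE]
    simp only [Fintype.card_fin]
    have solve : ∀ {h a b c e : ℕ} {Q : ℕ} (_ : h * a * b * Q = c * e) (_ : (c : ℚ) ≠ 0),
        (e : ℚ) = h * a * b * Q / c := by
      intro h a b c e Q he hc
      rw [eq_div_iff hc, mul_comm]
      exact_mod_cast he.symm
    push_cast
    rw [solve r1 (ha β), solve r2 (ha α), solve r3 (ha δ), solve r4 (ha γ)]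
    have p1' : (Nat.card {t : MRep Γ k (FinD τ.dim) // cl t = τ} : ℚ) ≠ 0 := by
      exact_mod_cast p1.ne'
    have p2' : (Nat.card {t : MRep Γ k (FinD σ.dim) // cl t = σ} : ℚ) ≠ 0 := by
      exact_mod_cast p2.ne'
    have p3' : (Nat.card {t : MRep Γ k (FinD σ'.dim) // cl t = σ'} : ℚ) ≠ 0 := by
      exact_mod_cast p3.ne'
    have p4' : (Nat.card {t : MRep Γ k (FinD ρ.dim) // cl t = ρ} : ℚ) ≠ 0 := by
      exact_mod_cast p4.ne'
    have h1 := ha τ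
    have h2 := ha σ
    have h3 := ha σ'
    have h4 := ha ρ
    have h5 := ha α
    have h6 := ha β
    have h7 := ha γ
    have h8 := ha δ
    push_cast
    generalize (Nat.card {t : MRep Γ k (FinD τ.dim) // cl t = τ} : ℚ) = n1 at *
    generalize (Nat.card {t : MRep Γ k (FinD σ.dim) // cl t = σ} : ℚ) = n2 at *
    generalize (Nat.card {t : MRep Γ k (FinD σ'.dim) // cl t = σ'} : ℚ) = n3 at *
    generalize (Nat.card {t : MRep Γ k (FinD ρ.dim) // cl t = ρ} : ℚ) = n4 at *
    field_simp
  · have hM : IsEmpty (MIso k (N4 (FinD τ.dim) (FinD σ.dim) (FinD σ'.dim) (FinD ρ.dim))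
        (FinD fun j => α.dim j + β.dim j)) := by
      refine ⟨fun p => hD fun j => ?_⟩
      have := p.card_eq j
      simpa only [Fintype.card_sum, Fintype.card_fin] using this
    have h0 : IsoCls.hall ρ σ' α = 0 ∨ IsoCls.hall σ τ β = 0 := by
      by_contra! h
      refine hD fun j => ?_
      rw [hall_dim h.1, hall_dim h.2]
      ring
    rw [Nat.card_eq_zero.2 (Or.inl hM)]
    rcases h0 with h0 | h0 <;> simp [h0]

end Green

end RingelHall
end

noncomputable section
namespace RingelHall

/-! ## Structure constants -/

section Constants

variable {J A k : Type*} [Fintype J] [Fintype A] [Field k] [Fintype k] {Γ : Quiv J A}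

theorem vC_sq (k : Type*) [Fintype k] : vC k ^ 2 = (Fintype.card k : ℂ) := by
  rw [vC, ← Complex.ofReal_pow, Real.sq_sqrt (Nat.cast_nonneg _)]
  simp

theorem vC_ne_zero : vC k ≠ 0 := by
  have h : vC k ^ 2 ≠ 0 := by
    rw [vC_sq]
    exact_mod_cast Fintype.card_ne_zero
  exact fun h0 => h (by simp [h0])

theorem card_ne_zero' : (Fintype.card k : ℂ) ≠ 0 := by
  exact_mod_cast Fintype.card_ne_zero

theorem aut_ne_zero (α : IsoCls Γ k) : (α.aut : ℂ) ≠ 0 := by exact_mod_cast (aut_pos α).ne'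

theorem Quiv.euler_add_left (Γ : Quiv J A) (a a' b : J → ℤ) :
    Γ.euler (a + a') b = Γ.euler a b + Γ.euler a' b := by
  simp only [Quiv.euler, Pi.add_apply, add_mul, Finset.sum_add_distrib]; ring

theorem Quiv.euler_add_right (Γ : Quiv J A) (a b b' : J → ℤ) :
    Γ.euler a (b + b') = Γ.euler a b + Γ.euler a b' := by
  simp only [Quiv.euler, Pi.add_apply, mul_add, Finset.sum_add_distrib]; ring

theorem Quiv.euler_zero_left (Γ : Quiv J A) (b : J → ℤ) : Γ.euler 0 b = 0 := by
  simp [Quiv.euler]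

theorem Quiv.euler_zero_right (Γ : Quiv J A) (b : J → ℤ) : Γ.euler b 0 = 0 := by
  simp [Quiv.euler]

theorem Quiv.symEuler_add_left (Γ : Quiv J A) (a a' b : J → ℤ) :
    Γ.symEuler (a + a') b = Γ.symEuler a b + Γ.symEuler a' b := by
  simp only [Quiv.symEuler, Quiv.euler_add_left, Quiv.euler_add_right]; ring

theorem Quiv.symEuler_add_right (Γ : Quiv J A) (a b b' : J → ℤ) :
    Γ.symEuler a (b + b') = Γ.symEuler a b + Γ.symEuler a b' := by
  simp only [Quiv.symEuler, Quiv.euler_add_left, Quiv.euler_add_right]; ring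

theorem Quiv.symEuler_comm (Γ : Quiv J A) (a b : J → ℤ) : Γ.symEuler a b = Γ.symEuler b a :=
  add_comm _ _

theorem Quiv.symEuler_zero_left (Γ : Quiv J A) (b : J → ℤ) : Γ.symEuler 0 b = 0 := by
  simp [Quiv.symEuler, Quiv.euler_zero_left, Quiv.euler_zero_right]

theorem Quiv.symEuler_zero_right (Γ : Quiv J A) (b : J → ℤ) : Γ.symEuler b 0 = 0 := by
  rw [Quiv.symEuler_comm, Quiv.symEuler_zero_left]

theorem Quiv.euler_neg_left (Γ : Quiv J A) (a b : J → ℤ) : Γ.euler (-a) b = -Γ.euler a b := by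
  simp [Quiv.euler]; ring

theorem Quiv.euler_neg_right (Γ : Quiv J A) (a b : J → ℤ) : Γ.euler a (-b) = -Γ.euler a b := by
  simp [Quiv.euler]; ring

theorem Quiv.symEuler_neg_left (Γ : Quiv J A) (a b : J → ℤ) :
    Γ.symEuler (-a) b = -Γ.symEuler a b := by
  simp only [Quiv.symEuler, Quiv.euler_neg_left, Quiv.euler_neg_right]; ring

theorem dimZ_of_hall {α β γ : IsoCls Γ k} (h : IsoCls.hall α β γ ≠ 0) :
    γ.dimZ = α.dimZ + β.dimZ := by
  funext j
  simp [IsoCls.dimZ, hall_dim h j]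

/-- The structure constant `v^{⟨α,β⟩} g^γ_{αβ}` of the twisted multiplication. -/
def mc (α β γ : IsoCls Γ k) : ℂ := vC k ^ Γ.euler α.dimZ β.dimZ * (IsoCls.hall α β γ : ℂ)

/-- The structure constant `v^{⟨α,β⟩} (a_α a_β / a_γ) g^γ_{αβ}` of the comultiplication. -/
def cc (γ α β : IsoCls Γ k) : ℂ := mc α β γ * (α.aut * β.aut / γ.aut)

/-- The value `|V_α| / a_α` of the pairing. -/
def ph (α : IsoCls Γ k) : ℂ := (Fintype.card k : ℂ) ^ α.totalDim / α.aut

/-- The power `v^{(α,β)}`. -/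
def vs (α β : IsoCls Γ k) : ℂ := vC k ^ Γ.symEuler α.dimZ β.dimZ

theorem hall_ne_of_mc {α β γ : IsoCls Γ k} (h : mc α β γ ≠ 0) : IsoCls.hall α β γ ≠ 0 := by
  intro h0
  simp [mc, h0] at h

theorem mc_of_hall {α β γ : IsoCls Γ k} (h : IsoCls.hall α β γ = 0) : mc α β γ = 0 := by
  simp [mc, h]

theorem hall_ne_of_cc {α β γ : IsoCls Γ k} (h : cc γ α β ≠ 0) : IsoCls.hall α β γ ≠ 0 :=
  hall_ne_of_mc (left_ne_zero_of_mul h)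

theorem ph_mul_mc (α β γ : IsoCls Γ k) : ph γ * mc α β γ = ph α * ph β * cc γ α β := by
  by_cases h : IsoCls.hall α β γ = 0
  · simp [cc, mc, h]
  · have e := totalDim_of_hall h
    have h1 := aut_ne_zero α
    have h2 := aut_ne_zero β
    have h3 := aut_ne_zero γ
    rw [cc, ph, ph, ph, e, pow_add]
    field_simp

theorem mc_assoc (α β γ κ : IsoCls Γ k) (S S' : Finset (IsoCls Γ k))
    (hS : ∀ μ : IsoCls Γ k, μ.totalDim ≤ β.totalDim + γ.totalDim → μ ∈ S)
    (hS' : ∀ μ : IsoCls Γ k, μ.totalDim ≤ α.totalDim + β.totalDim → μ ∈ S') :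
    ∑ μ ∈ S, mc β γ μ * mc α μ κ = ∑ μ ∈ S', mc α β μ * mc μ γ κ := by
  have h1 : ∀ μ : IsoCls Γ k, mc β γ μ * mc α μ κ = vC k ^ (Γ.euler α.dimZ β.dimZ +
      Γ.euler α.dimZ γ.dimZ + Γ.euler β.dimZ γ.dimZ) *
      ((IsoCls.hall β γ μ * IsoCls.hall α μ κ : ℕ) : ℂ) := by
    intro μ
    by_cases h : IsoCls.hall β γ μ = 0
    · simp [mc, h]
    · rw [mc, mc, dimZ_of_hall h, Quiv.euler_add_right, zpow_add₀ vC_ne_zero,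
        zpow_add₀ vC_ne_zero, zpow_add₀ vC_ne_zero]
      push_cast; ring
  have h2 : ∀ μ : IsoCls Γ k, mc α β μ * mc μ γ κ = vC k ^ (Γ.euler α.dimZ β.dimZ +
      Γ.euler α.dimZ γ.dimZ + Γ.euler β.dimZ γ.dimZ) *
      ((IsoCls.hall α β μ * IsoCls.hall μ γ κ : ℕ) : ℂ) := by
    intro μ
    by_cases h : IsoCls.hall α β μ = 0
    · simp [mc, h]
    · rw [mc, mc, dimZ_of_hall h, Quiv.euler_add_left, zpow_add₀ vC_ne_zero,
        zpow_add₀ vC_ne_zero, zpow_add₀ vC_ne_zero]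
      push_cast; ring
  simp only [h1, h2, ← Finset.mul_sum, ← Nat.cast_sum]
  rw [hall_assoc α β γ κ (S := S) (S' := S') ?_ ?_]
  · intro μ hμ
    refine hS μ (le_of_eq ?_)
    simp only [IsoCls.totalDim, hμ, Finset.sum_add_distrib]
  · intro μ hμ
    refine hS' μ (le_of_eq ?_)
    simp only [IsoCls.totalDim, hμ, Finset.sum_add_distrib]

theorem cc_coassoc (γ α β δ : IsoCls Γ k) (S : Finset (IsoCls Γ k))
    (hS : ∀ μ : IsoCls Γ k, μ.totalDim ≤ γ.totalDim → μ ∈ S) :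
    ∑ μ ∈ S, cc γ α μ * cc μ β δ = ∑ μ ∈ S, cc γ μ δ * cc μ α β := by
  by_cases hd : γ.totalDim = α.totalDim + β.totalDim + δ.totalDim
  · have h := mc_assoc α β δ γ S S (fun μ hμ => hS μ (by omega)) (fun μ hμ => hS μ (by omega))
    have e1 : ∀ μ ∈ S, cc γ α μ * cc μ β δ =
        (α.aut * β.aut * δ.aut / γ.aut) * (mc β δ μ * mc α μ γ) := by
      intro μ _
      have := aut_ne_zero μ
      rw [cc, cc]; field_simp
    have e2 : ∀ μ ∈ S, cc γ μ δ * cc μ α β =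
        (α.aut * β.aut * δ.aut / γ.aut) * (mc α β μ * mc μ δ γ) := by
      intro μ _
      have := aut_ne_zero μ
      rw [cc, cc]; field_simp
    rw [Finset.sum_congr rfl e1, Finset.sum_congr rfl e2, ← Finset.mul_sum, ← Finset.mul_sum, h]
  · rw [Finset.sum_eq_zero, Finset.sum_eq_zero]
    · intro μ _
      by_contra h
      have h1 := totalDim_of_hall (hall_ne_of_cc (left_ne_zero_of_mul h))
      have h2 := totalDim_of_hall (hall_ne_of_cc (right_ne_zero_of_mul h))
      omega
    · intro μ _
      by_contra h
      have h1 := totalDim_of_hall (hall_ne_of_cc (left_ne_zero_of_mul h))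
      have h2 := totalDim_of_hall (hall_ne_of_cc (right_ne_zero_of_mul h))
      omega

/-- The comultiplication is compatible with the multiplication. -/
theorem green (α β γ δ : IsoCls Γ k) (S : Finset (IsoCls Γ k))
    (hS : ∀ κ : IsoCls Γ k, κ.totalDim ≤ α.totalDim + β.totalDim → κ ∈ S) :
    ∑ κ ∈ S, mc α β κ * cc κ γ δ = ∑ β₂ ∈ S, ∑ β₁ ∈ S, ∑ α₂ ∈ S, ∑ α₁ ∈ S,
      cc α α₁ α₂ * cc β β₁ β₂ * vs α₂ β₁ * (mc α₁ β₁ γ * mc α₂ β₂ δ) := by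
  have h := congrArg (fun x : ℚ => (x : ℂ)) (green_rat α β γ δ S hS)
  simp only [Finset.sum_product] at h
  push_cast at h
  have e1 : ∀ κ ∈ S, mc α β κ * cc κ γ δ =
      (vC k ^ (Γ.euler α.dimZ β.dimZ + Γ.euler γ.dimZ δ.dimZ) * (γ.aut * δ.aut)) *
        (IsoCls.hall α β κ * IsoCls.hall γ δ κ / κ.aut) := by
    intro κ _
    rw [cc, mc, mc, zpow_add₀ vC_ne_zero]
    ring
  rw [Finset.sum_congr rfl e1, ← Finset.mul_sum, h]
  simp only [Finset.mul_sum]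
  refine Finset.sum_congr rfl fun t _ => Finset.sum_congr rfl fun s _ => Finset.sum_congr rfl
    fun s' _ => Finset.sum_congr rfl fun r _ => ?_
  by_cases z1 : IsoCls.hall r s γ = 0
  · simp [z1, mc]
  by_cases z2 : IsoCls.hall s' t δ = 0
  · simp [z2, mc]
  by_cases z3 : IsoCls.hall r s' α = 0
  · simp [z3, mc, cc]
  by_cases z4 : IsoCls.hall s t β = 0
  · simp [z4, mc, cc]
  have hv := vC_ne_zero (k := k)
  have hq : (Fintype.card k : ℂ) ^ (-Γ.euler r.dimZ t.dimZ) =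
      vC k ^ (-Γ.euler r.dimZ t.dimZ - Γ.euler r.dimZ t.dimZ) := by
    rw [← vC_sq, ← zpow_natCast, ← zpow_mul]
    congr 1
    push_cast
    ring
  have hpow : vC k ^ (Γ.euler α.dimZ β.dimZ + Γ.euler γ.dimZ δ.dimZ) *
      vC k ^ (-Γ.euler r.dimZ t.dimZ - Γ.euler r.dimZ t.dimZ) =
      vC k ^ Γ.euler r.dimZ s'.dimZ * vC k ^ Γ.euler s.dimZ t.dimZ *
      vC k ^ Γ.symEuler s'.dimZ s.dimZ * (vC k ^ Γ.euler r.dimZ s.dimZ *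
      vC k ^ Γ.euler s'.dimZ t.dimZ) := by
    simp only [← zpow_add₀ hv]
    congr 1
    rw [dimZ_of_hall z1, dimZ_of_hall z2, dimZ_of_hall z3, dimZ_of_hall z4, Quiv.symEuler]
    simp only [Quiv.euler_add_left, Quiv.euler_add_right]
    ring
  have h1 := aut_ne_zero α
  have h2 := aut_ne_zero β
  have h3 := aut_ne_zero γ
  have h4 := aut_ne_zero δ
  calc _ = (vC k ^ (Γ.euler α.dimZ β.dimZ + Γ.euler γ.dimZ δ.dimZ) *
      vC k ^ (-Γ.euler r.dimZ t.dimZ - Γ.euler r.dimZ t.dimZ)) *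
      ((IsoCls.hall r s γ * IsoCls.hall s' t δ * IsoCls.hall r s' α * IsoCls.hall s t β) *
        (t.aut * s.aut * s'.aut * r.aut) / (α.aut * β.aut)) := by
        rw [hq]; field_simp
    _ = _ := by
        rw [hpow, cc, cc, mc, mc, mc, mc, vs]
        field_simp

theorem dim_eq_zero {α : IsoCls Γ k} (h : α.totalDim = 0) (j : J) : α.dim j = 0 := by
  rw [IsoCls.totalDim, Finset.sum_eq_zero_iff] at h
  exact h j (Finset.mem_univ j)

theorem totalDim_zero : (IsoCls.zero Γ k).totalDim = 0 := by
  simp [IsoCls.totalDim, IsoCls.zero, IsoCls.mk, IsoCls.dim]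

theorem dimZ_zero : (IsoCls.zero Γ k).dimZ = 0 := by
  funext j
  simp [IsoCls.dimZ, IsoCls.zero, IsoCls.mk, IsoCls.dim]

theorem eq_zero_of_totalDim {α : IsoCls Γ k} (h : α.totalDim = 0) : α = IsoCls.zero Γ k := by
  have h1 := dim_eq_zero h
  have h2 := dim_eq_zero (totalDim_zero (Γ := Γ) (k := k))
  rw [← cl_rep α, ← cl_rep (IsoCls.zero Γ k), cl_eq_iff]
  refine ⟨MIso.ofEquiv k fun j => Fintype.equivOfCardEq (by simp [h1, h2]), ?_⟩
  funext h
  ext i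
  exact absurd (lt_of_lt_of_eq i.2 (h2 _)) (Nat.not_lt_zero _)

theorem aut_of_totalDim {α : IsoCls Γ k} (h : α.totalDim = 0) : α.aut = 1 := by
  have h1 := dim_eq_zero h
  rw [aut_eq_card (cl_rep α), Nat.card_eq_one_iff_unique]
  refine ⟨⟨fun p p' => Subtype.ext (MIso.ext_fwd ?_)⟩, ⟨⟨MIso.refl k _, MIso.refl_conj _⟩⟩⟩
  funext j
  ext i
  exact absurd (lt_of_lt_of_eq i.2 (h1 _)) (Nat.not_lt_zero _)

open Classical in
theorem hall_zero_right {α β γ : IsoCls Γ k} (h : β.totalDim = 0) :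
    IsoCls.hall α β γ = if α = γ then 1 else 0 := by
  have h1 := dim_eq_zero h
  have r := riedtmann (m := FinD β.dim) (n := FinD α.dim) β.rep α.rep (cl_rep β) (cl_rep α) γ
  have e : ∀ z, cl (blk (m := FinD β.dim) (n := FinD α.dim) β.rep z α.rep) = α := by
    intro z
    refine Eq.trans ?_ (cl_rep α)
    rw [cl_eq_iff]
    have : ∀ j, IsEmpty (FinD β.dim j) := fun j => by
      show IsEmpty (Fin _)
      rw [h1]; infer_instance
    refine ⟨MIso.ofEquiv k fun j => Equiv.emptySum _ _, ?_⟩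
    rw [MIso.ofEquiv_conj]
    rfl
  have e2 : extn (m := FinD β.dim) (n := FinD α.dim) β.rep α.rep γ = if α = γ then 1 else 0 := by
    unfold extn
    split_ifs with h2
    · rw [Nat.card_eq_one_iff_unique]
      refine ⟨⟨fun z z' => Subtype.ext ?_⟩, ⟨⟨0, (e 0).trans h2⟩⟩⟩
      funext h
      ext i
      exact absurd (lt_of_lt_of_eq i.2 (h1 _)) (Nat.not_lt_zero _)
    · rw [Nat.card_eq_zero]
      exact Or.inl ⟨fun z => h2 ((e z.1).symm.trans z.2)⟩
  rw [e2, aut_of_totalDim h] at r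
  simp only [h1, zero_mul, Finset.sum_const_zero, pow_zero, mul_one] at r
  split_ifs at r ⊢ with h2
  · subst h2
    rw [mul_one] at r
    exact Nat.eq_of_mul_eq_mul_right (aut_pos α) (by rw [r, one_mul])
  · rw [mul_zero] at r
    exact (mul_eq_zero.1 r).resolve_right (aut_pos α).ne'

open Classical in
theorem hall_zero_left {α β γ : IsoCls Γ k} (h : α.totalDim = 0) :
    IsoCls.hall α β γ = if β = γ then 1 else 0 := by
  have h1 := dim_eq_zero h
  have r := riedtmann (m := FinD β.dim) (n := FinD α.dim) β.rep α.rep (cl_rep β) (cl_rep α) γ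
  have e : ∀ z, cl (blk (m := FinD β.dim) (n := FinD α.dim) β.rep z α.rep) = β := by
    intro z
    refine Eq.trans ?_ (cl_rep β)
    rw [cl_eq_iff]
    have : ∀ j, IsEmpty (FinD α.dim j) := fun j => by
      show IsEmpty (Fin _)
      rw [h1]; infer_instance
    refine ⟨MIso.ofEquiv k fun j => Equiv.sumEmpty _ _, ?_⟩
    rw [MIso.ofEquiv_conj]
    rfl
  have e2 : extn (m := FinD β.dim) (n := FinD α.dim) β.rep α.rep γ = if β = γ then 1 else 0 := by
    unfold extn
    split_ifs with h2
    · rw [Nat.card_eq_one_iff_unique]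
      refine ⟨⟨fun z z' => Subtype.ext ?_⟩, ⟨⟨0, (e 0).trans h2⟩⟩⟩
      funext h
      ext i j
      exact absurd (lt_of_lt_of_eq j.2 (h1 _)) (Nat.not_lt_zero _)
    · rw [Nat.card_eq_zero]
      exact Or.inl ⟨fun z => h2 ((e z.1).symm.trans z.2)⟩
  rw [e2, aut_of_totalDim h] at r
  simp only [h1, mul_zero, Finset.sum_const_zero, pow_zero, mul_one] at r
  split_ifs at r ⊢ with h2
  · subst h2
    rw [mul_one] at r
    exact Nat.eq_of_mul_eq_mul_right (aut_pos β) (by rw [r, one_mul])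
  · rw [mul_zero] at r
    exact (mul_eq_zero.1 r).resolve_right (aut_pos β).ne'

open Classical in
theorem mc_zero_left {α β γ : IsoCls Γ k} (h : α.totalDim = 0) :
    mc α β γ = if β = γ then 1 else 0 := by
  rw [mc, hall_zero_left h, eq_zero_of_totalDim h, dimZ_zero, Quiv.euler_zero_left]
  split_ifs <;> simp

open Classical in
theorem mc_zero_right {α β γ : IsoCls Γ k} (h : β.totalDim = 0) :
    mc α β γ = if α = γ then 1 else 0 := by
  rw [mc, hall_zero_right h, eq_zero_of_totalDim h, dimZ_zero, Quiv.euler_zero_right]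
  split_ifs <;> simp

open Classical in
theorem cc_zero_left {α β γ : IsoCls Γ k} (h : α.totalDim = 0) :
    cc γ α β = if β = γ then 1 else 0 := by
  rw [cc, mc_zero_left h, aut_of_totalDim h]
  split_ifs with h2
  · have := aut_ne_zero γ
    subst h2
    field_simp
    simp
  · simp

open Classical in
theorem cc_zero_right {α β γ : IsoCls Γ k} (h : β.totalDim = 0) :
    cc γ α β = if α = γ then 1 else 0 := by
  rw [cc, mc_zero_right h, aut_of_totalDim h]
  split_ifs with h2
  · have := aut_ne_zero γ
    subst h2
    field_simp
    simp
  · simp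

theorem ph_of_totalDim {α : IsoCls Γ k} (h : α.totalDim = 0) : ph α = 1 := by
  simp [ph, h, aut_of_totalDim h]

end Constants

end RingelHall
end

noncomputable section
namespace RingelHall

/-! ## Operators on the Hall space -/

section Operators

variable {J A k : Type*} [Fintype J] [Fintype A] [Field k] [Fintype k] {Γ : Quiv J A}

/-- The space with basis the isomorphism classes. -/
abbrev HallSp {J A : Type*} (Γ : Quiv J A) (k : Type*) [Field k] : Type _ := IsoCls Γ k →₀ ℂ

/-- Matrix entries of an operator. -/
def mat (T : Module.End ℂ (HallSp Γ k)) (l X : IsoCls Γ k) : ℂ := T (Finsupp.single X 1) l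

/-- The operator with given matrix entries and given bounds for the columns. -/
def ofMat (M : IsoCls Γ k → IsoCls Γ k → ℂ) (B : IsoCls Γ k → Finset (IsoCls Γ k)) :
    Module.End ℂ (HallSp Γ k) :=
  Finsupp.linearCombination ℂ fun X => ∑ l ∈ B X, Finsupp.single l (M l X)

open Classical in
theorem mat_ofMat {M : IsoCls Γ k → IsoCls Γ k → ℂ} {B : IsoCls Γ k → Finset (IsoCls Γ k)}
    (h : ∀ l X, M l X ≠ 0 → l ∈ B X) (l X : IsoCls Γ k) : mat (ofMat M B) l X = M l X := by
  rw [mat, ofMat, Finsupp.linearCombination_single, one_smul, Finsupp.finsetSum_apply]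
  simp only [Finsupp.single_apply, Finset.sum_ite_eq']
  split_ifs with h1
  · rfl
  · by_contra h2
    exact h1 (h l X (Ne.symm h2))

theorem mat_ext {T T' : Module.End ℂ (HallSp Γ k)} (h : ∀ l X, mat T l X = mat T' l X) :
    T = T' := by
  refine Finsupp.lhom_ext' fun X => LinearMap.ext_ring ?_
  ext l
  exact h l X

theorem mat_smul (c : ℂ) (T : Module.End ℂ (HallSp Γ k)) (l X : IsoCls Γ k) :
    mat (c • T) l X = c * mat T l X := rfl

theorem mat_sum {ι : Type*} (s : Finset ι) (T : ι → Module.End ℂ (HallSp Γ k)) (l X : IsoCls Γ k) :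
    mat (∑ i ∈ s, T i) l X = ∑ i ∈ s, mat (T i) l X := by
  simp only [mat, LinearMap.sum_apply, Finsupp.finsetSum_apply]

theorem mat_mul (T T' : Module.End ℂ (HallSp Γ k)) (l X : IsoCls Γ k) {S : Finset (IsoCls Γ k)}
    (hS : ∀ Y, mat T' Y X ≠ 0 → Y ∈ S) :
    mat (T * T') l X = ∑ Y ∈ S, mat T' Y X * mat T l Y := by
  have e : T' (Finsupp.single X 1) = ∑ Y ∈ S, mat T' Y X • Finsupp.single Y 1 := by
    have := Finsupp.sum_of_support_subset (T' (Finsupp.single X 1)) (s := S) (fun Y hY =>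
      hS Y (Finsupp.mem_support_iff.1 hY)) (fun Y c => Finsupp.single Y c) (by simp)
    rw [Finsupp.sum_single] at this
    simpa [mat] using this
  rw [mat, Module.End.mul_apply, e, map_sum, Finsupp.finsetSum_apply]
  refine Finset.sum_congr rfl fun Y _ => ?_
  rw [map_smul, Finsupp.smul_apply, smul_eq_mul]
  rfl

/-- Multiplication by `u_α` from the left. -/
def bOp (α : IsoCls Γ k) : Module.End ℂ (HallSp Γ k) :=
  ofMat (fun l X => mc α X l) fun X => box Γ k (α.totalDim + X.totalDim)

/-- Left skew derivation. -/
def lOp (b : IsoCls Γ k) : Module.End ℂ (HallSp Γ k) :=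
  ofMat (fun a l => cc l a b * ph b) fun l => box Γ k l.totalDim

/-- Right skew derivation. -/
def rOp (a : IsoCls Γ k) : Module.End ℂ (HallSp Γ k) :=
  ofMat (fun b l => cc l a b * ph a) fun l => box Γ k l.totalDim

/-- The action of the torus. -/
def kOp (Γ : Quiv J A) (k : Type*) [Field k] [Fintype k] (μ : J → ℤ) :
    Module.End ℂ (HallSp Γ k) :=
  Finsupp.linearCombination ℂ fun X => Finsupp.single X (vC k ^ (-Γ.symEuler μ X.dimZ))

theorem mat_bOp (α l X : IsoCls Γ k) : mat (bOp α) l X = mc α X l :=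
  mat_ofMat (fun l X h => by
    rw [mem_box, totalDim_of_hall (hall_ne_of_mc h)]) l X

theorem mat_lOp (b a l : IsoCls Γ k) : mat (lOp b) a l = cc l a b * ph b :=
  mat_ofMat (fun a l h => by
    rw [mem_box, totalDim_of_hall (hall_ne_of_cc (left_ne_zero_of_mul h))]
    omega) a l

theorem mat_rOp (a b l : IsoCls Γ k) : mat (rOp a) b l = cc l a b * ph a :=
  mat_ofMat (fun b l h => by
    rw [mem_box, totalDim_of_hall (hall_ne_of_cc (left_ne_zero_of_mul h))]
    omega) b l

theorem kOp_single (μ : J → ℤ) (X : IsoCls Γ k) (c : ℂ) :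
    kOp Γ k μ (Finsupp.single X c) = (vC k ^ (-Γ.symEuler μ X.dimZ)) • Finsupp.single X c := by
  rw [kOp, Finsupp.linearCombination_single, Finsupp.smul_single, Finsupp.smul_single, smul_eq_mul,
    smul_eq_mul, mul_comm]

theorem kOp_apply (μ : J → ℤ) (f : HallSp Γ k) (l : IsoCls Γ k) :
    kOp Γ k μ f l = vC k ^ (-Γ.symEuler μ l.dimZ) * f l := by
  classical
  induction f using Finsupp.induction_linear with
  | zero => simp
  | add f g hf hg => rw [map_add, Finsupp.add_apply, hf, hg, Finsupp.add_apply, mul_add]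
  | single X c =>
    rw [kOp_single, Finsupp.smul_apply, smul_eq_mul]
    by_cases h : X = l
    · rw [h]
    · rw [Finsupp.single_apply, if_neg h, mul_zero, mul_zero]

theorem mat_kOp_mul (μ : J → ℤ) (T : Module.End ℂ (HallSp Γ k)) (l X : IsoCls Γ k) :
    mat (kOp Γ k μ * T) l X = vC k ^ (-Γ.symEuler μ l.dimZ) * mat T l X :=
  kOp_apply _ _ _

theorem mat_mul_kOp (μ : J → ℤ) (T : Module.End ℂ (HallSp Γ k)) (l X : IsoCls Γ k) :
    mat (T * kOp Γ k μ) l X = vC k ^ (-Γ.symEuler μ X.dimZ) * mat T l X := by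
  rw [mat, Module.End.mul_apply, kOp_single, map_smul]
  rfl

theorem kOp_zero : kOp Γ k 0 = 1 := by
  refine LinearMap.ext fun f => Finsupp.ext fun l => ?_
  rw [kOp_apply, Quiv.symEuler_zero_left]
  simp

theorem kOp_mul (μ ν : J → ℤ) : kOp Γ k μ * kOp Γ k ν = kOp Γ k (μ + ν) := by
  refine LinearMap.ext fun f => Finsupp.ext fun l => ?_
  rw [Module.End.mul_apply, kOp_apply, kOp_apply, kOp_apply, Quiv.symEuler_add_left, neg_add,
    zpow_add₀ vC_ne_zero, mul_assoc]

theorem kOp_bOp (μ : J → ℤ) (α : IsoCls Γ k) :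
    kOp Γ k μ * bOp α = vC k ^ (-Γ.symEuler μ α.dimZ) • (bOp α * kOp Γ k μ) := by
  refine mat_ext fun l X => ?_
  rw [mat_kOp_mul, mat_smul, mat_mul_kOp, mat_bOp]
  by_cases h : IsoCls.hall α X l = 0
  · simp [mc_of_hall h]
  · rw [dimZ_of_hall h, Quiv.symEuler_add_right, neg_add, zpow_add₀ vC_ne_zero, mul_assoc]

theorem kOp_lOp (μ : J → ℤ) (b : IsoCls Γ k) :
    kOp Γ k μ * lOp b = vC k ^ Γ.symEuler μ b.dimZ • (lOp b * kOp Γ k μ) := by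
  refine mat_ext fun a l => ?_
  rw [mat_kOp_mul, mat_smul, mat_mul_kOp, mat_lOp]
  by_cases h : IsoCls.hall a b l = 0
  · simp [cc, mc_of_hall h]
  · have e : vC k ^ Γ.symEuler μ b.dimZ * vC k ^ (-Γ.symEuler μ b.dimZ) = 1 := by
      rw [← zpow_add₀ vC_ne_zero, add_neg_cancel, zpow_zero]
    rw [dimZ_of_hall h, Quiv.symEuler_add_right, neg_add, zpow_add₀ vC_ne_zero]
    linear_combination (-(vC k ^ (-Γ.symEuler μ a.dimZ)) * (cc l a b * ph b)) * e

theorem kOp_rOp (μ : J → ℤ) (a : IsoCls Γ k) :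
    kOp Γ k μ * rOp a = vC k ^ Γ.symEuler μ a.dimZ • (rOp a * kOp Γ k μ) := by
  refine mat_ext fun b l => ?_
  rw [mat_kOp_mul, mat_smul, mat_mul_kOp, mat_rOp]
  by_cases h : IsoCls.hall a b l = 0
  · simp [cc, mc_of_hall h]
  · have e : vC k ^ Γ.symEuler μ a.dimZ * vC k ^ (-Γ.symEuler μ a.dimZ) = 1 := by
      rw [← zpow_add₀ vC_ne_zero, add_neg_cancel, zpow_zero]
    rw [dimZ_of_hall h, Quiv.symEuler_add_right, neg_add, zpow_add₀ vC_ne_zero]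
    linear_combination (-(vC k ^ (-Γ.symEuler μ b.dimZ)) * (cc l a b * ph a)) * e

theorem sum_eq_sum_of_supp {P M : Type*} [AddCommMonoid M] {f : P → M} {S S' : Finset P}
    (h : ∀ x, f x ≠ 0 → x ∈ S) (h' : ∀ x, f x ≠ 0 → x ∈ S') : ∑ x ∈ S, f x = ∑ x ∈ S', f x := by
  rw [← finsum_eq_sum_of_support_subset f (s := S) h, ← finsum_eq_sum_of_support_subset f (s := S') h']

theorem bOp_mul (α β : IsoCls Γ k) {S : Finset (IsoCls Γ k)}
    (hS : ∀ μ : IsoCls Γ k, μ.totalDim ≤ α.totalDim + β.totalDim → μ ∈ S) :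
    bOp α * bOp β = ∑ γ ∈ S, mc α β γ • bOp γ := by
  refine mat_ext fun l X => ?_
  rw [mat_mul _ _ _ _ (S := box Γ k (β.totalDim + X.totalDim)), mat_sum]
  · simp only [mat_smul, mat_bOp]
    exact mc_assoc α β X l _ S (fun μ hμ => mem_box.2 hμ) hS
  · intro Y h
    rw [mat_bOp] at h
    rw [mem_box, totalDim_of_hall (hall_ne_of_mc h)]

theorem mem_box_of_mat_lOp {b a l : IsoCls Γ k} {N : ℕ} (hN : l.totalDim ≤ N)
    (h : mat (lOp b) a l ≠ 0) : a ∈ box Γ k N := by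
  rw [mat_lOp] at h
  have := totalDim_of_hall (hall_ne_of_cc (left_ne_zero_of_mul h))
  rw [mem_box]; omega

theorem mem_box_of_mat_rOp {b a l : IsoCls Γ k} {N : ℕ} (hN : l.totalDim ≤ N)
    (h : mat (rOp a) b l ≠ 0) : b ∈ box Γ k N := by
  rw [mat_rOp] at h
  have := totalDim_of_hall (hall_ne_of_cc (left_ne_zero_of_mul h))
  rw [mem_box]; omega

theorem lOp_mul (α β : IsoCls Γ k) {S : Finset (IsoCls Γ k)}
    (hS : ∀ μ : IsoCls Γ k, μ.totalDim ≤ α.totalDim + β.totalDim → μ ∈ S) :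
    lOp α * lOp β = ∑ γ ∈ S, mc α β γ • lOp γ := by
  refine mat_ext fun a l => ?_
  rw [mat_mul _ _ _ _ fun Y => mem_box_of_mat_lOp le_rfl, mat_sum]
  simp only [mat_smul, mat_lOp]
  have h := cc_coassoc l a α β (box Γ k l.totalDim) fun μ hμ => mem_box.2 hμ
  calc _ = ph α * ph β * ∑ μ ∈ box Γ k l.totalDim, cc l μ β * cc μ a α := by
        rw [Finset.mul_sum]
        exact Finset.sum_congr rfl fun μ _ => by ring
    _ = ∑ μ ∈ box Γ k l.totalDim, mc α β μ * (cc l a μ * ph μ) := by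
        rw [← h, Finset.mul_sum]
        refine Finset.sum_congr rfl fun μ _ => ?_
        linear_combination (-cc l a μ) * ph_mul_mc α β μ
    _ = _ := by
        refine sum_eq_sum_of_supp (fun μ hμ => ?_) (fun μ hμ => hS μ ?_)
        · have := totalDim_of_hall (hall_ne_of_cc (left_ne_zero_of_mul (right_ne_zero_of_mul hμ)))
          rw [mem_box]; omega
        · exact (totalDim_of_hall (hall_ne_of_mc (left_ne_zero_of_mul hμ))).le

theorem rOp_mul (α β : IsoCls Γ k) {S : Finset (IsoCls Γ k)}
    (hS : ∀ μ : IsoCls Γ k, μ.totalDim ≤ α.totalDim + β.totalDim → μ ∈ S) :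
    rOp β * rOp α = ∑ γ ∈ S, mc α β γ • rOp γ := by
  refine mat_ext fun a l => ?_
  rw [mat_mul _ _ _ _ fun Y => mem_box_of_mat_rOp le_rfl, mat_sum]
  simp only [mat_smul, mat_rOp]
  have h := cc_coassoc l α β a (box Γ k l.totalDim) fun μ hμ => mem_box.2 hμ
  calc _ = ph α * ph β * ∑ μ ∈ box Γ k l.totalDim, cc l α μ * cc μ β a := by
        rw [Finset.mul_sum]
        exact Finset.sum_congr rfl fun μ _ => by ring
    _ = ∑ μ ∈ box Γ k l.totalDim, mc α β μ * (cc l μ a * ph μ) := by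
        rw [h, Finset.mul_sum]
        refine Finset.sum_congr rfl fun μ _ => ?_
        linear_combination (-cc l μ a) * ph_mul_mc α β μ
    _ = _ := by
        refine sum_eq_sum_of_supp (fun μ hμ => ?_) (fun μ hμ => hS μ ?_)
        · have := totalDim_of_hall (hall_ne_of_cc (left_ne_zero_of_mul (right_ne_zero_of_mul hμ)))
          rw [mem_box]; omega
        · exact (totalDim_of_hall (hall_ne_of_mc (left_ne_zero_of_mul hμ))).le

theorem lOp_rOp (α β : IsoCls Γ k) : lOp α * rOp β = rOp β * lOp α := by
  refine mat_ext fun x l => ?_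
  rw [mat_mul _ _ _ _ fun Y => mem_box_of_mat_rOp le_rfl,
    mat_mul _ _ _ _ fun Y => mem_box_of_mat_lOp le_rfl]
  simp only [mat_lOp, mat_rOp]
  have h := cc_coassoc l β x α (box Γ k l.totalDim) fun μ hμ => mem_box.2 hμ
  calc _ = ph α * ph β * ∑ μ ∈ box Γ k l.totalDim, cc l β μ * cc μ x α := by
        rw [Finset.mul_sum]
        exact Finset.sum_congr rfl fun μ _ => by ring
    _ = _ := by
        rw [h, Finset.mul_sum]
        exact Finset.sum_congr rfl fun μ _ => by ring

theorem td_left {γ α β : IsoCls Γ k} (h : cc γ α β ≠ 0) : α.totalDim ≤ γ.totalDim := by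
  have := totalDim_of_hall (hall_ne_of_cc h)
  omega

theorem td_right {γ α β : IsoCls Γ k} (h : cc γ α β ≠ 0) : β.totalDim ≤ γ.totalDim := by
  have := totalDim_of_hall (hall_ne_of_cc h)
  omega

theorem green_box (α β γ δ : IsoCls Γ k) {N M : ℕ} (hN : α.totalDim ≤ N) (hM : β.totalDim ≤ M) :
    ∑ κ ∈ box Γ k (α.totalDim + β.totalDim), mc α β κ * cc κ γ δ =
      ∑ α₁ ∈ box Γ k N, ∑ α₂ ∈ box Γ k N, ∑ β₁ ∈ box Γ k M, ∑ β₂ ∈ box Γ k M,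
      cc α α₁ α₂ * cc β β₁ β₂ * vs α₂ β₁ * (mc α₁ β₁ γ * mc α₂ β₂ δ) := by
  rw [green α β γ δ _ fun κ hκ => mem_box.2 hκ]
  set S := box Γ k (α.totalDim + β.totalDim)
  let F := fun β₂ β₁ α₂ α₁ : IsoCls Γ k =>
    cc α α₁ α₂ * cc β β₁ β₂ * vs α₂ β₁ * (mc α₁ β₁ γ * mc α₂ β₂ δ)
  have hF : ∀ b b' a a', F b b' a a' ≠ 0 → b.totalDim ≤ β.totalDim ∧ b'.totalDim ≤ β.totalDim ∧
      a.totalDim ≤ α.totalDim ∧ a'.totalDim ≤ α.totalDim := by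
    intro b b' a a' h
    have h1 := left_ne_zero_of_mul (left_ne_zero_of_mul (left_ne_zero_of_mul h))
    have h2 := right_ne_zero_of_mul (left_ne_zero_of_mul (left_ne_zero_of_mul h))
    exact ⟨td_right h2, td_left h2, td_right h1, td_left h1⟩
  change ∑ b ∈ S, ∑ b' ∈ S, ∑ a ∈ S, ∑ a' ∈ S, F b b' a a' =
    ∑ a' ∈ box Γ k N, ∑ a ∈ box Γ k N, ∑ b' ∈ box Γ k M, ∑ b ∈ box Γ k M, F b b' a a'
  have flat1 : ∑ b ∈ S, ∑ b' ∈ S, ∑ a ∈ S, ∑ a' ∈ S, F b b' a a' =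
      ∑ D ∈ S ×ˢ S ×ˢ S ×ˢ S, F D.2.2.2 D.2.2.1 D.2.1 D.1 := by
    simp only [Finset.sum_product]
    rw [Finset.sum_comm]
    rw [Finset.sum_congr rfl fun b' _ => Finset.sum_comm]
    rw [Finset.sum_comm]
    rw [Finset.sum_congr rfl fun a _ => Finset.sum_congr rfl fun b' _ => Finset.sum_comm]
    rw [Finset.sum_congr rfl fun a _ => Finset.sum_comm]
    rw [Finset.sum_comm]
  rw [flat1, sum_eq_sum_of_supp (S' := box Γ k N ×ˢ box Γ k N ×ˢ box Γ k M ×ˢ box Γ k M)]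
  · simp only [Finset.sum_product]
  · intro D hD
    obtain ⟨h1, h2, h3, h4⟩ := hF _ _ _ _ hD
    simp only [Finset.mem_product, S, mem_box]
    omega
  · intro D hD
    obtain ⟨h1, h2, h3, h4⟩ := hF _ _ _ _ hD
    simp only [Finset.mem_product, mem_box]
    omega

theorem lOp_bOp (g d : IsoCls Γ k) {N : ℕ} (hg : g.totalDim ≤ N) (hd : d.totalDim ≤ N) :
    lOp g * bOp d = ∑ d₂ ∈ box Γ k N, ∑ x₂ ∈ box Γ k N, ∑ d₁ ∈ box Γ k N,
      (cc g d₂ x₂ * (cc d d₁ d₂ * ph d₂)) • (bOp d₁ * kOp Γ k (-d₂.dimZ) * lOp x₂) := by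
  refine mat_ext fun a X => ?_
  have h1 : mat (lOp g * bOp d) a X = ph g * ∑ κ ∈ box Γ k (d.totalDim + X.totalDim),
      mc d X κ * cc κ a g := by
    rw [mat_mul _ _ _ _ (S := box Γ k (d.totalDim + X.totalDim)), Finset.mul_sum]
    · simp only [mat_lOp, mat_bOp]
      exact Finset.sum_congr rfl fun κ _ => by ring
    · intro Y h
      rw [mat_bOp] at h
      rw [mem_box, totalDim_of_hall (hall_ne_of_mc h)]
  rw [h1, green_box d X a g hd (le_refl X.totalDim), Finset.sum_comm, Finset.mul_sum, mat_sum]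
  refine Finset.sum_congr rfl fun d₂ _ => ?_
  rw [Finset.sum_comm (s := box Γ k N) (t := box Γ k N), mat_sum, Finset.mul_sum]
  refine Finset.sum_congr rfl fun d₁ _ => ?_
  have h2 : ∀ x₂, mat ((cc g d₂ x₂ * (cc d d₁ d₂ * ph d₂)) •
      (bOp d₁ * kOp Γ k (-d₂.dimZ) * lOp x₂)) a X = ∑ x₁ ∈ box Γ k X.totalDim,
      cc d d₁ d₂ * cc X x₁ x₂ * vs d₂ x₁ * (mc d₁ x₁ a * (ph d₂ * ph x₂ * cc g d₂ x₂)) := by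
    intro x₂
    rw [mat_smul, mat_mul _ _ _ _ fun Y => mem_box_of_mat_lOp le_rfl, Finset.mul_sum]
    refine Finset.sum_congr rfl fun x₁ _ => ?_
    rw [mat_lOp, mat_mul_kOp, mat_bOp, Quiv.symEuler_neg_left, neg_neg, vs]
    ring
  rw [mat_sum, Finset.sum_congr rfl fun x₂ _ => h2 x₂,
    Finset.sum_comm (s := box Γ k N), Finset.mul_sum]
  refine Finset.sum_congr rfl fun x₁ _ => ?_
  rw [Finset.mul_sum]
  have h3 : ∀ x₂, ph g * (cc d d₁ d₂ * cc X x₁ x₂ * vs d₂ x₁ * (mc d₁ x₁ a * mc d₂ x₂ g)) =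
      cc d d₁ d₂ * cc X x₁ x₂ * vs d₂ x₁ * (mc d₁ x₁ a * (ph d₂ * ph x₂ * cc g d₂ x₂)) := by
    intro x₂
    rw [← ph_mul_mc]; ring
  refine (Finset.sum_congr rfl fun x₂ _ => h3 x₂).trans ?_
  refine sum_eq_sum_of_supp (fun x₂ h => ?_) (fun x₂ h => ?_)
  · exact mem_box.2 (td_right (right_ne_zero_of_mul (left_ne_zero_of_mul (left_ne_zero_of_mul h))))
  · exact mem_box.2 ((td_right (right_ne_zero_of_mul (right_ne_zero_of_mul
      (right_ne_zero_of_mul h)))).trans hg)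

theorem rOp_bOp (g d : IsoCls Γ k) {N : ℕ} (hg : g.totalDim ≤ N) (hd : d.totalDim ≤ N) :
    rOp g * bOp d = ∑ d₁ ∈ box Γ k N, ∑ x₁ ∈ box Γ k N, ∑ d₂ ∈ box Γ k N,
      (cc g d₁ x₁ * (cc d d₁ d₂ * ph d₁) * vs x₁ d₂) • (bOp d₂ * rOp x₁) := by
  refine mat_ext fun x X => ?_
  have h1 : mat (rOp g * bOp d) x X = ph g * ∑ κ ∈ box Γ k (d.totalDim + X.totalDim),
      mc d X κ * cc κ g x := by
    rw [mat_mul _ _ _ _ (S := box Γ k (d.totalDim + X.totalDim)), Finset.mul_sum]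
    · simp only [mat_rOp, mat_bOp]
      exact Finset.sum_congr rfl fun κ _ => by ring
    · intro Y h
      rw [mat_bOp] at h
      rw [mem_box, totalDim_of_hall (hall_ne_of_mc h)]
  rw [h1, green_box d X g x hd (le_refl X.totalDim), Finset.mul_sum, mat_sum]
  refine Finset.sum_congr rfl fun d₁ _ => ?_
  rw [Finset.sum_comm (s := box Γ k N) (t := box Γ k N), mat_sum, Finset.mul_sum]
  refine Finset.sum_congr rfl fun d₂ _ => ?_
  have h2 : ∀ x₁, mat ((cc g d₁ x₁ * (cc d d₁ d₂ * ph d₁) * vs x₁ d₂) •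
      (bOp d₂ * rOp x₁)) x X = ∑ x₂ ∈ box Γ k X.totalDim,
      cc d d₁ d₂ * cc X x₁ x₂ * vs d₂ x₁ * ((ph d₁ * ph x₁ * cc g d₁ x₁) * mc d₂ x₂ x) := by
    intro x₁
    rw [mat_smul, mat_mul _ _ _ _ fun Y => mem_box_of_mat_rOp le_rfl, Finset.mul_sum]
    refine Finset.sum_congr rfl fun x₂ _ => ?_
    rw [mat_rOp, mat_bOp, vs, vs, Quiv.symEuler_comm]
    ring
  rw [mat_sum, Finset.sum_congr rfl fun x₁ _ => h2 x₁, Finset.mul_sum]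
  have h3 : ∀ x₁, ph g * ∑ x₂ ∈ box Γ k X.totalDim,
      cc d d₁ d₂ * cc X x₁ x₂ * vs d₂ x₁ * (mc d₁ x₁ g * mc d₂ x₂ x) = 
      ∑ x₂ ∈ box Γ k X.totalDim,
      cc d d₁ d₂ * cc X x₁ x₂ * vs d₂ x₁ * ((ph d₁ * ph x₁ * cc g d₁ x₁) * mc d₂ x₂ x) := by
    intro x₁
    rw [← ph_mul_mc, Finset.mul_sum]
    exact Finset.sum_congr rfl fun x₂ _ => by ring
  refine (Finset.sum_congr rfl fun x₁ _ => h3 x₁).trans ?_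
  refine sum_eq_sum_of_supp (fun x₁ h => ?_) (fun x₁ h => ?_)
  · obtain ⟨x₂, -, h⟩ := Finset.exists_ne_zero_of_sum_ne_zero h
    exact mem_box.2 (td_left (right_ne_zero_of_mul (left_ne_zero_of_mul (left_ne_zero_of_mul h))))
  · obtain ⟨x₂, -, h⟩ := Finset.exists_ne_zero_of_sum_ne_zero h
    exact mem_box.2 ((td_right (right_ne_zero_of_mul (left_ne_zero_of_mul
      (right_ne_zero_of_mul h)))).trans hg)

end Operators

end RingelHall
end

noncomputable section
namespace RingelHall

/-! ## The positive half -/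

section Positive

variable {J A k : Type*} [Fintype J] [Fintype A] [Field k] [Fintype k] {Γ : Quiv J A}

local notation "𝓔" => Module.End ℂ (HallSp Γ k)

/-- Convolution of families of operators. -/
def conv (F G : IsoCls Γ k → Module.End ℂ (HallSp Γ k)) (γ : IsoCls Γ k) :
    Module.End ℂ (HallSp Γ k) :=
  ∑ a ∈ box Γ k γ.totalDim, ∑ b ∈ box Γ k γ.totalDim, cc γ a b • (F a * G b)

theorem conv_eq (F G : IsoCls Γ k → 𝓔) {γ : IsoCls Γ k} {N : ℕ} (hN : γ.totalDim ≤ N) :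
    conv F G γ = ∑ a ∈ box Γ k N, ∑ b ∈ box Γ k N, cc γ a b • (F a * G b) := by
  rw [conv, ← Finset.sum_product', ← Finset.sum_product']
  have h : ∀ p : IsoCls Γ k × IsoCls Γ k, cc γ p.1 p.2 • (F p.1 * G p.2) ≠ 0 →
      p.1.totalDim ≤ γ.totalDim ∧ p.2.totalDim ≤ γ.totalDim := by
    intro p hp
    have h0 : cc γ p.1 p.2 ≠ 0 := fun h0 => hp (by rw [h0, zero_smul])
    exact ⟨td_left h0, td_right h0⟩
  refine sum_eq_sum_of_supp (fun p hp => ?_) (fun p hp => ?_)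
  · simpa using h p hp
  · have := h p hp
    simp only [Finset.mem_product, mem_box]
    omega

theorem conv_assoc (F G H : IsoCls Γ k → 𝓔) : conv (conv F G) H = conv F (conv G H) := by
  funext γ
  set S := box Γ k γ.totalDim with hS
  have h1 : conv (conv F G) H γ = ∑ a ∈ S, ∑ b ∈ S, ∑ c ∈ S,
      (∑ μ ∈ S, cc γ μ c * cc μ a b) • (F a * G b * H c) := by
    have e : ∀ μ ∈ S, ∀ c ∈ S, cc γ μ c • (conv F G μ * H c) =
        ∑ a ∈ S, ∑ b ∈ S, (cc γ μ c * cc μ a b) • (F a * G b * H c) := by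
      intro μ hμ c _
      rw [conv_eq F G (mem_box.1 hμ), Finset.sum_mul, Finset.smul_sum]
      refine Finset.sum_congr rfl fun a _ => ?_
      rw [Finset.sum_mul, Finset.smul_sum]
      refine Finset.sum_congr rfl fun b _ => ?_
      rw [smul_mul_assoc, smul_smul]
    rw [conv, Finset.sum_congr rfl fun μ hμ => Finset.sum_congr rfl fun c hc => e μ hμ c hc]
    simp only [Finset.sum_smul]
    rw [Finset.sum_comm]
    rw [Finset.sum_congr rfl fun c _ => Finset.sum_comm]
    rw [Finset.sum_comm]
    refine Finset.sum_congr rfl fun a _ => ?_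
    rw [Finset.sum_congr rfl fun c _ => Finset.sum_comm]
    rw [Finset.sum_comm]
  have h2 : conv F (conv G H) γ = ∑ a ∈ S, ∑ b ∈ S, ∑ c ∈ S,
      (∑ μ ∈ S, cc γ a μ * cc μ b c) • (F a * G b * H c) := by
    have e : ∀ a ∈ S, ∀ μ ∈ S, cc γ a μ • (F a * conv G H μ) =
        ∑ b ∈ S, ∑ c ∈ S, (cc γ a μ * cc μ b c) • (F a * G b * H c) := by
      intro a _ μ hμ
      rw [conv_eq G H (mem_box.1 hμ), Finset.mul_sum, Finset.smul_sum]
      refine Finset.sum_congr rfl fun b _ => ?_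
      rw [Finset.mul_sum, Finset.smul_sum]
      refine Finset.sum_congr rfl fun c _ => ?_
      rw [mul_smul_comm, smul_smul, mul_assoc]
    rw [conv, Finset.sum_congr rfl fun a ha => Finset.sum_congr rfl fun μ hμ => e a ha μ hμ]
    simp only [Finset.sum_smul]
    refine Finset.sum_congr rfl fun a _ => ?_
    rw [Finset.sum_comm]
    refine Finset.sum_congr rfl fun b _ => ?_
    rw [Finset.sum_comm]
  rw [h1, h2]
  refine Finset.sum_congr rfl fun a _ => Finset.sum_congr rfl fun b _ => Finset.sum_congr rfl
    fun c _ => ?_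
  rw [cc_coassoc γ a b c S fun μ hμ => mem_box.2 hμ]

theorem bOp_zero : bOp (IsoCls.zero Γ k) = 1 := by
  classical
  refine mat_ext fun l X => ?_
  rw [mat_bOp, mc_zero_left totalDim_zero]
  simp [mat, Finsupp.single_apply]

theorem lOp_zero : lOp (IsoCls.zero Γ k) = 1 := by
  classical
  refine mat_ext fun l X => ?_
  rw [mat_lOp, cc_zero_right totalDim_zero, ph_of_totalDim totalDim_zero, mul_one]
  simp [mat, Finsupp.single_apply, eq_comm]

theorem rOp_zero : rOp (IsoCls.zero Γ k) = 1 := by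
  classical
  refine mat_ext fun l X => ?_
  rw [mat_rOp, cc_zero_left totalDim_zero, ph_of_totalDim totalDim_zero, mul_one]
  simp [mat, Finsupp.single_apply, eq_comm]

/-- The operators `K_b R_b`. -/
def wOp (b : IsoCls Γ k) : Module.End ℂ (HallSp Γ k) := kOp Γ k b.dimZ * rOp b

theorem wOp_of_totalDim {b : IsoCls Γ k} (h : b.totalDim = 0) : wOp b = 1 := by
  rw [eq_zero_of_totalDim h, wOp, rOp_zero, dimZ_zero, kOp_zero, mul_one]

theorem conv_top (F : IsoCls Γ k → 𝓔) (γ : IsoCls Γ k) :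
    conv F wOp γ = F γ + ∑ a ∈ (box Γ k γ.totalDim).filter (fun a => a.totalDim < γ.totalDim),
      ∑ b ∈ box Γ k γ.totalDim, cc γ a b • (F a * wOp b) := by
  classical
  rw [conv, ← Finset.sum_filter_not_add_sum_filter _ (fun a => a.totalDim < γ.totalDim)]
  congr 1
  have h1 : ∀ a ∈ (box Γ k γ.totalDim).filter (fun a => ¬ a.totalDim < γ.totalDim),
      ∑ b ∈ box Γ k γ.totalDim, cc γ a b • (F a * wOp b) = if γ = a then F γ else 0 := by
    intro a ha
    rw [Finset.mem_filter, mem_box] at ha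
    have e : ∀ b, b ≠ IsoCls.zero Γ k → cc γ a b = 0 := by
      intro b hb
      by_contra h
      have := totalDim_of_hall (hall_ne_of_cc h)
      exact hb (eq_zero_of_totalDim (by omega))
    rw [Finset.sum_eq_single (IsoCls.zero Γ k), cc_zero_right totalDim_zero,
      wOp_of_totalDim totalDim_zero, mul_one]
    · by_cases h : γ = a
      · rw [if_pos h, if_pos h.symm, h, one_smul]
      · rw [if_neg h, if_neg (Ne.symm h), zero_smul]
    · intro b _ hb
      rw [e b hb, zero_smul]
    · intro h
      exact absurd (mem_box.2 (by rw [totalDim_zero]; omega)) h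
  rw [Finset.sum_congr rfl h1, Finset.sum_ite_eq, if_pos]
  simp

theorem conv_cancel {F G : IsoCls Γ k → 𝓔} (h : conv F wOp = conv G wOp) : F = G := by
  have key : ∀ n, ∀ γ : IsoCls Γ k, γ.totalDim = n → F γ = G γ := by
    intro n
    induction n using Nat.strong_induction_on with
    | _ n ih =>
      rintro γ rfl
      have e := congrFun h γ
      rw [conv_top, conv_top, Finset.sum_congr (s₂ := (box Γ k γ.totalDim).filter
        (fun a => a.totalDim < γ.totalDim)) rfl fun a ha => Finset.sum_congr rfl fun b _ => by
        rw [ih _ (Finset.mem_filter.1 ha).2 a rfl]] at e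
      exact LinearMap.ext fun x => add_right_cancel (LinearMap.congr_fun e x)
  exact funext fun γ => key _ γ rfl

/-- The action of the positive half. -/
def uOp (γ : IsoCls Γ k) : Module.End ℂ (HallSp Γ k) :=
  lOp γ - ∑ a ∈ ((box Γ k γ.totalDim).filter (fun a => a.totalDim < γ.totalDim)).attach,
    ∑ b ∈ box Γ k γ.totalDim, cc γ a.1 b • (uOp a.1 * wOp b)
termination_by γ.totalDim
decreasing_by exact (Finset.mem_filter.1 a.2).2

theorem conv_uOp_wOp : conv uOp wOp = (lOp : IsoCls Γ k → 𝓔) := by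
  funext γ
  rw [conv_top, uOp, Finset.sum_attach ((box Γ k γ.totalDim).filter
    (fun a => a.totalDim < γ.totalDim)) (fun a => ∑ b ∈ box Γ k γ.totalDim,
      cc γ a b • (uOp a * wOp b))]
  exact sub_add_cancel (G := 𝓔) _ _

theorem uOp_zero : uOp (IsoCls.zero Γ k) = 1 := by
  have h := congrFun (conv_uOp_wOp (Γ := Γ) (k := k)) (IsoCls.zero Γ k)
  rw [conv_top, lOp_zero, Finset.sum_eq_zero, add_zero] at h
  · exact h
  · intro a ha
    rw [totalDim_zero, Finset.mem_filter] at ha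
    exact absurd ha.2 (Nat.not_lt_zero _)

theorem uOp_of_totalDim_one {γ : IsoCls Γ k} (hγ : γ.totalDim = 1) : uOp γ = lOp γ - wOp γ := by
  classical
  have h := congrFun (conv_uOp_wOp (Γ := Γ) (k := k)) γ
  refine (eq_sub_iff_add_eq (G := 𝓔)).2 ?_
  rw [← h, conv_top]
  congr 1
  have e : (box Γ k γ.totalDim).filter (fun a => a.totalDim < γ.totalDim) = {IsoCls.zero Γ k} := by
    ext a
    rw [Finset.mem_filter, mem_box, Finset.mem_singleton]
    constructor
    · intro h
      exact eq_zero_of_totalDim (by omega)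
    · rintro rfl
      rw [totalDim_zero]
      omega
  rw [e, Finset.sum_singleton, Finset.sum_eq_single γ]
  · rw [cc_zero_left totalDim_zero, if_pos rfl, uOp_zero, one_mul, one_smul]
  · intro b _ hb
    rw [cc_zero_left totalDim_zero, if_neg hb, zero_smul]
  · intro h
    exact absurd (mem_box.2 le_rfl) h

theorem kOp_neg_mul (μ : J → ℤ) : kOp Γ k (-μ) * kOp Γ k μ = 1 := by
  rw [kOp_mul, neg_add_cancel, kOp_zero]

theorem kOp_wOp (μ : J → ℤ) (a : IsoCls Γ k) :
    kOp Γ k μ * wOp a = vC k ^ Γ.symEuler μ a.dimZ • (wOp a * kOp Γ k μ) := by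
  rw [wOp, ← mul_assoc, kOp_mul, add_comm, ← kOp_mul, mul_assoc, kOp_rOp, mul_smul_comm, mul_assoc]

theorem kOp_uOp (μ : J → ℤ) (a : IsoCls Γ k) :
    kOp Γ k μ * uOp a = vC k ^ Γ.symEuler μ a.dimZ • (uOp a * kOp Γ k μ) := by
  have hv := vC_ne_zero (k := k)
  have h : (fun a => vC k ^ (-Γ.symEuler μ a.dimZ) • (kOp Γ k μ * uOp a * kOp Γ k (-μ))) =
      (uOp : IsoCls Γ k → 𝓔) := by
    refine conv_cancel ?_
    rw [conv_uOp_wOp]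
    funext γ
    have e : ∀ a b, cc γ a b • (vC k ^ (-Γ.symEuler μ a.dimZ) •
        (kOp Γ k μ * uOp a * kOp Γ k (-μ)) * wOp b) = vC k ^ (-Γ.symEuler μ γ.dimZ) •
        (kOp Γ k μ * (cc γ a b • (uOp a * wOp b)) * kOp Γ k (-μ)) := by
      intro a b
      by_cases h : IsoCls.hall a b γ = 0
      · simp [cc, mc_of_hall h]
      · rw [smul_mul_assoc, mul_assoc _ (kOp Γ k (-μ)), kOp_wOp, dimZ_of_hall h,
          Quiv.symEuler_add_right, neg_add, zpow_add₀ hv, Quiv.symEuler_neg_left]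
        simp only [mul_smul_comm, smul_mul_assoc, smul_smul, mul_assoc]
        congr 1
        ring
    rw [conv, Finset.sum_congr rfl fun a _ => Finset.sum_congr rfl fun b _ => e a b]
    simp only [← Finset.smul_sum, ← Finset.sum_mul, ← Finset.mul_sum]
    change vC k ^ (-Γ.symEuler μ γ.dimZ) • (kOp Γ k μ * conv uOp wOp γ * kOp Γ k (-μ)) = _
    rw [conv_uOp_wOp, kOp_lOp, smul_mul_assoc, smul_smul, mul_assoc, kOp_mul, add_neg_cancel,
      kOp_zero, mul_one, ← zpow_add₀ hv, neg_add_cancel, zpow_zero, one_smul]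
  have h1 : vC k ^ (-Γ.symEuler μ a.dimZ) • (kOp Γ k μ * uOp a * kOp Γ k (-μ)) = uOp a :=
    congrFun h a
  conv_rhs => rw [← h1]
  simp only [smul_mul_assoc, mul_assoc, smul_smul, kOp_neg_mul, mul_one]
  rw [← zpow_add₀ hv, add_neg_cancel, zpow_zero, one_smul]

/-- The left-hand family of the commutation relation. -/
def pFam (d a : IsoCls Γ k) : Module.End ℂ (HallSp Γ k) :=
  ∑ e ∈ box Γ k d.totalDim, (cc d e a * ph a) • (bOp e * kOp Γ k (-a.dimZ))

/-- The right-hand family of the commutation relation. -/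
def sFam (d a : IsoCls Γ k) : Module.End ℂ (HallSp Γ k) :=
  ∑ z ∈ box Γ k d.totalDim, (cc d a z * ph a) • (kOp Γ k a.dimZ * bOp z)

theorem pFam_eq (d a : IsoCls Γ k) {N : ℕ} (hN : d.totalDim ≤ N) :
    pFam d a = ∑ e ∈ box Γ k N, (cc d e a * ph a) • (bOp e * kOp Γ k (-a.dimZ)) := by
  have h : ∀ e, (cc d e a * ph a) • (bOp e * kOp Γ k (-a.dimZ)) ≠ 0 → e.totalDim ≤ d.totalDim := by
    intro e he
    refine td_left (β := a) fun h0 => he (by rw [h0, zero_mul, zero_smul])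
  exact sum_eq_sum_of_supp (fun e he => mem_box.2 (h e he)) fun e he => mem_box.2 ((h e he).trans hN)

theorem sFam_eq (d a : IsoCls Γ k) {N : ℕ} (hN : d.totalDim ≤ N) :
    sFam d a = ∑ z ∈ box Γ k N, (cc d a z * ph a) • (kOp Γ k a.dimZ * bOp z) := by
  have h : ∀ e, (cc d a e * ph a) • (kOp Γ k a.dimZ * bOp e) ≠ 0 → e.totalDim ≤ d.totalDim := by
    intro e he
    refine td_right (α := a) fun h0 => he (by rw [h0, zero_mul, zero_smul])
  exact sum_eq_sum_of_supp (fun e he => mem_box.2 (h e he)) fun e he => mem_box.2 ((h e he).trans hN)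

theorem lOp_bOp_conv (d : IsoCls Γ k) : (fun γ => lOp γ * bOp d) = conv (pFam d) lOp := by
  funext γ
  rw [lOp_bOp γ d (N := γ.totalDim + d.totalDim) (by omega) (by omega),
    conv_eq _ _ (N := γ.totalDim + d.totalDim) (by omega)]
  refine Finset.sum_congr rfl fun a _ => Finset.sum_congr rfl fun b _ => ?_
  rw [pFam_eq d a (N := γ.totalDim + d.totalDim) (by omega), Finset.sum_mul, Finset.smul_sum]
  refine Finset.sum_congr rfl fun e _ => ?_
  rw [smul_mul_assoc, smul_smul]

theorem wOp_bOp_conv (d : IsoCls Γ k) : (fun γ => wOp γ * bOp d) = conv (sFam d) wOp := by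
  funext γ
  rw [wOp, mul_assoc, rOp_bOp γ d (N := γ.totalDim + d.totalDim) (by omega) (by omega),
    conv_eq _ _ (N := γ.totalDim + d.totalDim) (by omega), Finset.mul_sum]
  refine Finset.sum_congr rfl fun a _ => ?_
  rw [Finset.mul_sum]
  refine Finset.sum_congr rfl fun b _ => ?_
  rw [sFam_eq d a (N := γ.totalDim + d.totalDim) (by omega), Finset.sum_mul, Finset.smul_sum,
    Finset.mul_sum]
  refine Finset.sum_congr rfl fun z _ => ?_
  by_cases h : IsoCls.hall a b γ = 0
  · simp [cc, mc_of_hall h]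
  · rw [dimZ_of_hall h, ← kOp_mul, wOp, mul_smul_comm, smul_mul_assoc, smul_smul,
      mul_assoc (kOp Γ k a.dimZ) (kOp Γ k b.dimZ), ← mul_assoc (kOp Γ k b.dimZ), kOp_bOp]
    simp only [smul_mul_assoc, mul_smul_comm, smul_smul, mul_assoc, vs]
    congr 1
    have e : vC k ^ Γ.symEuler b.dimZ z.dimZ * vC k ^ (-Γ.symEuler b.dimZ z.dimZ) = 1 := by
      rw [← zpow_add₀ vC_ne_zero, add_neg_cancel, zpow_zero]
    linear_combination (cc γ a b * (cc d a z * ph a)) * e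

theorem conv_pFam_uOp (d : IsoCls Γ k) : conv (pFam d) uOp = conv uOp (sFam d) := by
  refine conv_cancel ?_
  rw [conv_assoc, conv_assoc, conv_uOp_wOp, ← lOp_bOp_conv, ← wOp_bOp_conv]
  funext γ
  rw [← conv_uOp_wOp]
  simp only [conv, Finset.sum_mul, smul_mul_assoc, mul_assoc]

end Positive

end RingelHall
end

noncomputable section
namespace RingelHall

section PositiveMul

variable {J A k : Type*} [Fintype J] [Fintype A] [Field k] [Fintype k] {Γ : Quiv J A}

local notation "𝓔" => Module.End ℂ (HallSp Γ k)

/-- The tail of the comultiplication of a product. -/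
def tailOp (a b : IsoCls Γ k) : Module.End ℂ (HallSp Γ k) :=
  kOp Γ k (a.dimZ + b.dimZ) * (rOp b * rOp a)

theorem tailOp_eq (a b : IsoCls Γ k) {S : Finset (IsoCls Γ k)}
    (hS : ∀ μ : IsoCls Γ k, μ.totalDim ≤ a.totalDim + b.totalDim → μ ∈ S) :
    tailOp a b = ∑ δ ∈ S, mc a b δ • wOp δ := by
  rw [tailOp, rOp_mul a b hS, Finset.mul_sum]
  refine Finset.sum_congr rfl fun δ _ => ?_
  by_cases h : IsoCls.hall a b δ = 0
  · simp [mc_of_hall h]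
  · rw [wOp, dimZ_of_hall h, mul_smul_comm]

theorem tailOp_zero {a b : IsoCls Γ k} (ha : a.totalDim = 0) (hb : b.totalDim = 0) :
    tailOp a b = 1 := by
  rw [tailOp, eq_zero_of_totalDim ha, eq_zero_of_totalDim hb, dimZ_zero, rOp_zero, add_zero,
    kOp_zero, mul_one, mul_one]

/-- The coefficient of the comultiplication of a product. -/
def c4 (α β : IsoCls Γ k) (D : IsoCls Γ k × IsoCls Γ k × IsoCls Γ k × IsoCls Γ k) : ℂ :=
  cc α D.1 D.2.1 * cc β D.2.2.1 D.2.2.2 * vs D.2.1 D.2.2.1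

theorem totalDim_of_c4 {α β : IsoCls Γ k} {D : IsoCls Γ k × IsoCls Γ k × IsoCls Γ k × IsoCls Γ k}
    (h : c4 α β D ≠ 0) : α.totalDim = D.1.totalDim + D.2.1.totalDim ∧
      β.totalDim = D.2.2.1.totalDim + D.2.2.2.totalDim :=
  ⟨totalDim_of_hall (hall_ne_of_cc (left_ne_zero_of_mul (left_ne_zero_of_mul h))),
    totalDim_of_hall (hall_ne_of_cc (right_ne_zero_of_mul (left_ne_zero_of_mul h)))⟩

theorem sum_c4_mc (α β : IsoCls Γ k) {N : ℕ} (hN : α.totalDim + β.totalDim = N) :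
    ∑ D ∈ box Γ k N ×ˢ box Γ k N ×ˢ box Γ k N ×ˢ box Γ k N, c4 α β D •
      ((∑ γ ∈ box Γ k N, mc D.1 D.2.2.1 γ • uOp γ) * tailOp D.2.1 D.2.2.2) = lOp α * lOp β := by
  set S := box Γ k N with hS
  have e1 : ∀ D ∈ S ×ˢ S ×ˢ S ×ˢ S, c4 α β D •
      ((∑ γ ∈ S, mc D.1 D.2.2.1 γ • uOp γ) * tailOp D.2.1 D.2.2.2) =
      ∑ γ ∈ S, ∑ δ ∈ S, (c4 α β D * (mc D.1 D.2.2.1 γ * mc D.2.1 D.2.2.2 δ)) •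
        (uOp γ * wOp δ) := by
    intro D _
    by_cases h : c4 α β D = 0
    · simp [h]
    · have := totalDim_of_c4 h
      rw [tailOp_eq D.2.1 D.2.2.2 (S := S) (fun μ hμ => mem_box.2 (by omega)), Finset.sum_mul,
        Finset.smul_sum]
      refine Finset.sum_congr rfl fun γ _ => ?_
      rw [Finset.mul_sum, Finset.smul_sum]
      refine Finset.sum_congr rfl fun δ _ => ?_
      rw [smul_mul_assoc, mul_smul_comm, smul_smul, smul_smul]
      ring_nf
  rw [Finset.sum_congr rfl e1, Finset.sum_comm, Finset.sum_congr rfl fun γ _ => Finset.sum_comm]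
  simp only [← Finset.sum_smul]
  have e2 : ∀ γ δ : IsoCls Γ k, ∑ D ∈ S ×ˢ S ×ˢ S ×ˢ S,
      (c4 α β D * (mc D.1 D.2.2.1 γ * mc D.2.1 D.2.2.2 δ)) = ∑ κ ∈ S, mc α β κ * cc κ γ δ := by
    intro γ δ
    have h := green_box α β γ δ (N := N) (M := N) (by omega) (by omega)
    rw [hN] at h
    rw [h]
    simp only [Finset.sum_product, c4]
    rfl
  simp only [e2, Finset.sum_smul]
  rw [lOp_mul α β (S := S) (fun μ hμ => mem_box.2 (by omega)),
    Finset.sum_congr rfl fun γ _ => Finset.sum_comm, Finset.sum_comm]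
  refine Finset.sum_congr rfl fun κ hκ => ?_
  rw [← conv_uOp_wOp, conv_eq _ _ (mem_box.1 hκ)]
  simp only [Finset.smul_sum, smul_smul]
  rfl

theorem sum_c4_mul (α β : IsoCls Γ k) {N : ℕ} (hN : α.totalDim + β.totalDim = N) :
    ∑ D ∈ box Γ k N ×ˢ box Γ k N ×ˢ box Γ k N ×ˢ box Γ k N, c4 α β D •
      ((uOp D.1 * uOp D.2.2.1) * tailOp D.2.1 D.2.2.2) = lOp α * lOp β := by
  set S := box Γ k N with hS
  have e1 : ∀ a a' b b' : IsoCls Γ k, c4 α β (a, a', b, b') •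
      ((uOp a * uOp b) * tailOp a' b') = cc α a a' • (uOp a * kOp Γ k a'.dimZ *
        (cc β b b' • (uOp b * wOp b')) * rOp a') := by
    intro a a' b b'
    have h : uOp a * kOp Γ k a'.dimZ * (uOp b * wOp b') * rOp a' =
        vs a' b • ((uOp a * uOp b) * tailOp a' b') := by
      calc _ = uOp a * (kOp Γ k a'.dimZ * uOp b) * wOp b' * rOp a' := by
            simp only [mul_assoc]
        _ = _ := by
            rw [kOp_uOp, tailOp, wOp, ← kOp_mul, vs]
            simp only [smul_mul_assoc, mul_smul_comm, mul_assoc]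
    rw [mul_smul_comm, smul_mul_assoc, h, c4, smul_smul, smul_smul]
  simp only [Finset.sum_product]
  rw [Finset.sum_congr rfl fun a _ => Finset.sum_congr rfl fun a' _ => Finset.sum_congr rfl
    fun b _ => Finset.sum_congr rfl fun b' _ => e1 a a' b b']
  simp only [← Finset.smul_sum, ← Finset.mul_sum, ← Finset.sum_mul]
  rw [← conv_eq uOp wOp (γ := β) (N := N) (by omega), conv_uOp_wOp]
  have hα : lOp α = _ := (congrFun (conv_uOp_wOp (Γ := Γ) (k := k)) α).symm.trans
    (conv_eq uOp wOp (γ := α) (N := N) (by omega))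
  rw [hα, Finset.sum_mul]
  refine Finset.sum_congr rfl fun a _ => ?_
  rw [Finset.sum_mul]
  refine Finset.sum_congr rfl fun a' _ => ?_
  rw [smul_mul_assoc, wOp]
  simp only [mul_assoc]
  rw [lOp_rOp]

theorem uOp_mul (α β : IsoCls Γ k) {S : Finset (IsoCls Γ k)}
    (hS : ∀ μ : IsoCls Γ k, μ.totalDim ≤ α.totalDim + β.totalDim → μ ∈ S) :
    uOp α * uOp β = ∑ γ ∈ S, mc α β γ • uOp γ := by
  classical
  have wide : ∀ (a b : IsoCls Γ k) {S S' : Finset (IsoCls Γ k)},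
      (∀ μ : IsoCls Γ k, μ.totalDim ≤ a.totalDim + b.totalDim → μ ∈ S) →
      (∀ μ : IsoCls Γ k, μ.totalDim ≤ a.totalDim + b.totalDim → μ ∈ S') →
      ∑ γ ∈ S, mc a b γ • uOp γ = ∑ γ ∈ S', mc a b γ • uOp γ := by
    intro a b S S' h h'
    have e : ∀ γ, mc a b γ • uOp γ ≠ 0 → γ.totalDim ≤ a.totalDim + b.totalDim := fun γ hγ =>
      (totalDim_of_hall (hall_ne_of_mc fun h0 => hγ (by rw [h0, zero_smul]))).le
    exact sum_eq_sum_of_supp (fun γ hγ => h γ (e γ hγ)) fun γ hγ => h' γ (e γ hγ)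
  have key : ∀ N, ∀ α β : IsoCls Γ k, α.totalDim + β.totalDim = N →
      uOp α * uOp β = ∑ γ ∈ box Γ k N, mc α β γ • uOp γ := by
    intro N
    induction N using Nat.strong_induction_on with
    | _ N ih =>
      intro α β hN
      have h := (sum_c4_mul α β hN).trans (sum_c4_mc α β hN).symm
      set T := box Γ k N ×ˢ box Γ k N ×ˢ box Γ k N ×ˢ box Γ k N
      have hz := totalDim_zero (Γ := Γ) (k := k)
      have hD : ((α, IsoCls.zero Γ k, β, IsoCls.zero Γ k) :
          IsoCls Γ k × IsoCls Γ k × IsoCls Γ k × IsoCls Γ k) ∈ T := by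
        simp only [T, Finset.mem_product, mem_box]
        omega
      rw [← Finset.add_sum_erase T _ hD, ← Finset.add_sum_erase T _ hD,
        Finset.sum_congr rfl (g := fun D => c4 α β D •
          ((∑ γ ∈ box Γ k N, mc D.1 D.2.2.1 γ • uOp γ) * tailOp D.2.1 D.2.2.2))] at h
      · have h2 : c4 α β (α, IsoCls.zero Γ k, β, IsoCls.zero Γ k) = 1 := by
          rw [c4, cc_zero_right hz, cc_zero_right hz, if_pos rfl, if_pos rfl, vs, dimZ_zero,
            Quiv.symEuler_zero_left]
          simp
        have h3 : uOp α * uOp β * tailOp (IsoCls.zero Γ k) (IsoCls.zero Γ k) =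
            (∑ γ ∈ box Γ k N, mc α β γ • uOp γ) *
              tailOp (IsoCls.zero Γ k) (IsoCls.zero Γ k) := by
          have := LinearMap.ext fun x => add_right_cancel (LinearMap.congr_fun h x)
          rwa [h2, one_smul, one_smul] at this
        rwa [tailOp_zero hz hz, mul_one, mul_one] at h3
      · intro D hD'
        by_cases hc : c4 α β D = 0
        · simp [hc]
        · obtain ⟨t1, t2⟩ := totalDim_of_c4 hc
          have lt : D.1.totalDim + D.2.2.1.totalDim < N := by
            by_contra hlt
            have a1 : D.2.1 = IsoCls.zero Γ k := eq_zero_of_totalDim (by omega)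
            have a2 : D.2.2.2 = IsoCls.zero Γ k := eq_zero_of_totalDim (by omega)
            rw [c4, a1, a2, cc_zero_right hz, cc_zero_right hz] at hc
            have a3 : D.1 = α := by
              by_contra h0
              simp [h0] at hc
            have a4 : D.2.2.1 = β := by
              by_contra h0
              simp [h0] at hc
            exact (Finset.mem_erase.1 hD').1
              (Prod.ext a3 (Prod.ext a1 (Prod.ext a4 a2)))
          rw [ih _ lt D.1 D.2.2.1 rfl, wide D.1 D.2.2.1 (S' := box Γ k N) (fun μ hμ => mem_box.2 hμ)
            (fun μ hμ => mem_box.2 (by omega))]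
  rw [key _ α β rfl]
  exact wide α β (fun μ hμ => mem_box.2 hμ) hS

end PositiveMul

end RingelHall
end

noncomputable section
namespace RingelHall

/-! ## The action of the double Ringel-Hall algebra on the Hall space -/

section DoubleAction

variable {J A k : Type*} [Fintype J] [Fintype A] [Field k] [Fintype k] {Γ : Quiv J A}

theorem qv_smul (c : Qv k) (T : Module.End ℂ (HallSp Γ k)) : c • T = (c : ℂ) • T := by
  refine LinearMap.ext fun x => Finsupp.ext fun l => ?_
  rfl

theorem coe_vv_zpow (n : ℤ) : ((vv k ^ n : Qv k) : ℂ) = vC k ^ n :=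
  map_zpow₀ (algebraMap (Qv k) ℂ) (vv k) n

theorem coe_natCast_qv (n : ℕ) : ((n : Qv k) : ℂ) = n := map_natCast (algebraMap (Qv k) ℂ) n

theorem coe_comulCoeff (γ α β : IsoCls Γ k) : (comulCoeff Γ k γ α β : ℂ) = cc γ α β := by
  have h : (comulCoeff Γ k γ α β : ℂ) = ((vv k ^ Γ.euler α.dimZ β.dimZ : Qv k) : ℂ) *
      (((α.aut : Qv k) : ℂ) * ((β.aut : Qv k) : ℂ) / ((γ.aut : Qv k) : ℂ)) *
      ((IsoCls.hall α β γ : Qv k) : ℂ) := by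
    simp only [comulCoeff, MulMemClass.coe_mul]
    rfl
  rw [h, coe_vv_zpow, coe_natCast_qv, coe_natCast_qv, coe_natCast_qv, coe_natCast_qv, cc, mc]
  ring

open Classical in
theorem coe_pairing (μ ν : J → ℤ) (α β : IsoCls Γ k) : (pairing Γ k μ α ν β : ℂ) =
    vC k ^ (-(Γ.symEuler μ ν) - Γ.symEuler α.dimZ ν + Γ.symEuler μ β.dimZ) *
      if α = β then ph α else 0 := by
  have h : (pairing Γ k μ α ν β : ℂ) =
      ((vv k ^ (-(Γ.symEuler μ ν) - Γ.symEuler α.dimZ ν + Γ.symEuler μ β.dimZ) : Qv k) : ℂ) *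
      (((Fintype.card k : Qv k) : ℂ) ^ α.totalDim / ((α.aut : Qv k) : ℂ)) *
      ((if α = β then 1 else 0 : Qv k) : ℂ) := by
    simp only [pairing, MulMemClass.coe_mul]
    rfl
  rw [h, coe_vv_zpow, coe_natCast_qv, coe_natCast_qv, mul_assoc, ph]
  split_ifs <;> simp

open Classical in
theorem coe_pairingR_left (α β : IsoCls Γ k) (μ : J → ℤ) :
    (pairingR Γ k α μ β 0 : ℂ) = if α = β then ph α else 0 := by
  have h : (pairingR Γ k α μ β 0 : ℂ) = ((vv k ^ (-(Γ.symEuler μ α.dimZ)) : Qv k) : ℂ) *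
      ((vv k ^ (Γ.symEuler 0 β.dimZ) : Qv k) : ℂ) * (pairing Γ k μ α 0 β : ℂ) := rfl
  rw [h, coe_vv_zpow, coe_vv_zpow, coe_pairing]
  split_ifs with e
  · subst e
    rw [← mul_assoc, ← zpow_add₀ vC_ne_zero, ← zpow_add₀ vC_ne_zero]
    simp [Quiv.symEuler_zero_left, Quiv.symEuler_zero_right]
  · simp

open Classical in
theorem coe_pairingR_right (α β : IsoCls Γ k) (ν : J → ℤ) :
    (pairingR Γ k α 0 β ν : ℂ) = if α = β then ph α else 0 := by
  have h : (pairingR Γ k α 0 β ν : ℂ) = ((vv k ^ (-(Γ.symEuler 0 α.dimZ)) : Qv k) : ℂ) *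
      ((vv k ^ (Γ.symEuler ν β.dimZ) : Qv k) : ℂ) * (pairing Γ k 0 α ν β : ℂ) := rfl
  rw [h, coe_vv_zpow, coe_vv_zpow, coe_pairing]
  split_ifs with e
  · subst e
    rw [← mul_assoc, ← zpow_add₀ vC_ne_zero, ← zpow_add₀ vC_ne_zero,
      Quiv.symEuler_comm Γ α.dimZ ν]
    simp [Quiv.symEuler_zero_left]
  · simp

/-- The scalar `-q`. -/
def nq (k : Type*) [Fintype k] : ℂ := -(Fintype.card k : ℂ)

theorem nq_ne_zero : nq k ≠ 0 := neg_ne_zero.2 card_ne_zero'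

/-- The operators by which the generators act. -/
def repGen : DGen Γ k → Module.End ℂ (HallSp Γ k)
  | .K μ => kOp Γ k μ
  | .uP α => nq k ^ (-(α.totalDim : ℤ)) • uOp α
  | .uM α => nq k ^ (α.totalDim : ℤ) • bOp α

/-- The action of the free algebra. -/
def repFree (Γ : Quiv J A) (k : Type*) [Field k] [Fintype k] :
    FreeAlgebra (Qv k) (DGen Γ k) →ₐ[Qv k] Module.End ℂ (HallSp Γ k) :=
  FreeAlgebra.lift (Qv k) repGen

theorem repFree_gen (x : DGen Γ k) : repFree Γ k (gen Γ k x) = repGen x :=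
  FreeAlgebra.lift_ι_apply _ _

theorem repFree_cross_left (γ δ : IsoCls Γ k) :
    repFree Γ k (∑ᶠ p : (IsoCls Γ k × IsoCls Γ k) × (IsoCls Γ k × IsoCls Γ k),
          (comulCoeff Γ k γ p.1.1 p.1.2 * comulCoeff Γ k δ p.2.1 p.2.2 *
            pairingR Γ k p.1.1 p.1.2.dimZ p.2.2 0) •
              ((gen Γ k (.uM p.2.1) * gen Γ k (.K (-p.2.2.dimZ))) * gen Γ k (.uP p.1.2))) =
      nq k ^ ((δ.totalDim : ℤ) - γ.totalDim) • conv (pFam δ) uOp γ := by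
  classical
  set n := γ.totalDim + δ.totalDim with hn
  set S := box Γ k n with hS
  rw [finsum_eq_sum_of_support_subset (s := (S ×ˢ S) ×ˢ (S ×ˢ S)), map_sum]
  · have e : ∀ a b e f : IsoCls Γ k, repFree Γ k ((comulCoeff Γ k γ a b * comulCoeff Γ k δ e f *
            pairingR Γ k a b.dimZ f 0) •
              ((gen Γ k (.uM e) * gen Γ k (.K (-f.dimZ))) * gen Γ k (.uP b))) =
        if a = f then nq k ^ ((δ.totalDim : ℤ) - γ.totalDim) •
          ((cc γ a b * (cc δ e a * ph a)) • (bOp e * kOp Γ k (-a.dimZ) * uOp b)) else 0 := by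
      intro a b e f
      rw [map_smul, map_mul, map_mul, repFree_gen, repFree_gen, repFree_gen, qv_smul,
        MulMemClass.coe_mul, MulMemClass.coe_mul, coe_comulCoeff, coe_comulCoeff,
        coe_pairingR_left]
      split_ifs with h
      · subst h
        by_cases h1 : IsoCls.hall a b γ = 0
        · simp [cc, mc_of_hall h1]
        by_cases h2 : IsoCls.hall e a δ = 0
        · simp [cc, mc_of_hall h2]
        have ex : nq k ^ ((δ.totalDim : ℤ) - γ.totalDim) =
            nq k ^ (e.totalDim : ℤ) * nq k ^ (-(b.totalDim : ℤ)) := by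
          rw [← zpow_add₀ nq_ne_zero, totalDim_of_hall h1, totalDim_of_hall h2]
          congr 1
          push_cast
          ring
        rw [ex]
        simp only [repGen, smul_mul_assoc, mul_smul_comm, smul_smul]
        congr 1
        ring
      · simp
    rw [Finset.sum_congr rfl fun p _ => e p.1.1 p.1.2 p.2.1 p.2.2]
    simp only [Finset.sum_product]
    have e2 : ∀ a ∈ S, ∀ b, ∑ e ∈ S, ∑ f ∈ S,
        (if a = f then nq k ^ ((δ.totalDim : ℤ) - γ.totalDim) •
          ((cc γ a b * (cc δ e a * ph a)) • (bOp e * kOp Γ k (-a.dimZ) * uOp b)) else 0) =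
        nq k ^ ((δ.totalDim : ℤ) - γ.totalDim) • cc γ a b • (pFam δ a * uOp b) := by
      intro a ha b
      rw [pFam_eq δ a (N := n) (by omega), Finset.sum_mul, Finset.smul_sum, Finset.smul_sum]
      refine Finset.sum_congr rfl fun e _ => ?_
      rw [Finset.sum_ite_eq, if_pos ha, smul_mul_assoc, smul_smul, smul_smul, smul_smul,
        mul_assoc (nq k ^ _)]
    rw [Finset.sum_congr rfl fun a ha => Finset.sum_congr rfl fun b _ => e2 a ha b,
      conv_eq _ _ (N := n) (by omega)]
    simp only [Finset.smul_sum]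
    rfl
  · intro p hp
    have h0 : comulCoeff Γ k γ p.1.1 p.1.2 ≠ 0 ∧ comulCoeff Γ k δ p.2.1 p.2.2 ≠ 0 := by
      constructor <;> intro h0 <;> exact hp (by simp [h0])
    have h1 : cc γ p.1.1 p.1.2 ≠ 0 := by
      rw [← coe_comulCoeff]; exact fun h => h0.1 (Subtype.ext h)
    have h2 : cc δ p.2.1 p.2.2 ≠ 0 := by
      rw [← coe_comulCoeff]; exact fun h => h0.2 (Subtype.ext h)
    have a1 := td_left h1
    have a2 := td_right h1
    have a3 := td_left h2
    have a4 := td_right h2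
    simp only [hS, Finset.coe_product, Set.mem_prod, Finset.mem_coe, mem_box]
    omega

theorem repFree_cross_right (γ δ : IsoCls Γ k) :
    repFree Γ k (∑ᶠ p : (IsoCls Γ k × IsoCls Γ k) × (IsoCls Γ k × IsoCls Γ k),
          (comulCoeff Γ k γ p.1.1 p.1.2 * comulCoeff Γ k δ p.2.1 p.2.2 *
            pairingR Γ k p.1.2 0 p.2.1 (-p.2.2.dimZ)) •
              ((gen Γ k (.uP p.1.1) * gen Γ k (.K p.1.2.dimZ)) * gen Γ k (.uM p.2.2))) =
      nq k ^ ((δ.totalDim : ℤ) - γ.totalDim) • conv uOp (sFam δ) γ := by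
  classical
  set n := γ.totalDim + δ.totalDim with hn
  set S := box Γ k n with hS
  rw [finsum_eq_sum_of_support_subset (s := (S ×ˢ S) ×ˢ (S ×ˢ S)), map_sum]
  · have e : ∀ a b e f : IsoCls Γ k, repFree Γ k ((comulCoeff Γ k γ a b * comulCoeff Γ k δ e f *
            pairingR Γ k b 0 e (-f.dimZ)) •
              ((gen Γ k (.uP a) * gen Γ k (.K b.dimZ)) * gen Γ k (.uM f))) =
        if b = e then nq k ^ ((δ.totalDim : ℤ) - γ.totalDim) •
          ((cc γ a b * (cc δ b f * ph b)) • (uOp a * (kOp Γ k b.dimZ * bOp f))) else 0 := by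
      intro a b e f
      rw [map_smul, map_mul, map_mul, repFree_gen, repFree_gen, repFree_gen, qv_smul,
        MulMemClass.coe_mul, MulMemClass.coe_mul, coe_comulCoeff, coe_comulCoeff,
        coe_pairingR_right]
      split_ifs with h
      · subst h
        by_cases h1 : IsoCls.hall a b γ = 0
        · simp [cc, mc_of_hall h1]
        by_cases h2 : IsoCls.hall b f δ = 0
        · simp [cc, mc_of_hall h2]
        have ex : nq k ^ ((δ.totalDim : ℤ) - γ.totalDim) =
            nq k ^ (f.totalDim : ℤ) * nq k ^ (-(a.totalDim : ℤ)) := by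
          rw [← zpow_add₀ nq_ne_zero, totalDim_of_hall h1, totalDim_of_hall h2]
          congr 1
          push_cast
          ring
        rw [ex]
        simp only [repGen, smul_mul_assoc, mul_smul_comm, smul_smul, mul_assoc]
        congr 1
        ring
      · simp
    rw [Finset.sum_congr rfl fun p _ => e p.1.1 p.1.2 p.2.1 p.2.2]
    simp only [Finset.sum_product]
    have e2 : ∀ a, ∀ b ∈ S, ∑ e ∈ S, ∑ f ∈ S,
        (if b = e then nq k ^ ((δ.totalDim : ℤ) - γ.totalDim) •
          ((cc γ a b * (cc δ b f * ph b)) • (uOp a * (kOp Γ k b.dimZ * bOp f))) else 0) =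
        nq k ^ ((δ.totalDim : ℤ) - γ.totalDim) • cc γ a b • (uOp a * sFam δ b) := by
      intro a b hb
      rw [Finset.sum_comm, sFam_eq δ b (N := n) (by omega), Finset.mul_sum, Finset.smul_sum,
        Finset.smul_sum]
      refine Finset.sum_congr rfl fun e _ => ?_
      rw [Finset.sum_ite_eq, if_pos hb, mul_smul_comm, smul_smul, smul_smul, smul_smul,
        mul_assoc (nq k ^ _)]
    rw [Finset.sum_congr rfl fun a _ => Finset.sum_congr rfl fun b hb => e2 a b hb,
      conv_eq _ _ (N := n) (by omega)]
    simp only [Finset.smul_sum]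
    rfl
  · intro p hp
    have h0 : comulCoeff Γ k γ p.1.1 p.1.2 ≠ 0 ∧ comulCoeff Γ k δ p.2.1 p.2.2 ≠ 0 := by
      constructor <;> intro h0 <;> exact hp (by simp [h0])
    have h1 : cc γ p.1.1 p.1.2 ≠ 0 := by
      rw [← coe_comulCoeff]; exact fun h => h0.1 (Subtype.ext h)
    have h2 : cc δ p.2.1 p.2.2 ≠ 0 := by
      rw [← coe_comulCoeff]; exact fun h => h0.2 (Subtype.ext h)
    have a1 := td_left h1
    have a2 := td_right h1
    have a3 := td_left h2
    have a4 := td_right h2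
    simp only [hS, Finset.coe_product, Set.mem_prod, Finset.mem_coe, mem_box]
    omega

theorem repFree_hall_sum (α β : IsoCls Γ k) (g : IsoCls Γ k → DGen Γ k) :
    repFree Γ k (vv k ^ Γ.euler α.dimZ β.dimZ •
          ∑ᶠ γ : IsoCls Γ k, (IsoCls.hall α β γ : Qv k) • gen Γ k (g γ)) =
      ∑ γ ∈ box Γ k (α.totalDim + β.totalDim), mc α β γ • repGen (g γ) := by
  rw [finsum_eq_sum_of_support_subset (s := box Γ k (α.totalDim + β.totalDim)), map_smul, map_sum,
    Finset.smul_sum]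
  · refine Finset.sum_congr rfl fun γ _ => ?_
    rw [map_smul, repFree_gen, qv_smul, qv_smul, smul_smul, coe_vv_zpow, coe_natCast_qv, mc]
  · intro γ hγ
    have h : IsoCls.hall α β γ ≠ 0 := by
      intro h0
      exact hγ (by simp [h0])
    simp [totalDim_of_hall h]

theorem repFree_rel {x y : FreeAlgebra (Qv k) (DGen Γ k)} (h : DRel Γ k x y) :
    repFree Γ k x = repFree Γ k y := by
  induction h with
  | K_zero => rw [repFree_gen, map_one]; exact kOp_zero
  | uP_zero =>
    rw [repFree_gen, map_one, repGen, uOp_zero, totalDim_zero]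
    simp
  | uM_zero =>
    rw [repFree_gen, map_one, repGen, bOp_zero, totalDim_zero]
    simp
  | K_mul μ ν =>
    rw [map_mul, repFree_gen, repFree_gen, repFree_gen]
    exact kOp_mul μ ν
  | K_uP μ α =>
    rw [map_smul, map_mul, map_mul, repFree_gen, repFree_gen, qv_smul, coe_vv_zpow]
    simp only [repGen]
    rw [mul_smul_comm, kOp_uOp, smul_mul_assoc, smul_comm]
  | K_uM μ α =>
    rw [map_smul, map_mul, map_mul, repFree_gen, repFree_gen, qv_smul, coe_vv_zpow]
    simp only [repGen]
    rw [mul_smul_comm, kOp_bOp, smul_mul_assoc, smul_comm]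
  | uP_mul α β =>
    rw [repFree_hall_sum, map_mul, repFree_gen, repFree_gen]
    simp only [repGen]
    rw [smul_mul_assoc, mul_smul_comm, smul_smul, uOp_mul α β (S := box Γ k _)
      (fun μ hμ => mem_box.2 hμ), Finset.smul_sum]
    refine Finset.sum_congr rfl fun γ _ => ?_
    by_cases h : IsoCls.hall α β γ = 0
    · simp [mc_of_hall h]
    · rw [smul_comm, totalDim_of_hall h, ← zpow_add₀ nq_ne_zero]
      push_cast
      rw [neg_add]
  | uM_mul α β =>
    rw [repFree_hall_sum, map_mul, repFree_gen, repFree_gen]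
    simp only [repGen]
    rw [smul_mul_assoc, mul_smul_comm, smul_smul, bOp_mul α β (S := box Γ k _)
      (fun μ hμ => mem_box.2 hμ), Finset.smul_sum]
    refine Finset.sum_congr rfl fun γ _ => ?_
    by_cases h : IsoCls.hall α β γ = 0
    · simp [mc_of_hall h]
    · rw [smul_comm, totalDim_of_hall h, ← zpow_add₀ nq_ne_zero]
      push_cast
      rfl
  | cross γ δ => rw [repFree_cross_left, repFree_cross_right, conv_pFam_uOp]

/-- The action of the double Ringel-Hall algebra on the Hall space. -/
def repD (Γ : Quiv J A) (k : Type*) [Field k] [Fintype k] :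
    DoubleHall Γ k →ₐ[Qv k] Module.End ℂ (HallSp Γ k) :=
  RingQuot.liftAlgHom (Qv k) ⟨repFree Γ k, fun _ _ h => repFree_rel h⟩

theorem repD_of (x : DGen Γ k) : repD Γ k (DoubleHall.of Γ k x) = repGen x := by
  rw [← repFree_gen]
  exact RingQuot.liftAlgHom_mkAlgHom_apply _ _ _ _

end DoubleAction

end RingelHall
end

noncomputable section
namespace RingelHall

/-! ## Right multiplication -/

section RightMul

variable {J A k : Type*} [Fintype J] [Fintype A] [Field k] [Fintype k] {Γ : Quiv J A}

/-- Multiplication by `u_β` from the right. -/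
def rmOp (β : IsoCls Γ k) : Module.End ℂ (HallSp Γ k) :=
  ofMat (fun l X => mc X β l) fun X => box Γ k (X.totalDim + β.totalDim)

theorem mat_rmOp (β l X : IsoCls Γ k) : mat (rmOp β) l X = mc X β l :=
  mat_ofMat (fun l X h => by
    rw [mem_box, totalDim_of_hall (hall_ne_of_mc h)]) l X

theorem bOp_rmOp (α β : IsoCls Γ k) : bOp α * rmOp β = rmOp β * bOp α := by
  refine mat_ext fun l X => ?_
  rw [mat_mul _ _ _ _ (S := box Γ k (X.totalDim + β.totalDim)),
    mat_mul _ _ _ _ (S := box Γ k (α.totalDim + X.totalDim))]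
  · simp only [mat_bOp, mat_rmOp]
    exact mc_assoc α X β l _ _ (fun μ hμ => mem_box.2 hμ) (fun μ hμ => mem_box.2 hμ)
  · intro Y h
    rw [mat_bOp] at h
    rw [mem_box, totalDim_of_hall (hall_ne_of_mc h)]
  · intro Y h
    rw [mat_rmOp] at h
    rw [mem_box, totalDim_of_hall (hall_ne_of_mc h)]

theorem kOp_rmOp (μ : J → ℤ) (β : IsoCls Γ k) :
    kOp Γ k μ * rmOp β = vC k ^ (-Γ.symEuler μ β.dimZ) • (rmOp β * kOp Γ k μ) := by
  refine mat_ext fun l X => ?_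
  rw [mat_kOp_mul, mat_smul, mat_mul_kOp, mat_rmOp]
  by_cases h : IsoCls.hall X β l = 0
  · simp [mc_of_hall h]
  · rw [dimZ_of_hall h, Quiv.symEuler_add_right, neg_add, zpow_add₀ vC_ne_zero]
    ring

theorem sum_cc_one {β : IsoCls Γ k} (hβ : β.totalDim = 1) (F : IsoCls Γ k → IsoCls Γ k → ℂ) :
    ∑ β₁ ∈ box Γ k 1, ∑ β₂ ∈ box Γ k 1, cc β β₁ β₂ * F β₁ β₂ =
      F (IsoCls.zero Γ k) β + F β (IsoCls.zero Γ k) := by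
  classical
  have hz := totalDim_zero (Γ := Γ) (k := k)
  have ne : IsoCls.zero Γ k ≠ β := by
    rintro rfl
    omega
  have h0 : ∀ β₁ ∈ box Γ k 1, β₁ ∉ ({IsoCls.zero Γ k, β} : Finset (IsoCls Γ k)) →
      ∑ β₂ ∈ box Γ k 1, cc β β₁ β₂ * F β₁ β₂ = 0 := by
    intro β₁ _ hn
    refine Finset.sum_eq_zero fun β₂ _ => ?_
    have : cc β β₁ β₂ = 0 := by
      by_contra hc
      have ht := totalDim_of_hall (hall_ne_of_cc hc)
      simp only [Finset.mem_insert, Finset.mem_singleton, not_or] at hn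
      by_cases h1 : β₁.totalDim = 0
      · exact hn.1 (eq_zero_of_totalDim h1)
      · have h2 : β₂.totalDim = 0 := by omega
        rw [cc_zero_right h2] at hc
        exact hn.2 (by by_contra h3; simp [h3] at hc)
    rw [this, zero_mul]
  rw [← Finset.sum_subset (s₁ := {IsoCls.zero Γ k, β}) ?_ h0, Finset.sum_pair ne]
  · congr 1
    · rw [Finset.sum_eq_single β]
      · rw [cc_zero_left hz, if_pos rfl, one_mul]
      · intro b _ hb
        rw [cc_zero_left hz, if_neg hb, zero_mul]
      · intro h
        exact absurd (mem_box.2 hβ.le) h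
    · rw [Finset.sum_eq_single (IsoCls.zero Γ k)]
      · rw [cc_zero_right hz, if_pos rfl, one_mul]
      · intro b _ hb
        have : cc β β b = 0 := by
          by_contra hc
          have ht := totalDim_of_hall (hall_ne_of_cc hc)
          exact hb (eq_zero_of_totalDim (by omega))
        rw [this, zero_mul]
      · intro h
        exact absurd (mem_box.2 (by omega)) h
  · intro b hb
    simp only [Finset.mem_insert, Finset.mem_singleton] at hb
    rw [mem_box]
    rcases hb with rfl | rfl <;> omega

theorem green_one (α : IsoCls Γ k) {β : IsoCls Γ k} (hβ : β.totalDim = 1) (γ δ : IsoCls Γ k) :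
    ∑ κ ∈ box Γ k (α.totalDim + β.totalDim), mc α β κ * cc κ γ δ =
      ∑ α₁ ∈ box Γ k α.totalDim, ∑ α₂ ∈ box Γ k α.totalDim, cc α α₁ α₂ *
        (mc α₁ (IsoCls.zero Γ k) γ * mc α₂ β δ + vs α₂ β * mc α₁ β γ *
          mc α₂ (IsoCls.zero Γ k) δ) := by
  rw [green_box α β γ δ (le_refl α.totalDim) hβ.le]
  refine Finset.sum_congr rfl fun α₁ _ => Finset.sum_congr rfl fun α₂ _ => ?_
  have h := sum_cc_one hβ fun β₁ β₂ => cc α α₁ α₂ * vs α₂ β₁ * (mc α₁ β₁ γ * mc α₂ β₂ δ)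
  have e : vs α₂ (IsoCls.zero Γ k) = 1 := by
    rw [vs, dimZ_zero, Quiv.symEuler_zero_right, zpow_zero]
  rw [e] at h
  calc _ = ∑ β₁ ∈ box Γ k 1, ∑ β₂ ∈ box Γ k 1, cc β β₁ β₂ *
        (cc α α₁ α₂ * vs α₂ β₁ * (mc α₁ β₁ γ * mc α₂ β₂ δ)) :=
        Finset.sum_congr rfl fun _ _ => Finset.sum_congr rfl fun _ _ => by ring
    _ = _ := by rw [h]; ring

theorem mem_box_of_mat_rmOp {β l X : IsoCls Γ k} (h : mat (rmOp β) l X ≠ 0) :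
    l ∈ box Γ k (X.totalDim + β.totalDim) := by
  rw [mat_rmOp] at h
  rw [mem_box, totalDim_of_hall (hall_ne_of_mc h)]

open Classical in
theorem lOp_rmOp {g β : IsoCls Γ k} (hg : g.totalDim = 1) (hβ : β.totalDim = 1) :
    lOp g * rmOp β = vs g β • (rmOp β * lOp g) + (if β = g then ph g else 0) • 1 := by
  have hz := totalDim_zero (Γ := Γ) (k := k)
  refine mat_ext fun a X => ?_
  have h1 : mat (lOp g * rmOp β) a X = ph g * ∑ κ ∈ box Γ k (X.totalDim + β.totalDim),
      mc X β κ * cc κ a g := by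
    rw [mat_mul _ _ _ _ fun Y => mem_box_of_mat_rmOp, Finset.mul_sum]
    simp only [mat_lOp, mat_rmOp]
    exact Finset.sum_congr rfl fun κ _ => by ring
  have h2 : mat (vs g β • (rmOp β * lOp g) + (if β = g then ph g else 0) • 1) a X =
      vs g β * mat (rmOp β * lOp g) a X + (if β = g then ph g else 0) *
        (if a = X then 1 else 0) := by
    have : mat (1 : Module.End ℂ (HallSp Γ k)) a X = if a = X then 1 else 0 := by
      simp [mat, Finsupp.single_apply, eq_comm]
    rw [← this]
    rfl
  rw [h1, green_one X hβ, h2, mat_mul _ _ _ _ fun Y => mem_box_of_mat_lOp le_rfl]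
  simp only [mat_lOp, mat_rmOp, mul_add, Finset.sum_add_distrib]
  rw [add_comm]
  congr 1
  · rw [Finset.mul_sum, Finset.mul_sum]
    refine Finset.sum_congr rfl fun x₁ _ => ?_
    rw [Finset.mul_sum]
    have e : ∀ x₂, x₂ ≠ g → ph g * (cc X x₁ x₂ * (vs x₂ β * mc x₁ β a *
        mc x₂ (IsoCls.zero Γ k) g)) = 0 := by
      intro x₂ h
      rw [mc_zero_right hz, if_neg h]
      ring
    rw [Finset.sum_eq_single g (fun x₂ _ h => e x₂ h)]
    · rw [mc_zero_right hz, if_pos rfl]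
      ring
    · intro hg'
      have : cc X x₁ g = 0 := by
        by_contra hc
        exact hg' (mem_box.2 (td_right hc))
      rw [this]; ring
  · have e : ∀ x₁ x₂, cc X x₁ x₂ * (mc x₁ (IsoCls.zero Γ k) a * mc x₂ β g) =
        if x₂ = IsoCls.zero Γ k then (if X = x₁ then (if a = X then (if β = g then 1 else 0) else 0)
          else 0) else 0 := by
      intro x₁ x₂
      split_ifs with c1 c2 c3 c4
      · rw [c1, cc_zero_right hz, mc_zero_right hz, mc_zero_left hz, if_pos c2.symm, if_pos c4,
          if_pos (c2.symm.trans c3.symm)]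
        ring
      · rw [c1, mc_zero_left hz, if_neg c4]
        ring
      · rw [mc_zero_right hz, if_neg (fun h => c3 (h.symm.trans c2.symm))]
        ring
      · rw [c1, cc_zero_right hz, if_neg (fun h => c2 h.symm)]
        ring
      · have : mc x₂ β g = 0 := by
          by_contra hc
          have ht := totalDim_of_hall (hall_ne_of_mc hc)
          exact c1 (eq_zero_of_totalDim (by omega))
        rw [this]; ring
    simp only [e, Finset.sum_ite_eq', Finset.sum_ite_eq, mem_box, le_refl, if_true, hz, zero_le]
    split_ifs <;> simp

open Classical in
theorem rOp_rmOp {g β : IsoCls Γ k} (hg : g.totalDim = 1) (hβ : β.totalDim = 1) :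
    rOp g * rmOp β = rmOp β * rOp g + (if β = g then ph g else 0) • kOp Γ k (-g.dimZ) := by
  have hz := totalDim_zero (Γ := Γ) (k := k)
  refine mat_ext fun a X => ?_
  have h1 : mat (rOp g * rmOp β) a X = ph g * ∑ κ ∈ box Γ k (X.totalDim + β.totalDim),
      mc X β κ * cc κ g a := by
    rw [mat_mul _ _ _ _ fun Y => mem_box_of_mat_rmOp, Finset.mul_sum]
    simp only [mat_rOp, mat_rmOp]
    exact Finset.sum_congr rfl fun κ _ => by ring
  have h2 : mat (rmOp β * rOp g + (if β = g then ph g else 0) • kOp Γ k (-g.dimZ)) a X =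
      mat (rmOp β * rOp g) a X + (if β = g then ph g else 0) *
        (if a = X then vs X g else 0) := by
    have : mat (kOp Γ k (-g.dimZ)) a X = if a = X then vs X g else 0 := by
      rw [mat, kOp_single, Finsupp.smul_apply, Finsupp.single_apply, Quiv.symEuler_neg_left,
        neg_neg, vs, Quiv.symEuler_comm]
      simp [eq_comm]
    rw [← this]
    rfl
  rw [h1, green_one X hβ, h2, mat_mul _ _ _ _ fun Y => mem_box_of_mat_rOp le_rfl]
  simp only [mat_rOp, mat_rmOp, mul_add, Finset.sum_add_distrib]
  congr 1
  · rw [Finset.sum_comm, Finset.mul_sum]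
    refine Finset.sum_congr rfl fun x₁ _ => ?_
    rw [Finset.mul_sum]
    have e : ∀ x₂, x₂ ≠ g → ph g * (cc X x₂ x₁ * (mc x₂ (IsoCls.zero Γ k) g * mc x₁ β a)) = 0 := by
      intro x₂ h
      rw [mc_zero_right hz, if_neg h]
      ring
    rw [Finset.sum_eq_single g (fun x₂ _ h => e x₂ h)]
    · rw [mc_zero_right hz, if_pos rfl]
      ring
    · intro hg'
      have : cc X g x₁ = 0 := by
        by_contra hc
        exact hg' (mem_box.2 (td_left hc))
      rw [this]; ring
  · have e : ∀ x₁ x₂, cc X x₁ x₂ * (vs x₂ β * mc x₁ β g * mc x₂ (IsoCls.zero Γ k) a) =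
        if X = x₂ then (if x₁ = IsoCls.zero Γ k then (if a = X then (if β = g then vs X g else 0)
          else 0) else 0) else 0 := by
      intro x₁ x₂
      split_ifs with c1 c2 c3 c4
      · rw [c2, cc_zero_left hz, mc_zero_right hz, mc_zero_left hz, if_pos c1.symm, if_pos c4,
          if_pos (c1.symm.trans c3.symm), c4, c1]
        ring
      · rw [c2, mc_zero_left hz, if_neg c4]
        ring
      · rw [mc_zero_right hz, if_neg (fun h => c3 (h.symm.trans c1.symm))]
        ring
      · have : mc x₁ β g = 0 := by
          by_contra hc
          have ht := totalDim_of_hall (hall_ne_of_mc hc)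
          exact c2 (eq_zero_of_totalDim (by omega))
        rw [this]; ring
      · by_cases c2 : x₁ = IsoCls.zero Γ k
        · rw [c2, cc_zero_left hz, if_neg (fun h => c1 h.symm)]
          ring
        · have : mc x₁ β g = 0 := by
            by_contra hc
            have ht := totalDim_of_hall (hall_ne_of_mc hc)
            exact c2 (eq_zero_of_totalDim (by omega))
          rw [this]; ring
    simp only [e, Finset.sum_ite_eq', Finset.sum_ite_eq, mem_box, le_refl, if_true, hz, zero_le]
    split_ifs <;> simp

theorem uOp_rmOp {g β : IsoCls Γ k} (hg : g.totalDim = 1) (hβ : β.totalDim = 1) :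
    ∃ T : Module.End ℂ (HallSp Γ k), uOp g * rmOp β = rmOp β * T := by
  classical
  refine ⟨vs g β • lOp g - vC k ^ (-Γ.symEuler g.dimZ β.dimZ) • (kOp Γ k g.dimZ * rOp g), ?_⟩
  have h1 : wOp g * rmOp β = vC k ^ (-Γ.symEuler g.dimZ β.dimZ) •
      (rmOp β * (kOp Γ k g.dimZ * rOp g)) + (if β = g then ph g else 0) • 1 := by
    rw [wOp, mul_assoc, rOp_rmOp hg hβ, mul_add, ← mul_assoc, kOp_rmOp, smul_mul_assoc, mul_assoc,
      mul_smul_comm, kOp_mul, add_neg_cancel, kOp_zero]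
  have h2 : uOp g * rmOp β = lOp g * rmOp β - wOp g * rmOp β := by
    rw [uOp_of_totalDim_one hg]
    exact sub_mul (α := Module.End ℂ (HallSp Γ k)) _ _ _
  have h3 : rmOp β * (vs g β • lOp g - vC k ^ (-Γ.symEuler g.dimZ β.dimZ) •
      (kOp Γ k g.dimZ * rOp g)) = vs g β • (rmOp β * lOp g) -
      vC k ^ (-Γ.symEuler g.dimZ β.dimZ) • (rmOp β * (kOp Γ k g.dimZ * rOp g)) := by
    rw [← mul_smul_comm (vs g β), ← mul_smul_comm _ (rmOp β) (kOp Γ k g.dimZ * rOp g)]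
    exact mul_sub (α := Module.End ℂ (HallSp Γ k)) _ _ _
  rw [h2, h3, h1, lOp_rmOp hg hβ]
  exact add_sub_add_right_eq_sub (G := Module.End ℂ (HallSp Γ k)) _ _ _

end RightMul

end RingelHall
end

noncomputable section
namespace RingelHall

/-! ## Framed quivers with one additional vertex -/

section ClassOf

variable {J A k : Type*} [Field k] {Γ : Quiv J A}

variable {n m m' : J → Type}
  [∀ j, Fintype (n j)] [∀ j, DecidableEq (n j)]
  [∀ j, Fintype (m j)] [∀ j, DecidableEq (m j)]
  [∀ j, Fintype (m' j)] [∀ j, DecidableEq (m' j)]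

theorem subC_iff {x : MRep Γ k n} {W : ∀ j, Submodule k (n j → k)} {t : MRep Γ k m}
    {β : IsoCls Γ k} (ht : cl t = β) : SubC x W β ↔ ∃ y : MMap k m n, IsMHom t x y ∧
      ∀ j, Function.Injective (y j).mulVec ∧ LinearMap.range (y j).mulVecLin = W j := by
  subst ht
  constructor
  · rintro ⟨y, hy, hj⟩
    obtain ⟨p, hp⟩ := exists_rep_iso t
    have hq : p.symm.conj t = (cl t).rep := by
      have := p.symm_conj_conj (Γ := Γ) (cl t).rep
      rwa [hp] at this
    refine ⟨fun j => y j * p.bwd j, hy.comp ((p.symm.conj_eq_iff _ _).1 hq), fun j => ⟨?_, ?_⟩⟩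
    · rw [mulVec_mul_eq]; exact (hj j).1.comp (p.symm.bijective_fwd j).1
    · rw [Matrix.mulVecLin_mul, LinearMap.range_comp_of_range_eq_top, (hj j).2]
      exact LinearMap.range_eq_top.2 (p.symm.bijective_fwd j).2
  · rintro ⟨y, hy, hj⟩
    obtain rfl : W = fun j => LinearMap.range (y j).mulVecLin := funext fun j => (hj j).2.symm
    exact SubC.of_hom hy fun j => (hj j).1

theorem quoC_iff {x : MRep Γ k n} {W : ∀ j, Submodule k (n j → k)} {s : MRep Γ k m}
    {α : IsoCls Γ k} (hs : cl s = α) : QuoC x W α ↔ ∃ z : MMap k n m, IsMHom x s z ∧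
      ∀ j, Function.Surjective (z j).mulVec ∧ LinearMap.ker (z j).mulVecLin = W j := by
  subst hs
  constructor
  · rintro ⟨z, hz, hj⟩
    obtain ⟨p, hp⟩ := exists_rep_iso s
    refine ⟨fun j => p.fwd j * z j, ((p.conj_eq_iff _ _).1 hp).comp hz, fun j => ⟨?_, ?_⟩⟩
    · rw [mulVec_mul_eq]; exact (p.bijective_fwd j).2.comp (hj j).1
    · rw [Matrix.mulVecLin_mul, LinearMap.ker_comp_of_ker_eq_bot, (hj j).2]
      exact LinearMap.ker_eq_bot.2 (p.bijective_fwd j).1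
  · rintro ⟨z, hz, hj⟩
    obtain rfl : W = fun j => LinearMap.ker (z j).mulVecLin := funext fun j => (hj j).2.symm
    exact QuoC.of_hom hz fun j => (hj j).1

theorem exists_eq_mk (α : IsoCls Γ k) {d : J → ℕ} (h : α.dim = d) :
    ∃ x : Rep Γ k d, IsoCls.mk x = α := by
  subst h
  exact ⟨α.rep, mk_rep α⟩

end ClassOf

section Framed

variable {I H : Type*} (Q : Quiv I H) (o : I → Bool) (w : I → ℕ)

/-- The quiver obtained from `Q` by adding one vertex and, for every vertex `i`, `w i` arrows
between `i` and the new vertex. -/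
def framed : Quiv (Option I) (H ⊕ Σ i, Fin (w i)) where
  s := Sum.elim (fun h => some (Q.s h)) fun p => bif o p.1 then none else some p.1
  t := Sum.elim (fun h => some (Q.t h)) fun p => bif o p.1 then some p.1 else none

variable {Q o w}

/-- Extension of a dimension vector by `0` at the new vertex. -/
def exDim (d : I → ℕ) : Option I → ℕ := fun j => j.elim 0 d

/-- Extension of an element of `ℤ I` by `0` at the new vertex. -/
def exDimZ (d : I → ℤ) : Option I → ℤ := fun j => j.elim 0 d

instance (d : I → ℕ) : IsEmpty (Fin (exDim d none)) := inferInstanceAs (IsEmpty (Fin 0))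

variable {k : Type*} [Field k]

/-- Extension of a representation by `0` at the new vertex. -/
def exRep (o : I → Bool) (w : I → ℕ) {d : I → ℕ} (x : Rep Q k d) :
    Rep (framed Q o w) k (exDim d) := fun h => match h with
  | .inl h => x h
  | .inr _ => 0

/-- Extension of a class by `0` at the new vertex. -/
def exCls (o : I → Bool) (w : I → ℕ) (α : IsoCls Q k) : IsoCls (framed Q o w) k :=
  IsoCls.mk (exRep o w α.rep)

theorem cl_exRep (α : IsoCls Q k) :
    cl (n := FinD (exDim α.dim)) (exRep o w α.rep) = exCls o w α := cl_eq_mk _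

theorem dim_exCls (α : IsoCls Q k) : (exCls o w α).dim = exDim α.dim := rfl

theorem dimZ_exCls (α : IsoCls Q k) : (exCls o w α).dimZ = exDimZ α.dimZ := by
  funext j
  cases j <;> rfl

/-- The extension of a graded map. -/
def exMap {d d' : I → ℕ} (y : GrMap k d d') : GrMap k (exDim d) (exDim d') := fun j => match j with
  | none => (0 : Matrix (Fin 0) (Fin 0) k)
  | some i => y i

theorem exMap_restrict {d d' : I → ℕ} (y : GrMap k (exDim d) (exDim d')) :
    exMap (fun i => y (some i)) = y := by
  funext j
  cases j with
  | none => ext a; exact isEmptyElim a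
  | some i => rfl

theorem isHom_exMap {d d' : I → ℕ} {x : Rep Q k d} {x' : Rep Q k d'} {y : GrMap k d d'} :
    IsHom (exRep o w x) (exRep o w x') (exMap y) ↔ IsHom x x' y := by
  constructor
  · intro h a
    exact h (.inl a)
  · intro h a
    cases a with
    | inl a => exact h a
    | inr p =>
      show (0 : Matrix _ _ k) * _ = _ * (0 : Matrix _ _ k)
      rw [Matrix.zero_mul, Matrix.mul_zero]

theorem mk_exRep_eq_iff {d d' : I → ℕ} (x : Rep Q k d) (x' : Rep Q k d') :
    IsoCls.mk (exRep o w x) = IsoCls.mk (exRep o w x') ↔ IsoCls.mk x = IsoCls.mk x' := by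
  rw [mk_eq_mk_iff, mk_eq_mk_iff]
  constructor
  · rintro ⟨p, hp⟩
    refine ⟨⟨fun i => p.fwd (some i), fun i => p.bwd (some i), fun i => p.bwd_fwd (some i),
      fun i => p.fwd_bwd (some i)⟩, ?_⟩
    rw [MIso.conj_eq_iff] at hp ⊢
    intro h
    exact hp (.inl h)
  · rintro ⟨p, hp⟩
    refine ⟨⟨exMap p.fwd, exMap p.bwd, ?_, ?_⟩, ?_⟩
    · intro j
      cases j with
      | none => ext a; exact isEmptyElim a
      | some i => exact p.bwd_fwd i
    · intro j
      cases j with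
      | none => ext a; exact isEmptyElim a
      | some i => exact p.fwd_bwd i
    · rw [MIso.conj_eq_iff] at hp ⊢
      exact isHom_exMap.2 hp

theorem exCls_mk {d : I → ℕ} (x : Rep Q k d) :
    exCls o w (IsoCls.mk x) = IsoCls.mk (exRep o w x) :=
  (mk_exRep_eq_iff _ _).2 (mk_rep _)

theorem exCls_injective : Function.Injective (exCls (Q := Q) (k := k) o w) := by
  intro α β h
  have := (mk_exRep_eq_iff _ _).1 h
  rwa [mk_rep, mk_rep] at this

theorem exists_exCls {γ : IsoCls (framed Q o w) k} (h : γ.dim none = 0) :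
    ∃ α : IsoCls Q k, exCls o w α = γ := by
  have hd : γ.dim = exDim fun i => γ.dim (some i) := by
    funext j
    cases j with
    | none => exact h
    | some i => rfl
  obtain ⟨x, hx⟩ := exists_eq_mk γ hd
  let x₀ : Rep Q k (fun i => γ.dim (some i)) := fun h => x (.inl h)
  refine ⟨IsoCls.mk x₀, (exCls_mk x₀).trans (Eq.trans ?_ hx)⟩
  refine congrArg IsoCls.mk ?_
  funext a
  cases a with
  | inl a => rfl
  | inr p =>
    obtain ⟨i, l⟩ := p
    ext a b
    exfalso
    revert a b
    simp only [framed, Sum.elim_inr]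
    cases o i
    · intro a; exact isEmptyElim (show Fin (exDim (fun i => γ.dim (some i)) none) from a)
    · intro _ b; exact isEmptyElim (show Fin (exDim (fun i => γ.dim (some i)) none) from b)

theorem subC_exRep {d : I → ℕ} {x : Rep Q k d}
    {W : ∀ j, Submodule k (Fin (exDim d j) → k)} {β : IsoCls Q k} :
    SubC (n := FinD (exDim d)) (exRep o w x) W (exCls o w β) ↔
      SubC (n := FinD d) x (fun i => W (some i)) β := by
  refine (subC_iff (m := FinD (exDim β.dim)) (cl_exRep β)).trans
    (Iff.trans ?_ (subC_iff (m := FinD β.dim) (cl_rep β)).symm)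
  constructor
  · rintro ⟨y, hy, hj⟩
    refine ⟨fun i => y (some i), ?_, fun i => hj (some i)⟩
    intro h
    exact hy (.inl h)
  · rintro ⟨y, hy, hj⟩
    refine ⟨exMap y, isHom_exMap.2 hy, ?_⟩
    intro j
    cases j with
    | none => exact ⟨Function.injective_of_subsingleton _, Subsingleton.elim _ _⟩
    | some i => exact hj i

theorem quoC_exRep {d : I → ℕ} {x : Rep Q k d}
    {W : ∀ j, Submodule k (Fin (exDim d j) → k)} {α : IsoCls Q k} :
    QuoC (n := FinD (exDim d)) (exRep o w x) W (exCls o w α) ↔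
      QuoC (n := FinD d) x (fun i => W (some i)) α := by
  refine (quoC_iff (m := FinD (exDim α.dim)) (cl_exRep α)).trans
    (Iff.trans ?_ (quoC_iff (m := FinD α.dim) (cl_rep α)).symm)
  constructor
  · rintro ⟨y, hy, hj⟩
    refine ⟨fun i => y (some i), ?_, fun i => hj (some i)⟩
    intro h
    exact hy (.inl h)
  · rintro ⟨y, hy, hj⟩
    refine ⟨exMap y, isHom_exMap.2 hy, ?_⟩
    intro j
    cases j with
    | none => exact ⟨Function.surjective_to_subsingleton _, Subsingleton.elim _ _⟩
    | some i => exact hj i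

/-- Families of subspaces, extended by zero. -/
def exFam (k : Type*) [Field k] (d : I → ℕ) : (∀ j, Submodule k (Fin (exDim d j) → k)) ≃
    (∀ i, Submodule k (Fin (d i) → k)) where
  toFun W := fun i => W (some i)
  invFun W := fun j => match j with
    | none => (⊥ : Submodule k (Fin 0 → k))
    | some i => W i
  left_inv W := by
    funext j
    cases j with
    | none => exact Subsingleton.elim (α := Submodule k (Fin 0 → k)) _ _
    | some i => rfl
  right_inv W := rfl

theorem hall_exCls (α β γ : IsoCls Q k) :
    IsoCls.hall (exCls o w α) (exCls o w β) (exCls o w γ) = IsoCls.hall α β γ := by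
  rw [hall_eq_card (cl_exRep γ), hall_eq_card (cl_rep γ)]
  refine Nat.card_congr (Equiv.subtypeEquiv (exFam k γ.dim) fun W => ?_)
  rw [subC_exRep, quoC_exRep]
  rfl

theorem aut_exCls (α : IsoCls Q k) : (exCls o w α).aut = α.aut := by
  rw [aut_eq_card (cl_exRep α), aut_eq_card (cl_rep α)]
  refine Nat.card_congr ⟨fun p => ⟨⟨fun i => p.1.fwd (some i), fun i => p.1.bwd (some i),
    fun i => p.1.bwd_fwd (some i), fun i => p.1.fwd_bwd (some i)⟩, ?_⟩,
    fun p => ⟨⟨exMap p.1.fwd, exMap p.1.bwd, ?_, ?_⟩, ?_⟩, ?_, ?_⟩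
  · have hp := (MIso.conj_eq_iff _ _ _).1 p.2
    rw [MIso.conj_eq_iff]
    intro h
    exact hp (.inl h)
  · intro j
    cases j with
    | none => ext a; exact isEmptyElim a
    | some i => exact p.1.bwd_fwd i
  · intro j
    cases j with
    | none => ext a; exact isEmptyElim a
    | some i => exact p.1.fwd_bwd i
  · have hp := (MIso.conj_eq_iff _ _ _).1 p.2
    rw [MIso.conj_eq_iff]
    exact isHom_exMap.2 hp
  · intro p
    exact Subtype.ext (MIso.ext_fwd (exMap_restrict _))
  · intro p
    exact Subtype.ext (MIso.ext_fwd rfl)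

variable [Fintype I] [Fintype H]

theorem totalDim_exCls (α : IsoCls Q k) : (exCls o w α).totalDim = α.totalDim := by
  simp [IsoCls.totalDim, dim_exCls, Fintype.sum_option, exDim]

theorem euler_exDimZ (a b : I → ℤ) :
    (framed Q o w).euler (exDimZ a) (exDimZ b) = Q.euler a b := by
  have h : ∀ p : Σ i, Fin (w i), exDimZ a ((framed Q o w).s (.inr p)) *
      exDimZ b ((framed Q o w).t (.inr p)) = 0 := by
    intro p
    simp only [framed, Sum.elim_inr]
    cases o p.1 <;> simp [exDimZ]
  simp only [Quiv.euler, Fintype.sum_option, Fintype.sum_sum_type, h, Finset.sum_const_zero]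
  simp [exDimZ, framed]

theorem symEuler_exDimZ (a b : I → ℤ) :
    (framed Q o w).symEuler (exDimZ a) (exDimZ b) = Q.symEuler a b := by
  rw [Quiv.symEuler, euler_exDimZ, euler_exDimZ, Quiv.symEuler]

theorem exDimZ_add (a b : I → ℤ) : exDimZ (a + b) = exDimZ a + exDimZ b := by
  funext j; cases j <;> rfl

theorem exDimZ_neg (a : I → ℤ) : exDimZ (-a) = -exDimZ a := by
  funext j; cases j <;> rfl

theorem exDimZ_zero : exDimZ (0 : I → ℤ) = 0 := by
  funext j; cases j <;> rfl

variable [Fintype k]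

theorem exCls_zero : exCls o w (IsoCls.zero Q k) = IsoCls.zero (framed Q o w) k :=
  eq_zero_of_totalDim (by rw [totalDim_exCls, totalDim_zero])

theorem mem_range_of_hall {α β : IsoCls Q k} {γ : IsoCls (framed Q o w) k}
    (h : IsoCls.hall (exCls o w α) (exCls o w β) γ ≠ 0) : γ ∈ Set.range (exCls (Q := Q) o w) :=
  exists_exCls (by rw [hall_dim h]; rfl)

theorem mem_range_of_hall' {α β : IsoCls (framed Q o w) k} {γ : IsoCls Q k}
    (h : IsoCls.hall α β (exCls o w γ) ≠ 0) :
    α ∈ Set.range (exCls (Q := Q) o w) ∧ β ∈ Set.range (exCls (Q := Q) o w) := by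
  have e : 0 = α.dim none + β.dim none := hall_dim h none
  exact ⟨exists_exCls (by omega), exists_exCls (by omega)⟩

theorem comulCoeff_exCls (γ α β : IsoCls Q k) :
    comulCoeff (framed Q o w) k (exCls o w γ) (exCls o w α) (exCls o w β) =
      comulCoeff Q k γ α β := by
  simp only [comulCoeff, hall_exCls, aut_exCls, dimZ_exCls, euler_exDimZ]

theorem pairingR_exCls (α β : IsoCls Q k) (μ ν : I → ℤ) :
    pairingR (framed Q o w) k (exCls o w α) (exDimZ μ) (exCls o w β) (exDimZ ν) =
      pairingR Q k α μ β ν := by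
  classical
  simp only [pairingR, pairing, symEuler_exDimZ, aut_exCls, dimZ_exCls, totalDim_exCls,
    exCls_injective.eq_iff]

/-- The generators of `D_q` of a framed quiver that correspond to those of `D_q(Q)`. -/
def exGen (o : I → Bool) (w : I → ℕ) : DGen Q k → DGen (framed Q o w) k
  | .K μ => .K (exDimZ μ)
  | .uP α => .uP (exCls o w α)
  | .uM α => .uM (exCls o w α)

theorem finsum_transfer {X Y M : Type*} [AddCommMonoid M] {e : X → Y} (he : Function.Injective e)
    {f : X → M} {g : Y → M} (h : ∀ x, f x = g (e x)) (h0 : ∀ y, g y ≠ 0 → y ∈ Set.range e) :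
    ∑ᶠ x, f x = ∑ᶠ y, g y := by
  rw [finsum_congr h, ← finsum_mem_range he, finsum_mem_def]
  refine finsum_congr fun y => ?_
  by_cases hy : y ∈ Set.range e
  · rw [Set.indicator_of_mem hy]
  · rw [Set.indicator_of_notMem hy]
    by_contra h1
    exact hy (h0 y (Ne.symm h1))

theorem finite_support_hall {X : Type*} [AddCommMonoid X] [Module (Qv k) X] (α β : IsoCls Q k)
    (g : IsoCls Q k → X) :
    (Function.support fun γ => (IsoCls.hall α β γ : Qv k) • g γ).Finite := by
  refine (box Q k (α.totalDim + β.totalDim)).finite_toSet.subset fun γ hγ => ?_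
  have h : IsoCls.hall α β γ ≠ 0 := by
    intro h0
    exact hγ (by simp [h0])
  simp [totalDim_of_hall h]

theorem hall_of_comulCoeff {γ α β : IsoCls Q k} (h : comulCoeff Q k γ α β ≠ 0) :
    IsoCls.hall α β γ ≠ 0 := by
  intro h0
  exact h (by simp [comulCoeff, h0])

theorem finite_support_comul {X : Type*} [AddCommMonoid X] [Module (Qv k) X] (γ δ : IsoCls Q k)
    (c : (IsoCls Q k × IsoCls Q k) × (IsoCls Q k × IsoCls Q k) → Qv k)
    (g : (IsoCls Q k × IsoCls Q k) × (IsoCls Q k × IsoCls Q k) → X) :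
    (Function.support fun p => (comulCoeff Q k γ p.1.1 p.1.2 * comulCoeff Q k δ p.2.1 p.2.2 * c p) •
      g p).Finite := by
  classical
  set S := box Q k (γ.totalDim + δ.totalDim) with hS
  refine ((S ×ˢ S) ×ˢ (S ×ˢ S)).finite_toSet.subset fun p hp => ?_
  have h0 : comulCoeff Q k γ p.1.1 p.1.2 ≠ 0 ∧ comulCoeff Q k δ p.2.1 p.2.2 ≠ 0 := by
    constructor <;> intro h0 <;> exact hp (by simp [h0])
  have h1 := totalDim_of_hall (hall_of_comulCoeff h0.1)
  have h2 := totalDim_of_hall (hall_of_comulCoeff h0.2)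
  simp only [hS, Finset.coe_product, Set.mem_prod, Finset.mem_coe, mem_box]
  omega

/-- The map from the free algebra that induces `D_q(Q) → D_q`. -/
def exFree (o : I → Bool) (w : I → ℕ) :
    FreeAlgebra (Qv k) (DGen Q k) →ₐ[Qv k] DoubleHall (framed Q o w) k :=
  FreeAlgebra.lift (Qv k) fun x => DoubleHall.of (framed Q o w) k (exGen o w x)

theorem exFree_gen (x : DGen Q k) :
    exFree o w (gen Q k x) = DoubleHall.proj (framed Q o w) k (gen (framed Q o w) k (exGen o w x)) :=
  FreeAlgebra.lift_ι_apply _ _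

theorem proj_rel {x y : FreeAlgebra (Qv k) (DGen Q k)} (h : DRel Q k x y) :
    DoubleHall.proj Q k x = DoubleHall.proj Q k y := RingQuot.mkAlgHom_rel _ h

theorem exFree_hall_sum (α β : IsoCls Q k) (g : IsoCls Q k → DGen Q k)
    (g' : IsoCls (framed Q o w) k → DGen (framed Q o w) k)
    (hg : ∀ γ, exGen o w (g γ) = g' (exCls o w γ)) :
    exFree o w (vv k ^ Q.euler α.dimZ β.dimZ •
          ∑ᶠ γ : IsoCls Q k, (IsoCls.hall α β γ : Qv k) • gen Q k (g γ)) =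
      DoubleHall.proj (framed Q o w) k (vv k ^ (framed Q o w).euler (exCls o w α).dimZ (exCls o w β).dimZ •
          ∑ᶠ γ, (IsoCls.hall (exCls o w α) (exCls o w β) γ : Qv k) •
            gen (framed Q o w) k (g' γ)) := by
  rw [map_smul, map_smul, dimZ_exCls, dimZ_exCls, euler_exDimZ,
    map_finsum _ (finite_support_hall _ _ _), map_finsum _ (finite_support_hall _ _ _)]
  congr 1
  refine finsum_transfer exCls_injective (fun γ => ?_) fun γ hγ => mem_range_of_hall (α := α) (β := β) ?_
  · rw [map_smul, map_smul, exFree_gen, hall_exCls, hg]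
  · intro h0
    exact hγ (by simp [h0])

theorem exFree_comul_sum (γ δ : IsoCls Q k)
    (c : (IsoCls Q k × IsoCls Q k) × (IsoCls Q k × IsoCls Q k) → Qv k)
    (g : (IsoCls Q k × IsoCls Q k) × (IsoCls Q k × IsoCls Q k) → FreeAlgebra (Qv k) (DGen Q k))
    (c' : (IsoCls (framed Q o w) k × IsoCls (framed Q o w) k) ×
      (IsoCls (framed Q o w) k × IsoCls (framed Q o w) k) → Qv k)
    (g' : (IsoCls (framed Q o w) k × IsoCls (framed Q o w) k) ×
      (IsoCls (framed Q o w) k × IsoCls (framed Q o w) k) →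
        FreeAlgebra (Qv k) (DGen (framed Q o w) k))
    (hc : ∀ a b a' b', c ((a, b), (a', b')) =
      c' ((exCls o w a, exCls o w b), (exCls o w a', exCls o w b')))
    (hg : ∀ a b a' b', exFree o w (g ((a, b), (a', b'))) = DoubleHall.proj (framed Q o w) k
      (g' ((exCls o w a, exCls o w b), (exCls o w a', exCls o w b')))) :
    exFree o w (∑ᶠ p : (IsoCls Q k × IsoCls Q k) × (IsoCls Q k × IsoCls Q k),
        (comulCoeff Q k γ p.1.1 p.1.2 * comulCoeff Q k δ p.2.1 p.2.2 * c p) • g p) =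
      DoubleHall.proj (framed Q o w) k
        (∑ᶠ p : (IsoCls (framed Q o w) k × IsoCls (framed Q o w) k) ×
          (IsoCls (framed Q o w) k × IsoCls (framed Q o w) k),
        (comulCoeff (framed Q o w) k (exCls o w γ) p.1.1 p.1.2 *
          comulCoeff (framed Q o w) k (exCls o w δ) p.2.1 p.2.2 * c' p) • g' p) := by
  rw [map_finsum _ (finite_support_comul _ _ _ _), map_finsum _ (finite_support_comul _ _ _ _)]
  have hi := exCls_injective (Q := Q) (k := k) (o := o) (w := w)
  refine finsum_transfer ((hi.prodMap hi).prodMap (hi.prodMap hi)) ?_ ?_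
  · rintro ⟨⟨a, b⟩, a', b'⟩
    simp only [Prod.map_apply]
    rw [map_smul, map_smul, comulCoeff_exCls, comulCoeff_exCls, hg, hc]
  · rintro ⟨⟨a, b⟩, a', b'⟩ hp
    have h0 : comulCoeff (framed Q o w) k (exCls o w γ) a b ≠ 0 ∧
        comulCoeff (framed Q o w) k (exCls o w δ) a' b' ≠ 0 := by
      constructor <;> intro h0 <;> exact hp (by simp [h0])
    obtain ⟨⟨x, rfl⟩, ⟨y, rfl⟩⟩ := mem_range_of_hall' (hall_of_comulCoeff h0.1)
    obtain ⟨⟨z, rfl⟩, ⟨t, rfl⟩⟩ := mem_range_of_hall' (hall_of_comulCoeff h0.2)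
    exact ⟨((x, y), (z, t)), rfl⟩

theorem exFree_rel {x y : FreeAlgebra (Qv k) (DGen Q k)} (h : DRel Q k x y) :
    exFree o w x = exFree o w y := by
  induction h with
  | K_zero =>
    rw [exFree_gen, map_one, exGen, exDimZ_zero, proj_rel DRel.K_zero, map_one]
  | uP_zero =>
    rw [exFree_gen, map_one, exGen, exCls_zero, proj_rel DRel.uP_zero, map_one]
  | uM_zero =>
    rw [exFree_gen, map_one, exGen, exCls_zero, proj_rel DRel.uM_zero, map_one]
  | K_mul μ ν =>
    rw [map_mul, exFree_gen, exFree_gen, exFree_gen, ← map_mul]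
    simp only [exGen]
    rw [proj_rel (DRel.K_mul _ _), exDimZ_add]
  | K_uP μ α =>
    rw [map_smul, map_mul, map_mul, exFree_gen, exFree_gen, ← map_mul]
    simp only [exGen]
    rw [proj_rel (DRel.K_uP _ _), map_smul, map_mul, dimZ_exCls, symEuler_exDimZ]
  | K_uM μ α =>
    rw [map_smul, map_mul, map_mul, exFree_gen, exFree_gen, ← map_mul]
    simp only [exGen]
    rw [proj_rel (DRel.K_uM _ _), map_smul, map_mul, dimZ_exCls, symEuler_exDimZ]
  | uP_mul α β =>
    rw [exFree_hall_sum α β _ DGen.uP (fun _ => rfl), map_mul, exFree_gen, exFree_gen, ← map_mul]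
    exact proj_rel (DRel.uP_mul _ _)
  | uM_mul α β =>
    rw [exFree_hall_sum α β _ DGen.uM (fun _ => rfl), map_mul, exFree_gen, exFree_gen, ← map_mul]
    exact proj_rel (DRel.uM_mul _ _)
  | cross γ δ =>
    have h := proj_rel (DRel.cross (Q := framed Q o w) (exCls o w γ) (exCls o w δ))
    refine Eq.trans ?_ (Eq.trans h (Eq.symm ?_))
    · refine exFree_comul_sum γ δ (fun p => pairingR Q k p.1.1 p.1.2.dimZ p.2.2 0)
        (fun p => (gen Q k (.uM p.2.1) * gen Q k (.K (-p.2.2.dimZ))) * gen Q k (.uP p.1.2))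
        (fun p => pairingR (framed Q o w) k p.1.1 p.1.2.dimZ p.2.2 0)
        (fun p => (gen (framed Q o w) k (.uM p.2.1) * gen (framed Q o w) k (.K (-p.2.2.dimZ))) *
          gen (framed Q o w) k (.uP p.1.2)) (fun a b a' b' => ?_) (fun a b a' b' => ?_)
      · rw [← pairingR_exCls (o := o) (w := w), exDimZ_zero, dimZ_exCls]
      · simp only [map_mul, exFree_gen, exGen, dimZ_exCls, exDimZ_neg]
    · refine exFree_comul_sum γ δ (fun p => pairingR Q k p.1.2 0 p.2.1 (-p.2.2.dimZ))
        (fun p => (gen Q k (.uP p.1.1) * gen Q k (.K p.1.2.dimZ)) * gen Q k (.uM p.2.2))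
        (fun p => pairingR (framed Q o w) k p.1.2 0 p.2.1 (-p.2.2.dimZ))
        (fun p => (gen (framed Q o w) k (.uP p.1.1) * gen (framed Q o w) k (.K p.1.2.dimZ)) *
          gen (framed Q o w) k (.uM p.2.2)) (fun a b a' b' => ?_) (fun a b a' b' => ?_)
      · rw [← pairingR_exCls (o := o) (w := w), exDimZ_zero, dimZ_exCls, exDimZ_neg]
      · simp only [map_mul, exFree_gen, exGen, dimZ_exCls]

/-- The algebra homomorphism from `D_q(Q)` to `D_q` of a framed quiver. -/
def exHom (o : I → Bool) (w : I → ℕ) : DoubleHall Q k →ₐ[Qv k] DoubleHall (framed Q o w) k :=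
  RingQuot.liftAlgHom (Qv k) ⟨exFree o w, fun _ _ h => exFree_rel h⟩

/-- The action of `D_q(Q)` on the Hall space of a framed quiver. -/
def repQ (o : I → Bool) (w : I → ℕ) :
    DoubleHall Q k →ₐ[Qv k] Module.End ℂ (HallSp (framed Q o w) k) :=
  (repD (framed Q o w) k).comp (exHom o w)

theorem repQ_of (x : DGen Q k) : repQ o w (DoubleHall.of Q k x) = repGen (exGen o w x) := by
  rw [← repD_of]
  refine congrArg (repD (framed Q o w) k) ?_
  exact (RingQuot.liftAlgHom_mkAlgHom_apply _ _ _ _).trans (exFree_gen x)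

end Framed

end RingelHall
end

noncomputable section
namespace RingelHall

/-! ## Fourier transforms and morphisms -/

section Edge

variable {k : Type*} [Field k] [Fintype k] [DecidableEq k]

theorem trPair_eq {m n : ℕ} (x : Matrix (Fin m) (Fin n) k) (y : Matrix (Fin n) (Fin m) k) :
    trPair x y = (x * y).trace := rfl

theorem sum_char_trace {ψ : AddChar k ℂ} (hψ : ψ ≠ 1) {m n : ℕ} (M : Matrix (Fin n) (Fin m) k) :
    ∑ η : Matrix (Fin m) (Fin n) k, ψ (η * M).trace =
      if M = 0 then (Fintype.card k : ℂ) ^ (m * n) else 0 := by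
  classical
  let χ : AddChar (Matrix (Fin m) (Fin n) k) ℂ :=
    { toFun := fun η => ψ (η * M).trace
      map_zero_eq_one' := by simp
      map_add_eq_mul' := fun a b => by
        rw [Matrix.add_mul, Matrix.trace_add, AddChar.map_add_eq_mul] }
  have h := AddChar.sum_eq_ite χ
  have hc : (Fintype.card (Matrix (Fin m) (Fin n) k) : ℂ) = (Fintype.card k : ℂ) ^ (m * n) := by
    have h1 : Fintype.card (Matrix (Fin m) (Fin n) k) = Fintype.card (Fin m → Fin n → k) :=
      Fintype.card_congr (Equiv.refl _)
    rw [h1]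
    simp [← pow_mul, mul_comm]
  rw [show ∑ η : Matrix (Fin m) (Fin n) k, ψ (η * M).trace = ∑ η, χ η from rfl, h, hc]
  have e : χ = 0 ↔ M = 0 := by
    constructor
    · intro h0
      by_contra hM
      obtain ⟨i, j, hij⟩ : ∃ i j, M i j ≠ 0 := by
        by_contra hn
        push Not at hn
        exact hM (Matrix.ext hn)
      refine hψ (DFunLike.ext _ _ fun c => ?_)
      have h1 : χ (Matrix.single j i (c / M i j)) = 1 := by rw [h0]; rfl
      have h2 : χ (Matrix.single j i (c / M i j)) = ψ c := by
        show ψ (Matrix.trace (Matrix.single j i (c / M i j) * M)) = _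
        rw [Matrix.trace_single_mul]
        simp [hij]
      rw [AddChar.one_apply, ← h2, h1]
    · rintro rfl
      refine DFunLike.ext _ _ fun η => ?_
      show ψ (Matrix.trace (η * 0)) = 1
      simp
  simp only [e]

theorem sum_char_dual {ψ : AddChar k ℂ} (hψ : ψ ≠ 1) {r r' p : ℕ}
    (A : Matrix (Fin r') (Fin r) k) (M : Matrix (Fin r') (Fin p) k) (ξ : Matrix (Fin p) (Fin r) k) :
    (Fintype.card k : ℂ) ^ (p * r') *
        ∑ x : Matrix (Fin r) (Fin p) k, (if M = A * x then ψ (x * ξ).trace else 0) =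
      (Fintype.card k : ℂ) ^ (r * p) *
        ∑ η : Matrix (Fin p) (Fin r') k, (if η * A = ξ then ψ (η * M).trace else 0) := by
  have h1 : (Fintype.card k : ℂ) ^ (p * r') *
      ∑ x : Matrix (Fin r) (Fin p) k, (if M = A * x then ψ (x * ξ).trace else 0) =
      ∑ x : Matrix (Fin r) (Fin p) k, ∑ η : Matrix (Fin p) (Fin r') k,
        ψ (x * ξ).trace * ψ (η * (M - A * x)).trace := by
    rw [Finset.mul_sum]
    refine Finset.sum_congr rfl fun x _ => ?_
    rw [← Finset.mul_sum, sum_char_trace hψ]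
    simp only [sub_eq_zero]
    split_ifs <;> ring
  have h2 : (Fintype.card k : ℂ) ^ (r * p) *
      ∑ η : Matrix (Fin p) (Fin r') k, (if η * A = ξ then ψ (η * M).trace else 0) =
      ∑ η : Matrix (Fin p) (Fin r') k, ∑ x : Matrix (Fin r) (Fin p) k,
        ψ (η * M).trace * ψ (x * (ξ - η * A)).trace := by
    rw [Finset.mul_sum]
    refine Finset.sum_congr rfl fun η _ => ?_
    rw [← Finset.mul_sum, sum_char_trace hψ]
    simp only [sub_eq_zero, eq_comm (a := ξ)]
    split_ifs <;> ring
  rw [h1, h2, Finset.sum_comm]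
  refine Finset.sum_congr rfl fun η _ => Finset.sum_congr rfl fun x _ => ?_
  rw [← AddChar.map_add_eq_mul, ← AddChar.map_add_eq_mul]
  congr 1
  have : (η * (A * x)).trace = (x * (η * A)).trace := by
    rw [← Matrix.mul_assoc, Matrix.trace_mul_comm]
  rw [Matrix.mul_sub, Matrix.mul_sub, Matrix.trace_sub, Matrix.trace_sub, this]
  ring

theorem exists_inverse_of_bijective {m n : ℕ} {A : Matrix (Fin m) (Fin n) k}
    (hA : Function.Bijective A.mulVec) :
    m = n ∧ ∃ A' : Matrix (Fin n) (Fin m) k, A' * A = 1 ∧ A * A' = 1 := by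
  let e : (Fin n → k) ≃ₗ[k] (Fin m → k) := LinearEquiv.ofBijective A.mulVecLin hA
  refine ⟨by simpa using e.finrank_eq.symm, LinearMap.toMatrix' e.symm.toLinearMap, ?_, ?_⟩
  · rw [← Matrix.toLin'.injective.eq_iff, Matrix.toLin'_mul, Matrix.toLin'_toMatrix',
      Matrix.toLin'_one]
    ext v
    exact congrFun (e.symm_apply_apply _) _
  · rw [← Matrix.toLin'.injective.eq_iff, Matrix.toLin'_mul, Matrix.toLin'_toMatrix',
      Matrix.toLin'_one]
    ext v
    exact congrFun (e.apply_symm_apply _) _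

theorem vC_pow_two_mul (n : ℕ) : vC k ^ (2 * n) = (Fintype.card k : ℂ) ^ n := by
  rw [pow_mul, vC_sq]

theorem sum_char_hom {ψ : AddChar k ℂ} (hψ : ψ ≠ 1) {r r' p p' : ℕ}
    (A : Matrix (Fin r') (Fin r) k) (B : Matrix (Fin p') (Fin p) k)
    (h : Function.Bijective A.mulVec ∨ Function.Bijective B.mulVec)
    (x' : Matrix (Fin r') (Fin p') k) (ξ : Matrix (Fin p) (Fin r) k) :
    ∑ x : Matrix (Fin r) (Fin p) k,
        (if x' * B = A * x then (vC k ^ (p * r))⁻¹ * ψ (x * ξ).trace else 0) =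
      vC k ^ ((r * p' : ℤ) - r' * p) * ∑ ξ' : Matrix (Fin p') (Fin r') k,
        (if ξ' * A = B * ξ then (vC k ^ (p' * r'))⁻¹ * ψ (x' * ξ').trace else 0) := by
  have hv : vC k ≠ 0 := vC_ne_zero
  rcases h with hA | hB
  · obtain ⟨rfl, A', h1, h2⟩ := exists_inverse_of_bijective hA
    have e1 : ∀ x : Matrix (Fin r') (Fin p) k, x' * B = A * x ↔ x = A' * (x' * B) := fun x =>
      ⟨fun h => by rw [h, ← Matrix.mul_assoc, h1, Matrix.one_mul],
        fun h => by rw [h, ← Matrix.mul_assoc A, h2, Matrix.one_mul]⟩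
    have e2 : ∀ ξ' : Matrix (Fin p') (Fin r') k, ξ' * A = B * ξ ↔ ξ' = B * ξ * A' := fun ξ' =>
      ⟨fun h => by rw [← h, Matrix.mul_assoc, h2, Matrix.mul_one],
        fun h => by rw [h, Matrix.mul_assoc, h1, Matrix.mul_one]⟩
    simp only [e1, e2, Finset.sum_ite_eq', Finset.mem_univ, if_true]
    have e3 : (A' * (x' * B) * ξ).trace = (x' * (B * ξ * A')).trace := by
      rw [Matrix.mul_assoc, Matrix.trace_mul_comm, Matrix.mul_assoc, Matrix.mul_assoc,
        Matrix.mul_assoc]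
    rw [e3, ← mul_assoc]
    congr 1
    rw [← zpow_natCast, ← zpow_natCast, ← zpow_neg, ← zpow_neg, ← zpow_add₀ hv]
    congr 1
    push_cast
    ring
  · obtain ⟨rfl, B', h1, h2⟩ := exists_inverse_of_bijective hB
    have hd := sum_char_dual hψ A (x' * B) ξ
    have e : ∑ ξ' : Matrix (Fin p') (Fin r') k,
        (if ξ' * A = B * ξ then (vC k ^ (p' * r'))⁻¹ * ψ (x' * ξ').trace else 0) =
        (vC k ^ (p' * r'))⁻¹ * ∑ η : Matrix (Fin p') (Fin r') k,
          (if η * A = ξ then ψ (η * (x' * B)).trace else 0) := by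
      rw [Finset.mul_sum]
      refine (Fintype.sum_equiv ⟨fun η => B * η, fun ξ' => B' * ξ',
        fun η => by simp [← Matrix.mul_assoc, h1], fun η => by simp [← Matrix.mul_assoc, h2]⟩
        _ _ fun η => ?_).symm
      have e1 : B * η * A = B * ξ ↔ η * A = ξ := by
        constructor
        · intro h
          have h3 := congrArg (fun M => B' * M) h
          simpa only [← Matrix.mul_assoc, h1, Matrix.one_mul] using h3
        · intro h
          rw [Matrix.mul_assoc, h]
      simp only [Equiv.coe_fn_mk, e1]
      rw [Matrix.trace_mul_comm η, Matrix.mul_assoc]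
      split_ifs <;> simp
    have hq : (Fintype.card k : ℂ) ^ (p' * r') ≠ 0 := pow_ne_zero _ card_ne_zero'
    rw [e]
    have e4 : ∑ x : Matrix (Fin r) (Fin p') k,
        (if x' * B = A * x then (vC k ^ (p' * r))⁻¹ * ψ (x * ξ).trace else 0) =
        (vC k ^ (p' * r))⁻¹ * ∑ x : Matrix (Fin r) (Fin p') k,
          (if x' * B = A * x then ψ (x * ξ).trace else 0) := by
      rw [Finset.mul_sum]
      exact Finset.sum_congr rfl fun x _ => by split_ifs <;> simp
    rw [e4]
    refine mul_left_cancel₀ hq ?_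
    rw [mul_left_comm, hd, ← mul_assoc, ← mul_assoc, ← mul_assoc]
    congr 1
    rw [← vC_pow_two_mul, ← vC_pow_two_mul, ← zpow_natCast, ← zpow_natCast, ← zpow_natCast,
      ← zpow_natCast, ← zpow_neg, ← zpow_neg, ← zpow_add₀ hv, ← zpow_add₀ hv, ← zpow_add₀ hv]
    congr 1
    push_cast
    ring

/-- The exponent of `v` in the commutation of graded maps with the transform along one edge. -/
def edgeExp {J : Type*} (d d' : J → ℕ) (p r : J) : Bool → Bool → ℤ
  | false, false => 0
  | true, true => 0
  | false, true => d r * d' p - d' r * d p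
  | true, false => d p * d' r - d' p * d r

theorem sum_ite_diag {X X' : Type*} [Fintype X] [Fintype X'] [DecidableEq X] [DecidableEq X']
    (ξ : X) (x' : X') (P : X → Prop) (P' : X' → Prop) [DecidablePred P] [DecidablePred P']
    (h : P ξ ↔ P' x') :
    ∑ x, (if P x then if x = ξ then (1 : ℂ) else 0 else 0) =
      ∑ y, if P' y then if x' = y then (1 : ℂ) else 0 else 0 := by
  rw [Finset.sum_eq_single ξ, Finset.sum_eq_single x']
  · simp [h]
  · intro y _ hn
    simp [hn.symm]
  · simp
  · intro x _ hn
    simp [hn]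
  · simp

theorem edgeKernel_hom {J : Type*} {ψ : AddChar k ℂ} (hψ : ψ ≠ 1) {d d' : J → ℕ} (p r : J)
    (y : GrMap k d d') (h : Function.Bijective (y p).mulVec ∨ Function.Bijective (y r).mulVec)
    (a b : Bool)
    (x' : Matrix (Fin (d' (bif a then p else r))) (Fin (d' (bif a then r else p))) k)
    (ξ : Matrix (Fin (d (bif b then p else r))) (Fin (d (bif b then r else p))) k) :
    ∑ x, (if x' * y (bif a then r else p) = y (bif a then p else r) * x then
        edgeKernel ψ d p r a b x ξ else 0) =
      vC k ^ edgeExp d d' p r a b *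
      ∑ ξ', (if ξ' * y (bif b then r else p) = y (bif b then p else r) * ξ then
        edgeKernel ψ d' p r a b x' ξ' else 0) := by
  cases a <;> cases b
  · simp only [edgeKernel, edgeExp, cond_false, zpow_zero, one_mul]
    exact sum_ite_diag ξ x' _ _ Iff.rfl
  · simp only [edgeKernel, edgeExp, cond_false, cond_true, trPair_eq]
    exact sum_char_hom hψ (y r) (y p) h.symm x' ξ
  · simp only [edgeKernel, edgeExp, cond_false, cond_true, trPair_eq]
    have := sum_char_hom (inv_ne_one.2 hψ) (y p) (y r) h x' ξ
    simp only [AddChar.inv_apply] at this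
    rw [mul_comm (d r) (d p), mul_comm (d' r) (d' p)] at this
    exact this
  · simp only [edgeKernel, edgeExp, cond_true, zpow_zero, one_mul]
    exact sum_ite_diag ξ x' _ _ Iff.rfl

theorem edgeKernel_symm {J : Type*} (ψ : AddChar k ℂ) (d : J → ℕ) (p r : J) (a b : Bool)
    (x : Matrix (Fin (d (bif a then p else r))) (Fin (d (bif a then r else p))) k)
    (y : Matrix (Fin (d (bif b then p else r))) (Fin (d (bif b then r else p))) k) :
    edgeKernel ψ⁻¹ d p r b a y x = edgeKernel ψ d p r a b x y := by
  cases a <;> cases b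
  · simp only [edgeKernel, eq_comm]
  · simp only [edgeKernel, AddChar.inv_apply, trPair_eq, neg_neg]
    rw [Matrix.trace_mul_comm]
  · simp only [edgeKernel, AddChar.inv_apply, trPair_eq]
    rw [Matrix.trace_mul_comm]
  · simp only [edgeKernel, eq_comm]

theorem edgeKernel_inv {J : Type*} {ψ : AddChar k ℂ} (hψ : ψ ≠ 1) (d : J → ℕ) (p r : J)
    (a b : Bool)
    (x z : Matrix (Fin (d (bif a then p else r))) (Fin (d (bif a then r else p))) k) :
    ∑ y, edgeKernel ψ d p r b a y z * edgeKernel ψ d p r a b x y = if x = z then 1 else 0 := by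
  have main : ∀ {ψ : AddChar k ℂ} (_ : ψ ≠ 1) {m n : ℕ} (x z : Matrix (Fin m) (Fin n) k),
      ∑ y : Matrix (Fin n) (Fin m) k, (vC k ^ (n * m))⁻¹ * ψ (-(y * z).trace) *
        ((vC k ^ (n * m))⁻¹ * ψ (x * y).trace) = if x = z then 1 else 0 := by
    intro ψ hψ m n x z
    have e : ∀ y : Matrix (Fin n) (Fin m) k, (vC k ^ (n * m))⁻¹ * ψ (-(y * z).trace) *
        ((vC k ^ (n * m))⁻¹ * ψ (x * y).trace) =
        ((Fintype.card k : ℂ) ^ (n * m))⁻¹ * ψ (y * (x - z)).trace := by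
      intro y
      rw [Matrix.mul_sub, Matrix.trace_sub, sub_eq_neg_add, AddChar.map_add_eq_mul,
        Matrix.trace_mul_comm x, ← vC_pow_two_mul, two_mul, pow_add, mul_inv]
      ring
    rw [Finset.sum_congr rfl fun y _ => e y, ← Finset.mul_sum, sum_char_trace hψ]
    have hq : (Fintype.card k : ℂ) ^ (n * m) ≠ 0 := pow_ne_zero _ card_ne_zero'
    simp only [sub_eq_zero]
    split_ifs
    · rw [inv_mul_cancel₀ hq]
    · rw [mul_zero]
  cases a <;> cases b
  · simp only [edgeKernel]
    rw [Finset.sum_eq_single x]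
    · simp
    · intro y _ hn
      simp [hn.symm]
    · simp
  · simp only [edgeKernel, trPair_eq]
    exact main hψ x z
  · simp only [edgeKernel, trPair_eq]
    have h := main (inv_ne_one.2 hψ) x z
    simp only [AddChar.inv_apply, neg_neg] at h
    rw [mul_comm (d p) (d r)]
    exact h
  · simp only [edgeKernel]
    rw [Finset.sum_eq_single x]
    · simp
    · intro y _ hn
      simp [hn.symm]
    · simp

end Edge

section Transform

variable {I H : Type*} [Fintype I] [DecidableEq I] [Fintype H] [DecidableEq H] (Q : Quiv I H)
  {k : Type*} [Field k] [Fintype k] [DecidableEq k]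

/-- The Fourier transform of an arbitrary function. -/
def ft (ψ : AddChar k ℂ) (Ω Ω' : H ⊕ I → Bool) {ν w : I → ℕ} :
    (HRep Q k Ω ν w → ℂ) →ₗ[ℂ] (HRep Q k Ω' ν w → ℂ) where
  toFun f x' := ∑ x, kernel Q ψ Ω Ω' x x' * f x
  map_add' f f' := by
    ext x'
    simp [mul_add, Finset.sum_add_distrib]
  map_smul' c f := by
    ext x'
    simp [Finset.mul_sum, mul_left_comm]

theorem coe_fourier (ψ : AddChar k ℂ) (Ω Ω' : H ⊕ I → Bool) {ν w : I → ℕ}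
    (f : InvFun Q k Ω ν w) : (fourier Q ψ Ω Ω' ν w f).1 = ft Q ψ Ω Ω' f.1 := rfl

variable {Q}

theorem ft_ft {ψ : AddChar k ℂ} (hψ : ψ ≠ 1) (Ω Ω' : H ⊕ I → Bool) {ν w : I → ℕ}
    (f : HRep Q k Ω ν w → ℂ) : ft Q ψ Ω' Ω (ft Q ψ Ω Ω' f) = f := by
  funext z
  show ∑ y, kernel Q ψ Ω' Ω y z * ∑ x, kernel Q ψ Ω Ω' x y * f x = f z
  simp only [Finset.mul_sum]
  rw [Finset.sum_comm]
  have e : ∀ x : HRep Q k Ω ν w, ∑ y, kernel Q ψ Ω' Ω y z * kernel Q ψ Ω Ω' x y =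
      if x = z then 1 else 0 := by
    intro x
    simp only [kernel, ← Finset.prod_mul_distrib]
    have h1 := fun h => edgeKernel_inv hψ (Sum.elim ν w) (Q.enlarge.s h) (Q.enlarge.t h) (Ω h)
      (Ω' h) (x h) (z h)
    have h2 : (if x = z then (1 : ℂ) else 0) = ∏ h, if x h = z h then (1 : ℂ) else 0 := by
      rw [Finset.prod_ite_zero]
      simp [funext_iff]
    rw [h2]
    refine Eq.trans ?_ (Finset.prod_congr rfl fun h _ => h1 h)
    rw [Finset.prod_univ_sum, Fintype.piFinset_univ]
    rfl
  simp only [← mul_assoc, ← Finset.sum_mul, e]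
  simp

/-- The exponent of `v` in the commutation of graded maps with the Fourier transform. -/
def homExp (Q : Quiv I H) (Ω Ω' : H ⊕ I → Bool) (ν ν' w : I → ℕ) : ℤ :=
  ∑ h, edgeExp (Sum.elim ν w) (Sum.elim ν' w) (Q.enlarge.s h) (Q.enlarge.t h) (Ω h) (Ω' h)

/-- At every edge, one of the components of `y` is invertible. -/
def EdgeInv (Q : Quiv I H) {ν ν' w : I → ℕ} (y : GrMap k (Sum.elim ν w) (Sum.elim ν' w)) : Prop :=
  ∀ h, Function.Bijective (y (Q.enlarge.s h)).mulVec ∨ Function.Bijective (y (Q.enlarge.t h)).mulVec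

open Classical in
theorem kernel_hom {ψ : AddChar k ℂ} (hψ : ψ ≠ 1) (Ω Ω' : H ⊕ I → Bool) {ν ν' w : I → ℕ}
    {y : GrMap k (Sum.elim ν w) (Sum.elim ν' w)} (hy : EdgeInv Q y)
    (x' : HRep Q k Ω ν' w) (ξ : HRep Q k Ω' ν w) :
    ∑ x : HRep Q k Ω ν w, (if IsHom x x' y then kernel Q ψ Ω Ω' x ξ else 0) =
      vC k ^ homExp Q Ω Ω' ν ν' w *
        ∑ ξ' : HRep Q k Ω' ν' w, (if IsHom ξ ξ' y then kernel Q ψ Ω Ω' x' ξ' else 0) := by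
  have h1 := fun h => edgeKernel_hom hψ (Q.enlarge.s h) (Q.enlarge.t h) y (hy h) (Ω h) (Ω' h)
    (x' h) (ξ h)
  have hp := Finset.prod_congr (rfl : (Finset.univ : Finset (H ⊕ I)) = Finset.univ)
    fun h _ => h1 h
  rw [Finset.prod_mul_distrib, Finset.prod_univ_sum, Finset.prod_univ_sum, Fintype.piFinset_univ,
    Fintype.piFinset_univ] at hp
  have hz : ∏ h, vC k ^ edgeExp (Sum.elim ν w) (Sum.elim ν' w) (Q.enlarge.s h) (Q.enlarge.t h)
      (Ω h) (Ω' h) = vC k ^ homExp Q Ω Ω' ν ν' w := by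
    rw [homExp]
    induction (Finset.univ : Finset (H ⊕ I)) using Finset.induction_on with
    | empty => simp
    | insert a s ha ih => rw [Finset.prod_insert ha, Finset.sum_insert ha, zpow_add₀ vC_ne_zero, ih]
  rw [hz] at hp
  refine Eq.trans (Finset.sum_congr rfl fun x _ => ?_) (Eq.trans hp
    (congrArg _ (Finset.sum_congr rfl fun ξ' _ => Eq.symm ?_)))
  · rw [Finset.prod_ite_zero]
    simp only [Finset.mem_univ, true_imp_iff]
    exact if_congr Iff.rfl rfl rfl
  · rw [Finset.prod_ite_zero]
    simp only [Finset.mem_univ, true_imp_iff]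
    exact if_congr Iff.rfl rfl rfl

open Classical in
/-- Summation over the targets of morphisms with given underlying map. -/
def pull {Ω : H ⊕ I → Bool} {ν ν' w : I → ℕ} (y : GrMap k (Sum.elim ν w) (Sum.elim ν' w)) :
    (HRep Q k Ω ν' w → ℂ) →ₗ[ℂ] (HRep Q k Ω ν w → ℂ) where
  toFun f x := ∑ x', if IsHom x x' y then f x' else 0
  map_add' f f' := by
    ext x
    simp only [Pi.add_apply, ← Finset.sum_add_distrib]
    exact Finset.sum_congr rfl fun _ _ => by split_ifs <;> simp
  map_smul' c f := by
    ext x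
    simp [Finset.mul_sum]

open Classical in
/-- Summation over the sources of morphisms with given underlying map. -/
def push {Ω : H ⊕ I → Bool} {ν ν' w : I → ℕ} (y : GrMap k (Sum.elim ν w) (Sum.elim ν' w)) :
    (HRep Q k Ω ν w → ℂ) →ₗ[ℂ] (HRep Q k Ω ν' w → ℂ) where
  toFun f x' := ∑ x, if IsHom x x' y then f x else 0
  map_add' f f' := by
    ext x
    simp only [Pi.add_apply, ← Finset.sum_add_distrib]
    exact Finset.sum_congr rfl fun _ _ => by split_ifs <;> simp
  map_smul' c f := by
    ext x
    simp [Finset.mul_sum]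

theorem ft_pull {ψ : AddChar k ℂ} (hψ : ψ ≠ 1) (Ω Ω' : H ⊕ I → Bool) {ν ν' w : I → ℕ}
    {y : GrMap k (Sum.elim ν w) (Sum.elim ν' w)} (hy : EdgeInv Q y) (f : HRep Q k Ω ν' w → ℂ) :
    ft Q ψ Ω Ω' (pull y f) = vC k ^ homExp Q Ω Ω' ν ν' w • pull y (ft Q ψ Ω Ω' f) := by
  classical
  funext ξ
  show ∑ x, kernel Q ψ Ω Ω' x ξ * ∑ x', (if IsHom x x' y then f x' else 0) =
    vC k ^ homExp Q Ω Ω' ν ν' w * ∑ ξ', if IsHom ξ ξ' y then ∑ x', kernel Q ψ Ω Ω' x' ξ' * f x' else 0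
  have e1 : ∑ x, kernel Q ψ Ω Ω' x ξ * ∑ x', (if IsHom x x' y then f x' else 0) =
      ∑ x', (∑ x, if IsHom x x' y then kernel Q ψ Ω Ω' x ξ else 0) * f x' := by
    simp only [Finset.mul_sum, Finset.sum_mul]
    rw [Finset.sum_comm]
    exact Finset.sum_congr rfl fun _ _ => Finset.sum_congr rfl fun _ _ => by split_ifs <;> simp
  have e2 : (∑ ξ', if IsHom ξ ξ' y then ∑ x', kernel Q ψ Ω Ω' x' ξ' * f x' else 0) =
      ∑ x', (∑ ξ', if IsHom ξ ξ' y then kernel Q ψ Ω Ω' x' ξ' else 0) * f x' := by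
    simp only [Finset.sum_mul]
    rw [Finset.sum_comm]
    refine Finset.sum_congr rfl fun _ _ => ?_
    split_ifs <;> simp
  rw [e1, e2, Finset.mul_sum]
  refine Finset.sum_congr rfl fun x' _ => ?_
  rw [kernel_hom hψ Ω Ω' hy, mul_assoc]

theorem kernel_symm (ψ : AddChar k ℂ) (Ω Ω' : H ⊕ I → Bool) {ν w : I → ℕ}
    (x : HRep Q k Ω ν w) (ξ : HRep Q k Ω' ν w) :
    kernel Q ψ⁻¹ Ω' Ω ξ x = kernel Q ψ Ω Ω' x ξ :=
  Finset.prod_congr rfl fun _ _ => edgeKernel_symm _ _ _ _ _ _ _ _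

theorem ft_push {ψ : AddChar k ℂ} (hψ : ψ ≠ 1) (Ω Ω' : H ⊕ I → Bool) {ν ν' w : I → ℕ}
    {y : GrMap k (Sum.elim ν w) (Sum.elim ν' w)} (hy : EdgeInv Q y) (f : HRep Q k Ω ν w → ℂ) :
    ft Q ψ Ω Ω' (push y f) = (vC k ^ homExp Q Ω' Ω ν ν' w)⁻¹ • push y (ft Q ψ Ω Ω' f) := by
  classical
  funext ξ'
  show ∑ x', kernel Q ψ Ω Ω' x' ξ' * ∑ x, (if IsHom x x' y then f x else 0) =
    (vC k ^ homExp Q Ω' Ω ν ν' w)⁻¹ *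
      ∑ ξ, if IsHom ξ ξ' y then ∑ x, kernel Q ψ Ω Ω' x ξ * f x else 0
  have e1 : ∑ x', kernel Q ψ Ω Ω' x' ξ' * ∑ x, (if IsHom x x' y then f x else 0) =
      ∑ x, (∑ x', if IsHom x x' y then kernel Q ψ Ω Ω' x' ξ' else 0) * f x := by
    simp only [Finset.mul_sum, Finset.sum_mul]
    rw [Finset.sum_comm]
    exact Finset.sum_congr rfl fun _ _ => Finset.sum_congr rfl fun _ _ => by split_ifs <;> simp
  have e2 : (∑ ξ, if IsHom ξ ξ' y then ∑ x, kernel Q ψ Ω Ω' x ξ * f x else 0) =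
      ∑ x, (∑ ξ, if IsHom ξ ξ' y then kernel Q ψ Ω Ω' x ξ else 0) * f x := by
    simp only [Finset.sum_mul]
    rw [Finset.sum_comm]
    refine Finset.sum_congr rfl fun _ _ => ?_
    split_ifs <;> simp
  rw [e1, e2, Finset.mul_sum]
  refine Finset.sum_congr rfl fun x _ => ?_
  have h := kernel_hom (Q := Q) (inv_ne_one.2 hψ) Ω' Ω hy ξ' x
  simp only [kernel_symm] at h
  rw [h, ← mul_assoc, inv_mul_cancel_left₀ (zpow_ne_zero _ vC_ne_zero)]

end Transform

end RingelHall
end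

noncomputable section
namespace RingelHall

/-! ## Subrepresentations and quotients of dimension one -/

section SimpleClass

variable {J A k : Type*} [Field k] {Γ : Quiv J A} [DecidableEq J]

variable {n n' : J → Type}
  [∀ j, Fintype (n j)] [∀ j, DecidableEq (n j)]
  [∀ j, Fintype (n' j)] [∀ j, DecidableEq (n' j)]

theorem exists_matrix_ker {a : Type} [Fintype a] [DecidableEq a] (W : Submodule k (a → k)) {d : ℕ}
    (h : Fintype.card a = Module.finrank k W + d) :
    ∃ z : Matrix (Fin d) a k, Function.Surjective z.mulVec ∧ LinearMap.ker z.mulVecLin = W := by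
  have h1 : Module.finrank k ((a → k) ⧸ W) = Module.finrank k (Fin d → k) := by
    have := W.finrank_quotient_add_finrank
    rw [Module.finrank_fintype_fun_eq_card] at this ⊢
    rw [Fintype.card_fin]
    omega
  let e := LinearEquiv.ofFinrankEq _ _ h1
  let f : (a → k) →ₗ[k] (Fin d → k) := e.toLinearMap ∘ₗ W.mkQ
  have hf : (LinearMap.toMatrix' f).mulVecLin = f := by
    rw [← Matrix.toLin'_apply', Matrix.toLin'_toMatrix']
  refine ⟨LinearMap.toMatrix' f, ?_, ?_⟩
  · have : (LinearMap.toMatrix' f).mulVec = f := by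
      funext v
      exact LinearMap.congr_fun hf v
    rw [this]
    exact e.surjective.comp W.mkQ_surjective
  · rw [hf, LinearMap.ker_comp_of_ker_eq_bot _ e.ker, Submodule.ker_mkQ]

theorem exists_matrix_range {a : Type} [Fintype a] [DecidableEq a] (W : Submodule k (a → k)) {d : ℕ}
    (h : Module.finrank k W = d) :
    ∃ y : Matrix a (Fin d) k, Function.Injective y.mulVec ∧ LinearMap.range y.mulVecLin = W := by
  have h1 : Module.finrank k (Fin d → k) = Module.finrank k W := by
    rw [Module.finrank_fintype_fun_eq_card, Fintype.card_fin, h]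
  let e := LinearEquiv.ofFinrankEq _ _ h1
  let f : (Fin d → k) →ₗ[k] (a → k) := W.subtype ∘ₗ e.toLinearMap
  have hf : (LinearMap.toMatrix' f).mulVecLin = f := by
    rw [← Matrix.toLin'_apply', Matrix.toLin'_toMatrix']
  refine ⟨LinearMap.toMatrix' f, ?_, ?_⟩
  · have : (LinearMap.toMatrix' f).mulVec = f := by
      funext v
      exact LinearMap.congr_fun hf v
    rw [this]
    exact W.injective_subtype.comp e.injective
  · rw [hf, LinearMap.range_comp_of_range_eq_top _ e.range, Submodule.range_subtype]

theorem surjective_of_card {a b : Type} [Fintype a] [Fintype b] {y : Matrix b a k}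
    (hy : Function.Injective y.mulVec) (h : Fintype.card b = Fintype.card a) :
    Function.Surjective y.mulVec :=
  (LinearMap.injective_iff_surjective_of_finrank_eq_finrank (f := y.mulVecLin)
    (by simp [h])).1 hy

theorem injective_of_card {a b : Type} [Fintype a] [Fintype b] {y : Matrix b a k}
    (hy : Function.Surjective y.mulVec) (h : Fintype.card b = Fintype.card a) :
    Function.Injective y.mulVec :=
  (LinearMap.injective_iff_surjective_of_finrank_eq_finrank (f := y.mulVecLin)
    (by simp [h])).2 hy

theorem cl_zero_simple (j₀ : J) : cl (n := FinD (Pi.single j₀ 1)) (0 : Rep Γ k (Pi.single j₀ 1)) =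
    IsoCls.simple Γ k j₀ := cl_eq_mk _

theorem quoC_simple {j₀ : J} (hl : ∀ h, Γ.s h = j₀ → Γ.t h ≠ j₀) {x : MRep Γ k n} {x' : MRep Γ k n'}
    {y : MMap k n n'} (hy : IsMHom x x' y) (hi : ∀ j, Function.Injective (y j).mulVec)
    (hc : ∀ j, Fintype.card (n' j) = Fintype.card (n j) + (Pi.single j₀ 1 : J → ℕ) j) :
    QuoC x' (fun j => LinearMap.range (y j).mulVecLin) (IsoCls.simple Γ k j₀) := by
  have key : ∀ j, ∃ z : Matrix (Fin ((Pi.single j₀ 1 : J → ℕ) j)) (n' j) k,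
      Function.Surjective z.mulVec ∧ LinearMap.ker z.mulVecLin = LinearMap.range (y j).mulVecLin := by
    intro j
    refine exists_matrix_ker _ ?_
    rw [hc, LinearMap.finrank_range_of_inj (hi j), Module.finrank_fintype_fun_eq_card]
  choose z hz using key
  rw [quoC_iff (cl_zero_simple j₀)]
  refine ⟨z, fun h => ?_, hz⟩
  have hs : ∀ j ≠ j₀, Function.Surjective (y j).mulVec := fun j hj =>
    surjective_of_card (hi j) (by rw [hc, Pi.single_eq_of_ne hj, add_zero])
  have hr : ∀ v, (x' h).mulVec v ∈ LinearMap.range (y (Γ.t h)).mulVecLin := by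
    intro v
    by_cases ht : Γ.t h = j₀
    · obtain ⟨u, rfl⟩ := hs _ (fun hs => hl h hs ht) v
      rw [Matrix.mulVec_mulVec, hy h, ← Matrix.mulVec_mulVec]
      exact ⟨_, rfl⟩
    · exact hs _ ht _
  show (0 : Matrix _ _ k) * z (Γ.s h) = z (Γ.t h) * x' h
  rw [Matrix.zero_mul]
  refine Matrix.toLin'.injective (LinearMap.ext fun v => ?_)
  rw [map_zero, Matrix.toLin'_apply, ← Matrix.mulVec_mulVec]
  have := hr v
  rw [← (hz (Γ.t h)).2] at this
  exact this.symm

theorem subC_simple {j₀ : J} (hl : ∀ h, Γ.s h = j₀ → Γ.t h ≠ j₀) {x : MRep Γ k n} {x' : MRep Γ k n'}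
    {z : MMap k n' n} (hz : IsMHom x' x z) (hi : ∀ j, Function.Surjective (z j).mulVec)
    (hc : ∀ j, Fintype.card (n' j) = Fintype.card (n j) + (Pi.single j₀ 1 : J → ℕ) j) :
    SubC x' (fun j => LinearMap.ker (z j).mulVecLin) (IsoCls.simple Γ k j₀) := by
  have key : ∀ j, ∃ y : Matrix (n' j) (Fin ((Pi.single j₀ 1 : J → ℕ) j)) k,
      Function.Injective y.mulVec ∧ LinearMap.range y.mulVecLin = LinearMap.ker (z j).mulVecLin := by
    intro j
    refine exists_matrix_range _ ?_
    have h1 := LinearMap.finrank_range_add_finrank_ker (z j).mulVecLin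
    rw [LinearMap.range_eq_top.2 (hi j), finrank_top, Module.finrank_fintype_fun_eq_card,
      Module.finrank_fintype_fun_eq_card, hc] at h1
    omega
  choose y hy using key
  rw [subC_iff (cl_zero_simple j₀)]
  refine ⟨y, fun h => ?_, hy⟩
  have hs : ∀ j ≠ j₀, Function.Injective (z j).mulVec := fun j hj =>
    injective_of_card (hi j) (by rw [hc, Pi.single_eq_of_ne hj, add_zero])
  have hr : ∀ u, (z (Γ.s h)).mulVec u = 0 → (x' h).mulVec u = 0 := by
    intro u hu
    by_cases ht : Γ.s h = j₀
    · refine hs _ (hl h ht) ?_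
      rw [Matrix.mulVec_mulVec, ← hz h, ← Matrix.mulVec_mulVec, hu, Matrix.mulVec_zero,
        Matrix.mulVec_zero]
    · have : u = 0 := hs _ ht (by rw [hu, Matrix.mulVec_zero])
      rw [this, Matrix.mulVec_zero]
  show x' h * y (Γ.s h) = y (Γ.t h) * (0 : Matrix _ _ k)
  rw [Matrix.mul_zero]
  refine Matrix.toLin'.injective (LinearMap.ext fun v => ?_)
  rw [map_zero, Matrix.toLin'_apply, ← Matrix.mulVec_mulVec]
  refine hr _ ?_
  have : (y (Γ.s h)).mulVec v ∈ LinearMap.ker (z (Γ.s h)).mulVecLin := by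
    rw [← (hy (Γ.s h)).2]
    exact ⟨v, rfl⟩
  exact this

theorem totalDim_simple [Fintype J] (j₀ : J) : (IsoCls.simple Γ k j₀).totalDim = 1 := by
  show ∑ j, (Pi.single j₀ 1 : J → ℕ) j = 1
  rw [Finset.sum_pi_single']
  simp

theorem dim_simple (j₀ : J) : (IsoCls.simple Γ k j₀).dim = Pi.single j₀ 1 := rfl

end SimpleClass

/-! ## Representations of the enlarged quiver as representations of a framed quiver -/

section Dictionary

variable {I H : Type*} {Q : Quiv I H} {o : I → Bool} {k : Type*} [Field k]

/-- The dimension vector of a framed quiver with component `1` at the new vertex. -/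
def fdim (ν : I → ℕ) : Option I → ℕ := fun j => j.elim 1 ν

/-- A matrix at the arrow `h_i`, cut into rows or columns. -/
def frEdge (ν w : I → ℕ) (i : I) : (b : Bool) →
    Matrix (Fin (Sum.elim ν w (bif b then .inl i else .inr i)))
      (Fin (Sum.elim ν w (bif b then .inr i else .inl i))) k ≃
    (Fin (w i) → Matrix (Fin (fdim ν (bif b then some i else none)))
      (Fin (fdim ν (bif b then none else some i))) k)
  | false =>
    { toFun := fun x l => Matrix.of fun _ c => x l c
      invFun := fun X => Matrix.of fun l c => X l (0 : Fin 1) c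
      left_inv := fun _ => rfl
      right_inv := fun X => by
        funext l
        ext r c
        exact congrArg (fun r => X l r c) (Subsingleton.elim (α := Fin 1) _ _) }
  | true =>
    { toFun := fun x l => Matrix.of fun r _ => x r l
      invFun := fun X => Matrix.of fun r l => X l r (0 : Fin 1)
      left_inv := fun _ => rfl
      right_inv := fun X => by
        funext l
        ext r c
        exact congrArg (fun c => X l r c) (Subsingleton.elim (α := Fin 1) _ _) }

/-- Representations of the enlarged quiver as representations of a framed quiver. -/
def fr {ν w : I → ℕ} : HRep Q k (framing o) ν w ≃ Rep (framed Q o w) k (fdim ν) where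
  toFun x := fun h => match h with
    | .inl h => x (.inl h)
    | .inr p => frEdge ν w p.1 (o p.1) (x (.inr p.1)) p.2
  invFun X := fun h => match h with
    | .inl h => X (.inl h)
    | .inr i => (frEdge ν w i (o i)).symm fun l => X (.inr ⟨i, l⟩)
  left_inv x := by
    funext h
    cases h with
    | inl h => rfl
    | inr i => exact (frEdge ν w i (o i)).symm_apply_apply (x (.inr i))
  right_inv X := by
    funext h
    cases h with
    | inl h => rfl
    | inr p =>
      exact congrFun ((frEdge ν w p.1 (o p.1)).apply_symm_apply fun l => X (.inr ⟨p.1, l⟩)) p.2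

/-- The extension of a graded map by the identity at the new vertex. -/
def frMap {ν ν' : I → ℕ} (y : GrMap k ν ν') : GrMap k (fdim ν) (fdim ν') := fun j => match j with
  | none => (1 : Matrix (Fin 1) (Fin 1) k)
  | some i => y i

theorem row_hom {a n n' : ℕ} (x : Matrix (Fin a) (Fin n) k) (x' : Matrix (Fin a) (Fin n') k)
    (y : Matrix (Fin n') (Fin n) k) :
    (∀ l, (Matrix.of fun _ c => x' l c : Matrix (Fin 1) (Fin n') k) * y =
      (1 : Matrix (Fin 1) (Fin 1) k) * (Matrix.of fun _ c => x l c : Matrix (Fin 1) (Fin n) k)) ↔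
      x' * y = (1 : Matrix (Fin a) (Fin a) k) * x := by
  simp only [Matrix.one_mul]
  constructor
  · intro h
    ext l c
    have := congrFun (congrFun (h l) 0) c
    simpa [Matrix.mul_apply] using this
  · intro h l
    ext r c
    have := congrFun (congrFun h l) c
    simpa [Matrix.mul_apply] using this

theorem col_hom {a n n' : ℕ} (x : Matrix (Fin n) (Fin a) k) (x' : Matrix (Fin n') (Fin a) k)
    (y : Matrix (Fin n') (Fin n) k) :
    (∀ l, (Matrix.of fun r _ => x' r l : Matrix (Fin n') (Fin 1) k) * (1 : Matrix (Fin 1) (Fin 1) k) =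
      y * (Matrix.of fun r _ => x r l : Matrix (Fin n) (Fin 1) k)) ↔
      x' * (1 : Matrix (Fin a) (Fin a) k) = y * x := by
  simp only [Matrix.mul_one]
  constructor
  · intro h
    ext r l
    have := congrFun (congrFun (h l) r) 0
    simpa [Matrix.mul_apply] using this
  · intro h l
    ext r c
    have := congrFun (congrFun h r) l
    simpa [Matrix.mul_apply] using this

theorem col_quo {a d n' : ℕ} (x' : Matrix (Fin n') (Fin a) k) (z : Matrix (Fin d) (Fin n') k) :
    (∀ l : Fin a, (0 : Matrix (Fin d) (Fin 0) k) * (0 : Matrix (Fin 0) (Fin 1) k) =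
      z * (Matrix.of fun r _ => x' r l : Matrix (Fin n') (Fin 1) k)) ↔
      (0 : Matrix (Fin d) (Fin 0) k) * (0 : Matrix (Fin 0) (Fin a) k) = z * x' := by
  simp only [Matrix.mul_zero]
  constructor
  · intro h
    ext r l
    have := congrFun (congrFun (h l) r) 0
    simpa [Matrix.mul_apply] using this
  · intro h l
    ext r c
    have := congrFun (congrFun h r) l
    simpa [Matrix.mul_apply] using this

theorem frEdge_hom {ν ν' w : I → ℕ} (i : I) (y : GrMap k ν ν') (b : Bool)
    (x : Matrix (Fin (Sum.elim ν w (bif b then .inl i else .inr i)))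
      (Fin (Sum.elim ν w (bif b then .inr i else .inl i))) k)
    (x' : Matrix (Fin (Sum.elim ν' w (bif b then .inl i else .inr i)))
      (Fin (Sum.elim ν' w (bif b then .inr i else .inl i))) k) :
    (∀ l, frEdge ν' w i b x' l * frMap y (bif b then none else some i) =
      frMap y (bif b then some i else none) * frEdge ν w i b x l) ↔
    x' * hatMap w y (bif b then .inr i else .inl i) =
      hatMap w y (bif b then .inl i else .inr i) * x := by
  cases b
  · exact row_hom (a := w i) (n := ν i) (n' := ν' i) x x' (y i)
  · exact col_hom (a := w i) (n := ν i) (n' := ν' i) x x' (y i)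

theorem isHom_fr {ν ν' w : I → ℕ} {x : HRep Q k (framing o) ν w} {x' : HRep Q k (framing o) ν' w}
    {y : GrMap k ν ν'} : IsHom (fr x) (fr x') (frMap y) ↔ IsHom x x' (hatMap w y) := by
  constructor
  · intro h a
    cases a with
    | inl a => exact h (.inl a)
    | inr i => exact (frEdge_hom i y (o i) (x (.inr i)) (x' (.inr i))).1 fun l => h (.inr ⟨i, l⟩)
  · intro h a
    cases a with
    | inl a => exact h (.inl a)
    | inr p => exact (frEdge_hom p.1 y (o p.1) (x (.inr p.1)) (x' (.inr p.1))).2 (h (.inr p.1)) p.2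

/-- Graded maps to a space that vanishes at the new vertex. -/
def frQuo {ν' d : I → ℕ} (z : GrMap k ν' d) : GrMap k (fdim ν') (exDim d) := fun j => match j with
  | none => (0 : Matrix (Fin 0) (Fin 1) k)
  | some i => z i

/-- Graded maps to a space that vanishes at the vertices `î`. -/
def hatQuo (w : I → ℕ) {ν' d : I → ℕ} (z : GrMap k ν' d) : GrMap k (Sum.elim ν' w) (Sum.elim d 0) :=
  fun j => match j with
  | .inl i => z i
  | .inr i => (0 : Matrix (Fin 0) (Fin (w i)) k)

theorem frQuo_restrict {ν' d : I → ℕ} (z : GrMap k (fdim ν') (exDim d)) :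
    frQuo (fun i => z (some i)) = z := by
  funext j
  cases j with
  | none => ext a; exact isEmptyElim a
  | some i => rfl

theorem hatQuo_restrict {w ν' d : I → ℕ} (z : GrMap k (Sum.elim ν' w) (Sum.elim d 0)) :
    hatQuo w (fun i => z (.inl i)) = z := by
  funext j
  cases j with
  | inl i => rfl
  | inr i => ext a; exact Fin.elim0 a

theorem frEdge_quo {ν' w d : I → ℕ} (i : I) (z : GrMap k ν' d) (b : Bool)
    (x' : Matrix (Fin (Sum.elim ν' w (bif b then .inl i else .inr i)))
      (Fin (Sum.elim ν' w (bif b then .inr i else .inl i))) k) :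
    (∀ l, (0 : Matrix (Fin (exDim d (bif b then some i else none))) _ k) *
        frQuo z (bif b then none else some i) =
      frQuo z (bif b then some i else none) * frEdge ν' w i b x' l) ↔
    (0 : Matrix (Fin (Sum.elim d 0 (bif b then .inl i else .inr i))) _ k) *
      hatQuo w z (bif b then .inr i else .inl i) =
      hatQuo w z (bif b then .inl i else .inr i) * x' := by
  cases b
  · refine ⟨fun _ => ?_, fun _ l => ?_⟩
    · ext a; exact Fin.elim0 a
    · ext a; exact Fin.elim0 a
  · exact col_quo (a := w i) (d := d i) (n' := ν' i) x' (z i)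

theorem isHom_frQuo {ν' w d : I → ℕ} {x' : HRep Q k (framing o) ν' w} {s : Rep Q k d}
    {z : GrMap k ν' d} :
    IsHom (fr x') (exRep o w s) (frQuo z) ↔ IsHom x' (extendZero Q o s) (hatQuo w z) := by
  constructor
  · intro h a
    cases a with
    | inl a => exact h (.inl a)
    | inr i => exact (frEdge_quo i z (o i) (x' (.inr i))).1 fun l => h (.inr ⟨i, l⟩)
  · intro h a
    cases a with
    | inl a => exact h (.inl a)
    | inr p => exact (frEdge_quo p.1 z (o p.1) (x' (.inr p.1))).2 (h (.inr p.1)) p.2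

theorem ker_eq_range_one {a b : Type} [Fintype a] [DecidableEq a] [IsEmpty b] (z : Matrix b a k) :
    LinearMap.ker z.mulVecLin = LinearMap.range (1 : Matrix a a k).mulVecLin := by
  rw [Matrix.mulVecLin_one, LinearMap.range_id, LinearMap.ker_eq_top]
  exact LinearMap.ext fun v => Subsingleton.elim _ _

variable [Fintype I] [DecidableEq I] [Fintype H] [DecidableEq H] [Fintype k] [DecidableEq k]

theorem quoC_fr_iff {ν ν' w : I → ℕ} {x' : HRep Q k (framing o) ν' w} {y : GrMap k ν ν'}
    {α : IsoCls Q k} :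
    QuoC (n := FinD (fdim ν')) (fr x') (fun j => LinearMap.range (frMap y j).mulVecLin)
      (exCls o w α) ↔ CokerIs Q o x' y α := by
  rw [quoC_iff (m := FinD (exDim α.dim)) (cl_exRep α)]
  constructor
  · rintro ⟨z, hz, hj⟩
    rw [← frQuo_restrict z] at hz
    refine ⟨hatQuo w fun i => z (some i), isHom_frQuo.1 hz, ?_⟩
    intro j
    cases j with
    | inl i => exact hj (some i)
    | inr i =>
      exact ⟨Function.surjective_to_subsingleton (α := Fin (w i) → k) (β := Fin 0 → k) _,
        ker_eq_range_one (b := Fin 0) _⟩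
  · rintro ⟨z, hz, hj⟩
    rw [← hatQuo_restrict z] at hz
    refine ⟨frQuo fun i => z (.inl i), isHom_frQuo.2 hz, ?_⟩
    intro j
    cases j with
    | none =>
      exact ⟨Function.surjective_to_subsingleton (α := Fin 1 → k) (β := Fin 0 → k) _,
        ker_eq_range_one (b := Fin 0) _⟩
    | some i => exact hj (.inl i)

/-- The class in the framed quiver of a representation of the enlarged quiver. -/
def frCls {ν w : I → ℕ} (x : HRep Q k (framing o) ν w) : IsoCls (framed Q o w) k :=
  cl (n := FinD (fdim ν)) (fr x)

theorem dim_frCls {ν w : I → ℕ} (x : HRep Q k (framing o) ν w) : (frCls x).dim = fdim ν := by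
  funext j
  exact (dim_cl _ j).trans (Fintype.card_fin _)

theorem exists_frCls {ν w : I → ℕ} {X : IsoCls (framed Q o w) k} (h : X.dim = fdim ν) :
    ∃ x : HRep Q k (framing o) ν w, frCls x = X := by
  obtain ⟨x, hx⟩ := exists_eq_mk X h
  refine ⟨fr.symm x, ?_⟩
  rw [frCls, Equiv.apply_symm_apply, cl_eq_mk, hx]

theorem fdim_injective : Function.Injective (fdim : (I → ℕ) → Option I → ℕ) := by
  intro ν ν' h
  funext i
  exact congrFun h (some i)

theorem isHom_smul_iff {J A : Type*} {Γ : Quiv J A} {d d' : J → ℕ} {x : Rep Γ k d} {x' : Rep Γ k d'}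
    {y : GrMap k d d'} (c : kˣ) : IsHom x x' (fun j => (c : k) • y j) ↔ IsHom x x' y := by
  refine forall_congr' fun h => ?_
  rw [Matrix.mul_smul, Matrix.smul_mul]
  exact (smul_right_injective _ c.ne_zero).eq_iff

/-- Graded maps on the framed spaces that do not vanish at the new vertex. -/
theorem exists_smul_frMap {ν ν' : I → ℕ} (Y : GrMap k (fdim ν) (fdim ν')) (hY : Y none ≠ 0) :
    ∃ (c : kˣ) (y : GrMap k ν ν'), Y = fun j => (c : k) • frMap y j := by
  have h0 : Y none = Y none (0 : Fin 1) (0 : Fin 1) • (1 : Matrix (Fin 1) (Fin 1) k) := by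
    ext a b
    have ha : a = (0 : Fin 1) := Subsingleton.elim (α := Fin 1) _ _
    have hb : b = (0 : Fin 1) := Subsingleton.elim (α := Fin 1) _ _
    subst ha hb
    simp
  have hc : Y none (0 : Fin 1) (0 : Fin 1) ≠ 0 := by
    intro h
    rw [h, zero_smul] at h0
    exact hY h0
  refine ⟨Units.mk0 _ hc, fun i => (Y none (0 : Fin 1) (0 : Fin 1))⁻¹ • Y (some i), ?_⟩
  funext j
  cases j with
  | none => exact h0
  | some i =>
    show Y (some i) = Y none (0 : Fin 1) (0 : Fin 1) • ((Y none (0 : Fin 1) (0 : Fin 1))⁻¹ • Y (some i))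
    rw [smul_smul, mul_inv_cancel₀ hc, one_smul]

theorem card_smul_frMap {X : Type*} {ν ν' : I → ℕ} (P : X → GrMap k (fdim ν) (fdim ν') → Prop)
    (hP : ∀ x Y (c : kˣ), P x (fun j => (c : k) • Y j) ↔ P x Y) (h0 : ∀ x Y, P x Y → Y none ≠ 0) :
    Nat.card {p : X × GrMap k (fdim ν) (fdim ν') // P p.1 p.2} =
      Nat.card kˣ * Nat.card {p : X × GrMap k ν ν' // P p.1 (frMap p.2)} := by
  rw [← Nat.card_prod]
  refine Nat.card_congr (Equiv.symm (Equiv.ofBijective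
    (fun q => ⟨(q.2.1.1, fun j => (q.1 : k) • frMap q.2.1.2 j), (hP _ _ _).2 q.2.2⟩) ⟨?_, ?_⟩))
  · rintro ⟨c, ⟨⟨x, y⟩, hy⟩⟩ ⟨c', ⟨⟨x', y'⟩, hy'⟩⟩ h
    have h1 := congrArg (fun q => q.1.1) h
    have h2 := congrArg (fun q => q.1.2) h
    simp only at h1 h2
    have hc : (c : k) = c' := by
      have h3 : ((c : k) • (1 : Matrix (Fin 1) (Fin 1) k)) 0 0 =
          ((c' : k) • (1 : Matrix (Fin 1) (Fin 1) k)) 0 0 :=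
        congrFun (congrFun (congrFun h2 none) (0 : Fin 1)) (0 : Fin 1)
      simpa using h3
    have hc' : c = c' := Units.ext hc
    subst h1 hc'
    have hy2 : y = y' := by
      funext i
      exact smul_right_injective _ c.ne_zero (congrFun h2 (some i))
    subst hy2
    rfl
  · rintro ⟨⟨x, Y⟩, hY⟩
    obtain ⟨c, y, rfl⟩ := exists_smul_frMap Y (h0 _ _ hY)
    exact ⟨(c, ⟨(x, y), (hP _ _ _).1 hY⟩), rfl⟩

theorem card_mIso_fdim (ν : I → ℕ) :
    Nat.card (MIso k (FinD (fdim ν)) (FinD (fdim ν))) = Nat.card kˣ * cardG k ν := by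
  rw [← Nat.card_congr (MIso.glEquiv k (fdim ν)), cardG, ← Nat.card_prod]
  refine Nat.card_congr (Equiv.piOptionEquivProd.trans (Equiv.prodCongr ?_ (Equiv.refl _)))
  exact (Units.mapEquiv (Matrix.uniqueRingEquiv (m := Fin 1) (A := k)).toMulEquiv).toEquiv

theorem frCls_eq_iff {ν w : I → ℕ} {x x' : HRep Q k (framing o) ν w} :
    frCls x = frCls x' ↔ ∃ g : GrGL k ν, act (hatGL w g) x = x' := by
  have key : ∀ (g : GrGL k ν), IsHom x x' (hatMap w fun i => (g i).val) ↔
      act (hatGL w g) x = x' := by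
    intro g
    have e : hatMap w (fun i => (g i).val) = (MIso.ofGL (hatGL w g)).fwd := by
      funext j
      cases j with
      | inl i => rfl
      | inr i => rfl
    rw [e, ← MIso.ofGL_conj]
    exact (MIso.conj_eq_iff (Γ := Q.hat (framing o)) (MIso.ofGL (hatGL w g)) x x').symm
  constructor
  · intro h
    obtain ⟨p, hp⟩ := (cl_eq_iff (n := FinD (fdim ν)) (n' := FinD (fdim ν)) _ _).1 h
    rw [MIso.conj_eq_iff] at hp
    obtain ⟨c, y, hy⟩ := exists_smul_frMap p.fwd (by
      intro h0
      have h1 := p.bwd_fwd none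
      rw [h0, Matrix.mul_zero] at h1
      exact zero_ne_one (congrFun (congrFun h1 (0 : Fin 1)) (0 : Fin 1)))
    rw [hy] at hp
    have h2 := isHom_fr.1 ((isHom_smul_iff c).1 hp)
    let b : GrMap k ν ν := fun i => p.bwd (some i)
    have hb : ∀ i, b i * ((c : k) • y i) = 1 := by
      intro i
      have := p.bwd_fwd (some i)
      rw [hy] at this
      exact this
    let g : GrGL k ν := fun i => ⟨y i, (c : k) • b i, by
      rw [Matrix.mul_smul, ← Matrix.smul_mul]
      exact mul_eq_one_comm.1 (hb i), by
      rw [Matrix.smul_mul, ← Matrix.mul_smul]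
      exact hb i⟩
    exact ⟨g, (key g).1 h2⟩
  · rintro ⟨g, hg⟩
    have h2 := isHom_fr.2 ((key g).2 hg)
    refine (cl_eq_iff (n := FinD (fdim ν)) (n' := FinD (fdim ν)) _ _).2
      ⟨⟨frMap fun i => (g i).val, frMap fun i => ((g i)⁻¹).val, ?_, ?_⟩,
        (MIso.conj_eq_iff _ _ _).2 h2⟩
    · intro j
      cases j with
      | none => exact Matrix.one_mul (1 : Matrix (Fin 1) (Fin 1) k)
      | some i => exact (g i).inv_mul
    · intro j
      cases j with
      | none => exact Matrix.one_mul (1 : Matrix (Fin 1) (Fin 1) k)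
      | some i => exact (g i).mul_inv

theorem injective_smul_iff {a b : Type} [Fintype a] (M : Matrix b a k) (c : kˣ) :
    Function.Injective ((c : k) • M).mulVec ↔ Function.Injective M.mulVec := by
  have : ((c : k) • M).mulVec = (fun v => (c : k) • v) ∘ M.mulVec := by
    funext v
    exact Matrix.smul_mulVec _ _ _
  rw [this]
  exact (smul_right_injective _ c.ne_zero).of_comp_iff _

theorem surjective_smul_iff {a b : Type} [Fintype a] (M : Matrix b a k) (c : kˣ) :
    Function.Surjective ((c : k) • M).mulVec ↔ Function.Surjective M.mulVec := by
  have : ((c : k) • M).mulVec = (MulAction.toPerm c : Equiv.Perm (b → k)) ∘ M.mulVec := by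
    funext v
    exact Matrix.smul_mulVec _ _ _
  rw [this]
  exact Function.Surjective.of_comp_iff' (MulAction.toPerm c : Equiv.Perm (b → k)).bijective _

theorem range_smul_mulVecLin {a b : Type} [Fintype a] (M : Matrix b a k) (c : kˣ) :
    LinearMap.range ((c : k) • M).mulVecLin = LinearMap.range M.mulVecLin := by
  rw [← LinearMap.range_smul M.mulVecLin (c : k) c.ne_zero]
  congr 1
  exact LinearMap.ext fun v => Matrix.smul_mulVec _ _ _

theorem ker_smul_mulVecLin {a b : Type} [Fintype a] (M : Matrix b a k) (c : kˣ) :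
    LinearMap.ker ((c : k) • M).mulVecLin = LinearMap.ker M.mulVecLin := by
  rw [← LinearMap.ker_smul M.mulVecLin (c : k) c.ne_zero]
  congr 1
  exact LinearMap.ext fun v => Matrix.smul_mulVec _ _ _

theorem injective_frMap {ν ν' : I → ℕ} {y : GrMap k ν ν'} :
    (∀ j, Function.Injective (frMap y j).mulVec) ↔ ∀ i, Function.Injective (y i).mulVec := by
  refine ⟨fun h i => h (some i), fun h j => ?_⟩
  cases j with
  | none =>
    have : (1 : Matrix (Fin 1) (Fin 1) k).mulVec = id := funext fun v => Matrix.one_mulVec v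
    show Function.Injective (1 : Matrix (Fin 1) (Fin 1) k).mulVec
    rw [this]
    exact Function.injective_id
  | some i => exact h i

theorem surjective_frMap {ν ν' : I → ℕ} {y : GrMap k ν ν'} :
    (∀ j, Function.Surjective (frMap y j).mulVec) ↔ ∀ i, Function.Surjective (y i).mulVec := by
  refine ⟨fun h i => h (some i), fun h j => ?_⟩
  cases j with
  | none =>
    have : (1 : Matrix (Fin 1) (Fin 1) k).mulVec = id := funext fun v => Matrix.one_mulVec v
    show Function.Surjective (1 : Matrix (Fin 1) (Fin 1) k).mulVec
    rw [this]
    exact Function.surjective_id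
  | some i => exact h i

instance (ν : I → ℕ) : Nonempty (Fin (fdim ν none)) := ⟨(0 : Fin 1)⟩

theorem ne_zero_of_injective {a b : Type} [Fintype a] [Nonempty a] {M : Matrix b a k}
    (h : Function.Injective M.mulVec) : M ≠ 0 := by
  rintro rfl
  have := h (a₁ := fun _ => 1) (a₂ := 0) (by simp)
  exact one_ne_zero (congrFun this (Classical.arbitrary a))

theorem ne_zero_of_surjective {a b : Type} [Fintype a] [Nonempty b] {M : Matrix b a k}
    (h : Function.Surjective M.mulVec) : M ≠ 0 := by
  rintro rfl
  obtain ⟨v, hv⟩ := h fun _ => 1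
  have := congrFun hv (Classical.arbitrary b)
  simp at this

theorem card_units_pos : 0 < Nat.card kˣ := Nat.card_pos

theorem card_inZ {ν ν' w : I → ℕ} {X : IsoCls (framed Q o w) k} (hX : X.dim = fdim ν)
    (x' : HRep Q k (framing o) ν' w) (α : IsoCls (framed Q o w) k) :
    Nat.card {p : HRep Q k (framing o) ν w × GrMap k ν ν' // frCls p.1 = X ∧ InZ Q p.1 x' p.2 ∧
      QuoC (n := FinD (fdim ν')) (fr x') (fun j => LinearMap.range (frMap p.2 j).mulVecLin) α} =
      IsoCls.hall α X (frCls x') * cardG k ν := by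
  obtain ⟨x₀, rfl⟩ := exists_frCls hX
  have h := card_sub_hom (n := FinD (fdim ν)) (n' := FinD (fdim ν')) (fr x₀) (fr x') α
  have hs := card_smul_frMap (ν := ν) (ν' := ν') (fun (x : Rep (framed Q o w) k (fdim ν)) Y => cl (n := FinD (fdim ν)) x =
    cl (n := FinD (fdim ν)) (fr x₀) ∧ IsHom x (fr x') Y ∧ (∀ j, Function.Injective (Y j).mulVec) ∧
      QuoC (n := FinD (fdim ν')) (fr x') (fun j => LinearMap.range (Y j).mulVecLin) α) ?_ ?_
  have h := hs.symm.trans (h.trans (by rw [card_mIso_fdim, mul_left_comm]))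
  · refine Eq.trans (Nat.card_congr (Equiv.subtypeEquiv (Equiv.prodCongr fr (Equiv.refl _)) ?_))
      (Nat.eq_of_mul_eq_mul_left card_units_pos h)
    rintro ⟨x, y⟩
    show frCls x = frCls x₀ ∧ InZ Q x x' y ∧ _ ↔ cl (n := FinD (fdim ν)) (fr x) = _ ∧
      IsHom (fr x) (fr x') (frMap y) ∧ (∀ j, Function.Injective (frMap y j).mulVec) ∧ _
    rw [isHom_fr, injective_frMap]
    unfold InZ
    tauto
  · intro x Y c
    simp only [isHom_smul_iff, injective_smul_iff, range_smul_mulVecLin]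
  · rintro x Y ⟨-, -, hY, -⟩
    exact ne_zero_of_injective (hY none)

/-- Morphisms `x' → x` all of whose components are surjective and that are the identity
at the vertices `î`. -/
def OutZ (Q : Quiv I H) {Ω : H ⊕ I → Bool} {ν ν' w : I → ℕ} (x : HRep Q k Ω ν w)
    (x' : HRep Q k Ω ν' w) (z : GrMap k ν' ν) : Prop :=
  (∀ j, Function.Surjective (z j).mulVec) ∧ IsHom x' x (hatMap w z)

theorem card_outZ {ν ν' w : I → ℕ} {X : IsoCls (framed Q o w) k} (hX : X.dim = fdim ν)
    (x' : HRep Q k (framing o) ν' w) (β : IsoCls (framed Q o w) k) :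
    Nat.card {p : HRep Q k (framing o) ν w × GrMap k ν' ν // frCls p.1 = X ∧ OutZ Q p.1 x' p.2 ∧
      SubC (n := FinD (fdim ν')) (fr x') (fun j => LinearMap.ker (frMap p.2 j).mulVecLin) β} =
      IsoCls.hall X β (frCls x') * cardG k ν := by
  obtain ⟨x₀, rfl⟩ := exists_frCls hX
  have h := card_quo_hom (n := FinD (fdim ν)) (n' := FinD (fdim ν')) (fr x₀) (fr x') β
  have hs := card_smul_frMap (ν := ν') (ν' := ν) (fun (x : Rep (framed Q o w) k (fdim ν)) Y => cl (n := FinD (fdim ν)) x =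
    cl (n := FinD (fdim ν)) (fr x₀) ∧ IsHom (fr x') x Y ∧ (∀ j, Function.Surjective (Y j).mulVec) ∧
      SubC (n := FinD (fdim ν')) (fr x') (fun j => LinearMap.ker (Y j).mulVecLin) β) ?_ ?_
  have h := hs.symm.trans (h.trans (by rw [card_mIso_fdim, mul_left_comm]))
  · refine Eq.trans (Nat.card_congr (Equiv.subtypeEquiv (Equiv.prodCongr fr (Equiv.refl _)) ?_))
      (Nat.eq_of_mul_eq_mul_left card_units_pos h)
    rintro ⟨x, y⟩
    show frCls x = frCls x₀ ∧ OutZ Q x x' y ∧ _ ↔ cl (n := FinD (fdim ν)) (fr x) = _ ∧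
      IsHom (fr x') (fr x) (frMap y) ∧ (∀ j, Function.Surjective (frMap y j).mulVec) ∧ _
    rw [isHom_fr, surjective_frMap]
    unfold OutZ
    tauto
  · intro x Y c
    simp only [isHom_smul_iff, surjective_smul_iff, ker_smul_mulVecLin]
  · rintro x Y ⟨-, -, hY, -⟩
    exact ne_zero_of_surjective (hY none)

end Dictionary

end RingelHall
end

noncomputable section
namespace RingelHall

/-! ## The operators on functions and on the Hall space of a framed quiver -/

section Counting

theorem double_count {X X' Y Z Z' : Type*} [Finite X] [Finite X'] [Finite Y]
    (R : X → X' → Y → Prop) (f : X → Z) (f' : X' → Z') (z : Z) (z' : Z') {a b : ℕ}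
    (ha : ∀ x, f x = z → Nat.card {p : X' × Y // f' p.1 = z' ∧ R x p.1 p.2} = a)
    (hb : ∀ x', f' x' = z' → Nat.card {p : X × Y // f p.1 = z ∧ R p.1 x' p.2} = b) :
    Nat.card {x // f x = z} * a = Nat.card {x' // f' x' = z'} * b := by
  rw [← card_sigma_const (F := fun x : {x // f x = z} =>
      {p : X' × Y // f' p.1 = z' ∧ R x.1 p.1 p.2}) fun x => ha x.1 x.2,
    ← card_sigma_const (F := fun x' : {x' // f' x' = z'} =>
      {p : X × Y // f p.1 = z ∧ R p.1 x'.1 p.2}) fun x' => hb x'.1 x'.2]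
  exact Nat.card_congr
    { toFun := fun t => ⟨⟨t.2.1.1, t.2.2.1⟩, ⟨(t.1.1, t.2.1.2), t.1.2, t.2.2.2⟩⟩
      invFun := fun t => ⟨⟨t.2.1.1, t.2.2.1⟩, ⟨(t.1.1, t.2.1.2), t.1.2, t.2.2.2⟩⟩
      left_inv := fun _ => rfl
      right_inv := fun _ => rfl }

theorem sum_ite_card {X Y Z : Type*} [Fintype X] [Fintype Y] (R : X → Y → Prop) (f : X → Z) (z : Z)
    {d : ∀ x y, Decidable (R x y)} {e : ∀ x, Decidable (z = f x)} :
    ∑ x, ∑ y, (if R x y then (if z = f x then (1 : ℂ) else 0) else 0) =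
      (Nat.card {p : X × Y // f p.1 = z ∧ R p.1 p.2} : ℂ) := by
  classical
  rw [Nat.card_eq_fintype_card, Fintype.card_subtype, Finset.card_filter, Fintype.sum_prod_type]
  push_cast
  refine Finset.sum_congr rfl fun x _ => Finset.sum_congr rfl fun y _ => ?_
  by_cases h1 : R x y <;> by_cases h2 : f x = z <;> simp [h1, h2, eq_comm (a := z)]

end Counting

section Functions

variable {I H : Type*} [Fintype I] [DecidableEq I] [Fintype H] [DecidableEq H] {Q : Quiv I H}
  {k : Type*} [Field k] [Fintype k] [DecidableEq k]

open Classical in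
/-- Summation over the injective morphisms that start at a given representation. -/
def lSum (Q : Quiv I H) (k : Type*) [Field k] [Fintype k] [DecidableEq k] (Ω : H ⊕ I → Bool)
    (ν ν' w : I → ℕ) : (HRep Q k Ω ν' w → ℂ) →ₗ[ℂ] (HRep Q k Ω ν w → ℂ) :=
  ∑ y ∈ Finset.univ.filter fun y : GrMap k ν ν' => ∀ j, Function.Injective (y j).mulVec,
    pull (hatMap w y)

open Classical in
/-- Summation over the surjective morphisms that end at a given representation. -/
def rSum (Q : Quiv I H) (k : Type*) [Field k] [Fintype k] [DecidableEq k] (Ω : H ⊕ I → Bool)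
    (ν ν' w : I → ℕ) : (HRep Q k Ω ν' w → ℂ) →ₗ[ℂ] (HRep Q k Ω ν w → ℂ) :=
  ∑ z ∈ Finset.univ.filter fun z : GrMap k ν' ν => ∀ j, Function.Surjective (z j).mulVec,
    push (hatMap w z)

open Classical in
/-- Summation over the surjective morphisms that start at a given representation. -/
def mSum (Q : Quiv I H) (k : Type*) [Field k] [Fintype k] [DecidableEq k] (Ω : H ⊕ I → Bool)
    (ν ν' w : I → ℕ) : (HRep Q k Ω ν w → ℂ) →ₗ[ℂ] (HRep Q k Ω ν' w → ℂ) :=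
  ∑ z ∈ Finset.univ.filter fun z : GrMap k ν' ν => ∀ j, Function.Surjective (z j).mulVec,
    pull (hatMap w z)

variable {Ω : H ⊕ I → Bool} {ν ν' w : I → ℕ}

open Classical in
theorem lSum_apply (f : HRep Q k Ω ν' w → ℂ) (x : HRep Q k Ω ν w) :
    lSum Q k Ω ν ν' w f x = ∑ x', ∑ y, if InZ Q x x' y then f x' else 0 := by
  rw [lSum, LinearMap.sum_apply, Finset.sum_apply, Finset.sum_filter, Finset.sum_comm]
  refine Finset.sum_congr rfl fun y _ => ?_
  by_cases h : ∀ j, Function.Injective (y j).mulVec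
  · rw [if_pos h]
    exact Finset.sum_congr rfl fun x' _ => if_congr (by simp [InZ, h]) rfl rfl
  · rw [if_neg h]
    exact (Finset.sum_eq_zero fun x' _ => if_neg fun hz => h hz.1).symm

open Classical in
theorem rSum_apply (f : HRep Q k Ω ν' w → ℂ) (x : HRep Q k Ω ν w) :
    rSum Q k Ω ν ν' w f x = ∑ x', ∑ z, if OutZ Q x x' z then f x' else 0 := by
  rw [rSum, LinearMap.sum_apply, Finset.sum_apply, Finset.sum_filter, Finset.sum_comm]
  refine Finset.sum_congr rfl fun y _ => ?_
  by_cases h : ∀ j, Function.Surjective (y j).mulVec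
  · rw [if_pos h]
    exact Finset.sum_congr rfl fun x' _ => if_congr (by simp [OutZ, h]) rfl rfl
  · rw [if_neg h]
    exact (Finset.sum_eq_zero fun x' _ => if_neg fun hz => h hz.1).symm

open Classical in
theorem mSum_apply (g : HRep Q k Ω ν w → ℂ) (x' : HRep Q k Ω ν' w) :
    mSum Q k Ω ν ν' w g x' = ∑ x, ∑ z, if OutZ Q x x' z then g x else 0 := by
  rw [mSum, LinearMap.sum_apply, Finset.sum_apply, Finset.sum_filter, Finset.sum_comm]
  refine Finset.sum_congr rfl fun y _ => ?_
  by_cases h : ∀ j, Function.Surjective (y j).mulVec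
  · rw [if_pos h]
    exact Finset.sum_congr rfl fun x' _ => if_congr (by simp [OutZ, h]) rfl rfl
  · rw [if_neg h]
    exact (Finset.sum_eq_zero fun x' _ => if_neg fun hz => h hz.1).symm

theorem isHom_act_left {J A : Type*} {Γ : Quiv J A} {d d' : J → ℕ} (g : GrGL k d) {x : Rep Γ k d}
    {x' : Rep Γ k d'} {z : GrMap k d' d} :
    IsHom x' (act g x) (fun j => (g j).val * z j) ↔ IsHom x' x z := by
  refine forall_congr' fun h => ?_
  have e : act g x h * ((g (Γ.s h)).val * z (Γ.s h)) = (g (Γ.t h)).val * (x h * z (Γ.s h)) := by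
    simp [act, Matrix.mul_assoc]
  rw [e, Matrix.mul_assoc]
  constructor
  · intro hh
    have h2 := congrArg (fun M => ((g (Γ.t h))⁻¹).val * M) hh
    simpa [← Matrix.mul_assoc] using h2
  · intro hh
    rw [hh]

theorem isHom_act_right {J A : Type*} {Γ : Quiv J A} {d d' : J → ℕ} (g : GrGL k d') {x : Rep Γ k d}
    {x' : Rep Γ k d'} {z : GrMap k d' d} :
    IsHom (act g x') x (fun j => z j * ((g j)⁻¹).val) ↔ IsHom x' x z := by
  refine forall_congr' fun h => ?_
  have e : z (Γ.t h) * ((g (Γ.t h))⁻¹).val * act g x' h =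
      z (Γ.t h) * x' h * ((g (Γ.s h))⁻¹).val := by
    simp [act, Matrix.mul_assoc]
  rw [e, ← Matrix.mul_assoc]
  constructor
  · intro hh
    have h2 := congrArg (fun M => M * (g (Γ.s h)).val) hh
    simpa [Matrix.mul_assoc] using h2
  · intro hh
    rw [hh]

theorem hatMap_postcomp (g : GrGL k ν') (y : GrMap k ν ν') :
    hatMap w (postcomp g y) = fun j => (hatGL w g j).val * hatMap w y j := by
  funext j
  cases j with
  | inl i => rfl
  | inr i =>
    have e : (1 : Matrix (Fin (w i)) (Fin (w i)) k) = (1 : GL (Fin (w i)) k).val * 1 := by simp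
    exact e

theorem hatMap_precomp (g : GrGL k ν) (y : GrMap k ν ν') :
    hatMap w (precomp g y) = fun j => hatMap w y j * ((hatGL w g j)⁻¹).val := by
  funext j
  cases j with
  | inl i => rfl
  | inr i =>
    have e : (1 : Matrix (Fin (w i)) (Fin (w i)) k) = 1 * ((1 : GL (Fin (w i)) k)⁻¹).val := by simp
    exact e

theorem bijective_gl {n : ℕ} (g : GL (Fin n) k) : Function.Bijective g.val.mulVec := by
  refine Function.bijective_iff_has_inverse.2 ⟨(g⁻¹).val.mulVec, fun v => ?_, fun v => ?_⟩ <;> simp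

theorem outZ_postcomp (g : GrGL k ν) (x : HRep Q k Ω ν w) (x' : HRep Q k Ω ν' w)
    (z : GrMap k ν' ν) : OutZ Q (act (hatGL w g) x) x' (postcomp g z) ↔ OutZ Q x x' z := by
  unfold OutZ
  rw [hatMap_postcomp, isHom_act_left]
  refine and_congr_left fun _ => forall_congr' fun j => ?_
  show Function.Surjective ((g j).val * z j).mulVec ↔ _
  rw [mulVec_mul_eq]
  exact Function.Surjective.of_comp_iff' (bijective_gl (g j)) _

theorem outZ_precomp (g : GrGL k ν') (x : HRep Q k Ω ν w) (x' : HRep Q k Ω ν' w)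
    (z : GrMap k ν' ν) : OutZ Q x (act (hatGL w g) x') (precomp g z) ↔ OutZ Q x x' z := by
  unfold OutZ
  rw [hatMap_precomp, isHom_act_right]
  refine and_congr_left fun _ => forall_congr' fun j => ?_
  show Function.Surjective (z j * ((g j)⁻¹).val).mulVec ↔ _
  rw [mulVec_mul_eq]
  exact Function.Surjective.of_comp_iff _ (bijective_gl (g j)⁻¹).2

end Functions

section HallFunctions

variable {I H : Type*} [Fintype I] [DecidableEq I] [Fintype H] [DecidableEq H] {Q : Quiv I H}
  {k : Type*} [Field k] [Fintype k] [DecidableEq k] {o : I → Bool}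

/-- The invariant function given by an element of the Hall space of a framed quiver. -/
def hallFn (Q : Quiv I H) (k : Type*) [Field k] [Fintype k] [DecidableEq k] (o : I → Bool)
    (ν w : I → ℕ) : HallSp (framed Q o w) k →ₗ[ℂ] InvFun Q k (framing o) ν w where
  toFun m := ⟨fun x => m (frCls x), fun g _ => congrArg m (frCls_eq_iff.2 ⟨g, rfl⟩).symm⟩
  map_add' _ _ := rfl
  map_smul' _ _ := rfl

variable {ν ν' w : I → ℕ}

theorem hallFn_apply (m : HallSp (framed Q o w) k) (x : HRep Q k (framing o) ν w) :
    (hallFn Q k o ν w m).1 x = m (frCls x) := rfl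

open Classical in
theorem hallFn_single (X : IsoCls (framed Q o w) k) (x : HRep Q k (framing o) ν w) :
    (hallFn Q k o ν w (Finsupp.single X 1)).1 x = if X = frCls x then 1 else 0 := by
  rw [hallFn_apply, Finsupp.single_apply]

/-- Elements of the Hall space that are supported on classes of dimension vector `(ν, 1)`. -/
def SuppIn (ν : I → ℕ) (m : HallSp (framed Q o w) k) : Prop := ∀ X, m X ≠ 0 → X.dim = fdim ν

theorem exists_hallFn (f : InvFun Q k (framing o) ν w) :
    ∃ m : HallSp (framed Q o w) k, hallFn Q k o ν w m = f ∧ SuppIn ν m := by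
  classical
  let F : IsoCls (framed Q o w) k → ℂ := fun X =>
    if h : X.dim = fdim ν then f.1 (exists_frCls h).choose else 0
  have hF : ∀ X, F X ≠ 0 → X.dim = fdim ν := by
    intro X h
    by_contra hd
    exact h (dif_neg hd)
  refine ⟨Finsupp.onFinset (box (framed Q o w) k (∑ j, fdim ν j)) F fun X h => ?_, ?_, ?_⟩
  · rw [mem_box, IsoCls.totalDim, hF X h]
  · refine Subtype.ext (funext fun x => ?_)
    show F (frCls x) = f.1 x
    have hd := dim_frCls x
    have h1 : F (frCls x) = f.1 (exists_frCls hd).choose := dif_pos hd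
    obtain ⟨g, hg⟩ := frCls_eq_iff.1 (exists_frCls hd).choose_spec
    rw [h1, ← f.2 g, hg]
  · exact fun X h => hF X h

theorem hallFn_eq_zero_of_suppIn {m : HallSp (framed Q o w) k} (h : SuppIn ν m) (hn : ν' ≠ ν) :
    hallFn Q k o ν' w m = 0 := by
  refine Subtype.ext (funext fun x => ?_)
  by_contra h0
  have := h _ h0
  rw [dim_frCls] at this
  exact hn (fdim_injective this)

theorem apply_eq_sum_mat (T : Module.End ℂ (HallSp (framed Q o w) k))
    (m : HallSp (framed Q o w) k) (l : IsoCls (framed Q o w) k) :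
    T m l = m.sum fun X c => c * mat T l X := by
  have e : T m = m.sum fun X c => c • T (Finsupp.single X 1) := by
    conv_lhs => rw [← Finsupp.sum_single m]
    rw [Finsupp.sum, map_sum]
    refine Finset.sum_congr rfl fun X _ => ?_
    show T (Finsupp.single X (m X)) = m X • T (Finsupp.single X 1)
    rw [← map_smul, Finsupp.smul_single, smul_eq_mul, mul_one]
  rw [e, Finsupp.sum, Finsupp.finsetSum_apply]
  rfl

theorem hallFn_mat_eq_zero_of_forall {T : Module.End ℂ (HallSp (framed Q o w) k)}
    (hT : ∀ l X, l.dim = fdim ν' → mat T l X = 0) (m : HallSp (framed Q o w) k) :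
    hallFn Q k o ν' w (T m) = 0 := by
  refine Subtype.ext (funext fun x' => ?_)
  refine (apply_eq_sum_mat T m (frCls x')).trans (Finset.sum_eq_zero fun X _ => ?_)
  show m X * mat T (frCls x') X = 0
  rw [hT _ _ (dim_frCls x'), mul_zero]

/-! ### Euler forms -/

theorem dimZ_of_dim {X : IsoCls (framed Q o w) k} (h : X.dim = fdim ν) :
    X.dimZ = fun j => (fdim ν j : ℤ) := by
  funext j
  rw [IsoCls.dimZ, h]

theorem euler_framed_left (a ν w : I → ℕ) : (Q.hat (framing o)).euler (hatZ a 0) (hatZ ν w) =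
    (framed Q o w).euler (exDimZ fun i => (a i : ℤ)) (fun j => (fdim ν j : ℤ)) := by
  simp only [Quiv.euler, Fintype.sum_sum_type, Fintype.sum_option, Fintype.sum_sigma]
  congr 1
  · simp [hatZ, exDimZ, fdim]
  · congr 1
    refine Finset.sum_congr rfl fun i _ => ?_
    simp only [Quiv.reorient, framing, Quiv.enlarge, Sum.elim_inr, framed]
    cases o i <;> simp [hatZ, exDimZ, fdim, mul_comm]

theorem euler_framed_right (a ν w : I → ℕ) : (Q.hat (framing o)).euler (hatZ ν w) (hatZ a 0) =
    (framed Q o w).euler (fun j => (fdim ν j : ℤ)) (exDimZ fun i => (a i : ℤ)) := by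
  simp only [Quiv.euler, Fintype.sum_sum_type, Fintype.sum_option, Fintype.sum_sigma]
  congr 1
  · simp [hatZ, exDimZ, fdim]
  · congr 1
    refine Finset.sum_congr rfl fun i _ => ?_
    simp only [Quiv.reorient, framing, Quiv.enlarge, Sum.elim_inr, framed]
    cases o i <;> simp [hatZ, exDimZ, fdim, mul_comm]

theorem hatZ_single (i : I) : hatZ (Pi.single i 1) 0 = Pi.single (Sum.inl i) 1 := by
  funext j
  cases j with
  | inl i' =>
    by_cases h : i' = i
    · subst h; simp [hatZ]
    · simp [hatZ, h]
  | inr i' => simp [hatZ]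

theorem kExp_eq (i : I) (ν w : I → ℕ) : kExp Q (framing o) i ν w =
    -((Q.hat (framing o)).euler (hatZ (Pi.single i 1) 0) (hatZ ν w) +
      (Q.hat (framing o)).euler (hatZ ν w) (hatZ (Pi.single i 1) 0)) := by
  rw [hatZ_single]
  simp only [Quiv.euler, kExp, Pi.single_apply, ite_mul, one_mul, zero_mul, mul_ite, mul_one,
    mul_zero, Finset.sum_ite_eq', Finset.mem_univ, if_true]
  simp only [hatZ, Sum.elim_inl]
  ring

theorem euler_single_right (i : I) (ν w : I → ℕ) :
    (Q.hat Ω).euler (hatZ ν w) (hatZ (Pi.single i 1) 0) = ν i -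
      ∑ h, if (Q.hat Ω).t h = Sum.inl i then ((Sum.elim ν w ((Q.hat Ω).s h) : ℕ) : ℤ) else 0 := by
  rw [hatZ_single]
  simp only [Quiv.euler, Pi.single_apply, mul_ite, mul_one,
    mul_zero, Finset.sum_ite_eq', Finset.mem_univ, if_true]
  simp only [hatZ, Sum.elim_inl]

theorem exDimZ_single (i : I) : exDimZ (fun j => ((Pi.single i 1 : I → ℕ) j : ℤ)) =
    exDimZ (Pi.single i 1) := by
  congr 1
  funext j
  by_cases h : j = i
  · subst h; simp
  · simp [h]

/-! ### Comparison of the operators -/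

theorem opK_hallFn (i : I) (m : HallSp (framed Q o w) k) :
    opK Q (framing o) i ν w (hallFn Q k o ν w m) =
      hallFn Q k o ν w (kOp (framed Q o w) k (exDimZ (Pi.single i 1)) m) := by
  refine Subtype.ext (funext fun x => ?_)
  show vC k ^ kExp Q (framing o) i ν w * m (frCls x) = kOp _ k _ m (frCls x)
  rw [kOp_apply, kExp_eq, euler_framed_left, euler_framed_right, exDimZ_single, Quiv.symEuler,
    dimZ_of_dim (dim_frCls x)]

theorem opKinv_hallFn (i : I) (m : HallSp (framed Q o w) k) :
    opKinv Q (framing o) i ν w (hallFn Q k o ν w m) =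
      hallFn Q k o ν w (kOp (framed Q o w) k (exDimZ (-Pi.single i 1)) m) := by
  refine Subtype.ext (funext fun x => ?_)
  show vC k ^ (-kExp Q (framing o) i ν w) * m (frCls x) = kOp _ k _ m (frCls x)
  rw [kOp_apply, kExp_eq, euler_framed_left, euler_framed_right, exDimZ_single, exDimZ_neg,
    Quiv.symEuler_neg_left, Quiv.symEuler, dimZ_of_dim (dim_frCls x)]

theorem cardG_ne_zero (ν : I → ℕ) : (cardG k ν : ℂ) ≠ 0 := by
  have : 0 < cardG k ν := Nat.card_pos
  exact_mod_cast this.ne'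

theorem opEminus_hallFn (α : IsoCls Q k) (m : HallSp (framed Q o w) k) :
    opEminus Q o α ν w (hallFn Q k o ν w m) =
      hallFn Q k o (ν + α.dim) w ((nq k ^ (α.totalDim : ℤ) • bOp (exCls o w α)) m) := by
  classical
  suffices h : (opEminus Q o α ν w).comp (hallFn Q k o ν w) = (hallFn Q k o (ν + α.dim) w).comp
      (nq k ^ (α.totalDim : ℤ) • bOp (exCls o w α)) from LinearMap.congr_fun h m
  refine Finsupp.lhom_ext' fun X => LinearMap.ext_ring (Subtype.ext (funext fun x' => ?_))
  show ((-vC k) ^ α.totalDim *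
      vC k ^ ((Q.hat (framing o)).euler (hatZ α.dim 0) (hatZ ν w) + (α.totalDim : ℤ)) *
      (cardG k ν : ℂ)⁻¹) * ∑ x, ∑ y, (if InZ Q x x' y ∧ CokerIs Q o x' y α then
        (hallFn Q k o ν w (Finsupp.single X 1)).1 x else 0) =
    nq k ^ (α.totalDim : ℤ) * mat (bOp (exCls o w α)) (frCls x') X
  simp only [hallFn_single]
  refine (congrArg (HMul.hMul _) (sum_ite_card (fun (x : HRep Q k (framing o) ν w)
    (y : GrMap k ν (ν + α.dim)) => InZ Q x x' y ∧ CokerIs Q o x' y α) (fun x => frCls x) X)).trans ?_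
  rw [mat_bOp, mc]
  by_cases hX : X.dim = fdim ν
  · have hc := card_inZ hX x' (exCls o w α)
    simp only [quoC_fr_iff] at hc
    rw [hc, euler_framed_left, dimZ_exCls, dimZ_of_dim hX, zpow_add₀ vC_ne_zero, nq,
      zpow_natCast, zpow_natCast, ← vC_sq, neg_pow (vC k), neg_pow (vC k ^ 2)]
    have := cardG_ne_zero (k := k) ν
    push_cast
    field_simp
    have e : (fun i => (α.dim i : ℤ)) = α.dimZ := rfl
    rw [e]
    ring
  · have h1 : Nat.card {p : HRep Q k (framing o) ν w × GrMap k ν (ν + α.dim) //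
        frCls p.1 = X ∧ InZ Q p.1 x' p.2 ∧ CokerIs Q o x' p.2 α} = 0 := by
      have : IsEmpty {p : HRep Q k (framing o) ν w × GrMap k ν (ν + α.dim) //
        frCls p.1 = X ∧ InZ Q p.1 x' p.2 ∧ CokerIs Q o x' p.2 α} :=
        ⟨fun p => hX (by rw [← p.2.1, dim_frCls])⟩
      exact Nat.card_of_isEmpty
    have h2 : IsoCls.hall (exCls o w α) X (frCls x') = 0 := by
      by_contra h
      refine hX (funext fun j => ?_)
      have hd := hall_dim h j
      rw [dim_frCls, dim_exCls] at hd
      cases j with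
      | none =>
        have e1 : fdim (ν + α.dim) none = 1 := rfl
        have e2 : exDim α.dim none = 0 := rfl
        have e3 : fdim ν none = 1 := rfl
        omega
      | some i =>
        have e1 : fdim (ν + α.dim) (some i) = ν i + α.dim i := rfl
        have e2 : exDim α.dim (some i) = α.dim i := rfl
        have e3 : fdim ν (some i) = ν i := rfl
        omega
    rw [h1, h2]
    simp

end HallFunctions

end RingelHall
end

noncomputable section
namespace RingelHall

/-! ## Functions on the representation spaces and the simple classes -/

section SimpleOperators

variable {I H : Type*} [Fintype I] [DecidableEq I] [Fintype H] [DecidableEq H] {Q : Quiv I H}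
  {k : Type*} [Field k] [Fintype k] [DecidableEq k] {o : I → Bool} {ν ν' w : I → ℕ}

theorem mk_zero_congr {J A : Type*} {Γ : Quiv J A} {d d' : J → ℕ} (h : d = d') :
    IsoCls.mk (0 : Rep Γ k d) = IsoCls.mk (0 : Rep Γ k d') := by
  subst h
  rfl

theorem exDim_single (i : I) : exDim (Pi.single i 1) = Pi.single (some i) 1 := by
  funext j
  cases j with
  | none => simp [exDim]
  | some j =>
    by_cases h : j = i
    · subst h; simp [exDim]
    · simp [exDim, h]

theorem exCls_simple (i : I) :
    exCls o w (IsoCls.simple Q k i) = IsoCls.simple (framed Q o w) k (some i) := by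
  refine (exCls_mk _).trans ((congrArg IsoCls.mk (funext fun h => ?_)).trans
    (mk_zero_congr (exDim_single i)))
  cases h <;> rfl

theorem framed_loopless (hQ : ∀ h, Q.s h ≠ Q.t h) (i : I) :
    ∀ h, (framed Q o w).s h = some i → (framed Q o w).t h ≠ some i := by
  rintro (h | ⟨j, l⟩) h1 h2
  · exact hQ h (Option.some_injective _ (h1.trans h2.symm))
  · simp only [framed, Sum.elim_inr] at h1 h2
    cases hj : o j <;> simp [hj] at h1 h2

theorem card_fdim_single (i : I) (j : Option I) : Fintype.card (FinD (fdim (ν + Pi.single i 1)) j) =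
    Fintype.card (FinD (fdim ν) j) + (Pi.single (some i) 1 : Option I → ℕ) j := by
  have e : ∀ (d : Option I → ℕ), Fintype.card (FinD d j) = d j := fun d => Fintype.card_fin _
  rw [e, e]
  cases j with
  | none => simp [fdim]
  | some j =>
    show ν j + (Pi.single i 1 : I → ℕ) j = ν j + _
    rw [← exDim_single]
    rfl

theorem dim_of_hall_simple {i : I} {X Y : IsoCls (framed Q o w) k}
    (hY : Y.dim = fdim (ν + Pi.single i 1))
    (h : ∀ j, Y.dim j = X.dim j + (IsoCls.simple (framed Q o w) k (some i)).dim j) :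
    X.dim = fdim ν := by
  funext j
  have h1 := h j
  have h2 := card_fdim_single (ν := ν) i j
  have e : ∀ (d : Option I → ℕ), Fintype.card (FinD d j) = d j := fun d => Fintype.card_fin _
  rw [e, e] at h2
  rw [hY, h2, dim_simple] at h1
  omega

theorem card_inZ_simple (hQ : ∀ h, Q.s h ≠ Q.t h) (i : I) {X : IsoCls (framed Q o w) k}
    (hX : X.dim = fdim ν) (x' : HRep Q k (framing o) (ν + Pi.single i 1) w) :
    Nat.card {p : HRep Q k (framing o) ν w × GrMap k ν (ν + Pi.single i 1) //
      frCls p.1 = X ∧ InZ Q p.1 x' p.2} =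
    IsoCls.hall (exCls o w (IsoCls.simple Q k i)) X (frCls x') * cardG k ν := by
  rw [← card_inZ hX x' (exCls o w (IsoCls.simple Q k i))]
  refine Nat.card_congr (Equiv.subtypeEquivRight fun p => and_congr_right fun _ =>
    (and_iff_left_of_imp fun hz => ?_).symm)
  rw [exCls_simple]
  exact quoC_simple (n := FinD (fdim ν)) (n' := FinD (fdim (ν + Pi.single i 1)))
    (framed_loopless hQ i) (isHom_fr.2 hz.2) (injective_frMap.2 hz.1) (card_fdim_single i)

theorem card_outZ_simple (hQ : ∀ h, Q.s h ≠ Q.t h) (i : I) {X : IsoCls (framed Q o w) k}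
    (hX : X.dim = fdim ν) (x' : HRep Q k (framing o) (ν + Pi.single i 1) w) :
    Nat.card {p : HRep Q k (framing o) ν w × GrMap k (ν + Pi.single i 1) ν //
      frCls p.1 = X ∧ OutZ Q p.1 x' p.2} =
    IsoCls.hall X (exCls o w (IsoCls.simple Q k i)) (frCls x') * cardG k ν := by
  rw [← card_outZ hX x' (exCls o w (IsoCls.simple Q k i))]
  refine Nat.card_congr (Equiv.subtypeEquivRight fun p => and_congr_right fun _ =>
    (and_iff_left_of_imp fun hz => ?_).symm)
  rw [exCls_simple]
  exact subC_simple (n := FinD (fdim ν)) (n' := FinD (fdim (ν + Pi.single i 1)))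
    (framed_loopless hQ i) (isHom_fr.2 hz.2) (surjective_frMap.2 hz.1) (card_fdim_single i)

theorem card_frCls {X : IsoCls (framed Q o w) k} (hX : X.dim = fdim ν) :
    Nat.card {x : HRep Q k (framing o) ν w // frCls x = X} * X.aut = Nat.card kˣ * cardG k ν := by
  rw [← card_mIso_fdim, ← card_orbit (n := FinD (fdim ν)) (α := X)
    (fun j => (Fintype.card_fin _).trans (congrFun hX j).symm)]
  exact congrArg (· * X.aut) (Nat.card_congr (Equiv.subtypeEquiv fr fun _ => Iff.rfl))

theorem card_transfer {Y : Type*} [Finite Y] (R : HRep Q k (framing o) ν w →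
      HRep Q k (framing o) ν' w → Y → Prop)
    (e : GrGL k ν → Y ≃ Y)
    (he : ∀ g x x' y, R (act (hatGL w g) x) x' (e g y) ↔ R x x' y)
    {X X' : IsoCls (framed Q o w) k} (hX' : X'.dim = fdim ν') {c : ℕ}
    (hc : ∀ x', frCls x' = X' → Nat.card {p : HRep Q k (framing o) ν w × Y //
      frCls p.1 = X ∧ R p.1 x' p.2} = c * cardG k ν) (x : HRep Q k (framing o) ν w)
    (hx : frCls x = X) :
    Nat.card {p : HRep Q k (framing o) ν' w × Y // frCls p.1 = X' ∧ R x p.1 p.2} * X'.aut =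
      c * cardG k ν' * X.aut := by
  have hX : X.dim = fdim ν := hx ▸ dim_frCls x
  have h := double_count R (fun x => frCls x) (fun x' => frCls x') X X'
    (a := Nat.card {p : HRep Q k (framing o) ν' w × Y // frCls p.1 = X' ∧ R x p.1 p.2})
    (fun x₂ hx₂ => by
      obtain ⟨g, rfl⟩ := frCls_eq_iff.1 (hx₂.trans hx.symm)
      refine Nat.card_congr (Equiv.subtypeEquiv (Equiv.prodCongr (Equiv.refl _) (e g)) ?_)
      rintro ⟨x', y⟩
      exact and_congr_right fun _ => (he g x₂ x' y).symm) hc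
  have h1 := card_frCls hX
  have h2 := card_frCls hX'
  have hp : 0 < Nat.card kˣ * cardG k ν := Nat.mul_pos card_units_pos Nat.card_pos
  refine Nat.eq_of_mul_eq_mul_left hp ?_
  calc _ = (Nat.card {x : HRep Q k (framing o) ν w // frCls x = X} *
        Nat.card {p : HRep Q k (framing o) ν' w × Y // frCls p.1 = X' ∧ R x p.1 p.2}) *
          X.aut * X'.aut := by rw [← h1]; ring
    _ = (Nat.card {x : HRep Q k (framing o) ν' w // frCls x = X'} * X'.aut) * c * cardG k ν *
          X.aut := by rw [h]; ring
    _ = _ := by rw [h2]; ring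

/-- The exponent of `v` that relates the simple class at `i` to sums over morphisms. -/
def simpleExp (Q : Quiv I H) (o : I → Bool) (i : I) (ν w : I → ℕ) : ℤ :=
  (Q.hat (framing o)).euler (hatZ ν w) (hatZ (Pi.single i 1) 0)

theorem euler_simple (i : I) {X : IsoCls (framed Q o w) k} (hX : X.dim = fdim ν) :
    (framed Q o w).euler X.dimZ (exCls o w (IsoCls.simple Q k i)).dimZ = simpleExp Q o i ν w := by
  rw [simpleExp, euler_framed_right, dimZ_exCls, dimZ_of_dim hX]
  rfl

theorem mSum_hallFn (hQ : ∀ h, Q.s h ≠ Q.t h) (i : I) (m : HallSp (framed Q o w) k) :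
    mSum Q k (framing o) ν (ν + Pi.single i 1) w (hallFn Q k o ν w m).1 =
      ((cardG k ν : ℂ) * vC k ^ (-simpleExp Q o i ν w)) • (hallFn Q k o (ν + Pi.single i 1) w
        (rmOp (exCls o w (IsoCls.simple Q k i)) m)).1 := by
  classical
  suffices h : (mSum Q k (framing o) ν (ν + Pi.single i 1) w).comp
      ((InvFun Q k (framing o) ν w).subtype.comp (hallFn Q k o ν w)) =
      ((cardG k ν : ℂ) * vC k ^ (-simpleExp Q o i ν w)) •
        ((InvFun Q k (framing o) (ν + Pi.single i 1) w).subtype.comp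
          ((hallFn Q k o (ν + Pi.single i 1) w).comp
            (rmOp (exCls o w (IsoCls.simple Q k i))))) from LinearMap.congr_fun h m
  refine Finsupp.lhom_ext' fun X => LinearMap.ext_ring (funext fun x' => ?_)
  show mSum Q k (framing o) ν (ν + Pi.single i 1) w
      (hallFn Q k o ν w (Finsupp.single X 1)).1 x' =
    ((cardG k ν : ℂ) * vC k ^ (-simpleExp Q o i ν w)) *
      mat (rmOp (exCls o w (IsoCls.simple Q k i))) (frCls x') X
  rw [mSum_apply, mat_rmOp, mc]
  simp only [hallFn_single]
  refine (sum_ite_card (fun (x : HRep Q k (framing o) ν w)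
    (z : GrMap k (ν + Pi.single i 1) ν) => OutZ Q x x' z) (fun x => frCls x) X).trans ?_
  by_cases hX : X.dim = fdim ν
  · rw [card_outZ_simple hQ i hX, euler_simple i hX, zpow_neg]
    have := zpow_ne_zero (simpleExp Q o i ν w) (vC_ne_zero (k := k))
    push_cast
    field_simp
  · have h1 : IsEmpty {p : HRep Q k (framing o) ν w × GrMap k (ν + Pi.single i 1) ν //
        frCls p.1 = X ∧ OutZ Q p.1 x' p.2} := ⟨fun p => hX (by rw [← p.2.1, dim_frCls])⟩
    have h2 : IsoCls.hall X (exCls o w (IsoCls.simple Q k i)) (frCls x') = 0 := by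
      by_contra h
      rw [exCls_simple] at h
      exact hX (dim_of_hall_simple (dim_frCls x') fun j => by
        have := hall_dim h j
        omega)
    rw [Nat.card_of_isEmpty, h2]
    simp

theorem hallFn_uOp (hQ : ∀ h, Q.s h ≠ Q.t h) (i : I) (m : HallSp (framed Q o w) k) :
    (hallFn Q k o ν w (((nq k)⁻¹ • uOp (exCls o w (IsoCls.simple Q k i))) m)).1 =
      (cardG k (ν + Pi.single i 1) : ℂ)⁻¹ •
        (vC k ^ (-simpleExp Q o i ν w) • lSum Q k (framing o) ν (ν + Pi.single i 1) w
            (hallFn Q k o (ν + Pi.single i 1) w m).1 -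
          vC k ^ simpleExp Q o i ν w • rSum Q k (framing o) ν (ν + Pi.single i 1) w
            (hallFn Q k o (ν + Pi.single i 1) w m).1) := by
  classical
  set S := exCls o w (IsoCls.simple Q k i) with hS
  set ν' := ν + Pi.single i 1 with hν'
  suffices h : ((InvFun Q k (framing o) ν w).subtype.comp (hallFn Q k o ν w)).comp
      ((nq k)⁻¹ • uOp S) = (cardG k ν' : ℂ)⁻¹ •
        (vC k ^ (-simpleExp Q o i ν w) • (lSum Q k (framing o) ν ν' w).comp
          ((InvFun Q k (framing o) ν' w).subtype.comp (hallFn Q k o ν' w)) -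
        vC k ^ simpleExp Q o i ν w • (rSum Q k (framing o) ν ν' w).comp
          ((InvFun Q k (framing o) ν' w).subtype.comp (hallFn Q k o ν' w))) from
    LinearMap.congr_fun h m
  refine Finsupp.lhom_ext' fun X' => LinearMap.ext_ring (funext fun x => ?_)
  show (nq k)⁻¹ * mat (uOp S) (frCls x) X' = (cardG k ν' : ℂ)⁻¹ *
    (vC k ^ (-simpleExp Q o i ν w) * lSum Q k (framing o) ν ν' w
        (hallFn Q k o ν' w (Finsupp.single X' 1)).1 x -
      vC k ^ simpleExp Q o i ν w * rSum Q k (framing o) ν ν' w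
        (hallFn Q k o ν' w (Finsupp.single X' 1)).1 x)
  have hS1 : S.totalDim = 1 := by rw [hS, totalDim_exCls, totalDim_simple]
  have hd := dim_frCls x
  have hu : mat (uOp S) (frCls x) X' = mat (lOp S) (frCls x) X' - mat (wOp S) (frCls x) X' := by
    rw [uOp_of_totalDim_one hS1]
    rfl
  rw [lSum_apply, rSum_apply, hu, wOp, mat_lOp, mat_kOp_mul, mat_rOp, cc, cc, mc, mc]
  simp only [hallFn_single]
  rw [show (∑ x', ∑ y : GrMap k ν ν', if InZ Q x x' y then
      (if X' = frCls x' then (1 : ℂ) else 0) else 0) = _ from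
    sum_ite_card (fun (x' : HRep Q k (framing o) ν' w) (y : GrMap k ν ν') => InZ Q x x' y)
      (fun x' => frCls x') X', show (∑ x', ∑ z : GrMap k ν' ν, if OutZ Q x x' z then
      (if X' = frCls x' then (1 : ℂ) else 0) else 0) = _ from
    sum_ite_card (fun (x' : HRep Q k (framing o) ν' w) (z : GrMap k ν' ν) => OutZ Q x x' z)
      (fun x' => frCls x') X']
  by_cases hX : X'.dim = fdim ν'
  · have e1 := card_transfer (fun x x' y => InZ Q x x' y) precomp
      (fun g x x' y => inZ_precomp Q g x x' y) hX (X := frCls x) (c := IsoCls.hall S (frCls x) X')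
      (fun x' hx' => by rw [card_inZ_simple hQ i hd, hx']) x rfl
    have e2 := card_transfer (fun x x' z => OutZ Q x x' z) postcomp
      (fun g x x' z => outZ_postcomp g x x' z) hX (X := frCls x) (c := IsoCls.hall (frCls x) S X')
      (fun x' hx' => by rw [card_outZ_simple hQ i hd, hx']) x rfl
    have e1' := congrArg (Nat.cast : ℕ → ℂ) e1
    have e2' := congrArg (Nat.cast : ℕ → ℂ) e2
    push_cast at e1' e2'
    have a1 : (X'.aut : ℂ) ≠ 0 := by exact_mod_cast aut_ne_zero X'
    have a2 : (S.aut : ℂ) ≠ 0 := by exact_mod_cast aut_ne_zero S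
    have a3 := cardG_ne_zero (k := k) ν'
    have a4 : (Fintype.card k : ℂ) ≠ 0 := card_ne_zero'
    rw [eq_div_of_mul_eq a1 e1', eq_div_of_mul_eq a1 e2', euler_simple i hd, Quiv.symEuler,
      euler_simple i hd, ph, hS1, nq]
    rw [neg_add, zpow_add₀ vC_ne_zero, zpow_neg, zpow_neg]
    have b1 := zpow_ne_zero (simpleExp Q o i ν w) (vC_ne_zero (k := k))
    have b2 := zpow_ne_zero ((framed Q o w).euler S.dimZ (frCls x).dimZ) (vC_ne_zero (k := k))
    field_simp
    ring
  · have h1 : IsEmpty {p : HRep Q k (framing o) ν' w × GrMap k ν ν' //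
        frCls p.1 = X' ∧ InZ Q x p.1 p.2} := ⟨fun p => hX (by rw [← p.2.1, dim_frCls])⟩
    have h2 : IsEmpty {p : HRep Q k (framing o) ν' w × GrMap k ν' ν //
        frCls p.1 = X' ∧ OutZ Q x p.1 p.2} := ⟨fun p => hX (by rw [← p.2.1, dim_frCls])⟩
    have key : (∀ j, X'.dim j = (frCls x).dim j + S.dim j) → False := by
      intro h
      refine hX (funext fun j => ?_)
      have h3 := card_fdim_single (ν := ν) i j
      have e : ∀ (d : Option I → ℕ), Fintype.card (FinD d j) = d j := fun d => Fintype.card_fin _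
      rw [e, e] at h3
      have h4 : S.dim j = (Pi.single (some i) 1 : Option I → ℕ) j := by rw [hS, exCls_simple]; rfl
      rw [h, hd, h4, h3]
    have h3 : IsoCls.hall (frCls x) S X' = 0 := by
      by_contra h
      exact key fun j => hall_dim h j
    have h4 : IsoCls.hall S (frCls x) X' = 0 := by
      by_contra h
      exact key fun j => (hall_dim h j).trans (add_comm _ _)
    rw [Nat.card_of_isEmpty, Nat.card_of_isEmpty, h3, h4]
    simp

end SimpleOperators

end RingelHall
end

noncomputable section
namespace RingelHall

/-! ## Functions that vanish on the injective locus -/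

section LinearAlgebra

variable {k : Type*} [Field k]

theorem exists_mul_eq_one {m n : ℕ} (h : m ≤ n) :
    ∃ (z : Matrix (Fin m) (Fin n) k) (w : Matrix (Fin n) (Fin m) k), z * w = 1 := by
  refine ⟨(1 : Matrix (Fin n) (Fin n) k).submatrix (Fin.castLE h) id,
    (1 : Matrix (Fin n) (Fin n) k).submatrix id (Fin.castLE h), ?_⟩
  rw [← Matrix.submatrix_mul _ _ _ _ _ Function.bijective_id, Matrix.one_mul,
    Matrix.submatrix_one _ (Fin.castLE_injective h)]

theorem mulVec_surjective_of_mul_eq_one {a b : Type} [Fintype a] [Fintype b] [DecidableEq b]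
    {z : Matrix b a k} {w : Matrix a b k} (h : z * w = 1) : Function.Surjective z.mulVec := fun v =>
  ⟨w.mulVec v, by rw [Matrix.mulVec_mulVec, h, Matrix.one_mulVec]⟩

theorem exists_mul_eq_one_of_surjective {a b : Type} [Fintype a] [Fintype b] [DecidableEq a]
    [DecidableEq b] {z : Matrix b a k} (h : Function.Surjective z.mulVec) :
    ∃ w : Matrix a b k, z * w = 1 := by
  obtain ⟨g, hg⟩ := z.mulVecLin.exists_rightInverse_of_surjective (LinearMap.range_eq_top.2 h)
  refine ⟨LinearMap.toMatrix' g, Matrix.toLin'.injective ?_⟩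
  rw [Matrix.toLin'_mul, Matrix.toLin'_toMatrix', Matrix.toLin'_one]
  exact hg

theorem exists_gl_of_surjective {m n : ℕ} {z z' : Matrix (Fin m) (Fin n) k}
    (hz : Function.Surjective z.mulVec) (hz' : Function.Surjective z'.mulVec) :
    ∃ g : GL (Fin n) k, z * (g⁻¹).val = z' := by
  obtain ⟨w, hw⟩ := exists_mul_eq_one_of_surjective hz
  obtain ⟨w', hw'⟩ := exists_mul_eq_one_of_surjective hz'
  have hr : ∀ {y : Matrix (Fin m) (Fin n) k}, Function.Surjective y.mulVec →
      Module.finrank k (LinearMap.ker y.mulVecLin) = n - m := by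
    intro y hy
    have h1 := LinearMap.finrank_range_add_finrank_ker y.mulVecLin
    rw [LinearMap.range_eq_top.2 hy, finrank_top, Module.finrank_fintype_fun_eq_card,
      Module.finrank_fintype_fun_eq_card, Fintype.card_fin, Fintype.card_fin] at h1
    omega
  obtain ⟨y, hy, hyr⟩ := exists_matrix_range (LinearMap.ker z.mulVecLin) (hr hz)
  obtain ⟨y', hy', hyr'⟩ := exists_matrix_ker (k := k) (a := Fin n) (d := n - m)
    (LinearMap.range w'.mulVecLin) (by
      rw [LinearMap.finrank_range_of_inj (f := w'.mulVecLin) (fun u v huv => by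
        have := congrArg z'.mulVec huv
        simpa [Matrix.mulVec_mulVec, hw'] using this)]
      have h1 := LinearMap.finrank_range_add_finrank_ker z'.mulVecLin
      rw [LinearMap.range_eq_top.2 hz', finrank_top, hr hz', Module.finrank_fintype_fun_eq_card,
        Module.finrank_fintype_fun_eq_card, Fintype.card_fin, Fintype.card_fin] at h1
      rw [Module.finrank_fintype_fun_eq_card, Fintype.card_fin, Fintype.card_fin]
      omega)
  let φ : Matrix (Fin n) (Fin n) k := w * z' + y * y'
  have hzy : z * y = 0 := by
    refine Matrix.toLin'.injective (LinearMap.ext fun v => ?_)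
    rw [map_zero, Matrix.toLin'_apply, ← Matrix.mulVec_mulVec]
    have : y.mulVec v ∈ LinearMap.ker z.mulVecLin := hyr ▸ ⟨v, rfl⟩
    exact this
  have hzφ : z * φ = z' := by
    rw [Matrix.mul_add, ← Matrix.mul_assoc, hw, Matrix.one_mul, ← Matrix.mul_assoc, hzy,
      Matrix.zero_mul, add_zero]
  have hi : Function.Injective φ.mulVec := by
    refine (injective_iff_map_eq_zero φ.mulVecLin).2 fun v hv => ?_
    have hv : φ.mulVec v = 0 := hv
    have h1 : z'.mulVec v = 0 := by
      rw [← hzφ, ← Matrix.mulVec_mulVec, hv, Matrix.mulVec_zero]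
    have h2 : y.mulVec (y'.mulVec v) = 0 := by
      have : φ.mulVec v = w.mulVec (z'.mulVec v) + y.mulVec (y'.mulVec v) := by
        rw [Matrix.add_mulVec, Matrix.mulVec_mulVec, Matrix.mulVec_mulVec]
      rw [this, h1, Matrix.mulVec_zero, zero_add] at hv
      exact hv
    have h3 : v ∈ LinearMap.ker y'.mulVecLin := hy (h2.trans (Matrix.mulVec_zero y).symm)
    rw [hyr'] at h3
    obtain ⟨u, rfl⟩ := h3
    have h4 : z'.mulVec (w'.mulVec u) = 0 := h1
    rw [Matrix.mulVec_mulVec, hw', Matrix.one_mulVec] at h4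
    rw [h4, map_zero]
  have hu : IsUnit φ := Matrix.mulVec_injective_iff_isUnit.1 hi
  refine ⟨hu.unit⁻¹, ?_⟩
  rw [inv_inv]
  exact hzφ

end LinearAlgebra

section Source

variable {I H : Type*} [Fintype I] [DecidableEq I] [Fintype H] [DecidableEq H] {Q : Quiv I H}
  {k : Type*} [Field k] [Fintype k] [DecidableEq k] {Ω : H ⊕ I → Bool} {i : I} {ν w : I → ℕ}

theorem bijective_hatMap_of_surjective {z : GrMap k (ν + Pi.single i 1) ν}
    (hz : ∀ j, Function.Surjective (z j).mulVec) {j : I ⊕ I} (hj : j ≠ Sum.inl i) :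
    Function.Bijective (hatMap w z j).mulVec := by
  cases j with
  | inl j =>
    refine ⟨injective_of_card (hz j) ?_, hz j⟩
    have hj : j ≠ i := fun h => hj (congrArg _ h)
    show Fintype.card (Fin (ν j)) = Fintype.card (Fin (ν j + (Pi.single i 1 : I → ℕ) j))
    rw [Pi.single_eq_of_ne hj, add_zero]
  | inr j => exact bijective_gl (1 : GL (Fin (w j)) k)

theorem bijective_hatMap_of_injective {y : GrMap k ν (ν + Pi.single i 1)}
    (hy : ∀ j, Function.Injective (y j).mulVec) {j : I ⊕ I} (hj : j ≠ Sum.inl i) :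
    Function.Bijective (hatMap w y j).mulVec := by
  cases j with
  | inl j =>
    refine ⟨hy j, surjective_of_card (hy j) ?_⟩
    have hj : j ≠ i := fun h => hj (congrArg _ h)
    show Fintype.card (Fin (ν j + (Pi.single i 1 : I → ℕ) j)) = Fintype.card (Fin (ν j))
    rw [Pi.single_eq_of_ne hj, add_zero]
  | inr j => exact bijective_gl (1 : GL (Fin (w j)) k)

theorem notMem_injLocus_of_outZ (hs : (Q.hat Ω).IsSource (Sum.inl i)) {x : HRep Q k Ω ν w}
    {x' : HRep Q k Ω (ν + Pi.single i 1) w} {z : GrMap k (ν + Pi.single i 1) ν}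
    (h : OutZ Q x x' z) : x' ∉ injLocus Q Ω i (ν + Pi.single i 1) w := by
  intro hx
  have hk : ∃ u : Fin ((ν + Pi.single i 1 : I → ℕ) i) → k, u ≠ 0 ∧ (z i).mulVec u = 0 := by
    by_contra hc
    push Not at hc
    have hi : Function.Injective (z i).mulVecLin :=
      (injective_iff_map_eq_zero _).2 fun u hu => by_contra fun hu0 => hc u hu0 hu
    have := LinearMap.finrank_le_finrank_of_injective hi
    simp at this
  obtain ⟨u, hu, hu0⟩ := hk
  let U : ∀ j : I ⊕ I, Fin (Sum.elim (ν + Pi.single i 1) w j) → k :=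
    Function.update 0 (Sum.inl i) u
  have hU : ∀ j, (hatMap w z j).mulVec (U j) = 0 := by
    intro j
    by_cases hj : j = Sum.inl i
    · subst hj
      have : U (Sum.inl i) = u := Function.update_self _ _ _
      rw [this]
      exact hu0
    · have : U j = 0 := Function.update_of_ne hj _ _
      rw [this, Matrix.mulVec_zero]
  have hUi : U (Sum.inl i) = u := Function.update_self _ _ _
  refine hu (hUi.symm.trans (hx U fun a _ => ?_))
  refine (bijective_hatMap_of_surjective h.1 (hs a)).1 ?_
  rw [Matrix.mulVec_mulVec, ← h.2 a, ← Matrix.mulVec_mulVec, hU, Matrix.mulVec_zero,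
    Matrix.mulVec_zero]

theorem exists_outZ_of_notMem (hs : (Q.hat Ω).IsSource (Sum.inl i))
    {x' : HRep Q k Ω (ν + Pi.single i 1) w} (h : x' ∉ injLocus Q Ω i (ν + Pi.single i 1) w) :
    ∃ (x : HRep Q k Ω ν w) (z : GrMap k (ν + Pi.single i 1) ν), OutZ Q x x' z := by
  have h : ∃ u : ∀ j : I ⊕ I, Fin (Sum.elim (ν + Pi.single i 1) w j) → k,
      (∀ h, (Q.hat Ω).s h = Sum.inl i → (x' h).mulVec (u ((Q.hat Ω).s h)) = 0) ∧
        u (Sum.inl i) ≠ 0 := by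
    by_contra hc
    push Not at hc
    exact h hc
  obtain ⟨u, hu, hu0⟩ := h
  have key : ∀ (d : I → ℕ) (u₀ : ∀ j, Fin (d j) → k), u₀ i ≠ 0 →
      (∀ j, d j = ν j + (Pi.single i 1 : I → ℕ) j) → ∀ j, ∃ z : Matrix (Fin (ν j)) (Fin (d j)) k,
        Function.Surjective z.mulVec ∧
          (j = i → ∀ v, z.mulVec v = 0 → ∃ c : k, v = c • u₀ j) := by
    intro d u₀ h₀ hd j
    by_cases hj : j = i
    · subst hj
      obtain ⟨z, hz, hk⟩ := exists_matrix_ker (Submodule.span k {u₀ j}) (d := ν j) (by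
        rw [finrank_span_singleton h₀, Fintype.card_fin, hd, Pi.single_eq_same, add_comm])
      refine ⟨z, hz, fun _ v hv => ?_⟩
      have : v ∈ LinearMap.ker z.mulVecLin := hv
      rw [hk] at this
      obtain ⟨c, hc⟩ := Submodule.mem_span_singleton.1 this
      exact ⟨c, hc.symm⟩
    · obtain ⟨z, y, hz⟩ := exists_mul_eq_one (k := k) (m := ν j) (n := d j) (by rw [hd]; omega)
      exact ⟨z, mulVec_surjective_of_mul_eq_one hz, fun h => absurd h hj⟩
  have key := key (ν + Pi.single i 1) (fun j => u (Sum.inl j)) hu0 fun _ => rfl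
  choose z hz hzk using key
  have key' : ∀ j, ∃ y : Matrix (Fin (Sum.elim (ν + Pi.single i 1) w j)) (Fin (Sum.elim ν w j)) k,
      hatMap w z j * y = 1 := by
    intro j
    cases j with
    | inl j => exact exists_mul_eq_one_of_surjective (hz j)
    | inr j => exact ⟨(1 : Matrix (Fin (w j)) (Fin (w j)) k), Matrix.one_mul _⟩
  choose y hy using key'
  refine ⟨fun a => hatMap w z ((Q.hat Ω).t a) * x' a * y ((Q.hat Ω).s a), z, hz, fun a => ?_⟩
  rw [Matrix.mul_assoc, Matrix.mul_assoc]
  congr 1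
  refine Matrix.toLin'.injective (LinearMap.ext fun v => ?_)
  rw [Matrix.toLin'_apply, Matrix.toLin'_apply, ← Matrix.mulVec_mulVec, ← sub_eq_zero,
    ← Matrix.mulVec_sub]
  set v' := (y ((Q.hat Ω).s a) * hatMap w z ((Q.hat Ω).s a)).mulVec v - v with hv'
  have hzv : (hatMap w z ((Q.hat Ω).s a)).mulVec v' = 0 := by
    rw [hv', Matrix.mulVec_sub, Matrix.mulVec_mulVec, ← Matrix.mul_assoc, hy, Matrix.one_mul,
      sub_self]
  clear_value v'
  by_cases ha : (Q.hat Ω).s a = Sum.inl i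
  · have hsp : ∀ j (v : Fin (Sum.elim (ν + Pi.single i 1) w j) → k), j = Sum.inl i →
        (hatMap w z j).mulVec v = 0 → ∃ c : k, v = c • u j := by
      rintro _ v rfl hv
      exact hzk i rfl v hv
    obtain ⟨c, rfl⟩ := hsp _ v' ha hzv
    rw [Matrix.mulVec_smul, hu a ha, smul_zero]
  · have : v' = 0 := (bijective_hatMap_of_surjective hz ha).1 (hzv.trans (Matrix.mulVec_zero _).symm)
    rw [this, Matrix.mulVec_zero]

theorem outZ_unique (hs : (Q.hat Ω).IsSource (Sum.inl i)) {x : HRep Q k Ω ν w}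
    {x₁ x₂ : HRep Q k Ω (ν + Pi.single i 1) w} {z : GrMap k (ν + Pi.single i 1) ν}
    (h₁ : OutZ Q x x₁ z) (h₂ : OutZ Q x x₂ z) : x₁ = x₂ := by
  funext a
  refine Matrix.toLin'.injective (LinearMap.ext fun v => ?_)
  rw [Matrix.toLin'_apply, Matrix.toLin'_apply]
  refine (bijective_hatMap_of_surjective h₁.1 (hs a)).1 ?_
  rw [Matrix.mulVec_mulVec, Matrix.mulVec_mulVec, ← h₁.2 a, h₂.2 a]

theorem exists_act_of_outZ (hs : (Q.hat Ω).IsSource (Sum.inl i)) {x : HRep Q k Ω ν w}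
    {x₁ x₂ : HRep Q k Ω (ν + Pi.single i 1) w} {z₁ z₂ : GrMap k (ν + Pi.single i 1) ν}
    (h₁ : OutZ Q x x₁ z₁) (h₂ : OutZ Q x x₂ z₂) :
    ∃ g : GrGL k (ν + Pi.single i 1), act (hatGL w g) x₁ = x₂ := by
  have key : ∀ j, ∃ g : GL (Fin ((ν + Pi.single i 1 : I → ℕ) j)) k, z₁ j * (g⁻¹).val = z₂ j :=
    fun j => exists_gl_of_surjective (h₁.1 j) (h₂.1 j)
  choose g hg using key
  have e : precomp g z₁ = z₂ := funext hg
  exact ⟨g, outZ_unique hs (e ▸ (outZ_precomp g x x₁ z₁).2 h₁) h₂⟩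

theorem exists_outZ (x : HRep Q k Ω ν w) :
    ∃ (x' : HRep Q k Ω (ν + Pi.single i 1) w) (z : GrMap k (ν + Pi.single i 1) ν),
      OutZ Q x x' z := by
  have key : ∀ j, ∃ (z : Matrix (Fin (ν j)) (Fin ((ν + Pi.single i 1 : I → ℕ) j)) k)
      (y : Matrix (Fin ((ν + Pi.single i 1 : I → ℕ) j)) (Fin (ν j)) k), z * y = 1 := fun j =>
    exists_mul_eq_one (Nat.le_add_right _ _)
  choose z y hy using key
  have hy' : ∀ j, hatMap w z j * hatMap w y j = 1 := by
    intro j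
    cases j with
    | inl j => exact hy j
    | inr j => exact Matrix.one_mul _
  refine ⟨fun a => hatMap w y ((Q.hat Ω).t a) * x a * hatMap w z ((Q.hat Ω).s a), z,
    fun j => mulVec_surjective_of_mul_eq_one (hy j), fun a => ?_⟩
  rw [← Matrix.mul_assoc, ← Matrix.mul_assoc, hy', Matrix.one_mul]

theorem mSum_eq_zero_of_mem (hs : (Q.hat Ω).IsSource (Sum.inl i)) (g : HRep Q k Ω ν w → ℂ)
    {x' : HRep Q k Ω (ν + Pi.single i 1) w} (h : x' ∈ injLocus Q Ω i (ν + Pi.single i 1) w) :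
    mSum Q k Ω ν (ν + Pi.single i 1) w g x' = 0 := by
  rw [mSum_apply]
  exact Finset.sum_eq_zero fun x _ => Finset.sum_eq_zero fun z _ =>
    if_neg fun hz => notMem_injLocus_of_outZ hs hz h

theorem rSum_eq_zero (hs : (Q.hat Ω).IsSource (Sum.inl i))
    {F : HRep Q k Ω (ν + Pi.single i 1) w → ℂ}
    (hF : ∀ x' ∉ injLocus Q Ω i (ν + Pi.single i 1) w, F x' = 0) :
    rSum Q k Ω ν (ν + Pi.single i 1) w F = 0 := by
  funext x
  rw [rSum_apply]
  refine Finset.sum_eq_zero fun x' _ => Finset.sum_eq_zero fun z _ => ?_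
  split_ifs with hz
  · exact hF x' (notMem_injLocus_of_outZ hs hz)
  · rfl

theorem exists_mSum_eq (hs : (Q.hat Ω).IsSource (Sum.inl i))
    (F : InvFun Q k Ω (ν + Pi.single i 1) w)
    (hF : ∀ x' ∈ injLocus Q Ω i (ν + Pi.single i 1) w, F.1 x' = 0) :
    ∃ G : InvFun Q k Ω ν w, mSum Q k Ω ν (ν + Pi.single i 1) w G.1 = F.1 := by
  classical
  let n : HRep Q k Ω (ν + Pi.single i 1) w → ℂ := mSum Q k Ω ν (ν + Pi.single i 1) w 1
  have hn : ∀ (g : GrGL k (ν + Pi.single i 1)) x', n (act (hatGL w g) x') = n x' := by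
    intro g x'
    show mSum Q k Ω ν _ w 1 _ = mSum Q k Ω ν _ w 1 _
    rw [mSum_apply, mSum_apply]
    refine Finset.sum_congr rfl fun x _ => ?_
    rw [← Equiv.sum_comp (precomp g)]
    simp only [outZ_precomp]
  let L := fun x : HRep Q k Ω ν w => (exists_outZ (i := i) x).choose
  have hL : ∀ x, ∃ z, OutZ Q x (L x) z := fun x => (exists_outZ (i := i) x).choose_spec
  have hG : ∀ {x x' z}, OutZ Q x x' z → F.1 (L x) / n (L x) = F.1 x' / n x' := by
    intro x x' z hz
    obtain ⟨z₀, hz₀⟩ := hL x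
    obtain ⟨g, rfl⟩ := exists_act_of_outZ hs hz₀ hz
    rw [F.2 g, hn]
  refine ⟨⟨fun x => F.1 (L x) / n (L x), fun g x => ?_⟩, funext fun x' => ?_⟩
  · obtain ⟨z₀, hz₀⟩ := hL x
    exact hG ((outZ_postcomp g x (L x) z₀).2 hz₀)
  · have h1 : mSum Q k Ω ν (ν + Pi.single i 1) w (fun x => F.1 (L x) / n (L x)) x' =
        F.1 x' / n x' * n x' := by
      show _ = F.1 x' / n x' * mSum Q k Ω ν _ w 1 x'
      rw [mSum_apply, mSum_apply, Finset.mul_sum]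
      refine Finset.sum_congr rfl fun x _ => ?_
      rw [Finset.mul_sum]
      refine Finset.sum_congr rfl fun z _ => ?_
      split_ifs with hz
      · rw [hG hz, Pi.one_apply, mul_one]
      · rw [mul_zero]
    refine h1.trans ?_
    by_cases hx : n x' = 0
    · rw [hx, mul_zero]
      refine (hF x' (by_contra fun hc => ?_)).symm
      obtain ⟨x, z, hz⟩ := exists_outZ_of_notMem hs hc
      have h2 : n x' = (Nat.card {p : HRep Q k Ω ν w × GrMap k (ν + Pi.single i 1) ν //
          OutZ Q p.1 x' p.2} : ℂ) := by
        show mSum Q k Ω ν _ w 1 x' = _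
        rw [mSum_apply, Nat.card_eq_fintype_card, Fintype.card_subtype, Finset.card_filter,
          Fintype.sum_prod_type]
        push_cast
        rfl
      have h3 : Nat.card {p : HRep Q k Ω ν w × GrMap k (ν + Pi.single i 1) ν //
          OutZ Q p.1 x' p.2} ≠ 0 := by
        have : Nonempty {p : HRep Q k Ω ν w × GrMap k (ν + Pi.single i 1) ν //
          OutZ Q p.1 x' p.2} := ⟨⟨(x, z), hz⟩⟩
        exact Nat.card_pos.ne'
      exact h3 (by exact_mod_cast h2.symm.trans hx)
    · exact div_mul_cancel₀ _ hx

theorem mem_injLocus_act (g : GrGL k ν) (x : HRep Q k Ω ν w) :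
    act (hatGL w g) x ∈ injLocus Q Ω i ν w ↔ x ∈ injLocus Q Ω i ν w := by
  have one : ∀ (g : GrGL k ν) (x : HRep Q k Ω ν w), x ∈ injLocus Q Ω i ν w →
      act (hatGL w g) x ∈ injLocus Q Ω i ν w := by
    intro g x hx u hu
    have h1 : ((hatGL w g (Sum.inl i))⁻¹).val.mulVec (u (Sum.inl i)) = 0 :=
      hx (fun j => ((hatGL w g j)⁻¹).val.mulVec (u j)) fun a ha => by
        have h2 := hu a ha
        have h3 : act (hatGL w g) x a = (hatGL w g ((Q.hat Ω).t a)).val *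
          (x a * ((hatGL w g ((Q.hat Ω).s a))⁻¹).val) := Matrix.mul_assoc _ _ _
        rw [h3, ← Matrix.mulVec_mulVec, ← Matrix.mulVec_mulVec] at h2
        exact (bijective_gl _).1 (h2.trans (Matrix.mulVec_zero _).symm)
    exact (bijective_gl _).1 (h1.trans (Matrix.mulVec_zero _).symm)
  refine ⟨fun h => ?_, one g x⟩
  have := one g⁻¹ _ h
  have e : hatGL w g⁻¹ * hatGL w g = 1 := by
    funext j
    cases j with
    | inl j => exact inv_mul_cancel (g j)
    | inr j => exact mul_one (1 : GL (Fin (w j)) k)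
  rwa [← act_mul, e, act_one] at this

end Source

end RingelHall
end

noncomputable section
namespace RingelHall

/-! ## The null spaces and the raising operators -/

section Null

variable {I H : Type*} [Fintype I] [DecidableEq I] [Fintype H] [DecidableEq H] {Q : Quiv I H}
  {k : Type*} [Field k] [Fintype k] [DecidableEq k] {ψ : AddChar k ℂ}
  {Ω Ω' : H ⊕ I → Bool} {i : I} {o : I → Bool} {ν ν' w : I → ℕ}

theorem enlarge_loopless (hQ : ∀ h, Q.s h ≠ Q.t h) (a : H ⊕ I) :
    Q.enlarge.s a ≠ Sum.inl i ∨ Q.enlarge.t a ≠ Sum.inl i := by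
  cases a with
  | inl h =>
    by_contra hc
    push Not at hc
    exact hQ h (Sum.inl_injective (hc.1.trans hc.2.symm))
  | inr j => exact Or.inr (by simp [Quiv.enlarge])

theorem toSource_isSource (hQ : ∀ h, Q.s h ≠ Q.t h) (Ω : H ⊕ I → Bool) (i : I) :
    (Q.hat (toSource Q Ω i)).IsSource (Sum.inl i) := by
  intro a
  have h := enlarge_loopless (i := i) hQ a
  by_cases ht : (Q.hat Ω).t a = Sum.inl i
  · simp only [Quiv.reorient, toSource] at ht ⊢
    rcases hΩ : Ω a with _ | _ <;> simp_all
  · simp only [Quiv.reorient, toSource] at ht ⊢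
    rw [if_neg ht]
    exact ht

theorem ft_mSum (hQ : ∀ h, Q.s h ≠ Q.t h) (hψ : ψ ≠ 1) (Ω Ω' : H ⊕ I → Bool)
    (g : HRep Q k Ω ν w → ℂ) :
    ft Q ψ Ω Ω' (mSum Q k Ω ν (ν + Pi.single i 1) w g) =
      vC k ^ homExp Q Ω Ω' (ν + Pi.single i 1) ν w •
        mSum Q k Ω' ν (ν + Pi.single i 1) w (ft Q ψ Ω Ω' g) := by
  rw [mSum, mSum, LinearMap.sum_apply, LinearMap.sum_apply, map_sum, Finset.smul_sum]
  refine Finset.sum_congr rfl fun z hz => ft_pull hψ Ω Ω' (fun a => ?_) g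
  have hz := (Finset.mem_filter.1 hz).2
  exact (enlarge_loopless (i := i) hQ a).imp (bijective_hatMap_of_surjective hz)
    (bijective_hatMap_of_surjective hz)

theorem ft_lSum (hQ : ∀ h, Q.s h ≠ Q.t h) (hψ : ψ ≠ 1) (Ω Ω' : H ⊕ I → Bool)
    (g : HRep Q k Ω (ν + Pi.single i 1) w → ℂ) :
    ft Q ψ Ω Ω' (lSum Q k Ω ν (ν + Pi.single i 1) w g) =
      vC k ^ homExp Q Ω Ω' ν (ν + Pi.single i 1) w •
        lSum Q k Ω' ν (ν + Pi.single i 1) w (ft Q ψ Ω Ω' g) := by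
  rw [lSum, lSum, LinearMap.sum_apply, LinearMap.sum_apply, map_sum, Finset.smul_sum]
  refine Finset.sum_congr rfl fun z hz => ft_pull hψ Ω Ω' (fun a => ?_) g
  have hz := (Finset.mem_filter.1 hz).2
  exact (enlarge_loopless (i := i) hQ a).imp (bijective_hatMap_of_injective hz)
    (bijective_hatMap_of_injective hz)

theorem ft_rSum (hQ : ∀ h, Q.s h ≠ Q.t h) (hψ : ψ ≠ 1) (Ω Ω' : H ⊕ I → Bool)
    (g : HRep Q k Ω (ν + Pi.single i 1) w → ℂ) :
    ft Q ψ Ω Ω' (rSum Q k Ω ν (ν + Pi.single i 1) w g) =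
      (vC k ^ homExp Q Ω' Ω (ν + Pi.single i 1) ν w)⁻¹ •
        rSum Q k Ω' ν (ν + Pi.single i 1) w (ft Q ψ Ω Ω' g) := by
  rw [rSum, rSum, LinearMap.sum_apply, LinearMap.sum_apply, map_sum, Finset.smul_sum]
  refine Finset.sum_congr rfl fun z hz => ft_push hψ Ω Ω' (fun a => ?_) g
  have hz := (Finset.mem_filter.1 hz).2
  exact (enlarge_loopless (i := i) hQ a).imp (bijective_hatMap_of_surjective hz)
    (bijective_hatMap_of_surjective hz)

theorem hallFn_rmOp_eq_zero (h : ν i = 0) (m : HallSp (framed Q o w) k) :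
    hallFn Q k o ν w (rmOp (exCls o w (IsoCls.simple Q k i)) m) = 0 := by
  refine hallFn_mat_eq_zero_of_forall (fun l X hl => ?_) m
  by_contra hc
  rw [mat_rmOp] at hc
  have h1 := hall_dim (hall_ne_of_mc hc) (some i)
  rw [hl, exCls_simple, dim_simple, Pi.single_eq_same] at h1
  have h2 : fdim ν (some i) = ν i := rfl
  omega

theorem exists_eq_add_single (h : ν i ≠ 0) : ∃ d : I → ℕ, ν = d + Pi.single i 1 := by
  refine ⟨fun j => ν j - (Pi.single i 1 : I → ℕ) j, funext fun j => ?_⟩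
  by_cases hj : j = i
  · subst hj
    simp only [Pi.add_apply, Pi.single_eq_same]
    omega
  · simp only [Pi.add_apply, Pi.single_eq_of_ne hj]
    omega

/-- For an orientation with source `i`, the functions whose transform vanishes on `ⁱE` are those
obtained from the Hall space by multiplication with the simple class at `i`. -/
theorem vanish_iff (hQ : ∀ h, Q.s h ≠ Q.t h) (hψ : ψ ≠ 1)
    (hs : (Q.hat Ω).IsSource (Sum.inl i)) (f : InvFun Q k (framing o) ν w) :
    (∀ x ∈ injLocus Q Ω i ν w, (fourier Q ψ (framing o) Ω ν w f).1 x = 0) ↔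
      ∃ m, hallFn Q k o ν w (rmOp (exCls o w (IsoCls.simple Q k i)) m) = f := by
  by_cases h0 : ν i = 0
  · have hloc : ∀ x : HRep Q k Ω ν w, x ∈ injLocus Q Ω i ν w := by
      intro x u _
      funext a
      have : IsEmpty (Fin (Sum.elim ν w (Sum.inl i))) := by
        show IsEmpty (Fin (ν i))
        rw [h0]
        infer_instance
      exact isEmptyElim a
    constructor
    · intro h
      refine ⟨0, ?_⟩
      have h1 : ft Q ψ (framing o) Ω f.1 = 0 := funext fun x => h x (hloc x)
      have h2 := ft_ft hψ (framing o) Ω f.1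
      rw [h1, map_zero] at h2
      rw [map_zero, map_zero]
      exact Subtype.ext h2
    · rintro ⟨m, rfl⟩ x _
      rw [hallFn_rmOp_eq_zero h0, map_zero]
      rfl
  · obtain ⟨d, rfl⟩ := exists_eq_add_single h0
    have hv : ∀ n : ℤ, vC k ^ n ≠ 0 := fun n => zpow_ne_zero n vC_ne_zero
    constructor
    · intro h
      obtain ⟨G, hG⟩ := exists_mSum_eq hs _ h
      obtain ⟨m, hm, -⟩ := exists_hallFn (fourier Q ψ Ω (framing o) d w G)
      have h1 : f.1 = ft Q ψ Ω (framing o) (mSum Q k Ω d (d + Pi.single i 1) w G.1) := by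
        rw [hG, coe_fourier, ft_ft hψ]
      rw [ft_mSum hQ hψ, ← coe_fourier, ← hm, mSum_hallFn hQ] at h1
      refine ⟨(vC k ^ homExp Q Ω (framing o) (d + Pi.single i 1) d w *
        (cardG k d * vC k ^ (-simpleExp Q o i d w))) • m, Subtype.ext ?_⟩
      rw [map_smul, map_smul, h1, smul_smul]
      rfl
    · rintro ⟨m, rfl⟩ x hx
      have h1 := congrArg (fun F => ft Q ψ (framing o) Ω F x) (mSum_hallFn (o := o) hQ i (ν := d) m)
      simp only [ft_mSum hQ hψ, map_smul, Pi.smul_apply] at h1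
      rw [mSum_eq_zero_of_mem hs _ hx, smul_zero] at h1
      exact (smul_eq_zero.1 h1.symm).resolve_left (mul_ne_zero (cardG_ne_zero d) (hv _))

theorem mem_nullAt_iff (hQ : ∀ h, Q.s h ≠ Q.t h) (hψ : ψ ≠ 1) {f : InvFun Q k (framing o) ν w} :
    f ∈ nullAt Q ψ (framing o) i ν w ↔
      ∃ m, hallFn Q k o ν w (rmOp (exCls o w (IsoCls.simple Q k i)) m) = f :=
  vanish_iff hQ hψ (toSource_isSource hQ (framing o) i) f

theorem hallFn_mem_null (hQ : ∀ h, Q.s h ≠ Q.t h) (hψ : ψ ≠ 1)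
    {T : Module.End ℂ (HallSp (framed Q o w) k)}
    (hT : ∀ i, ∃ T', T * rmOp (exCls o w (IsoCls.simple Q k i)) =
      rmOp (exCls o w (IsoCls.simple Q k i)) * T')
    (h0 : ∀ m, hallFn Q k o ν w m = 0 → hallFn Q k o ν' w (T m) = 0)
    {m : HallSp (framed Q o w) k} (hm : hallFn Q k o ν w m ∈ null Q ψ (framing o) ν w) :
    hallFn Q k o ν' w (T m) ∈ null Q ψ (framing o) ν' w := by
  have key : null Q ψ (framing o) ν w ≤ ((null Q ψ (framing o) ν' w).comap
      ((hallFn Q k o ν' w).comp T)).map (hallFn Q k o ν w) := by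
    refine iSup_le fun i f hf => ?_
    obtain ⟨m, rfl⟩ := (mem_nullAt_iff hQ hψ).1 hf
    obtain ⟨T', hT'⟩ := hT i
    refine ⟨_, ?_, rfl⟩
    show hallFn Q k o ν' w ((T * rmOp (exCls o w (IsoCls.simple Q k i))) m) ∈
      null Q ψ (framing o) ν' w
    rw [hT']
    exact le_iSup (fun i => nullAt Q ψ (framing o) i ν' w) i ((mem_nullAt_iff hQ hψ).2 ⟨T' m, rfl⟩)
  obtain ⟨m', hm', he⟩ := key hm
  have h1 := h0 (m - m') (by rw [map_sub, he, sub_self])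
  rw [map_sub, map_sub, sub_eq_zero] at h1
  rw [h1]
  exact hm'

theorem homExp_source (hQ : ∀ h, Q.s h ≠ Q.t h) (hs : (Q.hat Ω).IsSource (Sum.inl i)) :
    homExp Q Ω Ω' ν (ν + Pi.single i 1) w =
      ∑ h, if (Q.hat Ω').t h = Sum.inl i then ((Sum.elim ν w ((Q.hat Ω').s h) : ℕ) : ℤ) else 0 := by
  have hd : ∀ j : I ⊕ I, ((Sum.elim (ν + Pi.single i 1) w j : ℕ) : ℤ) =
      (Sum.elim ν w j : ℕ) + if j = Sum.inl i then 1 else 0 := by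
    intro j
    cases j with
    | inl j =>
      by_cases hj : j = i
      · subst hj; simp
      · simp [hj]
    | inr j => simp
  refine Finset.sum_congr rfl fun a _ => ?_
  have h1 := hs a
  have h2 := enlarge_loopless (i := i) hQ a
  simp only [Quiv.reorient] at h1 ⊢
  cases ha : Ω a <;> cases hb : Ω' a <;> simp only [ha, cond_true, cond_false] at h1 ⊢ <;>
    simp only [edgeExp, hd, if_neg h1]
  · by_cases h3 : Q.enlarge.s a = Sum.inl i
    · simp only [h3, if_true]; ring
    · simp only [h3, if_false]; ring
  · by_cases h3 : Q.enlarge.t a = Sum.inl i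
    · simp only [h3, if_true]; ring
    · simp only [h3, if_false]; ring

open Classical in
/-- Restriction of an invariant function to `ⁱE`. -/
def restrictInj (Q : Quiv I H) (i : I) (F : InvFun Q k Ω ν w) : InvFun Q k Ω ν w :=
  ⟨fun x => if x ∈ injLocus Q Ω i ν w then F.1 x else 0, fun g x => by
    simp only [mem_injLocus_act, F.2 g]⟩

theorem opEplus_hallFn (hQ : ∀ h, Q.s h ≠ Q.t h) (hψ : ψ ≠ 1)
    (hs : (Q.hat Ω).IsSource (Sum.inl i)) (m : HallSp (framed Q o w) k) :
    hallFn Q k o ν w (((nq k)⁻¹ • uOp (exCls o w (IsoCls.simple Q k i))) m) -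
      fourier Q ψ Ω (framing o) ν w (opEplus Q Ω i ν w
        (fourier Q ψ (framing o) Ω (ν + Pi.single i 1) w (hallFn Q k o (ν + Pi.single i 1) w m))) ∈
      null Q ψ (framing o) ν w := by
  classical
  set S := exCls o w (IsoCls.simple Q k i) with hS
  set f := hallFn Q k o (ν + Pi.single i 1) w m with hf
  set F := fourier Q ψ (framing o) Ω (ν + Pi.single i 1) w f with hF
  set F₁ := restrictInj Q i F with hF₁
  have hF₁' : ∀ x' ∉ injLocus Q Ω i (ν + Pi.single i 1) w, F₁.1 x' = 0 := fun x' hx' => if_neg hx'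
  obtain ⟨m₁, hm₁, -⟩ := exists_hallFn (fourier Q ψ Ω (framing o) (ν + Pi.single i 1) w F₁)
  have h1 : (opEplus Q Ω i ν w F).1 = (vC k ^ (-(ν i : ℤ)) *
      (cardG k (ν + Pi.single i 1) : ℂ)⁻¹) • lSum Q k Ω ν (ν + Pi.single i 1) w F₁.1 := by
    funext x
    rw [Pi.smul_apply, lSum_apply]
    refine congrArg (HMul.hMul _) (Finset.sum_congr rfl fun x' _ => Finset.sum_congr rfl
      fun y _ => ?_)
    by_cases h2 : InZ Q x x' y <;> by_cases h3 : x' ∈ injLocus Q Ω i (ν + Pi.single i 1) w <;>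
      simp [h2, h3, hF₁, restrictInj]
  have h2 : rSum Q k (framing o) ν (ν + Pi.single i 1) w
      (hallFn Q k o (ν + Pi.single i 1) w m₁).1 = 0 := by
    have h3 := ft_rSum (i := i) hQ hψ Ω (framing o) F₁.1 (ν := ν)
    rw [rSum_eq_zero hs hF₁', map_zero] at h3
    rw [hm₁, coe_fourier]
    exact (smul_eq_zero.1 h3.symm).resolve_left (inv_ne_zero (zpow_ne_zero _ vC_ne_zero))
  have h3 : fourier Q ψ Ω (framing o) ν w (opEplus Q Ω i ν w F) =
      hallFn Q k o ν w (((nq k)⁻¹ • uOp S) m₁) := by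
    refine Subtype.ext ?_
    rw [hallFn_uOp hQ, h2, smul_zero, sub_zero, coe_fourier, h1, map_smul, ft_lSum hQ hψ, hm₁,
      coe_fourier, smul_smul, smul_smul, homExp_source hQ hs, simpleExp, euler_single_right]
    congr 1
    rw [mul_right_comm, ← zpow_add₀ vC_ne_zero, mul_comm]
    congr 2
    ring
  have h4 : ∃ m₂, hallFn Q k o (ν + Pi.single i 1) w (rmOp S m₂) =
      f - fourier Q ψ Ω (framing o) (ν + Pi.single i 1) w F₁ := by
    refine (vanish_iff hQ hψ hs _).1 fun x hx => ?_
    rw [map_sub]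
    have h5 : (fourier Q ψ (framing o) Ω (ν + Pi.single i 1) w
        (fourier Q ψ Ω (framing o) (ν + Pi.single i 1) w F₁)).1 = F₁.1 := ft_ft hψ Ω (framing o) F₁.1
    show F.1 x - (fourier Q ψ (framing o) Ω (ν + Pi.single i 1) w
        (fourier Q ψ Ω (framing o) (ν + Pi.single i 1) w F₁)).1 x = 0
    rw [h5, sub_eq_zero]
    exact (if_pos hx).symm
  obtain ⟨m₂, hm₂⟩ := h4
  have hS1 : S.totalDim = 1 := by rw [hS, totalDim_exCls, totalDim_simple]
  obtain ⟨T, hT⟩ := uOp_rmOp hS1 hS1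
  have h5 : hallFn Q k o ν w (((nq k)⁻¹ • uOp S) (m - m₁ - rmOp S m₂)) = 0 := by
    have h6 : hallFn Q k o (ν + Pi.single i 1) w (m - m₁ - rmOp S m₂) = 0 := by
      rw [map_sub, map_sub, hm₁, hm₂, ← hf, sub_self]
    refine Subtype.ext ?_
    rw [hallFn_uOp hQ, h6]
    simp
  rw [map_sub, map_sub, map_sub, map_sub, ← h3, sub_eq_zero] at h5
  rw [h5]
  refine le_iSup (fun i => nullAt Q ψ (framing o) i ν w) i ((mem_nullAt_iff hQ hψ).2
    ⟨(nq k)⁻¹ • T m₂, ?_⟩)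
  have h6 := congrArg (fun A : Module.End ℂ (HallSp (framed Q o w) k) => A m₂) hT
  congr 1
  rw [map_smul]
  exact congrArg (fun a => (nq k)⁻¹ • a) h6.symm

end Null

end RingelHall
end

noncomputable section
namespace RingelHall

/-! ## The module structure -/

theorem exists_ringHom_of_surjective {R V W : Type*} [Ring R] [AddCommGroup V] [Module ℂ V]
    [AddCommGroup W] [Module ℂ W] (ρ : R →+* Module.End ℂ V) (p : V →ₗ[ℂ] W)
    (hp : Function.Surjective p) (hk : ∀ a v, p v = 0 → p (ρ a v) = 0) :
    ∃ Φ : R →+* Module.End ℂ W, ∀ a v, Φ a (p v) = p (ρ a v) := by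
  obtain ⟨s, hs⟩ := p.exists_rightInverse_of_surjective (LinearMap.range_eq_top.2 hp)
  have key : ∀ a v, p (ρ a (s (p v))) = p (ρ a v) := by
    intro a v
    rw [← sub_eq_zero, ← map_sub, ← map_sub]
    refine hk a _ ?_
    rw [map_sub, sub_eq_zero]
    exact LinearMap.congr_fun hs (p v)
  have hx : ∀ {f g : Module.End ℂ W}, (∀ v, f (p v) = g (p v)) → f = g := fun h =>
    LinearMap.ext fun x => by
      obtain ⟨v, rfl⟩ := hp x
      exact h v
  refine ⟨{ toFun := fun a => p ∘ₗ ρ a ∘ₗ s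
            map_one' := hx fun v => (key 1 v).trans (by rw [map_one]; rfl)
            map_zero' := hx fun v => (key 0 v).trans (by rw [map_zero]; exact map_zero p)
            map_mul' := fun a b => hx fun v => ?_
            map_add' := fun a b => hx fun v => ?_ }, key⟩
  · show p (ρ (a * b) (s (p v))) = p (ρ a (s (p (ρ b (s (p v))))))
    rw [key, key, map_mul]
    have := hk a (ρ b (s (p v)) - ρ b v) (by rw [map_sub, key, sub_self])
    rw [map_sub, map_sub, sub_eq_zero] at this
    exact this.symm
  · show p (ρ (a + b) (s (p v))) = p (ρ a (s (p v))) + p (ρ b (s (p v)))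
    rw [show ρ (a + b) = ρ a + ρ b from map_add ρ a b]
    exact map_add p _ _

section Degrees

variable {I H : Type*} [Fintype I] [DecidableEq I] [Fintype H] [DecidableEq H] {Q : Quiv I H}
  {k : Type*} [Field k] [Fintype k] [DecidableEq k] {o : I → Bool} {ν w : I → ℕ}

theorem hallFn_kOp_eq_zero (μ : Option I → ℤ) {m : HallSp (framed Q o w) k}
    (h : hallFn Q k o ν w m = 0) : hallFn Q k o ν w (kOp (framed Q o w) k μ m) = 0 := by
  refine Subtype.ext (funext fun x => ?_)
  have h1 : m (frCls x) = 0 := congrFun (congrArg Subtype.val h) x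
  rw [hallFn_apply, kOp_apply, h1, mul_zero]
  rfl

theorem hallFn_uOp_eq_zero (hQ : ∀ h, Q.s h ≠ Q.t h) (i : I) {m : HallSp (framed Q o w) k}
    (h : hallFn Q k o (ν + Pi.single i 1) w m = 0) :
    hallFn Q k o ν w (((nq k)⁻¹ • uOp (exCls o w (IsoCls.simple Q k i))) m) = 0 := by
  refine Subtype.ext ?_
  rw [hallFn_uOp hQ, h]
  simp

theorem hallFn_bOp_eq_zero (α : IsoCls Q k) {ν' : I → ℕ} {m : HallSp (framed Q o w) k}
    (h : ∀ ν, ν' = ν + α.dim → hallFn Q k o ν w m = 0) :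
    hallFn Q k o ν' w ((nq k ^ (α.totalDim : ℤ) • bOp (exCls o w α)) m) = 0 := by
  by_cases hν : ∃ ν, ν' = ν + α.dim
  · obtain ⟨ν, rfl⟩ := hν
    rw [← opEminus_hallFn, h ν rfl, map_zero]
  · refine hallFn_mat_eq_zero_of_forall (fun l X hl => ?_) m
    by_contra hc
    rw [mat_smul, mat_bOp] at hc
    have h1 := hall_dim (hall_ne_of_mc (right_ne_zero_of_mul hc))
    refine hν ⟨fun i => X.dim (some i), funext fun i => ?_⟩
    have h2 := h1 (some i)
    rw [hl, dim_exCls] at h2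
    exact h2.trans (add_comm _ _)

end Degrees

section Action

variable {I H : Type*} [Fintype I] [DecidableEq I] [Fintype H] [DecidableEq H] {Q : Quiv I H}
  {k : Type*} [Field k] [Fintype k] [DecidableEq k] {o : I → Bool} {w : I → ℕ} {ψ : AddChar k ℂ}

theorem repQ_K (μ : I → ℤ) : repQ o w (DHat.K Q k μ).1 = kOp (framed Q o w) k (exDimZ μ) :=
  repQ_of _

theorem repQ_uP (i : I) : repQ o w (DHat.uP Q k i).1 =
    (nq k)⁻¹ • uOp (exCls o w (IsoCls.simple Q k i)) := by
  refine (repQ_of _).trans ?_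
  show nq k ^ (-((exCls o w (IsoCls.simple Q k i)).totalDim : ℤ)) • _ = _
  rw [totalDim_exCls, totalDim_simple, Nat.cast_one, zpow_neg_one]

theorem repQ_uM (α : IsoCls Q k) : repQ o w (DHat.uM Q k α).1 =
    nq k ^ (α.totalDim : ℤ) • bOp (exCls o w α) := by
  refine (repQ_of _).trans ?_
  show nq k ^ ((exCls o w α).totalDim : ℤ) • _ = _
  rw [totalDim_exCls]

theorem repQ_mem_null (hQ : ∀ h, Q.s h ≠ Q.t h) (hψ : ψ ≠ 1) (a : DHat Q k)
    {m : HallSp (framed Q o w) k} (hm : ∀ ν, hallFn Q k o ν w m ∈ null Q ψ (framing o) ν w) :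
    ∀ ν, hallFn Q k o ν w (repQ o w a.1 m) ∈ null Q ψ (framing o) ν w := by
  obtain ⟨a, ha⟩ := a
  dsimp only
  unfold DHat at ha
  have hS : ∀ i, (exCls o w (IsoCls.simple Q k i)).totalDim = 1 := fun i => by
    rw [totalDim_exCls, totalDim_simple]
  induction ha using Algebra.adjoin_induction generalizing m with
  | mem a ha =>
    intro ν
    obtain (⟨i, rfl⟩ | ⟨α, rfl⟩) | ⟨μ, rfl⟩ := ha
    · have e := repQ_uP (o := o) (w := w) (Q := Q) (k := k) i
      simp only [DHat.uP] at e
      rw [e]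
      refine hallFn_mem_null hQ hψ (fun j => ?_) (fun m h => hallFn_uOp_eq_zero hQ i h) (hm _)
      obtain ⟨T, hT⟩ := uOp_rmOp (hS i) (hS j)
      exact ⟨(nq k)⁻¹ • T, by rw [smul_mul_assoc, hT, mul_smul_comm]⟩
    · have e := repQ_uM (o := o) (w := w) (Q := Q) (k := k) α
      simp only [DHat.uM] at e
      rw [e]
      by_cases hν : ∃ d, ν = d + α.dim
      · obtain ⟨d, rfl⟩ := hν
        refine hallFn_mem_null hQ hψ (fun j => ⟨nq k ^ (α.totalDim : ℤ) • bOp (exCls o w α), ?_⟩)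
          (fun m h => hallFn_bOp_eq_zero α fun d' hd => ?_) (hm d)
        · rw [smul_mul_assoc, bOp_rmOp, mul_smul_comm]
        · rw [← add_right_cancel hd, h]
      · rw [hallFn_bOp_eq_zero α fun d hd => absurd ⟨d, hd⟩ hν]
        exact Submodule.zero_mem _
    · have e := repQ_K (o := o) (w := w) (Q := Q) (k := k) μ
      simp only [DHat.K] at e
      rw [e]
      refine hallFn_mem_null hQ hψ (fun j => ?_) (fun m h => hallFn_kOp_eq_zero _ h) (hm ν)
      exact ⟨_, (kOp_rmOp _ _).trans (mul_smul_comm _ _ _).symm⟩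
  | algebraMap c =>
    intro ν
    have e : repQ o w (algebraMap (Qv k) (DoubleHall Q k) c) m = (c : ℂ) • m := by
      rw [AlgHom.commutes, Algebra.algebraMap_eq_smul_one, qv_smul]
      rfl
    rw [e, map_smul]
    exact Submodule.smul_mem _ _ (hm ν)
  | add a b _ _ ha hb =>
    intro ν
    rw [map_add, LinearMap.add_apply, map_add]
    exact Submodule.add_mem _ (ha hm ν) (hb hm ν)
  | mul a b _ _ ha hb =>
    intro ν
    rw [map_mul]
    exact ha (hb hm) ν

/-- The direct sum of the Hall spaces of all framed quivers. -/
abbrev FrSp (Q : Quiv I H) (k : Type*) [Field k] [Fintype k] (o : I → Bool) : Type _ :=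
  DirectSum (I → ℕ) fun w => HallSp (framed Q o w) k

/-- The action of `D̂_q(Q)` on the direct sum of the Hall spaces. -/
def repFr (Q : Quiv I H) (k : Type*) [Field k] [Fintype k] [DecidableEq k] (o : I → Bool) :
    DHat Q k →+* Module.End ℂ (FrSp Q k o) where
  toFun a := DirectSum.lmap fun w => repQ o w a.1
  map_one' := LinearMap.ext fun m => DFinsupp.ext fun w => by
    show repQ o w (1 : DoubleHall Q k) (m w) = m w
    rw [map_one]
    rfl
  map_zero' := LinearMap.ext fun m => DFinsupp.ext fun w => by
    show repQ o w (0 : DoubleHall Q k) (m w) = 0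
    rw [map_zero]
    rfl
  map_mul' a b := LinearMap.ext fun m => DFinsupp.ext fun w => by
    show repQ o w (a.1 * b.1) (m w) = repQ o w a.1 (repQ o w b.1 (m w))
    rw [map_mul]
    rfl
  map_add' a b := LinearMap.ext fun m => DFinsupp.ext fun w => by
    show repQ o w (a.1 + b.1) (m w) = repQ o w a.1 (m w) + repQ o w b.1 (m w)
    rw [map_add]
    rfl

/-- The components of the elements of `ℱ`. -/
def fComp (ψ : AddChar k ℂ) (Ω : H ⊕ I → Bool) (ν w : I → ℕ) :
    FSpace Q ψ Ω →ₗ[ℂ] InvFun Q k Ω ν w ⧸ null Q ψ Ω ν w :=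
  DirectSum.component ℂ ((I → ℕ) × (I → ℕ)) (FGr Q ψ Ω) (ν, w)

theorem fComp_ext {Ω : H ⊕ I → Bool} {x y : FSpace Q ψ Ω}
    (h : ∀ ν w, fComp ψ Ω ν w x = fComp ψ Ω ν w y) : x = y :=
  DFinsupp.ext fun d => h d.1 d.2

theorem fComp_cls {Ω : H ⊕ I → Bool} {ν : I → ℕ} (f : InvFun Q k Ω ν w) :
    fComp ψ Ω ν w (cls Q ψ Ω f) = (null Q ψ Ω ν w).mkQ f :=
  DFinsupp.single_eq_same

theorem fComp_cls_of_ne {Ω : H ⊕ I → Bool} {ν ν' w' : I → ℕ} (f : InvFun Q k Ω ν w)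
    (h : (ν, w) ≠ (ν', w')) : fComp ψ Ω ν' w' (cls Q ψ Ω f) = 0 :=
  DFinsupp.single_eq_of_ne h.symm

open Classical in
/-- The projection from the direct sum of the Hall spaces to the space `ℱ`. -/
def toF (Q : Quiv I H) (ψ : AddChar k ℂ) (o : I → Bool) : FrSp Q k o →ₗ[ℂ] FSpace Q ψ (framing o) :=
  DirectSum.toModule ℂ (I → ℕ) (FSpace Q ψ (framing o)) fun w =>
    Finsupp.linearCombination ℂ fun X : IsoCls (framed Q o w) k =>
      if X.dim none = 1 then
        cls Q ψ (framing o) (hallFn Q k o (fun i => X.dim (some i)) w (Finsupp.single X 1)) else 0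

theorem fComp_toF (ν w : I → ℕ) (m : FrSp Q k o) :
    fComp ψ (framing o) ν w (toF Q ψ o m) = (null Q ψ (framing o) ν w).mkQ (hallFn Q k o ν w (m w)) := by
  suffices h : (fComp ψ (framing o) ν w).comp (toF Q ψ o) = ((null Q ψ (framing o) ν w).mkQ.comp
      (hallFn Q k o ν w)).comp (DirectSum.component ℂ (I → ℕ) _ w) from LinearMap.congr_fun h m
  refine DirectSum.linearMap_ext _ fun w₀ => Finsupp.lhom_ext' fun X => LinearMap.ext_ring ?_
  show fComp ψ (framing o) ν w (toF Q ψ o (DirectSum.lof ℂ (I → ℕ)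
      (fun w => HallSp (framed Q o w) k) w₀ (Finsupp.single X 1))) =
    (null Q ψ (framing o) ν w).mkQ (hallFn Q k o ν w (DirectSum.lof ℂ (I → ℕ)
      (fun w => HallSp (framed Q o w) k) w₀ (Finsupp.single X 1) w))
  have h1 : toF Q ψ o (DirectSum.lof ℂ (I → ℕ) (fun w => HallSp (framed Q o w) k) w₀
      (Finsupp.single X 1)) = if X.dim none = 1 then
        cls Q ψ (framing o) (hallFn Q k o (fun i => X.dim (some i)) w₀ (Finsupp.single X 1))
          else 0 := by
    rw [toF, DirectSum.toModule_lof]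
    exact (Finsupp.linearCombination_single ℂ _ _).trans (one_smul ℂ _)
  rw [h1]
  have hs : ∀ {ν}, X.dim ≠ fdim ν → hallFn Q k o ν w₀ (Finsupp.single X 1) = 0 := by
    intro ν hX
    refine Subtype.ext (funext fun x => ?_)
    rw [hallFn_apply]
    exact Finsupp.single_eq_of_ne fun h => hX (by rw [← h, dim_frCls])
  by_cases hw : w₀ = w
  · subst hw
    rw [DirectSum.lof_apply]
    by_cases hν : X.dim = fdim ν
    · have h0 : X.dim none = 1 := congrFun hν none
      have h2 : (fun i => X.dim (some i)) = ν := funext fun i => congrFun hν (some i)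
      rw [if_pos h0]
      subst h2
      exact fComp_cls _
    · rw [hs hν, map_zero]
      split_ifs with h0
      · refine fComp_cls_of_ne _ fun h => hν (funext fun j => ?_)
        cases j with
        | none => exact h0
        | some i => exact congrFun (congrArg Prod.fst h) i
      · exact map_zero _
  · have h2 : DirectSum.lof ℂ (I → ℕ) (fun w => HallSp (framed Q o w) k) w₀
        (Finsupp.single X 1) w = 0 := DFinsupp.single_eq_of_ne (Ne.symm hw)
    rw [h2, map_zero, map_zero]
    split_ifs
    · exact fComp_cls_of_ne _ fun h => hw (congrArg Prod.snd h)
    · exact map_zero _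

theorem toF_eq_zero_iff (m : FrSp Q k o) : toF Q ψ o m = 0 ↔
    ∀ ν w, hallFn Q k o ν w (m w) ∈ null Q ψ (framing o) ν w := by
  simp only [← Submodule.Quotient.mk_eq_zero]
  constructor
  · intro h ν w
    rw [← Submodule.mkQ_apply, ← fComp_toF, h, map_zero]
  · intro h
    refine fComp_ext fun ν w => ?_
    rw [fComp_toF, map_zero]
    exact h ν w

theorem toF_lof {ν : I → ℕ} {m : HallSp (framed Q o w) k}
    (h : ∀ ν' ≠ ν, hallFn Q k o ν' w m = 0) :
    toF Q ψ o (DirectSum.lof ℂ (I → ℕ) (fun w => HallSp (framed Q o w) k) w m) =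
      cls Q ψ (framing o) (hallFn Q k o ν w m) := by
  refine fComp_ext fun ν' w' => ?_
  rw [fComp_toF]
  by_cases hw : w = w'
  · subst hw
    rw [DirectSum.lof_apply]
    by_cases hν : ν' = ν
    · subst hν
      exact (fComp_cls _).symm
    · rw [h ν' hν, map_zero]
      exact (fComp_cls_of_ne _ fun e => hν (congrArg Prod.fst e).symm).symm
  · have h2 : DirectSum.lof ℂ (I → ℕ) (fun w => HallSp (framed Q o w) k) w m w' = 0 :=
      DFinsupp.single_eq_of_ne (Ne.symm hw)
    rw [h2, map_zero, map_zero]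
    exact (fComp_cls_of_ne _ fun e => hw (congrArg Prod.snd e)).symm

theorem exists_toF_eq_cls {ν : I → ℕ} (f : InvFun Q k (framing o) ν w) :
    ∃ m : HallSp (framed Q o w) k, hallFn Q k o ν w m = f ∧
      (∀ ν' ≠ ν, hallFn Q k o ν' w m = 0) ∧
      toF Q ψ o (DirectSum.lof ℂ (I → ℕ) (fun w => HallSp (framed Q o w) k) w m) =
        cls Q ψ (framing o) f := by
  obtain ⟨m, rfl, hs⟩ := exists_hallFn f
  have h := fun (ν' : I → ℕ) (hν : ν' ≠ ν) => hallFn_eq_zero_of_suppIn hs hν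
  exact ⟨m, rfl, h, toF_lof h⟩

theorem toF_surjective : Function.Surjective (toF Q ψ o) := by
  rw [← LinearMap.range_eq_top, eq_top_iff]
  rintro x -
  induction x using DirectSum.induction_on with
  | zero => exact Submodule.zero_mem _
  | of d y =>
    obtain ⟨f, rfl⟩ := Submodule.mkQ_surjective _ y
    obtain ⟨m, -, -, hm⟩ := exists_toF_eq_cls (ψ := ψ) f
    exact ⟨_, hm⟩
  | add x y hx hy => exact Submodule.add_mem _ hx hy

theorem repFr_lof (a : DHat Q k) (m : HallSp (framed Q o w) k) :
    repFr Q k o a (DirectSum.lof ℂ (I → ℕ) (fun w => HallSp (framed Q o w) k) w m) =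
      DirectSum.lof ℂ (I → ℕ) (fun w => HallSp (framed Q o w) k) w (repQ o w a.1 m) :=
  DirectSum.lmap_lof _ _ _

theorem cls_eq_of_sub_mem {Ω : H ⊕ I → Bool} {ν : I → ℕ} {f g : InvFun Q k Ω ν w}
    (h : f - g ∈ null Q ψ Ω ν w) : cls Q ψ Ω f = cls Q ψ Ω g :=
  congrArg (DirectSum.lof ℂ ((I → ℕ) × (I → ℕ)) (FGr Q ψ Ω) (ν, w)) ((Submodule.Quotient.eq _).2 h)

theorem cls_zero {Ω : H ⊕ I → Bool} {ν : I → ℕ} : cls Q ψ Ω (0 : InvFun Q k Ω ν w) = 0 :=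
  map_zero ((DirectSum.lof ℂ ((I → ℕ) × (I → ℕ)) (FGr Q ψ Ω) (ν, w)).comp (null Q ψ Ω ν w).mkQ)

end Action

end RingelHall
end

theorem theorem3p2 {I H k : Type*} [Fintype I] [DecidableEq I] [Fintype H] [DecidableEq H]
    [Field k] [Fintype k] [DecidableEq k]
    (Q : Quiv I H) (hQ : ∀ h, Q.s h ≠ Q.t h)
    (ψ : AddChar k ℂ) (hψ : ψ ≠ 1) (o : I → Bool) :
    ∃ _ : Module (DHat Q k) (FSpace Q ψ (framing o)),
      -- scalars in `ℚ(v)` act as usual, and the action is `ℂ`-linear on the function space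
      (∀ (c : Qv k) (m : FSpace Q ψ (framing o)),
        algebraMap (Qv k) (DHat Q k) c • m = (c : ℂ) • m) ∧
      (∀ (c : ℂ) (a : DHat Q k) (m : FSpace Q ψ (framing o)), a • (c • m) = c • (a • m)) ∧
      -- `K_{± i}` acts as `𝒦_i^{± 1}`
      (∀ (i : I) (ν w : I → ℕ) (f : InvFun Q k (framing o) ν w),
        DHat.K Q k (Pi.single i 1) • cls Q ψ (framing o) f =
            cls Q ψ (framing o) (opK Q (framing o) i ν w f) ∧
          DHat.K Q k (-Pi.single i 1) • cls Q ψ (framing o) f =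
            cls Q ψ (framing o) (opKinv Q (framing o) i ν w f)) ∧
      -- `u⁺_i` acts as `ℰ⁺_i`, computed in any orientation in which `i` is a source
      (∀ (i : I) (Ω : H ⊕ I → Bool), (Q.hat Ω).IsSource (Sum.inl i) →
        ∀ (ν w : I → ℕ) (f : InvFun Q k (framing o) (ν + Pi.single i 1) w),
          DHat.uP Q k i • cls Q ψ (framing o) f =
            cls Q ψ (framing o) (fourier Q ψ Ω (framing o) ν w
              (opEplus Q Ω i ν w (fourier Q ψ (framing o) Ω (ν + Pi.single i 1) w f)))) ∧
      (∀ (i : I) (ν w : I → ℕ) (f : InvFun Q k (framing o) ν w), ν i = 0 →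
        DHat.uP Q k i • cls Q ψ (framing o) f = 0) ∧
      -- `u⁻_α` acts as `ℰ⁻_α`
      (∀ (α : IsoCls Q k) (ν w : I → ℕ) (f : InvFun Q k (framing o) ν w),
        DHat.uM Q k α • cls Q ψ (framing o) f =
          cls Q ψ (framing o) (opEminus Q o α ν w f)) := by
  obtain ⟨Φ, hΦ⟩ := exists_ringHom_of_surjective (V := FrSp Q k o)
    (W := FSpace Q ψ (framing o)) (repFr Q k o) (toF Q ψ o) toF_surjective
    fun a m hm => by
      rw [toF_eq_zero_iff] at hm ⊢
      exact fun ν w => repQ_mem_null hQ hψ a (fun ν => hm ν w) ν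
  have key : ∀ (a : DHat Q k) {w : I → ℕ} (m : HallSp (framed Q o w) k),
      Φ a (toF Q ψ o (DirectSum.lof ℂ (I → ℕ) (fun w => HallSp (framed Q o w) k) w m)) =
        toF Q ψ o (DirectSum.lof ℂ (I → ℕ) (fun w => HallSp (framed Q o w) k) w
          (repQ o w a.1 m)) := fun a w m => by rw [hΦ, repFr_lof]
  refine ⟨Module.compHom _ Φ, fun c x => ?_, fun c a x => map_smul (Φ a) c x, fun i ν w f => ?_,
    fun i Ω hΩ ν w f => ?_, fun i ν w f hν => ?_, fun α ν w f => ?_⟩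
  · show Φ (algebraMap (Qv k) (DHat Q k) c) x = (c : ℂ) • x
    obtain ⟨m, rfl⟩ := toF_surjective x
    rw [hΦ, ← map_smul]
    congr 1
    refine DFinsupp.ext fun w => ?_
    show repQ o w (algebraMap (Qv k) (DoubleHall Q k) c) (m w) = (c : ℂ) • m w
    rw [AlgHom.commutes, Algebra.algebraMap_eq_smul_one, qv_smul]
    rfl
  · obtain ⟨m, rfl, h0, hm⟩ := exists_toF_eq_cls (ψ := ψ) f
    rw [← hm]
    constructor
    · refine (key _ m).trans ?_
      rw [opK_hallFn, repQ_K]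
      exact toF_lof fun ν' hν' => hallFn_kOp_eq_zero _ (h0 ν' hν')
    · refine (key _ m).trans ?_
      rw [opKinv_hallFn, repQ_K]
      exact toF_lof fun ν' hν' => hallFn_kOp_eq_zero _ (h0 ν' hν')
  · obtain ⟨m, rfl, h0, hm⟩ := exists_toF_eq_cls (ψ := ψ) f
    rw [← hm, ← cls_eq_of_sub_mem (opEplus_hallFn hQ hψ hΩ m)]
    refine (key _ m).trans ?_
    rw [repQ_uP]
    exact toF_lof fun ν' hν' => hallFn_uOp_eq_zero hQ i
      (h0 _ fun h => hν' (add_right_cancel h))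
  · obtain ⟨m, rfl, h0, hm⟩ := exists_toF_eq_cls (ψ := ψ) f
    rw [← hm]
    refine (key _ m).trans ?_
    have h : ∀ ν', hallFn Q k o ν' w (((nq k)⁻¹ • uOp (exCls o w (IsoCls.simple Q k i))) m) = 0 :=
      fun ν' => hallFn_uOp_eq_zero hQ i (h0 _ fun h => by
        rw [← h, Pi.add_apply, Pi.single_eq_same] at hν
        exact Nat.succ_ne_zero _ hν)
    rw [repQ_uP, toF_lof (ν := ν) fun ν' _ => h ν', h, cls_zero]
  · obtain ⟨m, rfl, h0, hm⟩ := exists_toF_eq_cls (ψ := ψ) f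
    rw [← hm, opEminus_hallFn]
    refine (key _ m).trans ?_
    rw [repQ_uM]
    exact toF_lof fun ν' hν' => hallFn_bOp_eq_zero α fun d hd => h0 d fun h => hν' (by rw [hd, h])
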